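/- **Setting.** Let $n\ge 2$, let $M$ be a $W^*$-algebra and let $E_1,\dots,E_n$ be a product system of $W^*$-correspondences over $M$, over the semigroup $\mathbb Z_+^n$: each $E_i$ is a self-dual Hilbert $M$-module with a normal unital left action $\varphi_i:M\to\mathcal L(E_i)$, and there are isomorphisms of correspondences $t_{i,j}:E_i\otimes E_j\to E_j\otimes E_i$ with $t_{i,i}=\mathrm{id}$, $t_{j,i}=t_{i,j}^{-1}$ and $$(t_{j,i}\otimes I_l)(I_j\otimes t_{l,i})(t_{l,j}\otimes I_i)=(I_i\otimes t_{l,j})(t_{l,i}\otimes I_j)(I_l\otimes t_{j,i})\qquad(1\le i,j,l\le n).$$ Permuted tensor products of the $E_i$ are identified through the $t_{i,j}$. Suppose that every $\varphi_i$ is injective. For a normal representation of $M$ on $X$, $E\otimes X$ denotes the Hausdorff completion of the algebraic tensor product for $\langle\xi\otimes h,\eta\otimes k\rangle=\langle h,\langle\xi,\eta\rangle k\rangle$, with $M$ acting by $\varphi(\cdot)\otimes I$. All operators below intertwine the actions of $M$. Let $(\sigma,T_1,\dots,T_n)$ be a completely contractive representation of the product system on a Hilbert space $H$: $\sigma$ is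 a normal representation of $M$ on $H$, each $T_i:E_i\to B(H)$ is linear, completely contractive, and satisfies $T_i(a\xi b)=\sigma(a)T_i(\xi)\sigma(b)$, and with $\tilde T_i:E_i\otimes H\to H$, $\tilde T_i(\xi\otimes h)=T_i(\xi)h$, one has $\tilde T_i(I_i\otimes\tilde T_j)=\tilde T_j(I_j\otimes\tilde T_i)(t_{i,j}\otimes I_H)$. It is isometric if $T_i(\xi)^*T_i(\eta)=\sigma(\langle\xi,\eta\rangle)$ for all $i,\xi,\eta$. For $G=\{n_1<\dots<n_k\}$ put $\tilde T_G=\tilde T_{n_1}(I\otimes\tilde T_{n_2})\cdots(I\otimes\tilde T_{n_k})$, and let $$\Delta_1=\sum_{G\subseteq\{2,\dots,n\}}(-1)^{|G|}\tilde T_G\tilde T_G^*,\qquad \Delta_n=\sum_{G\subseteq\{1,\dots,n-1\}}(-1)^{|G|}\tilde T_G\tilde T_G^*,$$ and let $\Delta_{1n}$ be the sum defining $\Delta_n$ with $\tilde T_1$ replaced by $\tilde T_{1n}:=\tilde T_1(I_1\otimes\tilde T_n)$ on $E_{1n}:=E_1\otimes E_n$. Assume that $(\sigma,T_1,\dots,T_n)\in\mathcal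 T^n_{1,n}$: that is, $\Delta_1\ge0$ and $\Delta_n\ge0$ ($\hat T_1=(T_2,\dots,T_n)$ and $\hat T_n=(T_1,\dots,T_{n-1})$ are Szegő positive), and $\hat T_n$ is pure, i.e. $\tilde T_i^{(k)}\tilde T_i^{(k)*}\to0$ in the weak operator topology as $k\to\infty$ for $1\le i\le n-1$, where $\tilde T_i^{(k)}=\tilde T_i(I\otimes\tilde T_i)\cdots(I\otimes\tilde T_i)$ ($k$ factors). Put $D_1=\Delta_1^{1/2}$, $D_n=\Delta_n^{1/2}$, $D_{1n}=\Delta_{1n}^{1/2}$, and let $\mathcal D_1,\mathcal D_n,\mathcal D_{1n}$ be the closures of their ranges. **Data.** An infinite generator is a direct sum of infinitely many copies of a faithful normal representation of $M$. Consider infinite generators $\mathcal E_1,\mathcal E_2$; unitaries $u_1:E_1\otimes\mathcal E_2\to\mathcal E_1$ and $u_2:\mathcal E_2\to E_n\otimes\mathcal E_1$; with $\mathcal D:=\mathcal D_n\oplus(E_1\otimes\mathcal D_1)\oplus\mathcal E_1$, a unitary $U:\mathcal D_1\oplus(E_n\otimes\mathcal D_n)\oplus\mathcal E_2\to\mathcal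 D$ such that $$U\big(D_1h\oplus(I_n\otimes D_n)\tilde T_n^*h\oplus0\big)=D_nh\oplus(I_1\otimes D_1)\tilde T_1^*h\oplus0\qquad(h\in H);$$ and an isometry $V:\mathcal D_{1n}\to\mathcal D$ with $VD_{1n}h=D_nh\oplus(I_1\otimes D_1)\tilde T_1^*h\oplus 0$. Put $\mathcal D'=\mathcal D_n\oplus\mathcal E_1$ and define $$U_1=\begin{pmatrix}A_1&B_1\\C_1&0\end{pmatrix}:\mathcal D\oplus(E_{1n}\otimes\mathcal D')\to(E_1\otimes\mathcal D)\oplus\mathcal D',\qquad U_n=\begin{pmatrix}A_n&B_n\\C_n&0\end{pmatrix}:\mathcal D\oplus(E_{1n}\otimes\mathcal D_1)\to(E_n\otimes\mathcal D)\oplus\mathcal D_1$$ as follows. $A_1=(I_1\otimes U)P$, with $P$ the projection of $\mathcal D$ onto $E_1\otimes\mathcal D_1$, viewed as a subspace of $E_1\otimes(\mathcal D_1\oplus(E_n\otimes\mathcal D_n)\oplus\mathcal E_2)$; $B_1=I_1\otimes\big(U\circ(0\oplus I_{E_n\otimes\mathcal D_n}\oplus u_2^*)\big)$ on $E_1\otimes\big((E_n\otimes\mathcal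 D_n)\oplus(E_n\otimes\mathcal E_1)\big)$; $C_1$ is the projection of $\mathcal D$ onto $\mathcal D'$. $A_n=(I_{E_n\otimes\mathcal D_n}\oplus u_2)P_2U^*$, with $P_2$ the projection onto $(E_n\otimes\mathcal D_n)\oplus\mathcal E_2$ and the range regarded in $E_n\otimes\mathcal D$; $B_n$ is the inclusion of $E_n\otimes E_1\otimes\mathcal D_1$ into $E_n\otimes\mathcal D$ (after identifying $E_{1n}$ with $E_n\otimes E_1$); $C_n$ is $U^*$ followed by the projection onto $\mathcal D_1$. For $\alpha\in\mathbb Z_+^{n-1}$ let $E^\alpha=E_{1n}^{\otimes\alpha_1}\otimes E_2^{\otimes\alpha_2}\otimes\cdots\otimes E_{n-1}^{\otimes\alpha_{n-1}}$, let $K=\mathcal F(E)\otimes\mathcal D:=\bigoplus_{\alpha}E^\alpha\otimes\mathcal D$ with its natural representation $\rho$ of $M$, and let $\tilde L_1:E_{1n}\otimes K\to K$ and $\tilde L_i:E_i\otimes K\to K$ ($2\le i\le n-1$) be the creation operators $\xi\otimes v\mapsto\xi\otimes v$. For $j=1,n$ define $$\tau_{U_j^*}=I_{\mathcal F(E)}\otimes\big(A_j^*+(I_{1n}\otimes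 C_j^*)B_j^*\big):E_j\otimes K\cong\mathcal F(E)\otimes E_j\otimes\mathcal D\to\mathcal F(E)\otimes\mathcal D=K,$$ where $E^\alpha\otimes E_{1n}\otimes\mathcal D$ is identified with the summand $E^{\alpha+e_1}\otimes\mathcal D$ of $K$. Finally let $$\Pi_{1n,V}h=\bigoplus_{\alpha\in\mathbb Z_+^{n-1}}(I_{E^\alpha}\otimes VD_{1n})\tilde T_{1n}^{(\alpha)*}h,$$ where $\tilde T_{1n}^{(\alpha)}:E^\alpha\otimes H\to H$ is the product of the operators $\tilde T_{1n},\tilde T_2,\dots,\tilde T_{n-1}$ with multiplicities $\alpha_1,\dots,\alpha_{n-1}$. **Theorem.** Data $(\mathcal E_1,\mathcal E_2,u_1,u_2,U,V)$ as above exist, and for every choice of such data: 1. $U_1$ and $U_n$ are unitary, and $\tau_{U_1^*}$ and $\tau_{U_n^*}$ are isometries. 2. $\Pi_{1n,V}:H\to K$ is an isometry, and $$(I_1\otimes\Pi_{1n,V})\tilde T_1^*=\tau_{U_1^*}^*\Pi_{1n,V},\quad(I_i\otimes\Pi_{1n,V})\tilde T_i^*=\tilde L_i^*\Pi_{1n,V}\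 (2\le i\le n-1),\quad(I_n\otimes\Pi_{1n,V})\tilde T_n^*=\tau_{U_n^*}^*\Pi_{1n,V}.$$ 3. $\tau_{U_1^*}(I_1\otimes\tau_{U_n^*})=\tilde L_1$ and $\tau_{U_n^*}(I_n\otimes\tau_{U_1^*})=\tilde L_1(t_{n,1}\otimes I_K)$; i.e. both products are $\tilde L_1$ after identifying $E_n\otimes E_1$ with $E_1\otimes E_n$. 4. There is an isometric representation $(\rho,M_1,L_2,\dots,L_{n-1},M_n)$ of the product system on $K$ with $\tilde M_1=\tau_{U_1^*}$, $\tilde M_n=\tau_{U_n^*}$ and $L_i(\xi)v=\tilde L_i(\xi\otimes v)$, and it is a dilation of $(\sigma,T_1,\dots,T_n)$ by means of $\Pi_{1n,V}$: $\Pi_{1n,V}$ is an isometry that carries $\tilde T_i^*$ into the adjoint of the $i$-th operator of this representation, as in 2, for every $i$. -/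

import Mathlib

open scoped TensorProduct

universe u

namespace ProdSys

section Basic
variable {M : Type u} [CStarAlgebra M] [PartialOrder M]

/-- A Hilbert space with a (unital) `*`-representation of `M`. -/
structure HRep (M : Type u) [CStarAlgebra M] where
  carrier : Type u
  [normedAddCommGroup : NormedAddCommGroup carrier]
  [innerProductSpace : InnerProductSpace ℂ carrier]
  [completeSpace : CompleteSpace carrier]
  act : M →⋆ₐ[ℂ] (carrier →L[ℂ] carrier)

attribute [instance] HRep.normedAddCommGroup HRep.innerProductSpace HRep.completeSpace

instance : CoeSort (HRep M) (Type u) := ⟨HRep.carrier⟩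

/-- A `W*`-correspondence over the `W*`-algebra `M`: a self-dual Hilbert `M`-module, with `M`-valued
inner product `ip` (conjugate linear in the first variable), right action `ract`, and a left action
`lact` of `M` which is a normal (order continuous) unital `*`-homomorphism into the adjointable
operators. Linearity and associativity of the right action follow from `ip_ract` and
`ip_definite`; completeness follows from `selfDual`. -/
structure WCorr (M : Type u) [CStarAlgebra M] [PartialOrder M] where
  carrier : Type u
  [addCommGroup : AddCommGroup carrier]
  [module : Module ℂ carrier]
  ip : carrier →ₗ⋆[ℂ] carrier →ₗ[ℂ] M
  ract : carrier → M → carrier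
  lact : M →ₐ[ℂ] Module.End ℂ carrier
  star_ip : ∀ x y, star (ip x y) = ip y x
  ip_nonneg : ∀ x, 0 ≤ ip x x
  ip_definite : ∀ x, ip x x = 0 → x = 0
  ip_ract : ∀ x y a, ip x (ract y a) = ip x y * a
  ip_lact : ∀ a x y, ip (lact a x) y = ip x (lact (star a) y)
  selfDual : ∀ f : carrier →ₗ[ℂ] M, (∀ x a, f (ract x a) = f x * a) →
    (∃ C : ℝ, ∀ x, ‖f x‖ ^ 2 ≤ C * ‖ip x x‖) → ∃ y, ∀ x, f x = ip y x
  lact_normal : ∀ (S : Set M) (a : M), S.Nonempty → DirectedOn (· ≤ ·) S →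
    (∀ s ∈ S, IsSelfAdjoint s) → IsLUB S a →
    ∀ x, IsLUB ((fun s => ip x (lact s x)) '' S) (ip x (lact a x))

attribute [instance] WCorr.addCommGroup WCorr.module
instance : CoeSort (WCorr M) (Type u) := ⟨WCorr.carrier⟩

theorem exists_pos_neg {A : Type u} [CStarAlgebra A] [PartialOrder A] [StarOrderedRing A] {a : A}
    (ha : IsSelfAdjoint a) : ∃ p n : A, 0 ≤ p ∧ 0 ≤ n ∧ a = p - n ∧ n * p = 0 :=
  ⟨a⁺, a⁻, CFC.posPart_nonneg a, CFC.negPart_nonneg a, (CFC.posPart_sub_negPart a ha).symm,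
    CFC.negPart_mul_posPart a⟩

theorem exists_eq_star_mul {A : Type u} [CStarAlgebra A] [PartialOrder A] [StarOrderedRing A]
    {a : A} (ha : 0 ≤ a) : ∃ b : A, a = star b * b :=
  CStarAlgebra.nonneg_iff_eq_star_mul_self.mp ha

namespace WCorr
variable [StarOrderedRing M]

variable (E F G : WCorr M)

theorem gram_nonneg {k : ℕ} (ξ : Fin k → E) :
    ∃ B : CStarMatrix (Fin k) (Fin k) M,
      ∀ i j, E.ip (ξ i) (ξ j) = ∑ l, star (B l i) * B l j := by
  classical
  let A : CStarMatrix (Fin k) (Fin k) M := CStarMatrix.ofMatrix (fun i j => E.ip (ξ i) (ξ j))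
  have hA : IsSelfAdjoint A := by
    ext i j
    exact E.star_ip _ _
  obtain ⟨Q, N, hQ, hN, hAQ, hNQ⟩ := exists_pos_neg hA
  have hNs : star N = N := (IsSelfAdjoint.of_nonneg hN)
  have hAN : N * A * N = -(N * N * N) := by
    rw [hAQ, mul_sub, hNQ, zero_sub, neg_mul]
  obtain ⟨R, hR⟩ := exists_eq_star_mul hN
  have hract : ∀ x y a, E.ip (E.ract x a) y = star a * E.ip x y := by
    intro x y a
    rw [← E.star_ip, E.ip_ract, star_mul, E.star_ip]
  have hd : ∀ j, 0 ≤ (N * A * N) j j := by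
    intro j
    have : (N * A * N) j j
        = E.ip (∑ p, E.ract (ξ p) (N p j)) (∑ q, E.ract (ξ q) (N q j)) := by
      simp only [map_sum, LinearMap.sum_apply, CStarMatrix.mul_apply, E.ip_ract, hract,
        Finset.sum_mul]
      refine Finset.sum_congr rfl fun q _ => Finset.sum_congr rfl fun p _ => ?_
      rw [← CStarMatrix.star_apply, hNs]
      rfl
    rw [this]
    exact E.ip_nonneg _
  have hz : R * N = 0 := by
    have h3 : N * N * N = star (R * N) * (R * N) := by
      rw [star_mul, hNs]
      conv_lhs => rw [hR]
      rw [← hR]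
      conv_lhs => enter [1, 2]; rw [hR]
      simp only [mul_assoc]
    ext p j
    have h4 : (N * N * N) j j = ∑ p, star ((R * N) p j) * ((R * N) p j) := by
      rw [h3]
      simp [CStarMatrix.mul_apply, CStarMatrix.star_apply]
    have h5 : (∑ p, star ((R * N) p j) * ((R * N) p j)) = 0 := by
      apply le_antisymm
      · have := hd j
        rw [hAN] at this
        rw [← h4]
        simpa using this
      · exact Finset.sum_nonneg fun p _ => star_mul_self_nonneg _
    have h6 := (Finset.sum_eq_zero_iff_of_nonneg
      (fun p _ => star_mul_self_nonneg ((R * N) p j))).mp h5 p (Finset.mem_univ _)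
    simpa using h6
  have hN0 : N = 0 := by
    have h7 : N * N = 0 := by
      conv_lhs => enter [1]; rw [hR]
      rw [mul_assoc, hz, mul_zero]
    have h8 : star N * N = 0 := by rw [hNs, h7]
    exact (CStarRing.star_mul_self_eq_zero_iff N).mp h8
  have hApos : 0 ≤ A := by
    rw [hAQ, hN0, sub_zero]
    exact hQ
  obtain ⟨B, hB⟩ := exists_eq_star_mul hApos
  refine ⟨B, fun i j => ?_⟩
  have : A i j = (star B * B) i j := by rw [← hB]
  exact this


/-- The sesquilinear form `⟨ξ ⊗ h, η ⊗ k⟩ = ⟨h, ⟨ξ, η⟩ k⟩` on the algebraic tensor product. -/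
noncomputable def tform (X : HRep M) : (E ⊗[ℂ] X) →ₗ⋆[ℂ] (E ⊗[ℂ] X) →ₗ[ℂ] ℂ :=
  TensorProduct.lift (LinearMap.mk₂'ₛₗ (starRingEnd ℂ) (starRingEnd ℂ)
    (fun ξ h => TensorProduct.lift (LinearMap.mk₂ ℂ (fun η k => inner ℂ h (X.act (E.ip ξ η) k))
      (by intro a b c; simp)
      (by intro a b c; simp)
      (by intro a b c; simp)
      (by intro a b c; simp)))
    (by intro a b c; ext; simp)
    (by intro a b c; ext; simp)
    (by intro a b c; ext; simp)
    (by intro a b c; ext; simp [mul_comm]))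

@[simp] theorem tform_tmul (X : HRep M) (ξ η : E) (h k : X) :
    E.tform X (ξ ⊗ₜ h) (η ⊗ₜ k) = inner ℂ h (X.act (E.ip ξ η) k) := rfl

theorem exists_sum {V W : Type u} [AddCommGroup V] [Module ℂ V] [AddCommGroup W] [Module ℂ W]
    (v : V ⊗[ℂ] W) :
    ∃ (k : ℕ) (ξ : Fin k → V) (h : Fin k → W), v = ∑ i, ξ i ⊗ₜ[ℂ] h i := by
  induction v with
  | zero => exact ⟨0, Fin.elim0, Fin.elim0, by simp⟩
  | tmul x y => exact ⟨1, fun _ => x, fun _ => y, by simp⟩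
  | add a b ha hb =>
    obtain ⟨k, ξ, h, rfl⟩ := ha
    obtain ⟨l, η, g, rfl⟩ := hb
    exact ⟨k + l, Fin.append ξ η, Fin.append h g, by simp [Fin.sum_univ_add]⟩


theorem tform_sum_self (X : HRep M) {k : ℕ} (ξ : Fin k → E) {B : CStarMatrix (Fin k) (Fin k) M}
    (hB : ∀ i j, E.ip (ξ i) (ξ j) = ∑ l, star (B l i) * B l j) (h : Fin k → X) :
    E.tform X (∑ i, ξ i ⊗ₜ h i) (∑ i, ξ i ⊗ₜ h i)
      = ∑ l, (inner ℂ (∑ i, X.act (B l i) (h i)) (∑ i, X.act (B l i) (h i)) : ℂ) := by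
  have h1 : E.tform X (∑ i, ξ i ⊗ₜ h i) (∑ i, ξ i ⊗ₜ h i)
      = ∑ i, ∑ j, ∑ l, (inner ℂ (X.act (B l i) (h i)) (X.act (B l j) (h j)) : ℂ) := by
    have e1 : E.tform X (∑ i, ξ i ⊗ₜ h i) = ∑ i, E.tform X (ξ i ⊗ₜ h i) := map_sum _ _ _
    conv_lhs => rw [e1, LinearMap.sum_apply]
    refine Finset.sum_congr rfl fun i _ => ?_
    rw [map_sum]
    refine Finset.sum_congr rfl fun j _ => ?_
    rw [tform_tmul, hB, map_sum, sum_apply, inner_sum]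
    refine Finset.sum_congr rfl fun l _ => ?_
    rw [map_mul, map_star, ContinuousLinearMap.star_eq_adjoint, mul_apply_eq_comp,
      ContinuousLinearMap.adjoint_inner_right]
  rw [h1]
  simp_rw [sum_inner, inner_sum]
  calc _ = ∑ i, ∑ l, ∑ j, (inner ℂ (X.act (B l i) (h i)) (X.act (B l j) (h j)) : ℂ) :=
        Finset.sum_congr rfl fun i _ => Finset.sum_comm
    _ = _ := Finset.sum_comm

theorem tform_symm (X : HRep M) (u v : E ⊗[ℂ] X) :
    (starRingEnd ℂ) (E.tform X v u) = E.tform X u v := by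
  induction u with
  | zero => simp
  | add a b ha hb => simp [ha, hb]
  | tmul ξ h =>
    induction v with
    | zero => simp
    | add a b ha hb => simp [ha, hb]
    | tmul η k =>
      rw [tform_tmul, tform_tmul, inner_conj_symm, ← E.star_ip η ξ, map_star,
        ContinuousLinearMap.star_eq_adjoint, ContinuousLinearMap.adjoint_inner_right]

theorem tform_nonneg (X : HRep M) (u : E ⊗[ℂ] X) : 0 ≤ (E.tform X u u).re := by
  obtain ⟨k, ξ, h, rfl⟩ := exists_sum u
  obtain ⟨B, hB⟩ := E.gram_nonneg ξ
  rw [E.tform_sum_self X ξ hB, Complex.re_sum]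
  exact Finset.sum_nonneg fun l _ => inner_self_nonneg (𝕜 := ℂ)

/-- The algebraic tensor product, with the form `tform`. -/
def PreTensor (E : WCorr M) (X : HRep M) : Type u := E ⊗[ℂ] X

variable (X Y : HRep M)

/-- The identity map from the algebraic tensor product. -/
def toPre (u : E ⊗[ℂ] X) : PreTensor E X := u

instance : AddCommGroup (PreTensor E X) := inferInstanceAs (AddCommGroup (E ⊗[ℂ] X))
instance : Module ℂ (PreTensor E X) := inferInstanceAs (Module ℂ (E ⊗[ℂ] X))

/-- The semi-inner product given by `tform`. -/
noncomputable abbrev preCore : PreInnerProductSpace.Core ℂ (PreTensor E X) where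
  inner u v := E.tform X u v
  conj_inner_symm u v := E.tform_symm X u v
  re_inner_nonneg u := E.tform_nonneg X u
  add_left u v w := LinearMap.congr_fun (map_add (E.tform X) u v) w
  smul_left u v c := LinearMap.congr_fun (LinearMap.map_smulₛₗ (E.tform X) c u) v

noncomputable instance : SeminormedAddCommGroup (PreTensor E X) :=
  InnerProductSpace.Core.toSeminormedAddCommGroup (c := E.preCore X)
noncomputable instance : InnerProductSpace ℂ (PreTensor E X) :=
  InnerProductSpace.ofCore (E.preCore X)

theorem pre_inner (u v : E ⊗[ℂ] X) : inner ℂ (E.toPre X u) (E.toPre X v) = E.tform X u v := rfl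

theorem pre_norm_sq (u : E ⊗[ℂ] X) : ‖E.toPre X u‖ ^ 2 = (E.tform X u u).re :=
  norm_sq_eq_re_inner (𝕜 := ℂ) (E.toPre X u)

variable {E F G X Y}

theorem ampl_bound (f : E →ₗ[ℂ] F) (c : M)
    (hf : ∀ ξ η, F.ip (f ξ) (f η) = E.ip ξ (E.lact (star c * c) η)) (u : E ⊗[ℂ] X) :
    ‖F.toPre X (TensorProduct.map f LinearMap.id u)‖ ≤ ‖c‖ * ‖E.toPre X u‖ := by
  have key : ∀ (u v : E ⊗[ℂ] X), F.tform X (TensorProduct.map f LinearMap.id u)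
      (TensorProduct.map f LinearMap.id v)
      = E.tform X u (TensorProduct.map (E.lact (star c * c)) LinearMap.id v) := by
    intro u v
    induction u with
    | zero => simp
    | add a b ha hb => simp only [map_add, LinearMap.add_apply, ha, hb]
    | tmul ξ h =>
      induction v with
      | zero => simp
      | add a b ha hb => simp only [map_add, ha, hb]
      | tmul η k => simp [hf]
  obtain ⟨d, hd⟩ := exists_eq_star_mul (sub_nonneg.mpr (CStarAlgebra.star_mul_le_algebraMap_norm_sq (a := c)))
  have key2 : ∀ (u v : E ⊗[ℂ] X), E.tform X (TensorProduct.map (E.lact d) LinearMap.id u)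
      (TensorProduct.map (E.lact d) LinearMap.id v)
      = (‖c‖ ^ 2 : ℝ) * E.tform X u v
        - E.tform X u (TensorProduct.map (E.lact (star c * c)) LinearMap.id v) := by
    intro u v
    induction u with
    | zero => simp
    | add a b ha hb => simp only [map_add, LinearMap.add_apply, ha, hb]; ring
    | tmul ξ h =>
      induction v with
      | zero => simp
      | add a b ha hb => simp only [map_add, ha, hb]; ring
      | tmul η k =>
        have e1 : E.ip (E.lact d ξ) (E.lact d η)
            = ((‖c‖ ^ 2 : ℝ) : ℂ) • E.ip ξ η - E.ip ξ (E.lact (star c * c) η) := by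
          rw [E.ip_lact, ← Module.End.mul_apply, ← map_mul, ← hd, map_sub, LinearMap.sub_apply,
            map_sub, Algebra.algebraMap_eq_smul_one, ← Complex.coe_smul, map_smul, map_one]
          simp
        simp only [TensorProduct.map_tmul, tform_tmul, LinearMap.id_coe, id_eq, e1, map_sub,
          map_smul, sub_apply, smul_apply, inner_sub_right, inner_smul_right]
  have h3 := E.tform_nonneg X (TensorProduct.map (E.lact d) LinearMap.id u)
  rw [key2, Complex.sub_re, Complex.re_ofReal_mul, ← key] at h3
  refine le_of_sq_le_sq ?_ (by positivity)
  rw [mul_pow, pre_norm_sq, pre_norm_sq]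
  linarith

end WCorr
end Basic

section Basic2
variable {M : Type u} [CStarAlgebra M] [PartialOrder M]

/-- A bounded operator between Hilbert spaces intertwining the actions of `M`. -/
structure HHom (X Y : HRep M) where
  toCLM : X →L[ℂ] Y
  comm : ∀ a x, toCLM (X.act a x) = Y.act a (toCLM x)

namespace HHom
variable {X Y Z : HRep M}

instance : CoeFun (HHom X Y) (fun _ => X → Y) := ⟨fun f => f.toCLM⟩

@[ext] theorem ext {f g : HHom X Y} (h : ∀ x, f x = g x) : f = g := by
  cases f; cases g; congr; ext x; exact h x

/-- The identity. -/
def id (X : HRep M) : HHom X X := ⟨ContinuousLinearMap.id ℂ X, fun _ _ => rfl⟩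

/-- The composition. -/
def comp (g : HHom Y Z) (f : HHom X Y) : HHom X Z :=
  ⟨g.toCLM.comp f.toCLM, fun a x => by simp [f.comm, g.comm]⟩

/-- The Hilbert space adjoint. -/
noncomputable def adj (f : HHom X Y) : HHom Y X where
  toCLM := ContinuousLinearMap.adjoint f.toCLM
  comm a y := by
    refine ext_inner_left ℂ fun x => ?_
    rw [ContinuousLinearMap.adjoint_inner_right, ← ContinuousLinearMap.adjoint_inner_left,
      ← ContinuousLinearMap.star_eq_adjoint, ← map_star, ← f.comm,
      ← ContinuousLinearMap.adjoint_inner_right, map_star, ContinuousLinearMap.star_eq_adjoint,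
      ContinuousLinearMap.adjoint_inner_left]

instance : Zero (HHom X Y) := ⟨⟨0, fun a x => by simp⟩⟩
instance : Add (HHom X Y) := ⟨fun f g => ⟨f.toCLM + g.toCLM, fun a x => by
  simp [f.comm, g.comm]⟩⟩

/-- `f` is an isometry. -/
def IsIsometry (f : HHom X Y) : Prop := Isometry f.toCLM
/-- `f` is a unitary operator. -/
def IsUnitary (f : HHom X Y) : Prop := Isometry f.toCLM ∧ Function.Surjective f.toCLM

end HHom

namespace WCorr
variable [StarOrderedRing M] {E F G : WCorr M} {X Y Z : HRep M}

/-- The Hausdorff completion of the algebraic tensor product. -/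
abbrev TCarrier (E : WCorr M) (X : HRep M) : Type u := UniformSpace.Completion (PreTensor E X)

/-- The canonical map from the algebraic to the completed tensor product. -/
noncomputable def tmulₗ (E : WCorr M) (X : HRep M) : E ⊗[ℂ] X →ₗ[ℂ] TCarrier E X where
  toFun u := ((E.toPre X u : PreTensor E X) : TCarrier E X)
  map_add' u v := UniformSpace.Completion.coe_add (E.toPre X u) (E.toPre X v)
  map_smul' c u := UniformSpace.Completion.coe_smul c (E.toPre X u)

theorem tmulₗ_inner (u v : E ⊗[ℂ] X) :
    inner ℂ (E.tmulₗ X u) (E.tmulₗ X v) = E.tform X u v :=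
  (UniformSpace.Completion.inner_coe (E.toPre X u) (E.toPre X v)).trans (pre_inner E X u v)

theorem tcarrier_ext {W : Type*} [NormedAddCommGroup W] [NormedSpace ℂ W]
    {f g : TCarrier E X →L[ℂ] W}
    (h : ∀ ξ x, f (E.tmulₗ X (ξ ⊗ₜ x)) = g (E.tmulₗ X (ξ ⊗ₜ x))) : f = g := by
  have h1 : ∀ u : E ⊗[ℂ] X, f (E.tmulₗ X u) = g (E.tmulₗ X u) := by
    intro u
    induction u with
    | zero => simp
    | add a b ha hb => simp [ha, hb]
    | tmul ξ x => exact h ξ x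
  ext v
  induction v using UniformSpace.Completion.induction_on with
  | hp => exact isClosed_eq f.continuous g.continuous
  | ih a => exact h1 a

theorem eq_adjoint_of_tmul {f : TCarrier E X →L[ℂ] TCarrier F Y}
    {g : TCarrier F Y →L[ℂ] TCarrier E X}
    (h : ∀ ξ x η y, inner ℂ (f (E.tmulₗ X (ξ ⊗ₜ x))) (F.tmulₗ Y (η ⊗ₜ y))
      = inner ℂ (E.tmulₗ X (ξ ⊗ₜ x)) (g (F.tmulₗ Y (η ⊗ₜ y)))) :
    f = ContinuousLinearMap.adjoint g := by
  refine tcarrier_ext fun ξ x => ext_inner_right ℂ fun v => ?_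
  rw [ContinuousLinearMap.adjoint_inner_left]
  have : innerSL ℂ (f (E.tmulₗ X (ξ ⊗ₜ x)))
      = (innerSL ℂ (E.tmulₗ X (ξ ⊗ₜ x))).comp g :=
    tcarrier_ext fun η y => h ξ x η y
  exact DFunLike.congr_fun this v

/-- Extension of a bounded map defined on the algebraic tensor product. -/
noncomputable def preMap (f : (E ⊗[ℂ] X) →ₗ[ℂ] (F ⊗[ℂ] Y)) (C : ℝ)
    (hC : ∀ u, ‖F.toPre Y (f u)‖ ≤ C * ‖E.toPre X u‖) : TCarrier E X →L[ℂ] TCarrier F Y :=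
  ContinuousLinearMap.completion
    (LinearMap.mkContinuous (E := PreTensor E X) (F := PreTensor F Y) (σ := RingHom.id ℂ)
      { toFun := fun u => F.toPre Y (f u)
        map_add' := fun u v => f.map_add u v
        map_smul' := fun c u => f.map_smul c u } C hC)

theorem preMap_apply (f : (E ⊗[ℂ] X) →ₗ[ℂ] (F ⊗[ℂ] Y)) (C : ℝ)
    (hC : ∀ u, ‖F.toPre Y (f u)‖ ≤ C * ‖E.toPre X u‖) (u : E ⊗[ℂ] X) :
    preMap f C hC (E.tmulₗ X u) = F.tmulₗ Y (f u) :=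
  ContinuousLinearMap.completion_apply_coe _ (E.toPre X u)

/-- The operator `f ⊗ 1` for a map `f` with `⟨f ξ, f η⟩ = ⟨ξ, (c* c) η⟩`. -/
noncomputable def ampl (X : HRep M) (f : E →ₗ[ℂ] F) (c : M)
    (hf : ∀ ξ η, F.ip (f ξ) (f η) = E.ip ξ (E.lact (star c * c) η)) :
    TCarrier E X →L[ℂ] TCarrier F X :=
  preMap (TensorProduct.map f LinearMap.id) ‖c‖ (ampl_bound f c hf)

theorem ampl_tmul (f : E →ₗ[ℂ] F) (c : M)
    (hf : ∀ ξ η, F.ip (f ξ) (f η) = E.ip ξ (E.lact (star c * c) η)) (ξ : E) (x : X) :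
    ampl X f c hf (E.tmulₗ X (ξ ⊗ₜ x)) = F.tmulₗ X (f ξ ⊗ₜ x) :=
  preMap_apply _ _ _ _

theorem lact_ip_lact (a : M) (ξ η : E) :
    E.ip (E.lact a ξ) (E.lact a η) = E.ip ξ (E.lact (star a * a) η) := by
  rw [E.ip_lact, map_mul]; rfl

/-- The Hilbert space `E ⊗ X`, the Hausdorff completion of the algebraic tensor product for
`⟨ξ ⊗ h, η ⊗ k⟩ = ⟨h, ⟨ξ, η⟩ k⟩`, with the action `a ↦ φ(a) ⊗ 1`. -/
noncomputable def tens (E : WCorr M) (X : HRep M) : HRep M where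
  carrier := TCarrier E X
  act :=
    { toFun := fun a => ampl X (E.lact a) a (lact_ip_lact a)
      map_one' := tcarrier_ext fun ξ x => by
        rw [ampl_tmul, map_one]; rfl
      map_mul' := fun a b => tcarrier_ext fun ξ x => by
        rw [ampl_tmul, mul_apply_eq_comp, ampl_tmul, ampl_tmul, map_mul]; rfl
      map_zero' := tcarrier_ext fun ξ x => by
        rw [ampl_tmul, map_zero]; simp
      map_add' := fun a b => tcarrier_ext fun ξ x => by
        rw [ampl_tmul, add_apply, ampl_tmul, ampl_tmul, map_add,
          LinearMap.add_apply, TensorProduct.add_tmul, map_add]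
      commutes' := fun c => tcarrier_ext fun ξ x => by
        rw [ampl_tmul, AlgHom.commutes, Algebra.algebraMap_eq_smul_one,
          Algebra.algebraMap_eq_smul_one, LinearMap.smul_apply, ← TensorProduct.smul_tmul',
          map_smul]; rfl
      map_star' := fun a => by
        refine eq_adjoint_of_tmul fun ξ x η y => ?_
        rw [ampl_tmul, ampl_tmul, tmulₗ_inner, tmulₗ_inner, tform_tmul, tform_tmul, E.ip_lact,
          star_star] }

/-- The elementary tensor `ξ ⊗ x`. -/
noncomputable def tmul (ξ : E) (x : X) : E.tens X := E.tmulₗ X (ξ ⊗ₜ x)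

theorem tens_ext {W : Type*} [NormedAddCommGroup W] [NormedSpace ℂ W]
    {f g : E.tens X →L[ℂ] W} (h : ∀ ξ x, f (tmul ξ x) = g (tmul ξ x)) : f = g :=
  tcarrier_ext h

theorem act_tmul (a : M) (ξ : E) (x : X) :
    (E.tens X).act a (tmul ξ x) = tmul (E.lact a ξ) x :=
  ampl_tmul _ _ (lact_ip_lact a) _ _

theorem map_bound (f : HHom X Y) (u : E ⊗[ℂ] X) :
    ‖E.toPre Y (TensorProduct.map LinearMap.id (f.toCLM : X →ₗ[ℂ] Y) u)‖
      ≤ ‖f.toCLM‖ * ‖E.toPre X u‖ := by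
  obtain ⟨k, ξ, h, rfl⟩ := exists_sum u
  obtain ⟨B, hB⟩ := E.gram_nonneg ξ
  refine le_of_sq_le_sq ?_ (by positivity)
  rw [mul_pow, pre_norm_sq, pre_norm_sq, map_sum, E.tform_sum_self X ξ hB]
  simp only [TensorProduct.map_tmul, LinearMap.id_coe, id_eq, ContinuousLinearMap.coe_coe]
  rw [E.tform_sum_self Y ξ hB, Complex.re_sum, Complex.re_sum, Finset.mul_sum]
  refine Finset.sum_le_sum fun l _ => ?_
  have e : ∑ i, Y.act (B l i) (f.toCLM (h i)) = f.toCLM (∑ i, X.act (B l i) (h i)) := by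
    simp only [map_sum, f.comm]
  rw [e]
  have e1 := norm_sq_eq_re_inner (𝕜 := ℂ) (f.toCLM (∑ i, X.act (B l i) (h i)))
  have e2 := norm_sq_eq_re_inner (𝕜 := ℂ) (∑ i, X.act (B l i) (h i))
  simp only [RCLike.re_to_complex] at e1 e2
  rw [← e1, ← e2, ← mul_pow]
  gcongr
  exact f.toCLM.le_opNorm _

/-- The bounded operator `I_E ⊗ f`. -/
noncomputable def mapCLM (E : WCorr M) (f : HHom X Y) : E.tens X →L[ℂ] E.tens Y :=
  preMap (TensorProduct.map LinearMap.id (f.toCLM : X →ₗ[ℂ] Y)) ‖f.toCLM‖ (map_bound f)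

theorem mapCLM_tmul (f : HHom X Y) (ξ : E) (x : X) : E.mapCLM f (tmul ξ x) = tmul ξ (f x) :=
  preMap_apply _ _ (map_bound f) _

/-- The operator `I_E ⊗ f`. -/
noncomputable def map (E : WCorr M) (f : HHom X Y) : HHom (E.tens X) (E.tens Y) where
  toCLM := E.mapCLM f
  comm a v := by
    have : (E.mapCLM f).comp ((E.tens X).act a) = ((E.tens Y).act a).comp (E.mapCLM f) := by
      refine tens_ext fun ξ x => ?_
      rw [ContinuousLinearMap.comp_apply, ContinuousLinearMap.comp_apply, act_tmul,
        mapCLM_tmul, mapCLM_tmul, act_tmul]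
    exact DFunLike.congr_fun this v

theorem map_tmul (f : HHom X Y) (ξ : E) (x : X) : E.map f (tmul ξ x) = tmul ξ (f x) :=
  mapCLM_tmul f ξ x

theorem inner_tmul (ξ η : E) (x y : X) :
    inner ℂ (tmul ξ x) (tmul η y) = inner ℂ x (X.act (E.ip ξ η) y) :=
  tmulₗ_inner _ _

end WCorr
end Basic2

section Basic3
variable {M : Type u} [CStarAlgebra M] [PartialOrder M]

/-- Normality (order continuity) of a representation. -/
def HRep.Normal (X : HRep M) : Prop :=
  ∀ (S : Set M) (a : M), S.Nonempty → DirectedOn (· ≤ ·) S → (∀ s ∈ S, IsSelfAdjoint s) →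
    IsLUB S a → ∀ h : X, IsLUB ((fun s => (inner ℂ h (X.act s h)).re) '' S)
      (inner ℂ h (X.act a h)).re

/-- The left action of `M` on the correspondence is faithful. -/
def WCorr.Faithful (E : WCorr M) : Prop := ∀ a : M, (∀ x, E.lact a x = 0) → a = 0

/-- Isomorphisms of `W*`-correspondences. -/
structure WIso (G G' : WCorr M) where
  toEquiv : G ≃ₗ[ℂ] G'
  ip_map : ∀ x y, G'.ip (toEquiv x) (toEquiv y) = G.ip x y
  map_lact : ∀ a x, toEquiv (G.lact a x) = G'.lact a (toEquiv x)
  map_ract : ∀ x a, toEquiv (G.ract x a) = G'.ract (toEquiv x) a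

variable [StarOrderedRing M]

/-- A model of the (balanced, self-dual) tensor product `E ⊗ F` of `W*`-correspondences: a
`W*`-correspondence `G` with a balanced bilinear map `mul : (x, y) ↦ x ⊗ y`, the inner product being
`⟨x ⊗ y, x' ⊗ y'⟩ = ⟨y, ⟨x, x'⟩ y'⟩`, such that the span of the elements `x ⊗ y` is weak-`*` dense in
`G`; the latter is expressed by its density in `G ⊗ X` for every normal representation `X`. The
tensor product is determined up to a unique isomorphism by these properties. -/
structure BalancedTensor (E F : WCorr M) where
  G : WCorr M
  mul : E →ₗ[ℂ] F →ₗ[ℂ] G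
  ip_mul : ∀ x y x' y', G.ip (mul x y) (mul x' y') = F.ip y (F.lact (E.ip x x') y')
  lact_mul : ∀ a x y, G.lact a (mul x y) = mul (E.lact a x) y
  mul_ract : ∀ x y a, G.ract (mul x y) a = mul x (F.ract y a)
  balanced : ∀ x a y, mul (E.ract x a) y = mul x (F.lact a y)
  total : ∀ X : HRep M, X.Normal → Dense (Submodule.span ℂ
    {v : G.tens X | ∃ x y h, v = WCorr.tmul (mul x y) h} : Set (G.tens X))

theorem WCorr.tens_vec_ext {E : WCorr M} {X : HRep M} {v w : E.tens X}
    (h : ∀ ξ x, inner ℂ (WCorr.tmul ξ x) v = inner ℂ (WCorr.tmul ξ x) w) : v = w := by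
  have : innerSL ℂ v = innerSL ℂ w := WCorr.tens_ext fun ξ x => by
    rw [innerSL_apply_apply, innerSL_apply_apply, ← inner_conj_symm, h, inner_conj_symm]
  exact ext_inner_right ℂ fun z => DFunLike.congr_fun this z

/-- The operator `x ↦ ξ ⊗ x`. -/
noncomputable def WCorr.tmulCLM {E : WCorr M} (X : HRep M) (ξ : E) : X →L[ℂ] E.tens X :=
  LinearMap.mkContinuous
    { toFun := fun x => WCorr.tmul ξ x
      map_add' := fun x y => by
        simp only [WCorr.tmul, TensorProduct.tmul_add, map_add]; rfl
      map_smul' := fun c x => by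
        simp only [WCorr.tmul, TensorProduct.tmul_smul, map_smul]; rfl }
    (Real.sqrt ‖X.act (E.ip ξ ξ)‖) (fun x => by
      refine le_of_sq_le_sq ?_ (by positivity)
      rw [mul_pow, Real.sq_sqrt (norm_nonneg _)]
      have h : ‖(WCorr.tmul ξ x : E.tens X)‖ ^ 2 = (inner ℂ x (X.act (E.ip ξ ξ) x) : ℂ).re := by
        rw [norm_sq_eq_re_inner (𝕜 := ℂ), WCorr.inner_tmul]; rfl
      refine (le_of_eq h).trans ?_
      calc _ ≤ ‖(inner ℂ x (X.act (E.ip ξ ξ) x) : ℂ)‖ := Complex.re_le_norm _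
        _ ≤ ‖x‖ * ‖X.act (E.ip ξ ξ) x‖ := norm_inner_le_norm _ _
        _ ≤ ‖x‖ * (‖X.act (E.ip ξ ξ)‖ * ‖x‖) := by
          gcongr
          exact (X.act (E.ip ξ ξ)).le_opNorm x
        _ = _ := by ring)

theorem WCorr.tens_tens_ext {E F : WCorr M} {X : HRep M} {W : Type*} [NormedAddCommGroup W]
    [NormedSpace ℂ W] {f g : E.tens (F.tens X) →L[ℂ] W}
    (h : ∀ ξ η x, f (WCorr.tmul ξ (WCorr.tmul η x)) = g (WCorr.tmul ξ (WCorr.tmul η x))) :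
    f = g := by
  refine tens_ext fun ξ v => ?_
  have : f.comp (tmulCLM (F.tens X) ξ) = g.comp (tmulCLM (F.tens X) ξ) :=
    tens_ext fun η x => h ξ η x
  exact DFunLike.congr_fun this v

namespace BalancedTensor
open WCorr
variable {E F : WCorr M} (P : BalancedTensor E F) (X : HRep M)

theorem exists_ampl (ξ : E) : ∃ c : M, ∀ η η' : F,
    P.G.ip (P.mul ξ η) (P.mul ξ η') = F.ip η (F.lact (star c * c) η') := by
  obtain ⟨c, hc⟩ := exists_eq_star_mul (E.ip_nonneg ξ)
  exact ⟨c, fun η η' => by rw [P.ip_mul, hc]⟩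

/-- The operator `η ⊗ x ↦ (ξ ⊗ η) ⊗ x`. -/
noncomputable def lmulCLM (ξ : E) : F.tens X →L[ℂ] P.G.tens X :=
  ampl X (P.mul ξ) (P.exists_ampl ξ).choose (P.exists_ampl ξ).choose_spec

theorem lmulCLM_tmul (ξ : E) (η : F) (x : X) :
    P.lmulCLM X ξ (tmul η x) = tmul (P.mul ξ η) x := ampl_tmul _ _ (P.exists_ampl ξ).choose_spec _ _

/-- The map `ξ ⊗ (η ⊗ x) ↦ (ξ ⊗ η) ⊗ x` on the algebraic tensor product. -/
noncomputable def lmul : E ⊗[ℂ] (F.tens X) →ₗ[ℂ] P.G.tens X :=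
  TensorProduct.lift
    { toFun := fun ξ => (P.lmulCLM X ξ : F.tens X →ₗ[ℂ] P.G.tens X)
      map_add' := fun ξ ξ' => by
        rw [← ContinuousLinearMap.toLinearMap_add]
        refine congrArg _ (tens_ext fun η x => ?_)
        rw [add_apply, lmulCLM_tmul, lmulCLM_tmul, lmulCLM_tmul, map_add, LinearMap.add_apply]
        simp only [tmul, TensorProduct.add_tmul, map_add]
        rfl
      map_smul' := fun c ξ => by
        rw [RingHom.id_apply, ← ContinuousLinearMap.toLinearMap_smul]
        refine congrArg _ (tens_ext fun η x => ?_)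
        rw [smul_apply, lmulCLM_tmul, lmulCLM_tmul, map_smul, LinearMap.smul_apply]
        simp only [tmul, ← TensorProduct.smul_tmul', map_smul]
        rfl }

theorem lmul_tmul (ξ : E) (v : F.tens X) : P.lmul X (ξ ⊗ₜ v) = P.lmulCLM X ξ v := by
  simp [lmul]

theorem lmulCLM_inner (ξ ξ' : E) (v v' : F.tens X) :
    inner ℂ (P.lmulCLM X ξ v) (P.lmulCLM X ξ' v') = inner ℂ v ((F.tens X).act (E.ip ξ ξ') v') := by
  have h : (ContinuousLinearMap.adjoint (P.lmulCLM X ξ)).comp (P.lmulCLM X ξ')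
      = (F.tens X).act (E.ip ξ ξ') := by
    refine tens_ext fun η' x' => tens_vec_ext fun η x => ?_
    rw [ContinuousLinearMap.comp_apply, ContinuousLinearMap.adjoint_inner_right, lmulCLM_tmul,
      lmulCLM_tmul, act_tmul, inner_tmul, inner_tmul, P.ip_mul]
  rw [← h, ContinuousLinearMap.comp_apply, ContinuousLinearMap.adjoint_inner_right]

theorem lmul_inner (u v : E ⊗[ℂ] (F.tens X)) :
    inner ℂ (P.lmul X u) (P.lmul X v) = E.tform (F.tens X) u v := by
  induction u with
  | zero => simp
  | add a b ha hb => simp only [map_add, LinearMap.add_apply, inner_add_left, ha, hb]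
  | tmul ξ h =>
    induction v with
    | zero => simp
    | add a b ha hb => simp only [map_add, inner_add_right, ha, hb]
    | tmul η k => rw [lmul_tmul, lmul_tmul, lmulCLM_inner, tform_tmul]

theorem lmul_norm (u : E ⊗[ℂ] (F.tens X)) : ‖P.lmul X u‖ ≤ 1 * ‖E.toPre (F.tens X) u‖ := by
  rw [one_mul]
  refine le_of_sq_le_sq ?_ (norm_nonneg _)
  rw [norm_sq_eq_re_inner (𝕜 := ℂ), pre_norm_sq E (F.tens X) u]
  exact le_of_eq (congrArg Complex.re (P.lmul_inner X u u))

/-- The bounded operator `ξ ⊗ (η ⊗ x) ↦ (ξ ⊗ η) ⊗ x`. -/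
noncomputable def fuseCLM : E.tens (F.tens X) →L[ℂ] P.G.tens X :=
  ContinuousLinearMap.fromCompletion
    (LinearMap.mkContinuous (E := PreTensor E (F.tens X)) (F := P.G.tens X) (σ := RingHom.id ℂ)
      { toFun := fun u => P.lmul X u
        map_add' := fun u v => (P.lmul X).map_add u v
        map_smul' := fun c u => (P.lmul X).map_smul c u } 1 (P.lmul_norm X))

theorem fuseCLM_tmul (ξ : E) (η : F) (x : X) :
    P.fuseCLM X (tmul ξ (tmul η x)) = tmul (P.mul ξ η) x :=
  (ContinuousLinearMap.fromCompletion_apply_coe _ _).trans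
    ((P.lmul_tmul X ξ (tmul η x)).trans (P.lmulCLM_tmul X ξ η x))

/-- The isometry `E ⊗ (F ⊗ X) → (E ⊗ F) ⊗ X`, `ξ ⊗ (η ⊗ x) ↦ (ξ ⊗ η) ⊗ x` (unitary for normal
`X`). -/
noncomputable def fuse : HHom (E.tens (F.tens X)) (P.G.tens X) where
  toCLM := P.fuseCLM X
  comm a v := by
    have : (P.fuseCLM X).comp ((E.tens (F.tens X)).act a)
        = ((P.G.tens X).act a).comp (P.fuseCLM X) := by
      refine tens_tens_ext fun ξ η x => ?_
      rw [ContinuousLinearMap.comp_apply, ContinuousLinearMap.comp_apply, act_tmul,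
        fuseCLM_tmul, fuseCLM_tmul, act_tmul, P.lact_mul]
    exact DFunLike.congr_fun this v

end BalancedTensor

/-- The bounded operator `t ⊗ 1`. -/
noncomputable def WIso.amplCLM {G G' : WCorr M} (t : WIso G G') (X : HRep M) :
    G.tens X →L[ℂ] G'.tens X :=
  WCorr.ampl X (t.toEquiv : G →ₗ[ℂ] G') 1 (by
    intro ξ η
    rw [star_one, one_mul, map_one]
    exact t.ip_map ξ η)

theorem WIso.amplCLM_tmul {G G' : WCorr M} (t : WIso G G') (X : HRep M) (ξ : G) (x : X) :
    t.amplCLM X (WCorr.tmul ξ x) = WCorr.tmul (t.toEquiv ξ) x :=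
  WCorr.ampl_tmul _ _ _ _ _

/-- The operator `t ⊗ 1`. -/
noncomputable def WIso.ampl {G G' : WCorr M} (t : WIso G G') (X : HRep M) :
    HHom (G.tens X) (G'.tens X) where
  toCLM := t.amplCLM X
  comm a v := by
    have : (t.amplCLM X).comp ((G.tens X).act a) = ((G'.tens X).act a).comp (t.amplCLM X) := by
      refine WCorr.tens_ext fun ξ x => ?_
      rw [ContinuousLinearMap.comp_apply, ContinuousLinearMap.comp_apply, WCorr.act_tmul,
        amplCLM_tmul, amplCLM_tmul, WCorr.act_tmul, t.map_lact]
    exact DFunLike.congr_fun this v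

/-- A family of `W*`-correspondences over `M` with identifications
`t i j : E i ⊗ E j ≅ E j ⊗ E i`. -/
structure PreProductSystem (M : Type u) [CStarAlgebra M] [PartialOrder M] [StarOrderedRing M]
    (n : ℕ) where
  E : Fin n → WCorr M
  P : ∀ i j, BalancedTensor (E i) (E j)
  t : ∀ i j, WIso (P i j).G (P j i).G
  t_self : ∀ i x, (t i i).toEquiv x = x
  t_symm : ∀ i j x, (t j i).toEquiv ((t i j).toEquiv x) = x

namespace PreProductSystem
variable {n : ℕ} (S : PreProductSystem M n)

/-- The operator `t i j ⊗ 1 : E i ⊗ E j ⊗ X → E j ⊗ E i ⊗ X`, the spaces being written as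
`E i ⊗ (E j ⊗ X)` and `E j ⊗ (E i ⊗ X)`. -/
noncomputable def swap (i j : Fin n) (X : HRep M) :
    HHom ((S.E i).tens ((S.E j).tens X)) ((S.E j).tens ((S.E i).tens X)) :=
  ((S.P j i).fuse X).adj.comp (((S.t i j).ampl X).comp ((S.P i j).fuse X))

end PreProductSystem

/-- A product system over `ℤ₊ⁿ`: the correspondences `E i` of the generators and the
identifications `t i j`, subject to the compatibility of the `t i j` (on `E l ⊗ E j ⊗ E i`) which is
equivalent to the associativity of the multiplication. The two sides are compared as operators on
`E l ⊗ E j ⊗ E i ⊗ X`, for all normal representations `X`. -/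
structure ProductSystem (M : Type u) [CStarAlgebra M] [PartialOrder M] [StarOrderedRing M]
    (n : ℕ) extends PreProductSystem M n where
  hexagon : ∀ (i j l : Fin n) (X : HRep M), X.Normal →
    (toPreProductSystem.swap j i ((E l).tens X)).comp
      (((E j).map (toPreProductSystem.swap l i X)).comp
        (toPreProductSystem.swap l j ((E i).tens X)))
    = ((E i).map (toPreProductSystem.swap l j X)).comp
      ((toPreProductSystem.swap l i ((E j).tens X)).comp
        ((E l).map (toPreProductSystem.swap j i X)))

end Basic3

section Sums
variable {M : Type u} [CStarAlgebra M]

namespace HRep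
variable (X Y : HRep M)

theorem withLp_clm_ext {V V' W W' : Type u} [NormedAddCommGroup V] [NormedSpace ℂ V]
    [NormedAddCommGroup V'] [NormedSpace ℂ V'] [NormedAddCommGroup W] [NormedSpace ℂ W]
    [NormedAddCommGroup W'] [NormedSpace ℂ W']
    {f g : WithLp 2 (V × V') →L[ℂ] WithLp 2 (W × W')}
    (h1 : ∀ v, (f v).fst = (g v).fst) (h2 : ∀ v, (f v).snd = (g v).snd) : f = g :=
  ContinuousLinearMap.ext fun v => WithLp.ofLp_injective 2 (Prod.ext (h1 v) (h2 v))

/-- The Hilbert space direct sum of two representations. -/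
noncomputable def plus : HRep M where
  carrier := WithLp 2 (X × Y)
  act :=
    { toFun := fun a => ((WithLp.prodContinuousLinearEquiv 2 ℂ X Y).symm :
          (X × Y) →L[ℂ] WithLp 2 (X × Y)).comp
          (((X.act a).prodMap (Y.act a)).comp
            (WithLp.prodContinuousLinearEquiv 2 ℂ X Y : WithLp 2 (X × Y) →L[ℂ] X × Y))
      map_one' := withLp_clm_ext (fun v => by simp) (fun v => by simp)
      map_mul' := fun a b => withLp_clm_ext (fun v => by simp) (fun v => by simp)
      map_zero' := withLp_clm_ext (fun v => by simp) (fun v => by simp)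
      map_add' := fun a b => withLp_clm_ext (fun v => by simp) (fun v => by simp)
      commutes' := fun c => withLp_clm_ext (fun v => by simp [Algebra.algebraMap_eq_smul_one])
        (fun v => by simp [Algebra.algebraMap_eq_smul_one])
      map_star' := fun a => by
        rw [ContinuousLinearMap.star_eq_adjoint, ContinuousLinearMap.eq_adjoint_iff]
        intro v w
        simp [WithLp.prod_inner_apply, map_star]
        simp only [ContinuousLinearMap.star_eq_adjoint,
          ContinuousLinearMap.adjoint_inner_left] }

end HRep

/-- The operator `⨁ X i (a)` on the Hilbert space direct sum of a family. -/
noncomputable def lsumCLM {ι : Type} (X : ι → HRep M) (a : M) :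
    lp (fun i => X i) 2 →L[ℂ] lp (fun i => X i) 2 :=
  have key : ∀ (f : lp (fun i => X i) 2) (i : ι),
      ‖(X i).act a (f i)‖ ≤ ‖(((‖a‖ : ℂ) • f : lp (fun i => X i) 2) : ∀ i, X i) i‖ := fun f i => by
    rw [lp.coeFn_smul, Pi.smul_apply, norm_smul, Complex.norm_real, norm_norm]
    refine ((X i).act a).le_of_opNorm_le ?_ (f i)
    exact NonUnitalStarAlgHom.norm_apply_le (X i).act a
  LinearMap.mkContinuous
    { toFun := fun f => ⟨fun i => (X i).act a (f i),
        Memℓp.mono' (lp.memℓp ((‖a‖ : ℂ) • f : lp (fun i => X i) 2)) (key f)⟩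
      map_add' := fun f g => by ext i; simp; rfl
      map_smul' := fun c f => by ext i; simp }
    ‖a‖ (fun f => by
      have h := lp.norm_mono (p := 2) two_ne_zero
        (x := (⟨fun i => (X i).act a (f i), Memℓp.mono'
          (lp.memℓp ((‖a‖ : ℂ) • f : lp (fun i => X i) 2)) (key f)⟩ : lp (fun i => X i) 2))
        (y := ((‖a‖ : ℂ) • f : lp (fun i => X i) 2)) (key f)
      rw [norm_smul, Complex.norm_real, norm_norm] at h
      exact h)

theorem lsumCLM_apply {ι : Type} (X : ι → HRep M) (a : M) (f : lp (fun i => X i) 2) (i : ι) :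
    (lsumCLM X a f : ∀ i, X i) i = (X i).act a (f i) := rfl

/-- The Hilbert space direct sum of a family of representations. -/
noncomputable def lsum {ι : Type} (X : ι → HRep M) : HRep M where
  carrier := lp (fun i => X i) 2
  act :=
    { toFun := lsumCLM X
      map_one' := by ext f i; simp [lsumCLM_apply]
      map_mul' := fun a b => by ext f i; simp [lsumCLM_apply]
      map_zero' := by ext f i; simp [lsumCLM_apply]
      map_add' := fun a b => by ext f i; simp [lsumCLM_apply]
      commutes' := fun c => by ext f i; simp [lsumCLM_apply, Algebra.algebraMap_eq_smul_one]
      map_star' := fun a => by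
        rw [ContinuousLinearMap.star_eq_adjoint, ContinuousLinearMap.eq_adjoint_iff]
        intro v w
        rw [lp.inner_eq_tsum, lp.inner_eq_tsum]
        refine tsum_congr fun i => ?_
        rw [lsumCLM_apply, lsumCLM_apply, map_star, ContinuousLinearMap.star_eq_adjoint,
          ContinuousLinearMap.adjoint_inner_left] }

namespace HHom
variable {X Y Z : HRep M}

/-- The first inclusion. -/
noncomputable def inl (X Y : HRep M) : HHom X (X.plus Y) where
  toCLM := ((WithLp.prodContinuousLinearEquiv 2 ℂ X Y).symm :
    (X × Y) →L[ℂ] WithLp 2 (X × Y)).comp (ContinuousLinearMap.inl ℂ X Y)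
  comm a _ := WithLp.ofLp_injective 2 (Prod.ext rfl (map_zero (Y.act a)).symm)

/-- The second inclusion. -/
noncomputable def inr (X Y : HRep M) : HHom Y (X.plus Y) where
  toCLM := ((WithLp.prodContinuousLinearEquiv 2 ℂ X Y).symm :
    (X × Y) →L[ℂ] WithLp 2 (X × Y)).comp (ContinuousLinearMap.inr ℂ X Y)
  comm a _ := WithLp.ofLp_injective 2 (Prod.ext (map_zero (X.act a)).symm rfl)

/-- The first projection. -/
noncomputable def fst (X Y : HRep M) : HHom (X.plus Y) X where
  toCLM := (ContinuousLinearMap.fst ℂ X Y).comp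
    (WithLp.prodContinuousLinearEquiv 2 ℂ X Y : WithLp 2 (X × Y) →L[ℂ] X × Y)
  comm _ _ := rfl

/-- The second projection. -/
noncomputable def snd (X Y : HRep M) : HHom (X.plus Y) Y where
  toCLM := (ContinuousLinearMap.snd ℂ X Y).comp
    (WithLp.prodContinuousLinearEquiv 2 ℂ X Y : WithLp 2 (X × Y) →L[ℂ] X × Y)
  comm _ _ := rfl

/-- The `i`-th coordinate map of a Hilbert space direct sum. -/
noncomputable def eval {ι : Type} (X : ι → HRep M) (i : ι) : HHom (lsum X) (X i) where
  toCLM := lp.evalCLM ℂ (fun i => X i) 2 i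
  comm _ _ := rfl

open Classical in
/-- The operator into a Hilbert space direct sum with the components `f i`, if these define a
bounded operator (and `0` otherwise). -/
noncomputable def ofComponents {ι : Type} {X : ι → HRep M} (f : ∀ i, HHom Y (X i)) :
    HHom Y (lsum X) :=
  if h : ∃ g : HHom Y (lsum X), ∀ i, (eval X i).comp g = f i then h.choose else 0

theorem sqrt_comm (f : HHom X X) (a : M) : Commute (CFC.sqrt f.toCLM) (X.act a) := by
  have h : Commute f.toCLM (X.act a) := ContinuousLinearMap.ext fun x => f.comm a x
  exact h.cfcₙ_nnreal _

/-- The positive square root of a positive operator. -/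
noncomputable def sqrt (f : HHom X X) : HHom X X where
  toCLM := CFC.sqrt f.toCLM
  comm a x := DFunLike.congr_fun (sqrt_comm f a).eq x

theorem act_mem_closure (f : HHom X Y) (a : M) {y : Y}
    (hy : y ∈ (LinearMap.range (f.toCLM : X →ₗ[ℂ] Y)).topologicalClosure) :
    Y.act a y ∈ (LinearMap.range (f.toCLM : X →ₗ[ℂ] Y)).topologicalClosure := by
  refine map_mem_closure (Y.act a).continuous hy ?_
  rintro _ ⟨x, rfl⟩
  exact ⟨X.act a x, f.comm a x⟩

/-- The closure of the range of `f`, as a representation. -/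
noncomputable def rangeClosure (f : HHom X Y) : HRep M where
  carrier := (LinearMap.range (f.toCLM : X →ₗ[ℂ] Y)).topologicalClosure
  act :=
    { toFun := fun a => ((Y.act a).comp (Submodule.subtypeL _)).codRestrict _
        (fun y => act_mem_closure f a y.2)
      map_one' := by ext y; simp
      map_mul' := fun a b => by ext y; simp; rfl
      map_zero' := by ext y; simp
      map_add' := fun a b => by ext y; simp; rfl
      commutes' := fun c => by ext y; simp [Algebra.algebraMap_eq_smul_one]
      map_star' := fun a => by
        rw [ContinuousLinearMap.star_eq_adjoint, ContinuousLinearMap.eq_adjoint_iff]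
        intro v w
        rw [Submodule.coe_inner, Submodule.coe_inner]
        simp [map_star, ContinuousLinearMap.star_eq_adjoint,
          ContinuousLinearMap.adjoint_inner_left]
        rfl }

/-- `f`, as an operator into the closure of its range. -/
noncomputable def toClosure (f : HHom X Y) : HHom X f.rangeClosure where
  toCLM := f.toCLM.codRestrict _ (fun x => Submodule.le_topologicalClosure _ ⟨x, rfl⟩)
  comm a x := Subtype.ext (f.comm a x)

end HHom

end Sums

section Reps
variable {M : Type u} [CStarAlgebra M] [PartialOrder M] [StarOrderedRing M]

/-- A completely contractive covariant representation of `E` on `H`, the representation of `M`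
being the given one. -/
structure IsCCRep (E : WCorr M) (H : HRep M) (T : E →ₗ[ℂ] (H →L[ℂ] H)) : Prop where
  normal : H.Normal
  completely_contractive : ∀ (k : ℕ) (x : Fin k → Fin k → E),
    ‖(CStarMatrix.ofMatrix (fun i j => T (x i j)) : CStarMatrix (Fin k) (Fin k) (H →L[ℂ] H))‖ ^ 2
      ≤ ‖(CStarMatrix.ofMatrix (fun i j => ∑ l, E.ip (x l i) (x l j)) :
          CStarMatrix (Fin k) (Fin k) M)‖
  map_lact : ∀ a ξ, T (E.lact a ξ) = H.act a * T ξ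
  map_ract : ∀ ξ a, T (E.ract ξ a) = T ξ * H.act a

/-- The isometry condition `T(ξ)* T(η) = σ(⟨ξ, η⟩)`. -/
def IsIsometric (E : WCorr M) (H : HRep M) (T : E →ₗ[ℂ] (H →L[ℂ] H)) : Prop :=
  ∀ ξ η, star (T ξ) * T η = H.act (E.ip ξ η)

open Classical in
/-- The operator `T̃ : E ⊗ H → H`, `ξ ⊗ h ↦ T(ξ) h` (it exists, and is unique, for every
completely contractive covariant representation `T`). -/
noncomputable def tilde {E : WCorr M} {H : HRep M} (T : E →ₗ[ℂ] (H →L[ℂ] H)) :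
    HHom (E.tens H) H :=
  if h : ∃ S : HHom (E.tens H) H, ∀ ξ x, S (WCorr.tmul ξ x) = T ξ x then h.choose else 0

namespace PreProductSystem
variable {n : ℕ} (S : PreProductSystem M n)

/-- A completely contractive representation of a product system on `H`. -/
structure IsRep (H : HRep M) (T : ∀ i, S.E i →ₗ[ℂ] (H →L[ℂ] H)) : Prop where
  ccRep : ∀ i, IsCCRep (S.E i) H (T i)
  commute : ∀ i j, (tilde (T i)).comp ((S.E i).map (tilde (T j)))
    = (tilde (T j)).comp (((S.E j).map (tilde (T i))).comp (S.swap i j H))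

/-- An isometric representation of a product system on `K`. -/
def IsIsometricRep (K : HRep M) (R : ∀ i, S.E i →ₗ[ℂ] (K →L[ℂ] K)) : Prop :=
  S.IsRep K R ∧ ∀ i, IsIsometric (S.E i) K (R i)

/-- The representation `R` on `K` is a dilation of the representation `T` on `H`, by means of the
isometry `J : H → K`. -/
def IsDilation {H K : HRep M} (J : HHom H K) (T : ∀ i, S.E i →ₗ[ℂ] (H →L[ℂ] H))
    (R : ∀ i, S.E i →ₗ[ℂ] (K →L[ℂ] K)) : Prop :=
  J.IsIsometry ∧ ∀ i, ((S.E i).map J).comp (tilde (T i)).adj = (tilde (R i)).adj.comp J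

/-- For a word `w = i₁ i₂ ⋯ i_k`, the space `E_{i₁} ⊗ E_{i₂} ⊗ ⋯ ⊗ E_{i_k} ⊗ X`. -/
noncomputable def word : List (Fin n) → HRep M → HRep M
  | [], X => X
  | i :: w, X => (S.E i).tens (word w X)

/-- The operator `I ⊗ f` on `E_{i₁} ⊗ ⋯ ⊗ E_{i_k} ⊗ X`. -/
noncomputable def wordMap {X Y : HRep M} (f : HHom X Y) :
    (w : List (Fin n)) → HHom (S.word w X) (S.word w Y)
  | [] => f
  | i :: w => (S.E i).map (wordMap f w)

/-- The identification of `E_{w w'} ⊗ X` with `E_w ⊗ (E_{w'} ⊗ X)`. -/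
noncomputable def wordAppend : (w w' : List (Fin n)) → (X : HRep M) →
    HHom (S.word (w ++ w') X) (S.word w (S.word w' X))
  | [], w', X => HHom.id (S.word w' X)
  | i :: w, w', X => (S.E i).map (wordAppend w w' X)

/-- `E_w ⊗ X = E_{w'} ⊗ X` for equal words. -/
noncomputable def wordCast {w w' : List (Fin n)} (h : w = w') (X : HRep M) :
    HHom (S.word w X) (S.word w' X) :=
  h ▸ HHom.id (S.word w X)

/-- The operator `T̃_{i₁} (I ⊗ T̃_{i₂}) ⋯ (I ⊗ T̃_{i_k}) : E_{i₁} ⊗ ⋯ ⊗ E_{i_k} ⊗ H → H`. -/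
noncomputable def repWord {H : HRep M} (T : ∀ i, S.E i →ₗ[ℂ] (H →L[ℂ] H)) :
    (w : List (Fin n)) → HHom (S.word w H) H
  | [] => HHom.id H
  | i :: w => (tilde (T i)).comp ((S.E i).map (repWord T w))

/-- Move the first letter of a word past all smaller letters in front of it, by means of the
identifications `t`. -/
noncomputable def insertMap (i : Fin n) : (w : List (Fin n)) → (X : HRep M) →
    HHom ((S.E i).tens (S.word w X)) (S.word (w.orderedInsert (· ≤ ·) i) X)
  | [], X => HHom.id _
  | j :: w, X =>
    if h : i ≤ j then
      S.wordCast (w := i :: j :: w) (by simp [h]) X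
    else
      (S.wordCast (w := j :: w.orderedInsert (· ≤ ·) i) (by simp [h]) X).comp
        (((S.E j).map (insertMap i w X)).comp (S.swap i j (S.word w X)))

/-- Sort the letters of a word, by means of the identifications `t`. -/
noncomputable def sortMap : (w : List (Fin n)) → (X : HRep M) →
    HHom (S.word w X) (S.word (w.insertionSort (· ≤ ·)) X)
  | [], _ => HHom.id _
  | i :: w, X => (S.insertMap i (w.insertionSort (· ≤ ·)) X).comp ((S.E i).map (sortMap w X))

/-- The canonical identification of `E_w ⊗ X` with `E_{w'} ⊗ X`, for two words `w`, `w'` that are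
rearrangements of each other, given by the identifications `t` of the product system. -/
noncomputable def reorder (w w' : List (Fin n)) (X : HRep M) : HHom (S.word w X) (S.word w' X) :=
  if h : w.insertionSort (· ≤ ·) = w'.insertionSort (· ≤ ·) then
    (S.sortMap w' X).adj.comp ((S.wordCast h X).comp (S.sortMap w X))
  else 0

/-- `∑_{G ⊆ J} (-1)^|G| T̃_G T̃_G*`, where `T̃_G` belongs to the product of the words `w i`,
`i ∈ G`. -/
noncomputable def szego {H : HRep M} (T : ∀ i, S.E i →ₗ[ℂ] (H →L[ℂ] H)) (J : Finset (Fin n))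
    (w : Fin n → List (Fin n)) : HHom H H where
  toCLM := ∑ G ∈ J.powerset, ((-1 : ℂ) ^ G.card) •
    ((S.repWord T (G.sort.flatMap w)).comp (S.repWord T (G.sort.flatMap w)).adj).toCLM
  comm a x := by
    simp [((S.repWord T (List.flatMap w (Finset.sort _))).comp
      (S.repWord T (List.flatMap w (Finset.sort _))).adj).comm]

end PreProductSystem

end Reps

section Dil
variable {M : Type u} [CStarAlgebra M] [PartialOrder M] [StarOrderedRing M]

/-- A `W*`-algebra, as a `C*`-algebra that is `*`-isomorphic to a von Neumann algebra. -/
def IsWStar (M : Type u) [CStarAlgebra M] : Prop :=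
  ∃ (K : Type u) (_ : NormedAddCommGroup K) (_ : InnerProductSpace ℂ K) (_ : CompleteSpace K)
    (S : VonNeumannAlgebra K), Nonempty (M ≃⋆ₐ[ℂ] S.toStarSubalgebra)

/-- An infinite generator: a Hilbert space direct sum of infinitely many copies of a faithful
normal representation `Y` of `M`. -/
def IsInfiniteGenerator (X : HRep M) : Prop :=
  ∃ (Y : HRep M) (κ : Type u) (J : κ → HHom Y X), Y.Normal ∧ Function.Injective Y.act ∧
    Infinite κ ∧ (∀ k, (J k).IsIsometry) ∧
    (∀ k l, k ≠ l → ∀ y y', (inner ℂ (J k y) (J l y') : ℂ) = 0) ∧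
    Dense (Submodule.span ℂ {v : X | ∃ k y, v = J k y} : Set X)

namespace PreProductSystem
variable {m : ℕ} (S : PreProductSystem M (m + 2)) {H : HRep M}
  (T : ∀ i, S.E i →ₗ[ℂ] (H →L[ℂ] H))

/-- The operator `∑_G (-1)^|G| T̃_G T̃_G*` of `T̂₁ = (T₂, …, Tₙ)`. -/
noncomputable def szegoFst : HHom H H := S.szego T (Finset.univ.erase 0) (fun i => [i])

/-- The operator `∑_G (-1)^|G| T̃_G T̃_G*` of `T̂ₙ = (T₁, …, Tₙ₋₁)`. -/
noncomputable def szegoLast : HHom H H :=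
  S.szego T (Finset.univ.erase (Fin.last (m + 1))) (fun i => [i])

/-- The operator `∑_G (-1)^|G| T̃_G T̃_G*` of `T̂₁ₙ = (T₁Tₙ, T₂, …, Tₙ₋₁)`. -/
noncomputable def szegoFstLast : HHom H H :=
  S.szego T (Finset.univ.erase (Fin.last (m + 1)))
    (fun i => if i = 0 then [0, Fin.last (m + 1)] else [i])

/-- The class `𝒯ⁿ_{1,n}`: `T̂₁` and `T̂ₙ` are Szegő positive and `T̂ₙ` is pure, that is,
`T̃ᵢ^(N) T̃ᵢ^(N)* → 0` in the weak operator topology for `i ≠ n`. -/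
structure IsClassT : Prop where
  isRep : S.IsRep H T
  szegoFst_nonneg : 0 ≤ (S.szegoFst T).toCLM
  szegoLast_nonneg : 0 ≤ (S.szegoLast T).toCLM
  pure : ∀ i, i ≠ Fin.last (m + 1) → ∀ h k : H, Filter.Tendsto (fun N : ℕ =>
    (inner ℂ k (S.repWord T (List.replicate N i)
      ((S.repWord T (List.replicate N i)).adj h)) : ℂ)) Filter.atTop (nhds 0)

/-- The defect operator `D_{T̂₁}`. -/
noncomputable abbrev defFst : HHom H H := (S.szegoFst T).sqrt

/-- The defect operator `D_{T̂ₙ}`. -/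
noncomputable abbrev defLast : HHom H H := (S.szegoLast T).sqrt

/-- The defect operator `D_{T̂₁ₙ}`. -/
noncomputable abbrev defFstLast : HHom H H := (S.szegoFstLast T).sqrt

/-- The operator `h ↦ D_{T̂ₙ} h ⊕ (I₁ ⊗ D_{T̂₁}) T̃₁* h ⊕ 0`. -/
noncomputable def vecLast (ℰ : HRep M) : HHom H ((S.defLast T).rangeClosure.plus
    (((S.E 0).tens (S.defFst T).rangeClosure).plus ℰ)) :=
  (HHom.inl _ _).comp (S.defLast T).toClosure +
    (HHom.inr _ _).comp ((HHom.inl _ _).comp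
      (((S.E 0).map (S.defFst T).toClosure).comp (tilde (T 0)).adj))

/-- The operator `h ↦ D_{T̂₁} h ⊕ (Iₙ ⊗ D_{T̂ₙ}) T̃ₙ* h ⊕ 0`. -/
noncomputable def vecFst (ℰ : HRep M) : HHom H ((S.defFst T).rangeClosure.plus
    (((S.E (Fin.last (m + 1))).tens (S.defLast T).rangeClosure).plus ℰ)) :=
  (HHom.inl _ _).comp (S.defFst T).toClosure +
    (HHom.inr _ _).comp ((HHom.inl _ _).comp
      (((S.E (Fin.last (m + 1))).map (S.defLast T).toClosure).comp
        (tilde (T (Fin.last (m + 1)))).adj))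

/-- The data from which the dilation is built: infinite generators `ℰ₁`, `ℰ₂` with unitaries
`u₁ : E₁ ⊗ ℰ₂ → ℰ₁` and `u₂ : ℰ₂ → Eₙ ⊗ ℰ₁`, a unitary
`U : 𝒟_{T̂₁} ⊕ (Eₙ ⊗ 𝒟_{T̂ₙ}) ⊕ ℰ₂ → 𝒟_{T̂ₙ} ⊕ (E₁ ⊗ 𝒟_{T̂₁}) ⊕ ℰ₁` with
`U (D_{T̂₁} h ⊕ (Iₙ ⊗ D_{T̂ₙ}) T̃ₙ* h ⊕ 0) = D_{T̂ₙ} h ⊕ (I₁ ⊗ D_{T̂₁}) T̃₁* h ⊕ 0`, and the isometry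
`V` with `V D_{T̂₁ₙ} h = D_{T̂ₙ} h ⊕ (I₁ ⊗ D_{T̂₁}) T̃₁* h ⊕ 0`. All of them intertwine the actions
of `M`. -/
structure DilationData where
  ℰ₁ : HRep M
  ℰ₂ : HRep M
  ℰ₁_gen : IsInfiniteGenerator ℰ₁
  ℰ₂_gen : IsInfiniteGenerator ℰ₂
  u₁ : HHom ((S.E 0).tens ℰ₂) ℰ₁
  u₁_unitary : u₁.IsUnitary
  u₂ : HHom ℰ₂ ((S.E (Fin.last (m + 1))).tens ℰ₁)
  u₂_unitary : u₂.IsUnitary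
  U : HHom ((S.defFst T).rangeClosure.plus
      (((S.E (Fin.last (m + 1))).tens (S.defLast T).rangeClosure).plus ℰ₂))
    ((S.defLast T).rangeClosure.plus
      (((S.E 0).tens (S.defFst T).rangeClosure).plus ℰ₁))
  U_unitary : U.IsUnitary
  U_comp : U.comp (S.vecFst T ℰ₂) = S.vecLast T ℰ₁
  V : HHom (S.defFstLast T).rangeClosure ((S.defLast T).rangeClosure.plus
      (((S.E 0).tens (S.defFst T).rangeClosure).plus ℰ₁))
  V_isometry : V.IsIsometry
  V_comp : V.comp (S.defFstLast T).toClosure = S.vecLast T ℰ₁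

/-- The word of `E₁ₙ = E₁ ⊗ Eₙ` for `j = 0`, and of `E_{j+1}` for `j > 0`. -/
def genWord (m : ℕ) (j : Fin (m + 1)) : List (Fin (m + 2)) :=
  if j = 0 then [0, Fin.last (m + 1)] else [j.castSucc]

/-- The word of `E^α = E₁ₙ^{⊗ α₁} ⊗ E₂^{⊗ α₂} ⊗ ⋯ ⊗ Eₙ₋₁^{⊗ αₙ₋₁}`. -/
def fockWord (α : Fin (m + 1) → ℕ) : List (Fin (m + 2)) :=
  (List.finRange (m + 1)).flatMap fun j => (List.replicate (α j) (genWord m j)).flatten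

/-- `ℱ(E) ⊗ X = ⨁_α E^α ⊗ X`. -/
noncomputable def fock (X : HRep M) : HRep M :=
  lsum fun α : Fin (m + 1) → ℕ => S.word (fockWord α) X

/-- The creation operator `E_u ⊗ ℱ(E) ⊗ X → ℱ(E) ⊗ X`, `ξ ⊗ v ↦ ξ ⊗ v`, where `u` is the word of
the `j`-th generator (`u = [0, n - 1]` for `j = 0`, and `u = [j]` for `j > 0`). It takes the summand
of `α` to the summand of `α + e_j`. -/
noncomputable def create (u : List (Fin (m + 2))) (j : Fin (m + 1)) (X : HRep M) :
    HHom (S.word u (S.fock X)) (S.fock X) :=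
  HHom.ofComponents fun β =>
    if β j = 0 then 0 else
      (S.reorder (u ++ fockWord (β - Pi.single j 1)) (fockWord β) X).comp
        ((S.wordAppend u (fockWord (β - Pi.single j 1)) X).adj.comp
          (S.wordMap (HHom.eval _ (β - Pi.single j 1)) u))

/-- The identification of `E_i ⊗ E_w ⊗ X` with `E_w ⊗ E_i ⊗ X`. -/
noncomputable def moveIn (i : Fin (m + 2)) (w : List (Fin (m + 2))) (X : HRep M) :
    HHom ((S.E i).tens (S.word w X)) (S.word w ((S.E i).tens X)) :=
  (S.wordAppend w [i] X).comp (S.reorder (i :: w) (w ++ [i]) X)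

/-- `E₁ₙ ⊗ X` -/
noncomputable abbrev tensFL (X : HRep M) : HRep M :=
  (S.E 0).tens ((S.E (Fin.last (m + 1))).tens X)

/-- `I₁ₙ ⊗ f`. -/
noncomputable abbrev mapFL {X Y : HRep M} (f : HHom X Y) : HHom (S.tensFL X) (S.tensFL Y) :=
  (S.E 0).map ((S.E (Fin.last (m + 1))).map f)

/-- The multiplier `τ_{U*} = I ⊗ (A* + (I₁ₙ ⊗ C*) B*) : E_i ⊗ ℱ(E) ⊗ 𝒟 → ℱ(E) ⊗ 𝒟` for
`U = [A, B; C, 0]` with blocks `A : 𝒟 → E_i ⊗ 𝒟`, `B : E₁ₙ ⊗ 𝒟' → E_i ⊗ 𝒟` and `C : 𝒟 → 𝒟'`.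
The summand `E_i ⊗ E^α ⊗ 𝒟` is identified with `E^α ⊗ E_i ⊗ 𝒟`, and `E^α ⊗ E₁ₙ ⊗ 𝒟` with the summand of `α + e₁` of
`ℱ(E) ⊗ 𝒟`. -/
noncomputable def transfer (i : Fin (m + 2)) {D D' : HRep M} (A : HHom D ((S.E i).tens D))
    (B : HHom (S.tensFL D') ((S.E i).tens D)) (C : HHom D D') :
    HHom ((S.E i).tens (S.fock D)) (S.fock D) :=
  HHom.ofComponents fun β =>
    (S.wordMap A.adj (fockWord β)).comp
        ((S.moveIn i (fockWord β) D).comp ((S.E i).map (HHom.eval _ β))) +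
      if β 0 = 0 then 0 else
        (S.reorder (fockWord (β - Pi.single 0 1) ++ [0, Fin.last (m + 1)]) (fockWord β) D).comp
          ((S.wordAppend (fockWord (β - Pi.single 0 1)) [0, Fin.last (m + 1)] D).adj.comp
            ((S.wordMap ((S.mapFL C.adj).comp B.adj) (fockWord (β - Pi.single 0 1))).comp
              ((S.moveIn i (fockWord (β - Pi.single 0 1)) D).comp
                ((S.E i).map (HHom.eval _ (β - Pi.single 0 1))))))

/-- The block operator `[A, B; C, 0]`. -/
noncomputable def block {D D' X Y : HRep M} (A : HHom D X) (B : HHom Y X) (C : HHom D D') :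
    HHom (D.plus Y) (X.plus D') :=
  (HHom.inl _ _).comp (A.comp (HHom.fst _ _) + B.comp (HHom.snd _ _)) +
    (HHom.inr _ _).comp (C.comp (HHom.fst _ _))


namespace DilationData
variable {S T} (d : S.DilationData T)

/-- The defect space of `T̂₁`. -/
noncomputable abbrev D₁ (_ : S.DilationData T) : HRep M := (S.defFst T).rangeClosure

/-- The defect space of `T̂ₙ`. -/
noncomputable abbrev Dₙ (_ : S.DilationData T) : HRep M := (S.defLast T).rangeClosure

/-- `𝒟 = 𝒟_{T̂ₙ} ⊕ (E₁ ⊗ 𝒟_{T̂₁}) ⊕ ℰ₁` -/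
noncomputable abbrev D : HRep M := d.Dₙ.plus (((S.E 0).tens d.D₁).plus d.ℰ₁)

/-- `𝒟' = 𝒟_{T̂ₙ} ⊕ ℰ₁` -/
noncomputable abbrev D' : HRep M := d.Dₙ.plus d.ℰ₁

/-- `A₁ = (I₁ ⊗ U) P₁` -/
noncomputable def A₁ : HHom d.D ((S.E 0).tens d.D) :=
  ((S.E 0).map d.U).comp (((S.E 0).map (HHom.inl _ _)).comp
    ((HHom.fst _ _).comp (HHom.snd _ _)))

/-- `B₁ = (I₁ ⊗ U) j₂'` -/
noncomputable def B₁ : HHom (S.tensFL d.D') ((S.E 0).tens d.D) :=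
  (S.E 0).map (d.U.comp ((HHom.inr _ _).comp
    ((HHom.inl _ _).comp ((S.E (Fin.last (m + 1))).map (HHom.fst _ _)) +
      (HHom.inr _ _).comp (d.u₂.adj.comp ((S.E (Fin.last (m + 1))).map (HHom.snd _ _))))))

/-- `C₁ = i₂*` -/
noncomputable def C₁ : HHom d.D d.D' :=
  (HHom.inl _ _).comp (HHom.fst _ _) +
    (HHom.inr _ _).comp ((HHom.snd _ _).comp (HHom.snd _ _))

/-- `Aₙ = (I ⊕ u₂) P₂ U*` -/
noncomputable def Aₙ : HHom d.D ((S.E (Fin.last (m + 1))).tens d.D) :=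
  (((S.E (Fin.last (m + 1))).map (HHom.inl _ _)).comp ((HHom.fst _ _).comp (HHom.snd _ _)) +
    ((S.E (Fin.last (m + 1))).map ((HHom.inr _ _).comp (HHom.inr _ _))).comp
      (d.u₂.comp ((HHom.snd _ _).comp (HHom.snd _ _)))).comp d.U.adj

/-- `Bₙ = i₁'`, after the identification of `E₁ ⊗ Eₙ` with `Eₙ ⊗ E₁`. -/
noncomputable def Bₙ : HHom (S.tensFL d.D₁) ((S.E (Fin.last (m + 1))).tens d.D) :=
  ((S.E (Fin.last (m + 1))).map ((HHom.inr _ _).comp (HHom.inl _ _))).comp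
    (S.swap 0 (Fin.last (m + 1)) d.D₁)

/-- `Cₙ = i₁* U*` -/
noncomputable def Cₙ : HHom d.D d.D₁ := (HHom.fst _ _).comp d.U.adj

/-- `U₁ : 𝒟 ⊕ (E₁ₙ ⊗ 𝒟') → (E₁ ⊗ 𝒟) ⊕ 𝒟'` -/
noncomputable def U₁ : HHom (d.D.plus (S.tensFL d.D')) (((S.E 0).tens d.D).plus d.D') :=
  block d.A₁ d.B₁ d.C₁

/-- `Uₙ : 𝒟 ⊕ (E₁ₙ ⊗ 𝒟_{T̂₁}) → (Eₙ ⊗ 𝒟) ⊕ 𝒟_{T̂₁}` -/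
noncomputable def Uₙ : HHom (d.D.plus (S.tensFL d.D₁))
    (((S.E (Fin.last (m + 1))).tens d.D).plus d.D₁) :=
  block d.Aₙ d.Bₙ d.Cₙ

/-- `K = ℱ(E) ⊗ 𝒟` -/
noncomputable abbrev K : HRep M := S.fock d.D

/-- `τ_{U₁*} : E₁ ⊗ K → K` -/
noncomputable def τ₁ : HHom ((S.E 0).tens d.K) d.K := S.transfer 0 d.A₁ d.B₁ d.C₁

/-- `τ_{Uₙ*} : Eₙ ⊗ K → K` -/
noncomputable def τₙ : HHom ((S.E (Fin.last (m + 1))).tens d.K) d.K :=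
  S.transfer (Fin.last (m + 1)) d.Aₙ d.Bₙ d.Cₙ

/-- `L̃₁ : E₁ ⊗ Eₙ ⊗ K → K` -/
noncomputable def L₁ : HHom (S.tensFL d.K) d.K := S.create [0, Fin.last (m + 1)] 0 d.D

/-- `L̃ᵢ : Eᵢ ⊗ K → K` for the `m = n - 2` indices `i` strictly between the first and the last. -/
noncomputable def L (k : Fin m) : HHom ((S.E k.succ.castSucc).tens d.K) d.K :=
  S.create [k.succ.castSucc] k.succ d.D

/-- `Π_{1n,V} h = ⨁_α (I ⊗ V D_{T̂₁ₙ}) T̃₁ₙ^{(α)}* h` -/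
noncomputable def dilationMap : HHom H d.K :=
  HHom.ofComponents fun α =>
    (S.wordMap (d.V.comp (S.defFstLast T).toClosure) (fockWord α)).comp
      (S.repWord T (fockWord α)).adj

end DilationData
end PreProductSystem
end Dil

end ProdSys

open ProdSys

/-!
The dilation on `K = ⨁_α E^α ⊗ 𝒟` rests on two factorizations. The first factors the creation
operator `L₁` of `E₁ₙ` into two commuting isometries, the second compares the norms of defect
vectors.

*Identifications.* Every computation involves tensor products of the `E_i` in some order. The maps
that interchange two neighbouring factors generate all identifications, and two identifications
between the same words are equal: sorting a word absorbs every interchange, by the hexagon identity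
and `t_{j,i} = t_{i,j}⁻¹` (`ProductSystem.sortMap_natural_of_reord`), and sorting is unitary as soon
as the representation at the end of the word is normal. Hence an equation between compositions of
identifications follows by comparing the words (`ProductSystem.isCoh_unique`).

*Multipliers.* The operators `τ_{U₁*}`, `τ_{Uₙ*}` and `L_i` are operators on the Fock space of
degree at most one, that is, determined by a column `(g₀, g₁)` on `E_i ⊗ 𝒟` (`Mult`). Such an
operator is an isometry if the column is isometric and the parts of different degree have
orthogonal ranges (`Mult.op_isIsometry`). A product of two multipliers is computed on `𝒟`
(`ProductSystem.op_comp_op_eq_create`), and multipliers commute with the creation operators of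
`E₂, …, E_{n-1}`. For the two transfer operators everything follows from four relations
(`ProductSystem.IsPair`) between `A₁` and `Aₙ`. They hold because `A₁ = (I ⊗ i) k*` and
`Aₙ = (I ⊗ c) w*` come from the two orthogonal decompositions `𝒟 = (E₁ ⊗ 𝒟₁) ⊕ 𝒟'` and
`𝒟 = U 𝒟₁ ⊕ U (Eₙ ⊗ 𝒟')`, with the inclusions `k`, `c` and `i`, `w`; the relations yield the
unitarity of the blocks, the isometry of the transfer operators and
`τ_{U₁*} (I ⊗ τ_{Uₙ*}) = L₁`.

*The dilation map.* Complete contractivity makes the `T̃_i` exist and be contractions, by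
normalizing the Gram matrix of finitely many vectors (`IsCCRep.norm_sum_sq_le`). The alternating
sums satisfy `Δ₁ₙ = Δₙ + T̃₁ (I ⊗ Δ₁) T̃₁* = Δ₁ + T̃ₙ (I ⊗ Δₙ) T̃ₙ*`, so that `Δ₁ₙ ≥ 0`, and so that
the vectors that `U` and `V` relate to each other have equal norms. The series for `‖Π h‖²` is a sum
of alternating differences of `β ↦ ‖T̃^{(β)}* h‖²`; over a cube it telescopes to the values at the
corners, all of which but `‖h‖²` tend to `0` by purity (`ProductSystem.hasSum_norm_sq`). The
intertwining relations may be tested on the summands of `K`, and by naturality they reduce to a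
relation between `T̃₁`, `T̃ₙ` and the vector `Dₙ h ⊕ (I ⊗ D₁) T̃₁* h`, whose components in both
decompositions of `𝒟` are known.

*Existence of the data.* A `W*`-algebra has a faithful normal representation `Y`. A maximality
argument shows that some nonzero vector functional of a nonzero normal representation is dominated
by a vector functional of `Y` (`exists_vector_le`). This gives a nonzero intertwining operator and,
by polar decomposition, a nonzero part of the representation that embeds into `Y`. By Zorn's lemma
every normal representation is a direct sum of parts of `Y` (`exists_isSumOf`), so that it embeds
into a large multiple of `Y`. Let `ℰ₁` be a multiple of `Y` and `ℰ₂ = Eₙ ⊗ ℰ₁`; since the left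
actions are injective, `Eₙ ⊗ Y` and `E₁ ⊗ Eₙ ⊗ Y` are faithful too. If the multiplicity is large,
then `E₁ ⊗ ℰ₂` and `ℰ₁` embed into each other, and the Cantor–Bernstein argument
(`HHom.exists_unitary_of_isometries`) gives `u₁`; the domain and the range of `U` embed into the
complements of the ranges of the prescribed part, which gives `U` (`HHom.exists_unitary_extension`).
-/

set_option linter.unusedSectionVars false

namespace ProdSys

/-! ### Algebra of intertwining operators -/

section HHomAlgebra
variable {M : Type u} [CStarAlgebra M] [PartialOrder M] [StarOrderedRing M]
variable {X Y Z W : HRep M}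

namespace HHom

@[simp] theorem comp_apply (g : HHom Y Z) (f : HHom X Y) (x : X) : (g.comp f) x = g (f x) := rfl
@[simp] theorem id_apply (x : X) : (HHom.id X) x = x := rfl
@[simp] theorem add_apply (f g : HHom X Y) (x : X) : (f + g) x = f x + g x := rfl
@[simp] theorem zero_apply (x : X) : (0 : HHom X Y) x = 0 := rfl

theorem toCLM_injective : Function.Injective (HHom.toCLM : HHom X Y → (X →L[ℂ] Y)) :=
  fun _ _ h => HHom.ext fun x => DFunLike.congr_fun h x

theorem congr_hom {f g : HHom X Y} (h : f = g) (x : X) : f x = g x := by rw [h]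

instance : Neg (HHom X Y) := ⟨fun f => ⟨-f.toCLM, fun a x => by simp [f.comm]⟩⟩
instance : Sub (HHom X Y) := ⟨fun f g => ⟨f.toCLM - g.toCLM, fun a x => by simp [f.comm, g.comm]⟩⟩
instance : SMul ℂ (HHom X Y) := ⟨fun c f => ⟨c • f.toCLM, fun a x => by simp [f.comm]⟩⟩
instance : SMul ℕ (HHom X Y) := ⟨fun c f => ⟨c • f.toCLM, fun a x => by simp [f.comm]⟩⟩
instance : SMul ℤ (HHom X Y) := ⟨fun c f => ⟨c • f.toCLM, fun a x => by simp [f.comm]⟩⟩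

noncomputable instance : AddCommGroup (HHom X Y) :=
  toCLM_injective.addCommGroup _ rfl (fun _ _ => rfl) (fun _ => rfl) (fun _ _ => rfl)
    (fun _ _ => rfl) (fun _ _ => rfl)

/-- The underlying bounded operator, as an additive map. -/
noncomputable def toCLMAddHom : HHom X Y →+ (X →L[ℂ] Y) := ⟨⟨HHom.toCLM, rfl⟩, fun _ _ => rfl⟩

noncomputable instance : Module ℂ (HHom X Y) :=
  toCLM_injective.module ℂ toCLMAddHom (fun _ _ => rfl)

@[simp] theorem sub_apply (f g : HHom X Y) (x : X) : (f - g) x = f x - g x := rfl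
@[simp] theorem smul_apply (c : ℂ) (f : HHom X Y) (x : X) : (c • f) x = c • f x := rfl

theorem toCLM_sum {ι : Type*} (s : Finset ι) (f : ι → HHom X Y) :
    (∑ i ∈ s, f i).toCLM = ∑ i ∈ s, (f i).toCLM := map_sum toCLMAddHom f s

theorem comp_assoc (h : HHom Z W) (g : HHom Y Z) (f : HHom X Y) :
    (h.comp g).comp f = h.comp (g.comp f) := rfl
@[simp] theorem id_comp (f : HHom X Y) : (HHom.id Y).comp f = f := rfl
@[simp] theorem comp_id (f : HHom X Y) : f.comp (HHom.id X) = f := rfl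
theorem comp_add (g : HHom Y Z) (f f' : HHom X Y) : g.comp (f + f') = g.comp f + g.comp f' := by
  ext x; simp
theorem add_comp (g g' : HHom Y Z) (f : HHom X Y) : (g + g').comp f = g.comp f + g'.comp f := rfl
@[simp] theorem comp_zero (g : HHom Y Z) : g.comp (0 : HHom X Y) = 0 := by ext x; simp
@[simp] theorem zero_comp (f : HHom X Y) : (0 : HHom Y Z).comp f = 0 := rfl
theorem comp_smul (c : ℂ) (g : HHom Y Z) (f : HHom X Y) : g.comp (c • f) = c • g.comp f := by
  ext x; simp
theorem smul_comp (c : ℂ) (g : HHom Y Z) (f : HHom X Y) : (c • g).comp f = c • g.comp f := rfl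
theorem adj_inner_left (f : HHom X Y) (x : X) (y : Y) :
    inner ℂ (f.adj y) x = inner ℂ y (f x) := ContinuousLinearMap.adjoint_inner_left _ _ _
theorem adj_inner_right (f : HHom X Y) (x : X) (y : Y) :
    inner ℂ x (f.adj y) = inner ℂ (f x) y := ContinuousLinearMap.adjoint_inner_right _ _ _
@[simp] theorem adj_adj (f : HHom X Y) : f.adj.adj = f :=
  toCLM_injective (ContinuousLinearMap.adjoint_adjoint _)
theorem adj_comp (g : HHom Y Z) (f : HHom X Y) : (g.comp f).adj = f.adj.comp g.adj :=
  toCLM_injective (ContinuousLinearMap.adjoint_comp _ _)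
theorem adj_add (f g : HHom X Y) : (f + g).adj = f.adj + g.adj :=
  toCLM_injective (map_add ContinuousLinearMap.adjoint _ _)
@[simp] theorem adj_zero : (0 : HHom X Y).adj = 0 :=
  toCLM_injective (map_zero ContinuousLinearMap.adjoint)
@[simp] theorem adj_id : (HHom.id X).adj = HHom.id X :=
  toCLM_injective (ContinuousLinearMap.adjoint_id)
theorem eq_adj {f : HHom X Y} {g : HHom Y X} (h : ∀ x y, inner ℂ (g y) x = inner ℂ y (f x)) :
    g = f.adj := by
  ext y
  exact ext_inner_right ℂ fun x => by rw [h, adj_inner_left]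

theorem isIsometry_iff_norm {f : HHom X Y} : f.IsIsometry ↔ ∀ x, ‖f x‖ = ‖x‖ :=
  AddMonoidHomClass.isometry_iff_norm f.toCLM

theorem isIsometry_iff {f : HHom X Y} : f.IsIsometry ↔ f.adj.comp f = HHom.id X := by
  rw [isIsometry_iff_norm]
  constructor
  · intro h
    apply toCLM_injective
    exact (ContinuousLinearMap.norm_map_iff_adjoint_comp_self f.toCLM).mp h
  · intro h
    exact (ContinuousLinearMap.norm_map_iff_adjoint_comp_self f.toCLM).mpr
      (congrArg HHom.toCLM h)

theorem IsIsometry.inner_map {f : HHom X Y} (h : f.IsIsometry) (x y : X) :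
    inner ℂ (f x) (f y) = (inner ℂ x y : ℂ) := by
  rw [← adj_inner_right, ← comp_apply, isIsometry_iff.mp h, id_apply]

theorem IsIsometry.comp {g : HHom Y Z} {f : HHom X Y} (hg : g.IsIsometry) (hf : f.IsIsometry) :
    (g.comp f).IsIsometry :=
  isIsometry_iff_norm.mpr fun x => by
    rw [comp_apply, isIsometry_iff_norm.mp hg, isIsometry_iff_norm.mp hf]

theorem isIsometry_id : (HHom.id X).IsIsometry := isometry_id

theorem isUnitary_iff {f : HHom X Y} :
    f.IsUnitary ↔ f.adj.comp f = HHom.id X ∧ f.comp f.adj = HHom.id Y := by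
  constructor
  · rintro ⟨h, hs⟩
    refine ⟨isIsometry_iff.mp h, ?_⟩
    ext y
    obtain ⟨x, rfl⟩ := hs y
    exact congrArg f.toCLM (congr_hom (isIsometry_iff.mp h) x)
  · rintro ⟨h1, h2⟩
    exact ⟨isIsometry_iff.mpr h1, fun y => ⟨f.adj y, congr_hom h2 y⟩⟩

theorem IsUnitary.isIsometry {f : HHom X Y} (h : f.IsUnitary) : f.IsIsometry := h.1
theorem IsUnitary.adj_comp {f : HHom X Y} (h : f.IsUnitary) : f.adj.comp f = HHom.id X :=
  (isUnitary_iff.mp h).1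
theorem IsUnitary.comp_adj {f : HHom X Y} (h : f.IsUnitary) : f.comp f.adj = HHom.id Y :=
  (isUnitary_iff.mp h).2
theorem IsUnitary.adj {f : HHom X Y} (h : f.IsUnitary) : f.adj.IsUnitary :=
  isUnitary_iff.mpr ⟨by rw [adj_adj]; exact h.comp_adj, by rw [adj_adj]; exact h.adj_comp⟩
theorem IsUnitary.comp {g : HHom Y Z} {f : HHom X Y} (hg : g.IsUnitary) (hf : f.IsUnitary) :
    (g.comp f).IsUnitary := ⟨hg.1.comp hf.1, hg.2.comp hf.2⟩
theorem isUnitary_id : (HHom.id X).IsUnitary := ⟨isometry_id, Function.surjective_id⟩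

theorem IsUnitary.adj_comp_assoc {f : HHom X Y} (h : f.IsUnitary) (g : HHom Z X) :
    f.adj.comp (f.comp g) = g := by rw [← comp_assoc, h.adj_comp, id_comp]
theorem IsUnitary.comp_adj_assoc {f : HHom X Y} (h : f.IsUnitary) (g : HHom Z Y) :
    f.comp (f.adj.comp g) = g := by rw [← comp_assoc, h.comp_adj, id_comp]

/-- An intertwiner `g` defined on a dense subspace `f(A)` of `B` through `k = g f`. -/
theorem exists_extend {A B C : HRep M} (f : HHom A B) (hf : DenseRange f.toCLM) (k : HHom A C)
    (hk : ∀ a, ‖k a‖ ≤ ‖f a‖) : ∃ g : HHom B C, g.comp f = k := by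
  have h0 : ∀ a, ‖k a‖ ≤ 1 * ‖f a‖ := by simpa using hk
  have key : ∀ a, k.toCLM.extendOfNorm (f.toCLM : A →ₗ[ℂ] B) (f a) = k a := fun a =>
    k.toCLM.extendOfNorm_eq (e := (f.toCLM : A →ₗ[ℂ] B)) hf ⟨1, h0⟩ a
  refine ⟨⟨k.toCLM.extendOfNorm (f.toCLM : A →ₗ[ℂ] B), fun a => ?_⟩, HHom.ext key⟩
  intro x
  induction x using hf.induction_on with
  | hp => exact isClosed_eq (by fun_prop) (by fun_prop)
  | ih x =>
    change _ = C.act a (k.toCLM.extendOfNorm (f.toCLM : A →ₗ[ℂ] B) (f x))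
    rw [key, ← k.comm, ← f.comm]
    exact key _

theorem exists_extend_isometry {A B C : HRep M} (f : HHom A B) (hf : DenseRange f.toCLM)
    (k : HHom A C) (hk : ∀ a, ‖k a‖ = ‖f a‖) : ∃ g : HHom B C, g.IsIsometry ∧ g.comp f = k := by
  obtain ⟨g, hg⟩ := exists_extend f hf k fun a => (hk a).le
  refine ⟨g, isIsometry_iff_norm.mpr fun x => ?_, hg⟩
  induction x using hf.induction_on with
  | hp => exact isClosed_eq (by fun_prop) (by fun_prop)
  | ih x =>
    rw [← hk, ← hg]; rfl

theorem toClosure_denseRange (f : HHom X Y) : DenseRange f.toClosure.toCLM := by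
  intro y
  have hy := y.2
  rw [← SetLike.mem_coe, Submodule.topologicalClosure_coe, Metric.mem_closure_iff] at hy
  rw [Metric.mem_closure_iff]
  intro ε hε
  obtain ⟨b, ⟨x, rfl⟩, hb⟩ := hy ε hε
  exact ⟨_, ⟨x, rfl⟩, hb⟩

theorem toClosure_norm (f : HHom X Y) (x : X) : ‖f.toClosure x‖ = ‖f x‖ := rfl

/-- The inclusion of the closure of the range. -/
noncomputable def ofClosure (f : HHom X Y) : HHom f.rangeClosure Y where
  toCLM := Submodule.subtypeL _
  comm _ _ := rfl

theorem ofClosure_isIsometry (f : HHom X Y) : f.ofClosure.IsIsometry :=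
  isIsometry_iff_norm.mpr fun _ => rfl

theorem sqrt_comp_sqrt (f : HHom X X) (hf : 0 ≤ f.toCLM) : f.sqrt.comp f.sqrt = f :=
  toCLM_injective (CFC.sqrt_mul_sqrt_self f.toCLM hf)

theorem sqrt_adj (f : HHom X X) : f.sqrt.adj = f.sqrt :=
  toCLM_injective (IsSelfAdjoint.of_nonneg (CFC.sqrt_nonneg f.toCLM))

theorem norm_sqrt_sq (f : HHom X X) (hf : 0 ≤ f.toCLM) (x : X) :
    ‖f.sqrt x‖ ^ 2 = (inner ℂ x (f x) : ℂ).re := by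
  rw [norm_sq_eq_re_inner (𝕜 := ℂ), ← adj_inner_right, sqrt_adj, ← comp_apply,
    sqrt_comp_sqrt f hf]; rfl

end HHom

namespace WCorr
variable (E : WCorr M)

@[simp] theorem map_id : E.map (HHom.id X) = HHom.id (E.tens X) :=
  HHom.toCLM_injective (tens_ext fun ξ x => map_tmul _ ξ x)

theorem map_comp (g : HHom Y Z) (f : HHom X Y) : E.map (g.comp f) = (E.map g).comp (E.map f) :=
  HHom.toCLM_injective (tens_ext fun ξ x => by
    change E.map _ _ = E.map g (E.map f _)
    rw [map_tmul, map_tmul, map_tmul]; rfl)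

theorem tmul_add (ξ : E) (x y : X) : tmul ξ (x + y) = tmul ξ x + tmul ξ y :=
  map_add (tmulCLM X ξ) x y
theorem tmul_smul (ξ : E) (c : ℂ) (x : X) : tmul ξ (c • x) = c • tmul ξ x :=
  map_smul (tmulCLM X ξ) c x
theorem add_tmul (ξ η : E) (x : X) : tmul (ξ + η) x = tmul ξ x + tmul η x := by
  simp only [tmul, TensorProduct.add_tmul, map_add]; rfl
theorem smul_tmul (c : ℂ) (ξ : E) (x : X) : tmul (c • ξ) x = c • tmul ξ x := by
  simp only [tmul, ← TensorProduct.smul_tmul', map_smul]; rfl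

theorem map_add (f g : HHom X Y) : E.map (f + g) = E.map f + E.map g :=
  HHom.toCLM_injective (tens_ext fun ξ x => by
    change E.map _ _ = E.map f _ + E.map g _
    rw [map_tmul, map_tmul, map_tmul]; exact tmul_add E ξ _ _)

theorem map_smul (c : ℂ) (f : HHom X Y) : E.map (c • f) = c • E.map f :=
  HHom.toCLM_injective (tens_ext fun ξ x => by
    change E.map _ _ = c • E.map f _
    rw [map_tmul, map_tmul]; exact tmul_smul E ξ _ _)

/-- `f ↦ I ⊗ f` as a linear map. -/
noncomputable def mapₗ (X Y : HRep M) : HHom X Y →ₗ[ℂ] HHom (E.tens X) (E.tens Y) :=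
  ⟨⟨E.map, map_add E⟩, map_smul E⟩

@[simp] theorem map_zero : E.map (0 : HHom X Y) = 0 := _root_.map_zero (E.mapₗ X Y)

theorem map_adj (f : HHom X Y) : E.map f.adj = (E.map f).adj :=
  HHom.toCLM_injective (eq_adjoint_of_tmul fun ξ x η y => by
    change inner ℂ (E.map f.adj (tmul ξ x)) (tmul η y) = inner ℂ (tmul ξ x) (E.map f (tmul η y))
    rw [map_tmul, map_tmul, inner_tmul, inner_tmul, HHom.adj_inner_left, f.comm])

theorem map_isUnitary {f : HHom X Y} (hf : f.IsUnitary) : (E.map f).IsUnitary := by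
  rw [HHom.isUnitary_iff] at *
  rw [← map_adj, ← map_comp, ← map_comp, hf.1, hf.2, map_id, map_id]
  exact ⟨rfl, rfl⟩

/-- The algebraic span of the elementary tensors is dense. -/
theorem dense_tmul (X : HRep M) {s : Submodule ℂ (E.tens X)} (hs : ∀ ξ x, tmul ξ x ∈ s) :
    Dense (s : Set (E.tens X)) := by
  have h1 : ∀ u : E ⊗[ℂ] X, E.tmulₗ X u ∈ s := by
    intro u
    induction u with
    | zero => rw [LinearMap.map_zero]; exact s.zero_mem
    | add a b ha hb => rw [LinearMap.map_add]; exact s.add_mem ha hb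
    | tmul ξ x => exact hs ξ x
  refine (UniformSpace.Completion.denseRange_coe (α := PreTensor E X)).mono ?_
  rintro _ ⟨a, rfl⟩
  exact h1 a

end WCorr
end HHomAlgebra

/-! ### Normal representations -/

section Normality
variable {M : Type u} [CStarAlgebra M] [PartialOrder M] [StarOrderedRing M]
variable {X Y Z : HRep M}

theorem HRep.inner_act_star_mul (X : HRep M) (c : M) (h k : X) :
    (inner ℂ h (X.act (star c * c) k) : ℂ) = inner ℂ (X.act c h) (X.act c k) := by
  rw [map_mul, map_star, ContinuousLinearMap.star_eq_adjoint, mul_apply_eq_comp,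
    ContinuousLinearMap.adjoint_inner_right]

theorem HRep.act_nonneg_re (X : HRep M) {a : M} (ha : 0 ≤ a) (h : X) :
    0 ≤ (inner ℂ h (X.act a h) : ℂ).re := by
  obtain ⟨c, rfl⟩ := exists_eq_star_mul ha
  rw [X.inner_act_star_mul]
  exact inner_self_nonneg (𝕜 := ℂ)

theorem HRep.act_mono_re (X : HRep M) {a b : M} (hab : a ≤ b) (h : X) :
    (inner ℂ h (X.act a h) : ℂ).re ≤ (inner ℂ h (X.act b h) : ℂ).re := by
  have := X.act_nonneg_re (sub_nonneg.mpr hab) h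
  rw [map_sub, sub_apply, inner_sub_right, Complex.sub_re] at this
  linarith

/-- The form of a positive element satisfies `q (h + k) ≤ 2 q h + 2 q k`. -/
theorem HRep.act_add_le (X : HRep M) {a : M} (ha : 0 ≤ a) (h k : X) :
    (inner ℂ (h + k) (X.act a (h + k)) : ℂ).re ≤
      2 * (inner ℂ h (X.act a h) : ℂ).re + 2 * (inner ℂ k (X.act a k) : ℂ).re := by
  obtain ⟨c, rfl⟩ := exists_eq_star_mul ha
  simp only [X.inner_act_star_mul]
  have e : ∀ v : X, (inner ℂ v v : ℂ).re = ‖v‖ ^ 2 := fun v =>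
    (norm_sq_eq_re_inner (𝕜 := ℂ) v).symm
  rw [e, e, e, map_add]
  have := norm_add_le (X.act c h) (X.act c k)
  nlinarith [sq_nonneg (‖X.act c h‖ - ‖X.act c k‖), norm_nonneg (X.act c h + X.act c k)]

/-- The forms of the elements of the directed set `S` converge to that of `a` at `h`. -/
def HRep.ConvAt (X : HRep M) (S : Set M) (a : M) (h : X) : Prop :=
  ∀ ε : ℝ, 0 < ε → ∃ s ∈ S, ∀ s' ∈ S, s ≤ s' → (inner ℂ h (X.act (a - s') h) : ℂ).re < ε

theorem HRep.convAt_iff (X : HRep M) {S : Set M} {a : M} (ha : IsLUB S a) (h : X) :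
    X.ConvAt S a h ↔
      IsLUB ((fun s => (inner ℂ h (X.act s h) : ℂ).re) '' S) (inner ℂ h (X.act a h) : ℂ).re := by
  constructor
  · intro hc
    refine ⟨?_, fun b hb => le_of_forall_pos_lt_add fun ε hε => ?_⟩
    · rintro _ ⟨s, hs, rfl⟩
      exact X.act_mono_re (ha.1 hs) h
    · obtain ⟨s, hs, hs'⟩ := hc ε hε
      have h1 := hs' s hs le_rfl
      have h2 : (inner ℂ h (X.act s h) : ℂ).re ≤ b := hb ⟨s, hs, rfl⟩
      rw [map_sub, sub_apply, inner_sub_right, Complex.sub_re] at h1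
      linarith
  · intro hl ε hε
    obtain ⟨_, ⟨s, hs, rfl⟩, hs', -⟩ := hl.exists_between_sub_self hε
    refine ⟨s, hs, fun s' _ hss' => ?_⟩
    have := X.act_mono_re hss' h
    rw [map_sub, sub_apply, inner_sub_right, Complex.sub_re]
    dsimp only at hs'
    linarith

theorem dense_span_of_forall {V : Type*} [NormedAddCommGroup V] [InnerProductSpace ℂ V]
    [CompleteSpace V] {D : Set V} (h : ∀ v, (∀ d ∈ D, (inner ℂ d v : ℂ) = 0) → v = 0) :
    Dense (Submodule.span ℂ D : Set V) := by
  rw [Submodule.dense_iff_topologicalClosure_eq_top, Submodule.topologicalClosure_eq_top_iff,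
    Submodule.eq_bot_iff]
  intro v hv
  exact h v fun d hd => hv d (Submodule.subset_span hd)

/-- Normality can be tested on the vectors of a total set. -/
theorem HRep.normal_of_total {D : Set X} (hD : Dense (Submodule.span ℂ D : Set X))
    (h : ∀ (S : Set M) (a : M), S.Nonempty → DirectedOn (· ≤ ·) S → (∀ s ∈ S, IsSelfAdjoint s) →
      IsLUB S a → ∀ v ∈ D, IsLUB ((fun s => (inner ℂ v (X.act s v) : ℂ).re) '' S)
        (inner ℂ v (X.act a v) : ℂ).re) : X.Normal := by
  intro S a hS hdir hsa ha v
  rw [← X.convAt_iff ha]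
  let N : Submodule ℂ X :=
    { carrier := {v | X.ConvAt S a v}
      zero_mem' := fun ε hε => by
        obtain ⟨s, hs⟩ := hS
        exact ⟨s, hs, fun _ _ _ => by simpa using hε⟩
      add_mem' := by
        intro x y hx hy ε hε
        obtain ⟨s, hs, h1⟩ := hx (ε / 4) (by positivity)
        obtain ⟨t, ht, h2⟩ := hy (ε / 4) (by positivity)
        obtain ⟨r, hr, hsr, htr⟩ := hdir s hs t ht
        refine ⟨r, hr, fun s' hs' hrs => ?_⟩
        have h3 := X.act_add_le (sub_nonneg.mpr (ha.1 hs')) x y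
        have h4 := h1 s' hs' (hsr.trans hrs)
        have h5 := h2 s' hs' (htr.trans hrs)
        linarith
      smul_mem' := by
        intro c x hx ε hε
        obtain ⟨s, hs, h1⟩ := hx (ε / (‖c‖ ^ 2 + 1)) (by positivity)
        refine ⟨s, hs, fun s' hs' hss => ?_⟩
        have h2 := h1 s' hs' hss
        have h0 := X.act_nonneg_re (sub_nonneg.mpr (ha.1 hs')) x
        rw [map_smul, inner_smul_left, inner_smul_right, ← mul_assoc, Complex.conj_mul',
          ← Complex.ofReal_pow, Complex.re_ofReal_mul]
        rw [lt_div_iff₀ (by positivity)] at h2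
        nlinarith [sq_nonneg ‖c‖] }
  have hN : Submodule.span ℂ D ≤ N := Submodule.span_le.mpr fun d hd =>
    (X.convAt_iff ha d).mpr (h S a hS hdir hsa ha d hd)
  intro ε hε
  obtain ⟨s₀, hs₀⟩ := hS
  obtain ⟨w, hw, hvw⟩ := Metric.mem_closure_iff.mp (hD v)
    (Real.sqrt (ε / (4 * (‖X.act (a - s₀)‖ + 1)))) (by positivity)
  obtain ⟨s, hs, h1⟩ := hN hw (ε / 4) (by positivity)
  obtain ⟨r, hr, hsr, h0r⟩ := hdir s hs s₀ hs₀
  refine ⟨r, hr, fun s' hs' hrs => ?_⟩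
  have h2 := X.act_add_le (sub_nonneg.mpr (ha.1 hs')) w (v - w)
  rw [add_sub_cancel] at h2
  have h3 := h1 s' hs' (hsr.trans hrs)
  have h4 := X.act_mono_re (sub_le_sub_left (h0r.trans hrs) a) (v - w)
  have h5 : (inner ℂ (v - w) (X.act (a - s₀) (v - w)) : ℂ).re
      ≤ ‖X.act (a - s₀)‖ * ‖v - w‖ ^ 2 := by
    refine (Complex.re_le_norm _).trans ((norm_inner_le_norm _ _).trans ?_)
    have := (X.act (a - s₀)).le_opNorm (v - w)
    nlinarith [norm_nonneg (v - w)]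
  have h6 : ‖v - w‖ ^ 2 < ε / (4 * (‖X.act (a - s₀)‖ + 1)) := by
    rw [dist_eq_norm] at hvw
    exact (Real.lt_sqrt (norm_nonneg _)).mp hvw
  rw [lt_div_iff₀ (by positivity)] at h6
  nlinarith [norm_nonneg (X.act (a - s₀)), sq_nonneg ‖v - w‖]

theorem HHom.IsIsometry.inner_act {f : HHom X Y} (hf : f.IsIsometry) (a : M) (x : X) :
    (inner ℂ (f x) (Y.act a (f x)) : ℂ) = inner ℂ x (X.act a x) := by
  rw [← f.comm]; exact hf.inner_map _ _

theorem HRep.Normal.of_isometry (hY : Y.Normal) {f : HHom X Y} (hf : f.IsIsometry) : X.Normal := by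
  intro S a hS hdir hsa ha v
  simp_rw [← hf.inner_act]
  exact hY S a hS hdir hsa ha (f v)

/-- A representation spanned by isometric images of normal ones is normal. -/
theorem HRep.normal_of_family {κ : Type*} {W : κ → HRep M} (hW : ∀ k, (W k).Normal)
    (J : ∀ k, HHom (W k) X) (hJ : ∀ k, (J k).IsIsometry)
    (hd : Dense (Submodule.span ℂ {v : X | ∃ k y, v = J k y} : Set X)) : X.Normal := by
  refine HRep.normal_of_total hd ?_
  rintro S a hS hdir hsa ha _ ⟨k, y, rfl⟩
  simp_rw [(hJ k).inner_act]
  exact hW k S a hS hdir hsa ha y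

theorem WCorr.tens_normal (E : WCorr M) (hX : X.Normal) : (E.tens X).Normal := by
  refine HRep.normal_of_total (D := {v | ∃ ξ x, v = WCorr.tmul ξ x})
    (E.dense_tmul X fun ξ x => Submodule.subset_span ⟨ξ, x, rfl⟩) ?_
  rintro S a hS hdir hsa ha _ ⟨ξ, x, rfl⟩
  simp_rw [WCorr.act_tmul, WCorr.inner_tmul]
  have h1 := E.lact_normal S a hS hdir hsa ha ξ
  have hmono : ∀ s t : M, s ≤ t → E.ip ξ (E.lact s ξ) ≤ E.ip ξ (E.lact t ξ) := by
    intro s t hst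
    obtain ⟨c, hc⟩ := exists_eq_star_mul (sub_nonneg.mpr hst)
    rw [← sub_nonneg, ← map_sub, ← LinearMap.sub_apply, ← map_sub, hc, ← WCorr.lact_ip_lact]
    exact E.ip_nonneg _
  have h2 := hX ((fun s => E.ip ξ (E.lact s ξ)) '' S) _ (hS.image _) ?_ ?_ h1 x
  · rwa [Set.image_image] at h2
  · rintro _ ⟨s, hs, rfl⟩ _ ⟨t, ht, rfl⟩
    obtain ⟨r, hr, hsr, htr⟩ := hdir s hs t ht
    exact ⟨_, ⟨r, hr, rfl⟩, hmono _ _ hsr, hmono _ _ htr⟩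
  · rintro _ ⟨s, hs, rfl⟩
    rw [isSelfAdjoint_iff, E.star_ip, E.ip_lact, (hsa s hs).star_eq]

/-! ### Direct sums -/

namespace HHom

theorem plus_ext {v w : X.plus Y} (h1 : fst X Y v = fst X Y w) (h2 : snd X Y v = snd X Y w) :
    v = w := WithLp.ofLp_injective 2 (Prod.ext h1 h2)

@[simp] theorem fst_comp_inl : (fst X Y).comp (inl X Y) = HHom.id X := rfl
@[simp] theorem snd_comp_inr : (snd X Y).comp (inr X Y) = HHom.id Y := rfl
@[simp] theorem fst_comp_inr : (fst X Y).comp (inr X Y) = 0 := rfl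
@[simp] theorem snd_comp_inl : (snd X Y).comp (inl X Y) = 0 := rfl
@[simp] theorem fst_inl (x : X) : fst X Y (inl X Y x) = x := rfl
@[simp] theorem snd_inl (x : X) : snd X Y (inl X Y x) = 0 := rfl
@[simp] theorem fst_inr (y : Y) : fst X Y (inr X Y y) = 0 := rfl
@[simp] theorem snd_inr (y : Y) : snd X Y (inr X Y y) = y := rfl

theorem inl_fst_add_inr_snd :
    (inl X Y).comp (fst X Y) + (inr X Y).comp (snd X Y) = HHom.id (X.plus Y) :=
  HHom.ext fun v => plus_ext (by
      change fst X Y v + 0 = _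
      rw [add_zero]; rfl) (by
      change 0 + snd X Y v = _
      rw [zero_add]; rfl)

theorem plus_inner (v w : X.plus Y) :
    (inner ℂ v w : ℂ) = inner ℂ (fst X Y v) (fst X Y w) + inner ℂ (snd X Y v) (snd X Y w) :=
  WithLp.prod_inner_apply v w

@[simp] theorem inl_adj : (inl X Y).adj = fst X Y :=
  (eq_adj fun x v => by simp [plus_inner]).symm
@[simp] theorem inr_adj : (inr X Y).adj = snd X Y :=
  (eq_adj fun x v => by simp [plus_inner]).symm
@[simp] theorem fst_adj : (fst X Y).adj = inl X Y := by rw [← inl_adj, adj_adj]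
@[simp] theorem snd_adj : (snd X Y).adj = inr X Y := by rw [← inr_adj, adj_adj]

theorem inl_isIsometry : (inl X Y).IsIsometry := isIsometry_iff.mpr (by simp)
theorem inr_isIsometry : (inr X Y).IsIsometry := isIsometry_iff.mpr (by simp)

theorem plus_normal (hX : X.Normal) (hY : Y.Normal) : (X.plus Y).Normal := by
  refine HRep.normal_of_family (κ := Bool) (W := fun b => bif b then X else Y)
    (by rintro (_ | _) <;> assumption)
    (fun b => match b with
      | true => inl X Y
      | false => inr X Y)
    (by rintro (_ | _); exacts [inr_isIsometry, inl_isIsometry]) ?_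
  refine dense_span_of_forall fun v hv => plus_ext ?_ ?_
  · refine ext_inner_left ℂ fun x => ?_
    have := hv _ ⟨true, x, rfl⟩
    change inner ℂ (inl X Y x) v = (0 : ℂ) at this
    rw [← adj_inner_right, inl_adj] at this
    rw [this, map_zero, inner_zero_right]
  · refine ext_inner_left ℂ fun x => ?_
    have := hv _ ⟨false, x, rfl⟩
    change inner ℂ (inr X Y x) v = (0 : ℂ) at this
    rw [← adj_inner_right, inr_adj] at this
    rw [this, map_zero, inner_zero_right]

section lsum
variable {ι : Type} {V : ι → HRep M}

/-- The inclusion of a summand into a Hilbert space direct sum. -/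
noncomputable def incl (V : ι → HRep M) (i : ι) : HHom (V i) (lsum V) := (eval V i).adj

theorem lsum_ext {v w : lsum V} (h : ∀ i, eval V i v = eval V i w) : v = w :=
  lp.ext (funext h)

open Classical in
theorem incl_apply (i : ι) (x : V i) : incl V i x = lp.single 2 i x := by
  refine ext_inner_right ℂ fun v => ?_
  rw [incl, adj_inner_left]
  exact (lp.inner_single_left (𝕜 := ℂ) i x v).symm

@[simp] theorem eval_comp_incl_self (i : ι) : (eval V i).comp (incl V i) = HHom.id (V i) := by
  classical
  ext x
  rw [comp_apply, incl_apply]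
  exact lp.single_apply_self (E := fun i => V i) 2 i x

theorem eval_comp_incl_ne {i j : ι} (h : j ≠ i) : (eval V j).comp (incl V i) = 0 := by
  classical
  ext x
  rw [comp_apply, incl_apply]
  exact lp.single_apply_ne (E := fun i => V i) 2 i x h

theorem incl_isIsometry (i : ι) : (incl V i).IsIsometry :=
  isIsometry_iff.mpr (by rw [incl, adj_adj, ← incl, eval_comp_incl_self])

theorem dense_incl : Dense (Submodule.span ℂ {v : lsum V | ∃ i x, v = incl V i x} : Set (lsum V)) :=
  dense_span_of_forall fun v hv => lsum_ext fun i => ext_inner_left ℂ fun x => by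
    have := hv _ ⟨i, x, rfl⟩
    rw [incl, adj_inner_left] at this
    rw [this, map_zero, inner_zero_right]

theorem lsum_normal (hV : ∀ i, (V i).Normal) : (lsum V).Normal :=
  HRep.normal_of_family hV (incl V) incl_isIsometry dense_incl

theorem clm_ext_of_dense {V W : Type*} [NormedAddCommGroup V] [NormedSpace ℂ V]
    [NormedAddCommGroup W] [NormedSpace ℂ W] {D : Set V}
    (hD : Dense (Submodule.span ℂ D : Set V)) {f g : V →L[ℂ] W} (h : ∀ d ∈ D, f d = g d) :
    f = g := ContinuousLinearMap.ext_on hD h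

end lsum
end HHom
end Normality
/-! ### Flips of two correspondences -/

section Swaps
variable {M : Type u} [CStarAlgebra M] [PartialOrder M] [StarOrderedRing M]
variable {X Y Z : HRep M}

namespace BalancedTensor
open WCorr
variable {E F : WCorr M} (P : BalancedTensor E F)

theorem fuse_tmul (ξ : E) (v : F.tens X) : P.fuse X (tmul ξ v) = P.lmulCLM X ξ v :=
  (ContinuousLinearMap.fromCompletion_apply_coe _ _).trans (P.lmul_tmul X ξ v)

theorem fuse_tmul_tmul (ξ : E) (η : F) (x : X) :
    P.fuse X (tmul ξ (tmul η x)) = tmul (P.mul ξ η) x := P.fuseCLM_tmul X ξ η x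

theorem fuse_isIsometry (X : HRep M) : (P.fuse X).IsIsometry := by
  rw [HHom.isIsometry_iff]
  refine HHom.toCLM_injective (tens_ext fun ξ v => tens_vec_ext fun η w => ?_)
  change inner ℂ (tmul η w) ((P.fuse X).adj (P.fuse X (tmul ξ v))) = inner ℂ _ (tmul ξ v)
  rw [HHom.adj_inner_right, fuse_tmul, fuse_tmul, lmulCLM_inner, inner_tmul]

theorem fuse_isUnitary (hX : X.Normal) : (P.fuse X).IsUnitary := by
  rw [HHom.isUnitary_iff]
  have h1 := HHom.isIsometry_iff.mp (P.fuse_isIsometry X)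
  refine ⟨h1, HHom.toCLM_injective (HHom.clm_ext_of_dense (P.total X hX) ?_)⟩
  rintro _ ⟨x, y, h, rfl⟩
  rw [← fuse_tmul_tmul]
  exact congrArg (P.fuse X).toCLM (HHom.congr_hom h1 (tmul x (tmul y h)))

theorem fuse_natural (f : HHom X Y) :
    (P.G.map f).comp (P.fuse X) = (P.fuse Y).comp (E.map (F.map f)) := by
  refine HHom.toCLM_injective (tens_tens_ext fun ξ η x => ?_)
  change P.G.map f (P.fuse X _) = P.fuse Y (E.map (F.map f) _)
  rw [fuse_tmul_tmul, map_tmul, map_tmul, map_tmul, fuse_tmul_tmul]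

theorem fuse_adj_natural (f : HHom X Y) :
    (P.fuse Y).adj.comp (P.G.map f) = (E.map (F.map f)).comp (P.fuse X).adj := by
  have h := congrArg HHom.adj (P.fuse_natural f.adj)
  simp only [HHom.adj_comp, map_adj, HHom.adj_adj] at h
  exact h

end BalancedTensor

theorem WIso.ampl_tmul {G G' : WCorr M} (t : WIso G G') (ξ : G) (x : X) :
    t.ampl X (WCorr.tmul ξ x) = WCorr.tmul (t.toEquiv ξ) x := t.amplCLM_tmul X ξ x

theorem WIso.ampl_natural {G G' : WCorr M} (t : WIso G G') (f : HHom X Y) :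
    (G'.map f).comp (t.ampl X) = (t.ampl Y).comp (G.map f) := by
  refine HHom.toCLM_injective (WCorr.tens_ext fun ξ x => ?_)
  change G'.map f (t.ampl X _) = t.ampl Y (G.map f _)
  rw [WIso.ampl_tmul, WCorr.map_tmul, WCorr.map_tmul, WIso.ampl_tmul]

theorem WIso.ampl_isIsometry {G G' : WCorr M} (t : WIso G G') (X : HRep M) :
    (t.ampl X).IsIsometry := by
  rw [HHom.isIsometry_iff]
  refine HHom.toCLM_injective (WCorr.tens_ext fun ξ v => WCorr.tens_vec_ext fun η w => ?_)
  change inner ℂ (WCorr.tmul η w) ((t.ampl X).adj (t.ampl X (WCorr.tmul ξ v)))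
    = inner ℂ _ (WCorr.tmul ξ v)
  rw [HHom.adj_inner_right, ampl_tmul, ampl_tmul, WCorr.inner_tmul, WCorr.inner_tmul, t.ip_map]

namespace PreProductSystem
variable {n : ℕ} (S : PreProductSystem M n)

theorem ampl_comp_ampl (i j : Fin n) (X : HRep M) :
    ((S.t j i).ampl X).comp ((S.t i j).ampl X) = HHom.id _ := by
  refine HHom.toCLM_injective (WCorr.tens_ext fun ξ x => ?_)
  change (S.t j i).ampl X ((S.t i j).ampl X _) = WCorr.tmul ξ x
  rw [WIso.ampl_tmul, WIso.ampl_tmul, S.t_symm]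

theorem ampl_isUnitary (i j : Fin n) (X : HRep M) : ((S.t i j).ampl X).IsUnitary :=
  ⟨(S.t i j).ampl_isIsometry X, fun v => ⟨_, HHom.congr_hom (S.ampl_comp_ampl j i X) v⟩⟩

theorem ampl_adj (i j : Fin n) (X : HRep M) : ((S.t i j).ampl X).adj = (S.t j i).ampl X := by
  rw [← HHom.comp_id ((S.t i j).ampl X).adj, ← S.ampl_comp_ampl j i X,
    (S.ampl_isUnitary i j X).adj_comp_assoc]

theorem swap_adj (i j : Fin n) (X : HRep M) : (S.swap i j X).adj = S.swap j i X := by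
  rw [swap, HHom.adj_comp, HHom.adj_comp, HHom.adj_adj, ampl_adj]; rfl

theorem swap_natural (i j : Fin n) (f : HHom X Y) :
    (S.swap i j Y).comp ((S.E i).map ((S.E j).map f))
      = ((S.E j).map ((S.E i).map f)).comp (S.swap i j X) := by
  rw [swap, swap, ← HHom.comp_assoc ((S.E j).map _), ← BalancedTensor.fuse_adj_natural,
    HHom.comp_assoc, HHom.comp_assoc, HHom.comp_assoc, ← BalancedTensor.fuse_natural,
    ← HHom.comp_assoc _ _ ((S.P i j).fuse X), ← WIso.ampl_natural]
  rfl

theorem swap_isUnitary (i j : Fin n) (hX : X.Normal) : (S.swap i j X).IsUnitary :=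
  ((S.P j i).fuse_isUnitary hX).adj.comp
    ((S.ampl_isUnitary i j X).comp ((S.P i j).fuse_isUnitary hX))

theorem swap_swap (i j : Fin n) (hX : X.Normal) :
    (S.swap j i X).comp (S.swap i j X) = HHom.id _ := by
  rw [← S.swap_adj i j X]; exact (S.swap_isUnitary i j hX).adj_comp

theorem swap_self (i : Fin n) (hX : X.Normal) : S.swap i i X = HHom.id _ := by
  have : (S.t i i).ampl X = HHom.id _ := by
    refine HHom.toCLM_injective (WCorr.tens_ext fun ξ x => ?_)
    change (S.t i i).ampl X (WCorr.tmul ξ x) = WCorr.tmul ξ x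
    rw [WIso.ampl_tmul, S.t_self]
  rw [swap, this, HHom.id_comp, ((S.P i i).fuse_isUnitary hX).adj_comp]

end PreProductSystem
end Swaps
/-! ### Functoriality of words -/

section Words
variable {M : Type u} [CStarAlgebra M] [PartialOrder M] [StarOrderedRing M]
variable {X Y Z A B C : HRep M}

/-- The identity map between equal representations. -/
noncomputable def HHom.ofEq (h : A = B) : HHom A B := h ▸ HHom.id A

namespace PreProductSystem
variable {n : ℕ} (S : PreProductSystem M n)

theorem word_normal (hX : X.Normal) : ∀ w, (S.word w X).Normal
  | [] => hX
  | i :: w => (S.E i).tens_normal (word_normal hX w)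

@[simp] theorem wordMap_id : ∀ w, S.wordMap (HHom.id X) w = HHom.id (S.word w X)
  | [] => rfl
  | i :: w => by
    change (S.E i).map (S.wordMap (HHom.id X) w) = _
    rw [wordMap_id w, WCorr.map_id]; rfl

theorem wordMap_comp (g : HHom Y Z) (f : HHom X Y) :
    ∀ w, S.wordMap (g.comp f) w = (S.wordMap g w).comp (S.wordMap f w)
  | [] => rfl
  | i :: w => by
    change (S.E i).map (S.wordMap (g.comp f) w) = _
    rw [wordMap_comp g f w, WCorr.map_comp]; rfl

theorem wordMap_add (f g : HHom X Y) :
    ∀ w, S.wordMap (f + g) w = S.wordMap f w + S.wordMap g w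
  | [] => rfl
  | i :: w => by
    change (S.E i).map (S.wordMap (f + g) w) = _
    rw [wordMap_add f g w, WCorr.map_add]; rfl

theorem wordMap_smul (c : ℂ) (f : HHom X Y) : ∀ w, S.wordMap (c • f) w = c • S.wordMap f w
  | [] => rfl
  | i :: w => by
    change (S.E i).map (S.wordMap (c • f) w) = _
    rw [wordMap_smul c f w, WCorr.map_smul]; rfl

/-- `f ↦ I_w ⊗ f` as a linear map. -/
noncomputable def wordMapₗ (X Y : HRep M) (w : List (Fin n)) :
    HHom X Y →ₗ[ℂ] HHom (S.word w X) (S.word w Y) :=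
  ⟨⟨fun f => S.wordMap f w, fun f g => S.wordMap_add f g w⟩, fun c f => S.wordMap_smul c f w⟩

@[simp] theorem wordMap_zero (w : List (Fin n)) : S.wordMap (0 : HHom X Y) w = 0 :=
  map_zero (S.wordMapₗ X Y w)

theorem wordMap_adj (f : HHom X Y) : ∀ w, S.wordMap f.adj w = (S.wordMap f w).adj
  | [] => rfl
  | i :: w => by
    change (S.E i).map (S.wordMap f.adj w) = _
    rw [wordMap_adj f w, WCorr.map_adj]; rfl

/-! ### The identifications of words agree -/

/-- The maps `E_w ⊗ X → E_{w'} ⊗ X` that are built from the identifications of two neighbouring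
letters. -/
inductive Reord (X : HRep M) :
    (w w' : List (Fin n)) → HHom (S.word w X) (S.word w' X) → Prop
  | refl (w : List (Fin n)) : Reord X w w (HHom.id _)
  | cons (i : Fin n) {w w' : List (Fin n)} {f : HHom (S.word w X) (S.word w' X)}
      (h : Reord X w w' f) : Reord X (i :: w) (i :: w') ((S.E i).map f)
  | swap (i j : Fin n) (w : List (Fin n)) :
      Reord X (i :: j :: w) (j :: i :: w) (S.swap i j (S.word w X))
  | trans {w w' w'' : List (Fin n)} {f : HHom (S.word w X) (S.word w' X)}
      {g : HHom (S.word w' X) (S.word w'' X)} (hf : Reord X w w' f) (hg : Reord X w' w'' g) :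
      Reord X w w'' (g.comp f)

/-- `f` and `g` are equal, once their target words are known to be equal. -/
def SameMap {w w' : List (Fin n)} (f : HHom A (S.word w X)) (g : HHom A (S.word w' X)) : Prop :=
  ∃ h : w = w', (S.wordCast h X).comp f = g

variable {S}

namespace SameMap
variable {w w' w'' : List (Fin n)} {f : HHom A (S.word w X)} {g : HHom A (S.word w' X)}
  {k : HHom A (S.word w'' X)}

theorem refl (f : HHom A (S.word w X)) : S.SameMap f f := ⟨rfl, rfl⟩

theorem symm (h : S.SameMap f g) : S.SameMap g f := by
  obtain ⟨rfl, rfl⟩ := h; exact ⟨rfl, rfl⟩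

theorem trans (h : S.SameMap f g) (h' : S.SameMap g k) : S.SameMap f k := by
  obtain ⟨rfl, rfl⟩ := h; exact h'

theorem of_eq {f g : HHom A (S.word w X)} (h : f = g) : S.SameMap f g := h ▸ refl f

theorem comp_right (h : S.SameMap f g) (k : HHom B A) : S.SameMap (f.comp k) (g.comp k) := by
  obtain ⟨rfl, rfl⟩ := h; exact ⟨rfl, rfl⟩

theorem map (i : Fin n) (h : S.SameMap f g) :
    S.SameMap (w := i :: w) (w' := i :: w') ((S.E i).map f) ((S.E i).map g) := by
  obtain ⟨rfl, rfl⟩ := h; exact ⟨rfl, rfl⟩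

/-- Inserting a further letter on the left respects equality up to the target word. -/
theorem insert (i : Fin n) (h : S.SameMap f g) :
    S.SameMap ((S.insertMap i w X).comp ((S.E i).map f))
      ((S.insertMap i w' X).comp ((S.E i).map g)) := by
  obtain ⟨rfl, rfl⟩ := h; exact ⟨rfl, rfl⟩

end SameMap

variable (S)

theorem insertMap_cons_le {i j : Fin n} (h : i ≤ j) (w : List (Fin n)) (X : HRep M) :
    S.SameMap (w := i :: j :: w) (HHom.id _) (S.insertMap i (j :: w) X) := by
  refine ⟨by simp [h], ?_⟩
  rw [insertMap]
  exact Eq.symm ((dif_pos h).trans rfl)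

theorem insertMap_cons_gt {i j : Fin n} (h : ¬ i ≤ j) (w : List (Fin n)) (X : HRep M) :
    S.SameMap (w := j :: w.orderedInsert (· ≤ ·) i)
      (((S.E j).map (S.insertMap i w X)).comp (S.swap i j (S.word w X)))
      (S.insertMap i (j :: w) X) := by
  refine ⟨by simp [h], ?_⟩
  rw [insertMap]
  exact Eq.symm ((dif_neg h).trans rfl)

end PreProductSystem

namespace ProductSystem
variable {n : ℕ} (S : ProductSystem M n)
open PreProductSystem

/-- Two letters may be inserted in either order. -/
theorem insert_insert_of_lt (hX : X.Normal) {i j : Fin n} (hij : i < j) : ∀ s : List (Fin n),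
    S.SameMap
      ((S.insertMap j (s.orderedInsert (· ≤ ·) i) X).comp
        (((S.E j).map (S.insertMap i s X)).comp (S.swap i j (S.word s X))))
      ((S.insertMap i (s.orderedInsert (· ≤ ·) j) X).comp ((S.E i).map (S.insertMap j s X)))
  | [] => by
    have h1 := (S.insertMap_cons_gt (not_le.mpr hij) [] X).symm
    have h2 := (S.insertMap_cons_le hij.le [] X)
    refine (h1.comp_right _).trans (SameMap.trans ?_ (h2.comp_right _))
    refine SameMap.of_eq ?_
    change (((S.E i).map (HHom.id _)).comp (S.swap j i X)).comp
      (((S.E j).map (HHom.id _)).comp (S.swap i j X)) = (HHom.id _).comp ((S.E i).map (HHom.id _))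
    rw [WCorr.map_id, WCorr.map_id, HHom.id_comp, HHom.id_comp, S.swap_swap i j hX]
    rfl
  | k :: s => by
    by_cases hik : i ≤ k
    · have h1 := (S.insertMap_cons_le hik s X).symm
      have h2 := (h1.insert j).comp_right (S.swap i j (S.word (k :: s) X))
      refine SameMap.trans h2 ?_
      have h3 := (S.insertMap_cons_gt (not_le.mpr hij) (k :: s) X).symm
      have h4 := h3.comp_right (((S.E j).map (HHom.id _)).comp (S.swap i j (S.word (k :: s) X)))
      refine SameMap.trans h4 ?_
      have h5 : ∀ l : List (Fin n), (∀ x ∈ l.head?, i ≤ x) →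
          S.SameMap (w := i :: l) (HHom.id _) (S.insertMap i l X) := by
        rintro (_ | ⟨x, l⟩) hl
        · exact SameMap.refl _
        · exact S.insertMap_cons_le (hl x rfl) l X
      have h6 := (h5 ((k :: s).orderedInsert (· ≤ ·) j) (by
        intro x hx
        by_cases hjk : j ≤ k
        · simp [hjk] at hx; omega
        · simp [hjk] at hx; omega)).comp_right ((S.E i).map (S.insertMap j (k :: s) X))
      refine SameMap.trans (SameMap.of_eq ?_) h6
      rw [WCorr.map_id, HHom.id_comp]
      exact congrArg ((S.E i).map (S.insertMap j (k :: s) X)).comp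
        (S.swap_swap i j (S.word_normal hX _))
    · have hjk : ¬ j ≤ k := by omega
      have ih := ((insert_insert_of_lt hX hij s).map k).comp_right
        ((S.swap i k _).comp ((S.E i).map (S.swap j k (S.word s X))))
      -- both sides are first brought to the form `I_k ⊗ _` by means of the hexagon identity
      have h1 := ((S.insertMap_cons_gt hik s X).symm.insert j).comp_right
        (S.swap i j (S.word (k :: s) X))
      have h2 := (S.insertMap_cons_gt hjk (s.orderedInsert (· ≤ ·) i) X).symm.comp_right
        (((S.E j).map (((S.E k).map (S.insertMap i s X)).comp (S.swap i k (S.word s X)))).comp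
          (S.swap i j (S.word (k :: s) X)))
      have h3 := ((S.insertMap_cons_gt hjk s X).symm.insert i)
      have h4 := (S.insertMap_cons_gt hik (s.orderedInsert (· ≤ ·) j) X).symm.comp_right
        ((S.E i).map (((S.E k).map (S.insertMap j s X)).comp (S.swap j k (S.word s X))))
      refine (h1.trans h2).trans (SameMap.trans ?_ (h3.trans h4).symm)
      refine SameMap.trans (SameMap.of_eq ?_) (ih.trans (SameMap.of_eq ?_))
      · rw [WCorr.map_comp, WCorr.map_comp, WCorr.map_comp]
        have hex := S.hexagon k j i (S.word s X) (S.word_normal hX s)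
        have nat := S.swap_natural j k (S.insertMap i s X)
        ext v
        have e1 := HHom.congr_hom hex v
        have e2 := HHom.congr_hom nat ((S.E j).map (S.swap i k (S.word s X))
          (S.swap i j (S.word (k :: s) X) v))
        simp only [HHom.comp_apply] at e1 e2 ⊢
        refine (congrArg _ e2).trans ?_
        exact congrArg (fun z => (S.E k).map _ ((S.E k).map _ z)) e1
      · rw [WCorr.map_comp, WCorr.map_comp]
        have nat := S.swap_natural i k (S.insertMap j s X)
        ext v
        have e2 := HHom.congr_hom nat ((S.E i).map (S.swap j k (S.word s X)) v)
        simp only [HHom.comp_apply] at e2 ⊢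
        exact congrArg _ e2.symm

/-- Two letters may be inserted in either order, without assumptions on the letters. -/
theorem insert_insert (hX : X.Normal) (i j : Fin n) (s : List (Fin n)) :
    S.SameMap
      ((S.insertMap j (s.orderedInsert (· ≤ ·) i) X).comp
        (((S.E j).map (S.insertMap i s X)).comp (S.swap i j (S.word s X))))
      ((S.insertMap i (s.orderedInsert (· ≤ ·) j) X).comp ((S.E i).map (S.insertMap j s X))) := by
  rcases lt_trichotomy i j with h | rfl | h
  · exact S.insert_insert_of_lt hX h s
  · rw [S.swap_self i (S.word_normal hX s)]; exact SameMap.refl _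
  · have h1 := (S.insert_insert_of_lt hX h s).symm.comp_right (S.swap i j (S.word s X))
    refine SameMap.trans h1 (SameMap.of_eq ?_)
    rw [HHom.comp_assoc, HHom.comp_assoc, S.swap_swap i j (S.word_normal hX s)]
    rfl

/-- Sorting absorbs every rearrangement. This determines a rearrangement, since sorting is unitary.
-/
theorem sortMap_natural_of_reord (hX : X.Normal) {w w' : List (Fin n)}
    {f : HHom (S.word w X) (S.word w' X)} (h : S.Reord X w w' f) :
    S.SameMap (S.sortMap w X) ((S.sortMap w' X).comp f) := by
  induction h with
  | refl w => exact SameMap.refl _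
  | cons i h ih =>
    refine SameMap.trans (ih.insert i) (SameMap.of_eq ?_)
    rw [WCorr.map_comp]; rfl
  | swap i j w =>
    have h1 := (S.insert_insert hX i j (w.insertionSort (· ≤ ·))).symm.comp_right
      ((S.E i).map ((S.E j).map (S.sortMap w X)))
    refine SameMap.trans (SameMap.of_eq ?_) (h1.trans (SameMap.of_eq ?_))
    · rw [HHom.comp_assoc, ← WCorr.map_comp]; rfl
    · rw [HHom.comp_assoc, HHom.comp_assoc, S.swap_natural, ← HHom.comp_assoc ((S.E j).map _),
        ← WCorr.map_comp]; rfl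
  | trans hf hg ihf ihg => exact ihf.trans (ihg.comp_right _)

theorem insertMap_isUnitary (hX : X.Normal) (i : Fin n) :
    ∀ s, (S.insertMap i s X).IsUnitary := by
  have aux : ∀ {w w' : List (Fin n)} {A : HRep M} {f : HHom A (S.word w X)}
      {g : HHom A (S.word w' X)}, S.SameMap f g → f.IsUnitary → g.IsUnitary := by
    rintro w w' A f g ⟨rfl, rfl⟩ hf; exact hf
  intro s
  induction s with
  | nil => exact HHom.isUnitary_id
  | cons k s ih =>
    by_cases h : i ≤ k
    · exact aux (S.insertMap_cons_le h s X) HHom.isUnitary_id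
    · exact aux (S.insertMap_cons_gt h s X)
        (((S.E k).map_isUnitary ih).comp (S.swap_isUnitary i k (S.word_normal hX s)))

theorem sortMap_isUnitary (hX : X.Normal) : ∀ w, (S.sortMap w X).IsUnitary
  | [] => HHom.isUnitary_id
  | i :: w => (S.insertMap_isUnitary hX i _).comp ((S.E i).map_isUnitary (sortMap_isUnitary hX w))

/-- Every composite of identifications of neighbouring letters is the map `reorder`. -/
theorem eq_reorder (hX : X.Normal) {w w' : List (Fin n)}
    {f : HHom (S.word w X) (S.word w' X)} (h : S.Reord X w w' f) : f = S.reorder w w' X := by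
  obtain ⟨h1, h2⟩ := S.sortMap_natural_of_reord hX h
  rw [reorder, dif_pos h1, h2, (S.sortMap_isUnitary hX w').adj_comp_assoc]

theorem exists_reord (X : HRep M) {w w' : List (Fin n)} (h : w.Perm w') :
    ∃ f, S.Reord X w w' f := by
  induction h with
  | nil => exact ⟨_, .refl _⟩
  | cons i _ ih => obtain ⟨f, hf⟩ := ih; exact ⟨_, .cons i hf⟩
  | swap i j w => exact ⟨_, .swap j i w⟩
  | trans _ _ ih1 ih2 =>
    obtain ⟨f, hf⟩ := ih1; obtain ⟨g, hg⟩ := ih2; exact ⟨_, .trans hf hg⟩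

theorem reord_reorder (hX : X.Normal) {w w' : List (Fin n)} (h : w.Perm w') :
    S.Reord X w w' (S.reorder w w' X) := by
  obtain ⟨f, hf⟩ := S.exists_reord X h
  rwa [← S.eq_reorder hX hf]

theorem reord_isUnitary (hX : X.Normal) {w w' : List (Fin n)}
    {f : HHom (S.word w X) (S.word w' X)} (h : S.Reord X w w' f) : f.IsUnitary := by
  induction h with
  | refl w => exact HHom.isUnitary_id
  | cons i h ih => exact (S.E i).map_isUnitary ih
  | swap i j w => exact S.swap_isUnitary i j (S.word_normal hX w)
  | trans hf hg ihf ihg => exact ihg.comp ihf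

theorem reorder_isUnitary (hX : X.Normal) {w w' : List (Fin n)} (h : w.Perm w') :
    (S.reorder w w' X).IsUnitary := S.reord_isUnitary hX (S.reord_reorder hX h)

theorem reorder_natural (hX : X.Normal) (hY : Y.Normal) {w w' : List (Fin n)} (h : w.Perm w')
    (f : HHom X Y) : (S.reorder w w' Y).comp (S.wordMap f w)
      = (S.wordMap f w').comp (S.reorder w w' X) := by
  obtain ⟨a, b, ha, hb, hab⟩ : ∃ a b, S.Reord X w w' a ∧ S.Reord Y w w' b ∧
      b.comp (S.wordMap f w) = (S.wordMap f w').comp a := by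
    induction h with
    | nil => exact ⟨_, _, .refl _, .refl _, rfl⟩
    | cons i _ ih =>
      obtain ⟨a, b, ha, hb, hab⟩ := ih
      refine ⟨_, _, .cons i ha, .cons i hb, ?_⟩
      change ((S.E i).map _).comp ((S.E i).map _) = ((S.E i).map _).comp ((S.E i).map _)
      rw [← WCorr.map_comp, ← WCorr.map_comp, hab]
    | swap i j w => exact ⟨_, _, .swap j i w, .swap j i w, S.swap_natural j i _⟩
    | trans _ _ ih1 ih2 =>
      obtain ⟨a, b, ha, hb, hab⟩ := ih1
      obtain ⟨c, d, hc, hd, hcd⟩ := ih2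
      refine ⟨_, _, .trans ha hc, .trans hb hd, ?_⟩
      rw [HHom.comp_assoc, hab, ← HHom.comp_assoc, hcd, HHom.comp_assoc]
  rw [← S.eq_reorder hX ha, ← S.eq_reorder hY hb, hab]

end ProductSystem
end Words
/-! ### Canonical identifications of nested words -/

section Coherence
variable {M : Type u} [CStarAlgebra M] [PartialOrder M] [StarOrderedRing M]
variable {X Y Z A B C : HRep M}

namespace PreProductSystem
variable {n : ℕ} (S : PreProductSystem M n)

theorem word_append (X : HRep M) (w' : List (Fin n)) :
    ∀ w, S.word w (S.word w' X) = S.word (w ++ w') X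
  | [] => rfl
  | i :: w => congrArg (S.E i).tens (word_append X w' w)

/-- `f : A → B` is a canonical identification, where `A` and `B` are (possibly nested) tensor
products of the correspondences of the product system with `X`, whose words are `w` and `w'`. -/
def IsCoh (X : HRep M) (w w' : List (Fin n)) (f : HHom A B) : Prop :=
  ∃ (hA : A = S.word w X) (hB : B = S.word w' X) (g : HHom (S.word w X) (S.word w' X)),
    S.Reord X w w' g ∧ f = (HHom.ofEq hB.symm).comp (g.comp (HHom.ofEq hA))

variable {S}

theorem IsCoh.of_reord {w w' : List (Fin n)} {f : HHom (S.word w X) (S.word w' X)}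
    (h : S.Reord X w w' f) : S.IsCoh X w w' f := ⟨rfl, rfl, f, h, rfl⟩

theorem IsCoh.id {w : List (Fin n)} (hA : A = S.word w X) : S.IsCoh X w w (HHom.id A) := by
  subst hA; exact .of_reord (.refl w)

theorem IsCoh.comp {w w' w'' : List (Fin n)} {f : HHom A B} {g : HHom B C}
    (hg : S.IsCoh X w' w'' g) (hf : S.IsCoh X w w' f) : S.IsCoh X w w'' (g.comp f) := by
  obtain ⟨rfl, rfl, f, hf, rfl⟩ := hf
  obtain ⟨hB, rfl, g, hg, rfl⟩ := hg
  exact .of_reord (.trans hf hg)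

theorem IsCoh.map (i : Fin n) {w w' : List (Fin n)} {f : HHom A B} (hf : S.IsCoh X w w' f) :
    S.IsCoh X (i :: w) (i :: w') ((S.E i).map f) := by
  obtain ⟨rfl, rfl, f, hf, rfl⟩ := hf
  exact .of_reord (.cons i hf)

theorem IsCoh.wordMap {w w' : List (Fin n)} {f : HHom A B} (hf : S.IsCoh X w w' f) :
    ∀ v, S.IsCoh X (v ++ w) (v ++ w') (S.wordMap f v)
  | [] => hf
  | i :: v => (wordMap hf v).map i

theorem IsCoh.swap (i j : Fin n) {w : List (Fin n)} (hA : A = S.word w X) :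
    S.IsCoh X (i :: j :: w) (j :: i :: w) (S.swap i j A) := by
  subst hA; exact .of_reord (.swap i j w)

theorem IsCoh.adj {w w' : List (Fin n)} {f : HHom A B} (hf : S.IsCoh X w w' f) :
    S.IsCoh X w' w f.adj := by
  obtain ⟨rfl, rfl, f, hf, rfl⟩ := hf
  have : S.Reord X w' w f.adj := by
    induction hf with
    | refl w => rw [HHom.adj_id]; exact .refl _
    | cons i h ih => exact (S.E i).map_adj _ ▸ Reord.cons i ih
    | swap i j w => exact (S.swap_adj i j (S.word w X)).symm ▸ Reord.swap j i w
    | trans hf hg ihf ihg => rw [HHom.adj_comp]; exact .trans ihg ihf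
  exact .of_reord this

theorem IsCoh.wordAppend {v : List (Fin n)} (hA : A = S.word v X) (w' : List (Fin n)) :
    ∀ w, S.IsCoh X (w ++ (w' ++ v)) (w ++ (w' ++ v)) (S.wordAppend w w' A)
  | [] => by subst hA; exact .id (S.word_append X v w')
  | i :: w => (wordAppend hA w' w).map i

/-- A rearrangement over the base `E_v ⊗ X` is a canonical identification over the base `X`. -/
theorem IsCoh.of_reord_word {v w w' : List (Fin n)} (hA : A = S.word v X)
    {f : HHom (S.word w A) (S.word w' A)} (h : S.Reord A w w' f) :
    S.IsCoh X (w ++ v) (w' ++ v) f := by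
  subst hA
  induction h with
  | refl w => exact .id (S.word_append X v w)
  | cons i _ ih => exact ih.map i
  | swap i j w => exact .swap i j (S.word_append X v w)
  | trans _ _ ih1 ih2 => exact ih2.comp ih1

theorem IsCoh.congr {w w' v v' : List (Fin n)} {f : HHom A B} (hf : S.IsCoh X w w' f)
    (h : w = v) (h' : w' = v') : S.IsCoh X v v' f := h ▸ h' ▸ hf

variable (S)

theorem wordAppend_natural (f : HHom X Y) (u : List (Fin n)) :
    ∀ w, (S.wordMap (S.wordMap f u) w).comp (S.wordAppend w u X)
      = (S.wordAppend w u Y).comp (S.wordMap f (w ++ u))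
  | [] => rfl
  | i :: w => by
    change ((S.E i).map _).comp ((S.E i).map _) = ((S.E i).map _).comp ((S.E i).map _)
    rw [← WCorr.map_comp, ← WCorr.map_comp, wordAppend_natural f u w]
    rfl

theorem wordAppend_adj_natural (f : HHom X Y) (w u : List (Fin n)) :
    (S.wordAppend w u Y).adj.comp (S.wordMap (S.wordMap f u) w)
      = (S.wordMap f (w ++ u)).comp (S.wordAppend w u X).adj := by
  have h := congrArg HHom.adj (S.wordAppend_natural f.adj u w)
  simp only [HHom.adj_comp, wordMap_adj, HHom.adj_adj] at h
  exact h

theorem wordAppend_isUnitary (u : List (Fin n)) :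
    ∀ w, (S.wordAppend w u X).IsUnitary
  | [] => HHom.isUnitary_id
  | i :: w => (S.E i).map_isUnitary (wordAppend_isUnitary u w)

/-- The identification of `E_w ⊗ E_u ⊗ X` with `E_{w'} ⊗ X`, for `w'` a rearrangement of `w u`. -/
noncomputable def fold (w u w' : List (Fin n)) (X : HRep M) :
    HHom (S.word w (S.word u X)) (S.word w' X) :=
  (S.reorder (w ++ u) w' X).comp (S.wordAppend w u X).adj

/-- The identification of `E_p ⊗ E_w ⊗ X` with `E_w ⊗ E_p ⊗ X`. -/
noncomputable def move (p w : List (Fin n)) (X : HRep M) :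
    HHom (S.word p (S.word w X)) (S.word w (S.word p X)) :=
  (S.wordAppend w p X).comp (S.fold p w (w ++ p) X)

/-- The operator `I_w ⊗ g`, for `g : E_p ⊗ X → E_u ⊗ Y`, regarded as an operator from
`E_p ⊗ E_w ⊗ X` to `E_{w'} ⊗ Y`. -/
noncomputable def lift {p u : List (Fin n)} (w w' : List (Fin n))
    (g : HHom (S.word p X) (S.word u Y)) : HHom (S.word p (S.word w X)) (S.word w' Y) :=
  (S.fold w u w' Y).comp ((S.wordMap g w).comp (S.move p w X))

@[simp] theorem lift_zero {p u : List (Fin n)} (w w' : List (Fin n)) :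
    S.lift w w' (0 : HHom (S.word p X) (S.word u Y)) = 0 := by
  rw [lift, wordMap_zero, HHom.zero_comp, HHom.comp_zero]

end PreProductSystem

namespace ProductSystem
variable {n : ℕ} (S : ProductSystem M n)
open PreProductSystem

/-- Canonical identifications are unique. -/
theorem isCoh_unique (hX : X.Normal) {w w' v v' : List (Fin n)} {f g : HHom A B}
    (hf : S.IsCoh X w w' f) (hg : S.IsCoh X v v' g) (h : w = v) (h' : w' = v') : f = g := by
  subst h h'
  obtain ⟨rfl, rfl, f, hf, rfl⟩ := hf
  obtain ⟨_, _, g, hg, rfl⟩ := hg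
  rw [S.eq_reorder hX hf, S.eq_reorder hX hg]

theorem isCoh_isUnitary (hX : X.Normal) {w w' : List (Fin n)} {f : HHom A B}
    (hf : S.IsCoh X w w' f) : f.IsUnitary := by
  obtain ⟨rfl, rfl, f, hf, rfl⟩ := hf
  exact S.reord_isUnitary hX hf

theorem isCoh_reorder {v w w' : List (Fin n)} (hX : X.Normal) (hA : A = S.word v X)
    (h : w.Perm w') : S.IsCoh X (w ++ v) (w' ++ v) (S.reorder w w' A) :=
  .of_reord_word hA (S.reord_reorder (hA ▸ S.word_normal hX v) h)

theorem isCoh_fold {v w u w' : List (Fin n)} (hX : X.Normal) (hA : A = S.word v X)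
    (h : (w ++ u).Perm w') : S.IsCoh X (w ++ (u ++ v)) (w' ++ v) (S.fold w u w' A) :=
  ((S.isCoh_reorder hX hA h).congr (List.append_assoc _ _ _) rfl).comp (IsCoh.wordAppend hA u w).adj

theorem isCoh_move {v : List (Fin n)} (hX : X.Normal) (hA : A = S.word v X)
    (p w : List (Fin n)) : S.IsCoh X (p ++ (w ++ v)) (w ++ (p ++ v)) (S.move p w A) :=
  (IsCoh.wordAppend hA p w).comp ((S.isCoh_fold hX hA List.perm_append_comm).congr rfl
    (List.append_assoc _ _ _))

/-- `fold` is natural in the last tensor factor. -/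
theorem fold_natural (hX : X.Normal) (hY : Y.Normal) {w u w' : List (Fin n)}
    (h : (w ++ u).Perm w') (f : HHom X Y) :
    (S.fold w u w' Y).comp (S.wordMap (S.wordMap f u) w)
      = (S.wordMap f w').comp (S.fold w u w' X) := by
  rw [fold, HHom.comp_assoc, wordAppend_adj_natural, ← HHom.comp_assoc,
    S.reorder_natural hX hY h, HHom.comp_assoc]; rfl

theorem move_natural (hX : X.Normal) (hY : Y.Normal) (p w : List (Fin n)) (f : HHom X Y) :
    (S.move p w Y).comp (S.wordMap (S.wordMap f w) p)
      = (S.wordMap (S.wordMap f p) w).comp (S.move p w X) := by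
  rw [move, HHom.comp_assoc, S.fold_natural hX hY List.perm_append_comm, ← HHom.comp_assoc,
    ← wordAppend_natural, HHom.comp_assoc]; rfl

theorem move_isUnitary (hX : X.Normal) (p w : List (Fin n)) : (S.move p w X).IsUnitary :=
  S.isCoh_isUnitary hX (S.isCoh_move (v := []) hX rfl p w)

theorem fold_isUnitary (hX : X.Normal) {w u w' : List (Fin n)} (h : (w ++ u).Perm w') :
    (S.fold w u w' X).IsUnitary :=
  (S.reorder_isUnitary hX h).comp (S.wordAppend_isUnitary u w).adj

/-- Moving `E_p` past `E_{w'}` amounts to moving it past `E_u` and past `E_w`. -/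
theorem move_fold (hX : X.Normal)
    (p : List (Fin n)) {w u w' : List (Fin n)} (h : (w ++ u).Perm w') :
    (S.move p w' X).comp (S.wordMap (S.fold w u w' X) p)
      = (S.fold w u w' (S.word p X)).comp ((S.wordMap (S.move p u X) w).comp
          (S.move p w (S.word u X))) := by
  refine S.isCoh_unique hX
    ((S.isCoh_move (v := []) hX rfl p w').comp
      ((S.isCoh_fold (v := []) hX rfl h).wordMap p))
    ((S.isCoh_fold (v := p ++ []) hX (S.word_append X [] p) h).comp
      (((S.isCoh_move (v := []) hX rfl p u).wordMap w).comp
        (S.isCoh_move (v := u ++ []) hX (S.word_append X [] u) p w))) ?_ ?_ <;> simp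

/-- The composite of `I ⊗ g` and `I ⊗ g'` in terms of the composite of `g` and `g'`. -/
theorem lift_comp_lift (hX : X.Normal) (hY : Y.Normal) (hZ : Z.Normal)
    {p p' u u' w w' w'' : List (Fin n)} (g : HHom (S.word p X) (S.word u Y))
    (g' : HHom (S.word p' Y) (S.word u' Z)) (h : (w ++ u).Perm w') (h' : (w' ++ u').Perm w'')
    {C₁ : HHom (S.word p' (S.word p (S.word w X))) (S.word w (S.word p' (S.word p X)))}
    (hC₁ : S.IsCoh X (p' ++ (p ++ (w ++ []))) (w ++ (p' ++ (p ++ []))) C₁)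
    {C₂ : HHom (S.word w (S.word u (S.word u' Z))) (S.word w'' Z)}
    (hC₂ : S.IsCoh Z (w ++ (u ++ (u' ++ []))) w'' C₂) :
    (S.lift w' w'' g').comp (S.wordMap (S.lift w w' g) p')
      = C₂.comp ((S.wordMap ((S.wordMap g' u).comp ((S.move p' u Y).comp (S.wordMap g p'))) w).comp
          C₁) := by
  have hpY := S.word_normal hY p'
  have huZ := S.word_normal hZ u'
  -- the two identifications in the middle are moved past `g'` and `g`
  have e1 := S.move_fold hY p' h
  have e2 := S.fold_natural hpY huZ h g'
  have e3 := S.move_natural (S.word_normal hX p) (S.word_normal hY u) p' w g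
  have e4 : (S.fold w' u' w'' Z).comp (S.fold w u w' (S.word u' Z)) = C₂ := by
    refine S.isCoh_unique hZ
      ((S.isCoh_fold (v := []) hZ rfl h').comp
        (S.isCoh_fold (v := u' ++ []) hZ (S.word_append Z [] u') h)) hC₂ ?_ ?_ <;> simp
  have e5 : (S.move p' w (S.word p X)).comp (S.wordMap (S.move p w X) p') = C₁ := by
    refine S.isCoh_unique hX
      ((S.isCoh_move (v := p ++ []) hX (S.word_append X [] p) p' w).comp
        ((S.isCoh_move (v := []) hX rfl p w).wordMap p')) hC₁ ?_ ?_ <;> simp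
  rw [← e4, ← e5]
  ext v
  simp only [lift, wordMap_comp, HHom.comp_apply]
  have f1 := HHom.congr_hom e1 (S.wordMap (S.wordMap g w) p' (S.wordMap (S.move p w X) p' v))
  have f3 := HHom.congr_hom e3 (S.wordMap (S.move p w X) p' v)
  simp only [HHom.comp_apply] at f1 f3
  rw [f1, f3]
  have f2 := HHom.congr_hom e2 (S.wordMap (S.move p' u Y) w (S.wordMap (S.wordMap g p') w
    (S.move p' w (S.word p X) (S.wordMap (S.move p w X) p' v))))
  simp only [HHom.comp_apply] at f2
  rw [f2]

end ProductSystem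
end Coherence
/-! ### Orthogonal decompositions -/

section Decompositions
variable {M : Type u} [CStarAlgebra M] [PartialOrder M] [StarOrderedRing M]
variable {X Y Z W : HRep M}

/-- Isometries `J i : V i → Z` with pairwise orthogonal ranges. -/
structure IsOrtho {ι : Type*} {V : ι → HRep M} (J : ∀ i, HHom (V i) Z) : Prop where
  iso : ∀ i, (J i).adj.comp (J i) = HHom.id (V i)
  ortho : ∀ i j, i ≠ j → (J i).adj.comp (J j) = 0

/-- Isometries `J i : V i → Z` that exhibit `Z` as the Hilbert space direct sum of the `V i`. -/
structure IsDecomp {ι : Type*} {V : ι → HRep M} (J : ∀ i, HHom (V i) Z) : Prop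
    extends IsOrtho J where
  dense : Dense (Submodule.span ℂ {v : Z | ∃ i x, v = J i x} : Set Z)

/-- An intertwining isometry, as a linear isometry. -/
def HHom.IsIsometry.toLinearIsometry {f : HHom X Y} (hf : f.IsIsometry) : X →ₗᵢ[ℂ] Y where
  toLinearMap := f.toCLM
  norm_map' := HHom.isIsometry_iff_norm.mp hf

namespace IsOrtho
variable {ι : Type*} {V : ι → HRep M} {J : ∀ i, HHom (V i) Z}

theorem isIsometry (h : IsOrtho J) (i : ι) : (J i).IsIsometry :=
  HHom.isIsometry_iff.mpr (h.iso i)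

theorem inner_eq_zero (h : IsOrtho J) {i j : ι} (hij : i ≠ j) (x : V i) (y : V j) :
    inner ℂ (J i x) (J j y) = (0 : ℂ) := by
  rw [← HHom.adj_inner_right, ← HHom.comp_apply, h.ortho i j hij, HHom.zero_apply,
    inner_zero_right]

theorem map (h : IsOrtho J) (E : WCorr M) : IsOrtho fun i => E.map (J i) where
  iso i := by rw [← E.map_adj, ← E.map_comp, h.iso, E.map_id]
  ortho i j hij := by rw [← E.map_adj, ← E.map_comp, h.ortho i j hij, E.map_zero]

/-- The isometries of an orthogonal family, as an `OrthogonalFamily`. -/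
theorem orthogonalFamily (h : IsOrtho J) : OrthogonalFamily ℂ (fun i => (V i : Type u))
    fun i => (h.isIsometry i).toLinearIsometry :=
  fun _ _ hij x y => h.inner_eq_zero hij x y

end IsOrtho

namespace IsDecomp
variable {ι : Type*} {V : ι → HRep M} {J : ∀ i, HHom (V i) Z}

theorem map (h : IsDecomp J) (E : WCorr M) : IsDecomp fun i => E.map (J i) where
  toIsOrtho := h.toIsOrtho.map E
  dense := by
    rw [Submodule.dense_iff_topologicalClosure_eq_top]
    set s := Submodule.span ℂ {v : E.tens Z | ∃ i x, v = E.map (J i) x}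
    have h1 := E.dense_tmul Z (s := s.topologicalClosure) fun ξ x => by
      have h2 : ∀ x : Z, WCorr.tmulCLM Z ξ x ∈ s.topologicalClosure := by
        intro x
        have h3 : Submodule.span ℂ {v : Z | ∃ i x, v = J i x} ≤
            s.topologicalClosure.comap (WCorr.tmulCLM Z ξ : Z →ₗ[ℂ] E.tens Z) := by
          rw [Submodule.span_le]
          rintro _ ⟨i, y, rfl⟩
          refine Submodule.le_topologicalClosure _ (Submodule.subset_span
            ⟨i, WCorr.tmul ξ y, ?_⟩)
          rw [WCorr.map_tmul]; rfl
        have h4 : IsClosed ((WCorr.tmulCLM Z ξ) ⁻¹' (s.topologicalClosure : Set (E.tens Z))) :=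
          s.isClosed_topologicalClosure.preimage (WCorr.tmulCLM Z ξ).continuous
        exact closure_minimal h3 h4 (h.dense x)
      exact h2 x
    rw [Submodule.dense_iff_topologicalClosure_eq_top] at h1
    rwa [s.isClosed_topologicalClosure.submodule_topologicalClosure_eq] at h1

theorem isHilbertSum (h : IsDecomp J) : IsHilbertSum ℂ (fun i => (V i : Type u))
    fun i => (h.isIsometry i).toLinearIsometry := by
  refine IsHilbertSum.mk h.orthogonalFamily ?_
  rw [top_le_iff, ← Submodule.dense_iff_topologicalClosure_eq_top]
  refine h.dense.mono ?_
  rw [SetLike.coe_subset_coe, Submodule.span_le]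
  rintro _ ⟨i, x, rfl⟩
  exact Submodule.mem_iSup_of_mem i ⟨x, rfl⟩

theorem hom_ext (h : IsDecomp J) {f g : HHom Z W} (hfg : ∀ i, f.comp (J i) = g.comp (J i)) :
    f = g :=
  HHom.toCLM_injective (HHom.clm_ext_of_dense h.dense (by
    rintro _ ⟨i, x, rfl⟩; exact HHom.congr_hom (hfg i) x))

/-- The coordinates with respect to a decomposition. -/
theorem isHilbertSum_apply (h : IsDecomp J) (v : Z) (i : ι) :
    h.isHilbertSum.linearIsometryEquiv v i = (J i).adj v := by
  classical
  have h1 := (h.isHilbertSum.hasSum_linearIsometryEquiv_symm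
    (h.isHilbertSum.linearIsometryEquiv v)).mapL (J i).adj.toCLM
  rw [LinearIsometryEquiv.symm_apply_apply] at h1
  refine HasSum.unique ?_ h1
  convert hasSum_single i ?_ using 1
  · exact (HHom.congr_hom (h.iso i) _).symm
  · intro j hj
    exact HHom.congr_hom (h.ortho i j hj.symm) _

theorem hasSum_norm (h : IsDecomp J) (v : Z) :
    HasSum (fun i => ‖(J i).adj v‖ ^ 2) (‖v‖ ^ 2) := by
  have h1 := lp.hasSum_inner (𝕜 := ℂ) (h.isHilbertSum.linearIsometryEquiv v)
    (h.isHilbertSum.linearIsometryEquiv v)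
  simp only [LinearIsometryEquiv.inner_map_map, h.isHilbertSum_apply] at h1
  have h2 := h1.mapL Complex.reCLM
  simp only [Complex.reCLM_apply] at h2
  have e : ∀ {V : HRep M} (v : V), (inner ℂ v v : ℂ).re = ‖v‖ ^ 2 := fun v =>
    (norm_sq_eq_re_inner (𝕜 := ℂ) v).symm
  simpa only [e] using h2

theorem ext (h : IsDecomp J) {v w : Z} (hvw : ∀ i, (J i).adj v = (J i).adj w) : v = w := by
  have := h.hasSum_norm (v - w)
  have h0 : ∀ i, ‖(J i).adj (v - w)‖ ^ 2 = 0 := fun i => by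
    rw [map_sub, hvw, sub_self, norm_zero]; norm_num
  simp only [h0] at this
  have := this.unique hasSum_zero
  rwa [sq_eq_zero_iff, norm_eq_zero, sub_eq_zero] at this

/-- Isometries on the summands with orthogonal ranges extend to an isometry on the sum. -/
theorem exists_isometry (h : IsDecomp J) {f : ∀ i, HHom (V i) W} (hf : IsOrtho f) :
    ∃ g : HHom Z W, g.IsIsometry ∧ ∀ i, g.comp (J i) = f i := by
  classical
  let g : Z →ₗᵢ[ℂ] W := hf.orthogonalFamily.linearIsometry.comp
    h.isHilbertSum.linearIsometryEquiv.toLinearIsometry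
  have key : ∀ i x, g (J i x) = f i x := by
    intro i x
    have e1 : h.isHilbertSum.linearIsometryEquiv (J i x)
        = lp.single (E := fun i => (V i : Type u)) 2 i x := by
      rw [← LinearIsometryEquiv.eq_symm_apply]
      exact (h.isHilbertSum.linearIsometryEquiv_symm_apply_single x).symm
    change hf.orthogonalFamily.linearIsometry (h.isHilbertSum.linearIsometryEquiv (J i x)) = _
    rw [e1]
    exact hf.orthogonalFamily.linearIsometry_apply_single x
  refine ⟨⟨g.toContinuousLinearMap, fun a => ?_⟩, g.isometry, fun i => HHom.ext (key i)⟩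
  refine DFunLike.congr_fun (f := g.toContinuousLinearMap.comp (Z.act a))
    (g := (W.act a).comp g.toContinuousLinearMap) (HHom.clm_ext_of_dense h.dense ?_)
  rintro _ ⟨i, x, rfl⟩
  change g (Z.act a (J i x)) = W.act a (g (J i x))
  rw [← (J i).comm, key, key, (f i).comm]

end IsDecomp

namespace HHom
variable {ι : Type} {V : ι → HRep M}

theorem incl_isDecomp : IsDecomp (incl V) where
  iso i := by rw [incl, adj_adj, ← incl, eval_comp_incl_self]
  ortho i j h := by rw [incl, adj_adj, eval_comp_incl_ne h]
  dense := dense_incl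

/-- Components with `∑ ‖f i y‖² = ‖y‖²` define an isometry into the direct sum. -/
theorem exists_of_hasSum {f : ∀ i, HHom Y (V i)} (hf : ∀ y, HasSum (fun i => ‖f i y‖ ^ 2) (‖y‖ ^ 2)) :
    ∃ g : HHom Y (lsum V), ∀ i, (eval V i).comp g = f i := by
  have h2 : (2 : ENNReal).toReal = (2 : ℕ) := by norm_num
  have hmem : ∀ y, Memℓp (fun i => f i y) 2 := fun y => memℓp_gen (by
    simp only [h2, Real.rpow_natCast]; exact (hf y).summable)
  let g : Y →ₗ[ℂ] lp (fun i => (V i : Type u)) 2 :=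
    { toFun := fun y => ⟨fun i => f i y, hmem y⟩
      map_add' := fun y z => by ext i; exact map_add (f i).toCLM y z
      map_smul' := fun c y => by ext i; exact map_smul (f i).toCLM c y }
  have hg : ∀ y, ‖g y‖ ≤ 1 * ‖y‖ := by
    intro y
    rw [one_mul]
    refine le_of_sq_le_sq (le_of_eq ?_) (norm_nonneg y)
    have h3 := lp.norm_rpow_eq_tsum (p := 2) (by norm_num) (g y)
    simp only [h2, Real.rpow_natCast] at h3
    rw [h3]
    exact (hf y).tsum_eq
  exact ⟨⟨LinearMap.mkContinuous g 1 hg, fun a y => lp.ext (funext fun i => (f i).comm a y)⟩,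
    fun i => rfl⟩

theorem eval_ofComponents {f : ∀ i, HHom Y (V i)}
    (hf : ∀ y, HasSum (fun i => ‖f i y‖ ^ 2) (‖y‖ ^ 2)) (i : ι) :
    (eval V i).comp (ofComponents f) = f i := by
  rw [ofComponents, dif_pos (exists_of_hasSum hf)]
  exact (exists_of_hasSum hf).choose_spec i

theorem ofComponents_isIsometry {f : ∀ i, HHom Y (V i)}
    (hf : ∀ y, HasSum (fun i => ‖f i y‖ ^ 2) (‖y‖ ^ 2)) : (ofComponents f).IsIsometry := by
  refine isIsometry_iff_norm.mpr fun y => ?_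
  have h1 := incl_isDecomp.hasSum_norm (ofComponents f y)
  have h2 : ∀ i, (incl V i).adj (ofComponents f y) = f i y := fun i => by
    rw [incl, adj_adj]; exact congr_hom (eval_ofComponents hf i) y
  simp only [h2] at h1
  exact (sq_eq_sq₀ (norm_nonneg _) (norm_nonneg _)).mp (h1.unique (hf y))

end HHom

namespace PreProductSystem
variable {n : ℕ} (S : PreProductSystem M n)

theorem isDecomp_wordMap {ι : Type*} {V : ι → HRep M} {J : ∀ i, HHom (V i) Z} (h : IsDecomp J) :
    ∀ w, IsDecomp fun i => S.wordMap (J i) w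
  | [] => h
  | k :: w => (isDecomp_wordMap h w).map (S.E k)

end PreProductSystem
end Decompositions
/-! ### Multipliers on the Fock space -/

section Multipliers
variable {M : Type u} [CStarAlgebra M] [PartialOrder M] [StarOrderedRing M]
variable {X Y Z A B C : HRep M}

namespace PreProductSystem
variable {m : ℕ}

theorem count_fockWord (β : Fin (m + 1) → ℕ) (a : Fin (m + 2)) : (fockWord β).count a
    = ∑ k, β k * (genWord m k).count a := by
  rw [fockWord, List.count_flatMap, ← List.sum_ofFn, List.ofFn_eq_map]
  congr 2
  funext k
  simp [List.count_flatten]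

theorem fockWord_add_single (α : Fin (m + 1) → ℕ) (j : Fin (m + 1)) :
    (fockWord α ++ genWord m j).Perm (fockWord (α + Pi.single j 1)) := by
  classical
  rw [List.perm_iff_count]
  intro a
  rw [List.count_append, count_fockWord, count_fockWord]
  simp [add_mul, Finset.sum_add_distrib, Pi.single_apply]

theorem sub_single_add_single {β : Fin (m + 1) → ℕ} {j : Fin (m + 1)} (h : ¬ β j = 0) :
    β - Pi.single j 1 + Pi.single j 1 = β := by
  refine tsub_add_cancel_of_le fun k => ?_
  by_cases hk : k = j
  · subst hk; simp; omega
  · simp [hk]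

end PreProductSystem

/-- The ranges of two operators are orthogonal. -/
def HHom.IsOrthogonal (f : HHom X Z) (g : HHom Y Z) : Prop := f.adj.comp g = 0

/-- Two operators are the entries of an isometric column. -/
def HHom.IsColumn (f : HHom X Y) (g : HHom X Z) : Prop :=
  f.adj.comp f + g.adj.comp g = HHom.id X

theorem HHom.zero_isOrthogonal (g : HHom Y Z) : (0 : HHom X Z).IsOrthogonal g := by
  rw [IsOrthogonal, adj_zero, zero_comp]

theorem HHom.zero_isColumn {g : HHom X Z} (hg : g.IsIsometry) : (0 : HHom X Y).IsColumn g := by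
  rw [IsColumn, adj_zero, zero_comp, zero_add, isIsometry_iff.mp hg]

namespace PreProductSystem
variable {m : ℕ}

/-- The data of an isometry `E_p ⊗ ℱ(E) ⊗ D → ℱ(E) ⊗ D` that acts on `E_p ⊗ D` as a column with the
entries `g₀`, of degree `0`, and `g₁`, of the degree of the `j`-th generator, whose word is `u`. -/
structure Mult (S : PreProductSystem M (m + 2)) (D : HRep M) (p u : List (Fin (m + 2)))
    (j : Fin (m + 1)) where
  word_eq : u = genWord m j
  g₀ : HHom (S.word p D) (S.word [] D)
  g₁ : HHom (S.word p D) (S.word u D)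
  column : g₀.IsColumn g₁
  ortho : (S.wordMap g₀ u).IsOrthogonal g₁

namespace Mult
variable {S : PreProductSystem M (m + 2)} {D : HRep M} {p u : List (Fin (m + 2))}
  {j : Fin (m + 1)} (a : Mult S D p u j)

/-- The part of degree zero, into the summand of `β`. -/
noncomputable def part₀ (β : Fin (m + 1) → ℕ) :
    HHom (S.word p (S.fock D)) (S.word (fockWord β) D) :=
  (S.lift (u := []) (fockWord β) (fockWord β) a.g₀).comp (S.wordMap (HHom.eval _ β) p)

/-- The part of the degree of the generator, from the summand of `γ` into that of `β`. -/
noncomputable def part₁ (γ β : Fin (m + 1) → ℕ) :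
    HHom (S.word p (S.fock D)) (S.word (fockWord β) D) :=
  (S.lift (fockWord γ) (fockWord β) a.g₁).comp (S.wordMap (HHom.eval _ γ) p)

/-- The component in the summand of `β`. -/
noncomputable def component (β : Fin (m + 1) → ℕ) :
    HHom (S.word p (S.fock D)) (S.word (fockWord β) D) :=
  a.part₀ β + if β j = 0 then 0 else a.part₁ (β - Pi.single j 1) β

/-- The operator on the Fock space given by the data. -/
noncomputable def op : HHom (S.word p (S.fock D)) (S.fock D) := HHom.ofComponents a.component

end Mult
end PreProductSystem

open PreProductSystem

theorem HHom.inner_eq_zero_of_adj_comp {f : HHom X Z} {g : HHom Y Z} (h : f.adj.comp g = 0)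
    (x : X) (y : Y) : inner ℂ (f x) (g y) = (0 : ℂ) := by
  rw [← HHom.adj_inner_right, ← HHom.comp_apply, h, HHom.zero_apply, inner_zero_right]

theorem HHom.norm_sq_eq (f : HHom X Y) (x : X) :
    ‖f x‖ ^ 2 = (inner ℂ x (f.adj.comp f x) : ℂ).re := by
  rw [comp_apply, adj_inner_right]; exact norm_sq_eq_re_inner (𝕜 := ℂ) (f x)

/-- Pythagoras for an operator of the form "diagonal plus shift by `e_j`" on a Hilbert space direct
sum: the two parts of each component are orthogonal. -/
theorem hasSum_norm_sq_shift {m : ℕ} (j : Fin (m + 1)) {V : (Fin (m + 1) → ℕ) → HRep M}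
    (x : ∀ β, V β) (y : (Fin (m + 1) → ℕ) → ∀ β, V β) {N : (Fin (m + 1) → ℕ) → ℝ} {s : ℝ}
    (hN : HasSum N s) (h : ∀ γ, ‖x γ‖ ^ 2 + ‖y γ (γ + Pi.single j 1)‖ ^ 2 = N γ)
    (ho : ∀ γ, inner ℂ (x (γ + Pi.single j 1)) (y γ (γ + Pi.single j 1)) = (0 : ℂ)) :
    HasSum (fun β => ‖x β + if β j = 0 then 0 else y (β - Pi.single j 1) β‖ ^ 2) s := by
  set A : (Fin (m + 1) → ℕ) → ℝ := fun β => ‖x β‖ ^ 2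
  set B : (Fin (m + 1) → ℕ) → ℝ := fun γ => ‖y γ (γ + Pi.single j 1)‖ ^ 2
  have hA : Summable A := hN.summable.of_nonneg_of_le (fun _ => sq_nonneg _) fun _ => by
    rw [← h]; exact le_add_of_nonneg_right (sq_nonneg _)
  have hB : HasSum B (s - ∑' γ, A γ) := by
    have := hN.sub hA.hasSum
    simp only [← h, A, add_sub_cancel_left] at this
    exact this
  have hinj : Function.Injective fun γ : Fin (m + 1) → ℕ => γ + Pi.single j 1 :=
    add_left_injective _
  set B' : (Fin (m + 1) → ℕ) → ℝ := fun β =>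
    if β j = 0 then 0 else ‖y (β - Pi.single j 1) β‖ ^ 2
  have hsub : ∀ γ : Fin (m + 1) → ℕ, γ + Pi.single j 1 - Pi.single j 1 = γ := fun γ =>
    add_tsub_cancel_right _ _
  have hB' : HasSum B' (s - ∑' γ, A γ) := by
    rw [← hinj.hasSum_iff (f := B')]
    · have : B' ∘ (fun γ : Fin (m + 1) → ℕ => γ + Pi.single j 1) = B := funext fun γ => by
        simp only [Function.comp_apply, B', B]
        rw [if_neg (by simp), hsub]
      rw [this]
      exact hB
    · intro β hβ
      simp only [B']
      split_ifs with h
      · rfl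
      · exact (hβ ⟨β - Pi.single j 1, sub_single_add_single h⟩).elim
  have hsum := hA.hasSum.add hB'
  rw [add_sub_cancel] at hsum
  convert hsum using 2 with β
  simp only [B', A]
  split_ifs with h
  · simp
  · obtain ⟨γ, rfl⟩ : ∃ γ, β = γ + Pi.single j 1 :=
      ⟨β - Pi.single j 1, (sub_single_add_single h).symm⟩
    rw [hsub]
    have := norm_add_sq_eq_norm_sq_add_norm_sq_of_inner_eq_zero _ _ (ho γ)
    nlinarith [this]

/-- An operator of the form "diagonal plus shift by `e_j`", restricted to the summand of `α`, has
its components in the summands of `α` and `α + e_j` only. -/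
theorem HHom.shift_comp_incl {m : ℕ} (j : Fin (m + 1)) {V U : (Fin (m + 1) → ℕ) → HRep M}
    {α : Fin (m + 1) → ℕ} (P : ∀ γ, HHom Z (U γ)) (I : HHom (U α) Z)
    (hself : (P α).comp I = HHom.id _) (hne : ∀ γ, γ ≠ α → (P γ).comp I = 0)
    (L₀ : ∀ β, HHom (U β) (V β)) (L₁ : ∀ γ β, HHom (U γ) (V β)) (β : Fin (m + 1) → ℕ) :
    ((L₀ β).comp (P β) + if β j = 0 then 0 else
        (L₁ (β - Pi.single j 1) β).comp (P (β - Pi.single j 1))).comp I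
      = (HHom.eval V β).comp ((HHom.incl V α).comp (L₀ α)
          + (HHom.incl V (α + Pi.single j 1)).comp (L₁ α (α + Pi.single j 1))) := by
  have hsub : ∀ γ : Fin (m + 1) → ℕ, γ + Pi.single j 1 - Pi.single j 1 = γ := fun γ =>
    add_tsub_cancel_right _ _
  have p0 : ((L₀ β).comp (P β)).comp I
      = (HHom.eval V β).comp ((HHom.incl V α).comp (L₀ α)) := by
    rw [HHom.comp_assoc]
    by_cases hβ : β = α
    · subst hβ
      rw [hself, ← HHom.comp_assoc, HHom.eval_comp_incl_self]; rfl
    · rw [hne β hβ, ← HHom.comp_assoc, HHom.eval_comp_incl_ne hβ, HHom.comp_zero]; rfl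
  have p1 : (if β j = 0 then 0 else
        (L₁ (β - Pi.single j 1) β).comp (P (β - Pi.single j 1))).comp I
      = (HHom.eval V β).comp ((HHom.incl V (α + Pi.single j 1)).comp
          (L₁ α (α + Pi.single j 1))) := by
    by_cases hβ : β = α + Pi.single j 1
    · subst hβ
      rw [if_neg (by simp), hsub, HHom.comp_assoc, hself, ← HHom.comp_assoc (HHom.eval V _),
        HHom.eval_comp_incl_self]; rfl
    · rw [← HHom.comp_assoc (HHom.eval V _), HHom.eval_comp_incl_ne hβ, HHom.zero_comp]
      split_ifs with h
      · rfl
      · have : β - Pi.single j 1 ≠ α := by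
          rintro rfl
          exact hβ (sub_single_add_single h).symm
        rw [HHom.comp_assoc, hne _ this, HHom.comp_zero]
  rw [HHom.add_comp, p0, p1, HHom.comp_add]

namespace PreProductSystem
variable {n : ℕ} (S : PreProductSystem M n)

theorem wordMap_isUnitary {f : HHom X Y} (hf : f.IsUnitary) : ∀ w, (S.wordMap f w).IsUnitary
  | [] => hf
  | i :: w => (S.E i).map_isUnitary (wordMap_isUnitary hf w)

end PreProductSystem

namespace ProductSystem
variable {m : ℕ} (S : ProductSystem M (m + 2)) {D : HRep M} {p u : List (Fin (m + 2))}
  {j : Fin (m + 1)} (a : Mult S.toPreProductSystem D p u j)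

theorem fock_normal (hD : D.Normal) : (S.fock D).Normal :=
  HHom.lsum_normal fun α => S.word_normal hD (fockWord α)

/-- The inclusion of a summand of the Fock space. -/
noncomputable abbrev fockIncl (D : HRep M) (α : Fin (m + 1) → ℕ) :
    HHom (S.word (fockWord α) D) (S.fock D) := HHom.incl (fun α => S.word (fockWord α) D) α

/-- The projection onto a summand of the Fock space. -/
noncomputable abbrev fockEval (D : HRep M) (α : Fin (m + 1) → ℕ) :
    HHom (S.fock D) (S.word (fockWord α) D) := HHom.eval (fun α => S.word (fockWord α) D) α

theorem fockEval_comp_incl_self (α : Fin (m + 1) → ℕ) :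
    (S.fockEval D α).comp (S.fockIncl D α) = HHom.id _ := HHom.eval_comp_incl_self α

theorem fockEval_comp_incl_ne {α β : Fin (m + 1) → ℕ} (h : β ≠ α) :
    (S.fockEval D β).comp (S.fockIncl D α) = 0 := HHom.eval_comp_incl_ne h

variable {S}

theorem mult_perm (a : Mult S.toPreProductSystem D p u j) (α : Fin (m + 1) → ℕ) :
    (fockWord α ++ u).Perm (fockWord (α + Pi.single j 1)) := by
  rw [a.word_eq]; exact fockWord_add_single α j

/-- The operators of degree `0` and of degree one of a multiplier have orthogonal ranges. -/
theorem lift_ortho (hD : D.Normal) {w w' : List (Fin (m + 2))} (h : (w ++ u).Perm w')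
    (x : S.word p (S.word w' D)) (y : S.word p (S.word w D)) :
    inner ℂ (S.lift (u := []) w' w' a.g₀ x) (S.lift w w' a.g₁ y) = (0 : ℂ) := by
  have hF := S.fold_isUnitary hD h
  have h0 : S.fold w' [] w' D = HHom.id (S.word w' D) := S.isCoh_unique hD
    (S.isCoh_fold (v := []) hD rfl (by simp)) (IsCoh.id (w := w') rfl) (by simp) (by simp)
  -- the summand of `w'` is written as `E_w ⊗ E_u ⊗ D`
  obtain ⟨z, rfl⟩ := (S.wordMap_isUnitary hF p).2 x
  have e1 := HHom.congr_hom (S.move_fold hD p h) z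
  have e2 := HHom.congr_hom (S.fold_natural (S.word_normal hD p) hD h a.g₀)
    (S.wordMap (S.move p u D) w (S.move p w (S.word u D) z))
  have e3 : S.lift (u := []) w' w' a.g₀ (S.wordMap (S.fold w u w' D) p z)
      = S.fold w u w' D (S.wordMap (S.wordMap a.g₀ u) w
        (S.wordMap (S.move p u D) w (S.move p w (S.word u D) z))) :=
    (HHom.congr_hom h0 _).trans ((congrArg (S.wordMap a.g₀ w').toCLM e1).trans e2.symm)
  have e4 : (S.wordMap (S.wordMap a.g₀ u) w).adj.comp (S.wordMap a.g₁ w) = 0 := by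
    have h1 := (S.wordMap_comp (S.wordMap a.g₀ u).adj a.g₁ w).symm.trans
      ((congrArg (fun f => S.wordMap f w) a.ortho).trans (S.wordMap_zero w))
    exact (congrArg (fun f => HHom.comp f (S.wordMap a.g₁ w)) (S.wordMap_adj _ w)).symm.trans h1
  refine (congrArg (fun v => (inner ℂ v (S.lift w w' a.g₁ y) : ℂ)) e3).trans ?_
  exact (hF.isIsometry.inner_map _ _).trans (HHom.inner_eq_zero_of_adj_comp e4 _ _)

/-- The column of `a` remains isometric after it has been tensored with the identity of `E_w`. -/
theorem lift_norm_sq (hD : D.Normal) {w w' w'' : List (Fin (m + 2))} (h : (w ++ u).Perm w')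
    (h' : (w ++ []).Perm w'') (x : S.word p (S.word w D)) :
    ‖S.lift (u := []) w w'' a.g₀ x‖ ^ 2 + ‖S.lift w w' a.g₁ x‖ ^ 2 = ‖x‖ ^ 2 := by
  have hm := S.move_isUnitary hD p w
  simp only [lift, HHom.comp_apply,
    HHom.isIsometry_iff_norm.mp (S.fold_isUnitary hD h).isIsometry,
    HHom.isIsometry_iff_norm.mp (S.fold_isUnitary hD h').isIsometry]
  rw [HHom.norm_sq_eq (S.wordMap a.g₀ w), HHom.norm_sq_eq (S.wordMap a.g₁ w), ← Complex.add_re,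
    ← inner_add_right, ← HHom.add_apply, ← wordMap_adj, ← wordMap_adj, ← wordMap_comp,
    ← wordMap_comp, ← wordMap_add, show _ = _ from a.column, wordMap_id, HHom.id_apply,
    ← HHom.isIsometry_iff_norm.mp hm.isIsometry x]
  exact (norm_sq_eq_re_inner (𝕜 := ℂ) _).symm

theorem hasSum_norm_sq_lift (hD : D.Normal) {fw : (Fin (m + 1) → ℕ) → List (Fin (m + 2))}
    (hfw : ∀ γ, (fw γ ++ u).Perm (fw (γ + Pi.single j 1)))
    {Z : HRep M} {P : ∀ γ, HHom Z (S.word p (S.word (fw γ) D))} {z : Z} {s : ℝ}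
    (hz : HasSum (fun γ => ‖P γ z‖ ^ 2) s) :
    HasSum (fun β => ‖S.lift (u := []) (fw β) (fw β) a.g₀ (P β z) + if β j = 0 then 0 else
      S.lift (fw (β - Pi.single j 1)) (fw β) a.g₁ (P (β - Pi.single j 1) z)‖ ^ 2) s :=
  hasSum_norm_sq_shift j (V := fun β => S.word (fw β) D)
    (fun β => S.lift (u := []) (fw β) (fw β) a.g₀ (P β z))
    (fun γ β => S.lift (fw γ) (fw β) a.g₁ (P γ z)) hz
    (fun γ => lift_norm_sq a hD (hfw γ) (by rw [List.append_nil]) _)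
    (fun γ => lift_ortho a hD (hfw γ) _ _)

theorem component_apply (β : Fin (m + 1) → ℕ) (v : S.word p (S.fock D)) :
    a.component β v = a.part₀ β v + if β j = 0 then 0 else a.part₁ (β - Pi.single j 1) β v := by
  rw [Mult.component, HHom.add_apply]
  congr 1
  split_ifs <;> rfl

/-- The components of `a` are square summable, and define an isometry. -/
theorem mult_hasSum (hD : D.Normal) (v : S.word p (S.fock D)) :
    HasSum (fun β => ‖a.component β v‖ ^ 2) (‖v‖ ^ 2) := by
  have hv := (S.isDecomp_wordMap
    (HHom.incl_isDecomp (V := fun α => S.word (fockWord α) D)) p).hasSum_norm v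
  have hv' : HasSum (fun γ => ‖S.wordMap (HHom.eval (fun α => S.word (fockWord α) D) γ) p v‖ ^ 2)
      (‖v‖ ^ 2) := by
    refine (congrArg (fun f => HasSum f (‖v‖ ^ 2)) (funext fun γ => ?_)).mp hv
    have : (S.wordMap (HHom.incl (fun α => S.word (fockWord α) D) γ) p).adj
        = S.wordMap (HHom.eval (fun α => S.word (fockWord α) D) γ) p := by
      rw [HHom.incl, wordMap_adj, HHom.adj_adj]
    rw [this]
  refine (congrArg (fun f => HasSum f (‖v‖ ^ 2)) (funext fun β => ?_)).mp
    (hasSum_norm_sq_lift a hD (mult_perm a) hv')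
  rw [component_apply]
  rfl

theorem op_isIsometry (hD : D.Normal) : a.op.IsIsometry :=
  HHom.ofComponents_isIsometry (mult_hasSum a hD)

/-- The components of `a.op` are the prescribed ones. -/
theorem eval_op (hD : D.Normal) (β : Fin (m + 1) → ℕ) :
    (HHom.eval _ β).comp a.op = a.component β := HHom.eval_ofComponents (mult_hasSum a hD) β

theorem eval_comp_op_comp_incl (hD : D.Normal) (α β : Fin (m + 1) → ℕ) :
    (HHom.eval (fun α => S.word (fockWord α) D) β).comp
        (a.op.comp (S.wordMap (S.fockIncl D α) p))
      = (a.component β).comp (S.wordMap (S.fockIncl D α) p) :=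
  congrArg (fun f => HHom.comp f (S.wordMap (S.fockIncl D α) p)) (eval_op a hD β)

theorem component_comp_incl (α β : Fin (m + 1) → ℕ) :
    (a.component β).comp (S.wordMap (S.fockIncl D α) p)
      = (HHom.eval (fun α => S.word (fockWord α) D) β).comp
        ((S.fockIncl D α).comp (S.lift (u := []) (fockWord α) (fockWord α) a.g₀)
          + (S.fockIncl D (α + Pi.single j 1)).comp
            (S.lift (fockWord α) (fockWord (α + Pi.single j 1)) a.g₁)) := by
  have hself : (S.wordMap (S.fockEval D α) p).comp (S.wordMap (S.fockIncl D α) p)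
      = HHom.id _ := by
    rw [← wordMap_comp, fockEval_comp_incl_self, wordMap_id]
  have hne : ∀ γ, γ ≠ α →
      (S.wordMap (S.fockEval D γ) p).comp (S.wordMap (S.fockIncl D α) p) = 0 := fun γ hγ => by
    rw [← wordMap_comp, fockEval_comp_incl_ne S hγ, wordMap_zero]
  exact HHom.shift_comp_incl j (V := fun α => S.word (fockWord α) D)
    (fun γ => S.wordMap (S.fockEval D γ) p)
    (S.wordMap (S.fockIncl D α) p) hself hne
    (fun β => S.lift (u := []) (fockWord β) (fockWord β) a.g₀)
    (fun γ β => S.lift (fockWord γ) (fockWord β) a.g₁) β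

/-- The operator of a multiplier on a summand of `E_p ⊗ ℱ(E) ⊗ D`. -/
theorem op_comp_incl (hD : D.Normal) (α : Fin (m + 1) → ℕ) :
    a.op.comp (S.wordMap (S.fockIncl D α) p)
      = (S.fockIncl D α).comp (S.lift (u := []) (fockWord α) (fockWord α) a.g₀)
        + (S.fockIncl D (α + Pi.single j 1)).comp
            (S.lift (fockWord α) (fockWord (α + Pi.single j 1)) a.g₁) :=
  HHom.ext fun x => HHom.lsum_ext fun β =>
    HHom.congr_hom ((eval_comp_op_comp_incl a hD α β).trans (component_comp_incl a α β)) x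

end ProductSystem
end Multipliers
/-! ### Transfer and creation operators as multipliers -/

section Products
variable {M : Type u} [CStarAlgebra M] [PartialOrder M] [StarOrderedRing M]
variable {X Y Z A B C : HRep M}

namespace ProductSystem
open PreProductSystem
variable {m : ℕ} (S : ProductSystem M (m + 2)) {D : HRep M}

theorem fold_nil (hX : X.Normal) (w : List (Fin (m + 2))) :
    S.fold w [] w X = HHom.id (S.word w X) :=
  S.isCoh_unique hX (S.isCoh_fold (v := []) hX rfl (by simp)) (IsCoh.id (w := w) rfl)
    (by simp) (by simp)

theorem move_nil (hX : X.Normal) (p : List (Fin (m + 2))) :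
    S.move p [] X = HHom.id (S.word p X) :=
  S.isCoh_unique hX (S.isCoh_move (v := []) hX rfl p []) (IsCoh.id (w := p) rfl)
    (by simp) (by simp)

theorem moveIn_eq_move (hX : X.Normal) (i : Fin (m + 2)) (w : List (Fin (m + 2))) :
    S.moveIn i w X = S.move [i] w X :=
  S.isCoh_unique hX
    ((IsCoh.wordAppend (v := []) rfl [i] w).comp
      ((S.isCoh_reorder (v := []) hX rfl (w := i :: w) (w' := w ++ [i])
        (List.perm_append_comm (l₁ := [i]))).congr rfl (List.append_assoc _ _ _)))
    (S.isCoh_move (v := []) hX rfl [i] w) rfl rfl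

/-- The multiplier of an operator from `E_i ⊗ D` to `D ⊕ (E₁ₙ ⊗ D)`. -/
noncomputable def multOf (i : Fin (m + 2)) (g₀ : HHom ((S.E i).tens D) D)
    (g₁ : HHom ((S.E i).tens D) (S.tensFL D))
    (h : g₀.IsColumn g₁) (ho : (S.mapFL g₀).IsOrthogonal g₁) :
    Mult S.toPreProductSystem D [i] [0, Fin.last (m + 1)] 0 where
  word_eq := rfl
  g₀ := g₀
  g₁ := g₁
  column := h
  ortho := ho

/-- The multiplier of the operator `create`. -/
noncomputable def createMult (D : HRep M) (u : List (Fin (m + 2))) (j : Fin (m + 1))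
    (hu : u = genWord m j) : Mult S.toPreProductSystem D u u j where
  word_eq := hu
  g₀ := 0
  g₁ := HHom.id _
  column := HHom.zero_isColumn HHom.isIsometry_id
  ortho := (S.wordMap_zero (X := S.word u D) (Y := S.word [] D) u).symm ▸ HHom.zero_isOrthogonal _

/-- The transfer operator of a block `(A, B; C, 0)` is the multiplier with the column `(A*, (I ⊗ C*)
B*)`. -/
theorem transfer_eq_op (hD : D.Normal) (i : Fin (m + 2)) {D' : HRep M}
    (A : HHom D ((S.E i).tens D)) (B : HHom (S.tensFL D') ((S.E i).tens D)) (C : HHom D D')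
    {N : HHom ((S.E i).tens D) (S.tensFL D)} (hN : (S.mapFL C.adj).comp B.adj = N)
    (h : A.adj.IsColumn N) (ho : (S.mapFL A.adj).IsOrthogonal N) :
    S.transfer i A B C = (S.multOf i A.adj N h ho).op := by
  subst hN
  refine congrArg HHom.ofComponents (funext fun β => ?_)
  refine congrArg₂ HAdd.hAdd ?_ ?_
  · have e := S.fold_nil hD (fockWord β)
    refine HHom.ext fun v => ?_
    have e1 := HHom.congr_hom (S.moveIn_eq_move hD i (fockWord β))
      ((S.E i).map (S.fockEval D β) v)
    refine (congrArg (S.wordMap A.adj (fockWord β)).toCLM e1).trans ?_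
    exact (HHom.congr_hom e _).symm
  · split_ifs with hβ
    · rfl
    · refine HHom.ext fun v => ?_
      have e1 := HHom.congr_hom (S.moveIn_eq_move hD i (fockWord (β - Pi.single 0 1)))
        ((S.E i).map (S.fockEval D (β - Pi.single 0 1)) v)
      exact congrArg (fun z => S.fold (fockWord (β - Pi.single 0 1)) [0, Fin.last (m + 1)]
        (fockWord β) D (S.wordMap ((S.mapFL C.adj).comp B.adj)
          (fockWord (β - Pi.single 0 1)) z)) e1

theorem lift_id (hX : X.Normal) {w u w' : List (Fin (m + 2))} (h : (w ++ u).Perm w') :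
    S.lift w w' (HHom.id (S.word u X)) = S.fold u w w' X := by
  have h' : (u ++ w).Perm w' := List.perm_append_comm.trans h
  refine S.isCoh_unique hX
    ((S.isCoh_fold (v := []) hX rfl h).comp (((IsCoh.id (w := u ++ []) (S.word_append X [] u)).wordMap w).comp
      (S.isCoh_move (v := []) hX rfl u w))) (S.isCoh_fold (v := []) hX rfl h') rfl rfl

/-- The creation operators are the multipliers with the column `(0, I)`. -/
theorem create_eq_op (hD : D.Normal) (u : List (Fin (m + 2))) (j : Fin (m + 1))
    (hu : u = genWord m j) : S.create u j D = (S.createMult D u j hu).op := by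
  refine congrArg HHom.ofComponents (funext fun β => ?_)
  have e0 : (S.createMult D u j hu).part₀ β = 0 := by
    rw [Mult.part₀]
    exact (congrArg (fun f => HHom.comp f (S.wordMap (S.fockEval D β) u))
      (S.lift_zero (fockWord β) (fockWord β))).trans (HHom.zero_comp _)
  have e1 : ¬ β j = 0 → (S.createMult D u j hu).part₁ (β - Pi.single j 1) β
      = (S.fold u (fockWord (β - Pi.single j 1)) (fockWord β) D).comp
          (S.wordMap (S.fockEval D (β - Pi.single j 1)) u) := fun hβ => by
    have hp := mult_perm (S.createMult D u j hu) (β - Pi.single j 1)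
    rw [sub_single_add_single hβ] at hp
    exact congrArg (fun f => HHom.comp f (S.wordMap (S.fockEval D (β - Pi.single j 1)) u))
      (S.lift_id hD hp)
  rw [Mult.component, e0, zero_add]
  split_ifs with hβ
  · rfl
  · rw [e1 hβ]; rfl

end ProductSystem
end Products
/-! ### Products of liftings -/

section Relations
variable {M : Type u} [CStarAlgebra M] [PartialOrder M] [StarOrderedRing M]
variable {X Y Z A B C : HRep M}

/-- The operator vanishes. -/
def HHom.IsZero (f : HHom X Y) : Prop := f = 0

namespace ProductSystem
open PreProductSystem
variable {m : ℕ} {S : ProductSystem M (m + 2)} {D : HRep M}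
variable {p p' u : List (Fin (m + 2))} {j : Fin (m + 1)}

/-- The composite `(I ⊗ g') (I ⊗ g)`, up to canonical identifications, if the composite of `g'` and `g` is `h`. -/
theorem lift_comp_lift_eq (hD : D.Normal) {u₁ u₂ w w' w'' : List (Fin (m + 2))}
    {g : HHom (S.word p D) (S.word u₁ D)} {g' : HHom (S.word p' D) (S.word u₂ D)}
    (h : (w ++ u₁).Perm w') (h' : (w' ++ u₂).Perm w'')
    {C₁ : HHom (S.word p' (S.word p (S.word w D))) (S.word w (S.word p' (S.word p D)))}
    (hC₁ : S.IsCoh D (p' ++ (p ++ (w ++ []))) (w ++ (p' ++ (p ++ []))) C₁)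
    {k : HHom (S.word p' (S.word p D)) (S.word u₁ (S.word u₂ D))}
    (hk : (S.wordMap g' u₁).comp ((S.move p' u₁ D).comp (S.wordMap g p')) = k) :
    (S.lift w' w'' g').comp (S.wordMap (S.lift w w' g) p')
      = ((S.fold w' u₂ w'' D).comp (S.fold w u₁ w' (S.word u₂ D))).comp ((S.wordMap k w).comp C₁) := by
  subst hk
  exact S.lift_comp_lift hD hD hD g g' h h' hC₁
    ((S.isCoh_fold (v := []) hD rfl h').comp
        ((S.isCoh_fold (v := u₂ ++ []) hD (S.word_append D [] u₂) h).congr (w' := w' ++ (u₂ ++ []))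
        (by simp) rfl) |>.congr rfl (by simp))

/-- The product of two operators `b` and `a`, of which the summands of degree zero and two vanish. -/
theorem comp_map_comp_eq {K V₀ V₁ V₂ : HRep M} {a : HHom (S.word p' K) K} {b : HHom (S.word p K) K}
    {J₀ : HHom V₀ K} {J₁ : HHom V₁ K} {J₂ : HHom V₂ K}
    {l₀ : HHom (S.word p V₀) V₀} {l₁ : HHom (S.word p V₀) V₁}
    {m₀ : HHom (S.word p' V₀) V₀} {m₁ : HHom (S.word p' V₀) V₁}
    {m₀' : HHom (S.word p' V₁) V₁} {m₁' : HHom (S.word p' V₁) V₂}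
    (hb : b.comp (S.wordMap J₀ p) = J₀.comp l₀ + J₁.comp l₁)
    (ha : a.comp (S.wordMap J₀ p') = J₀.comp m₀ + J₁.comp m₁)
    (ha' : a.comp (S.wordMap J₁ p') = J₁.comp m₀' + J₂.comp m₁')
    (h₀ : m₀.comp (S.wordMap l₀ p') = 0) (h₂ : m₁'.comp (S.wordMap l₁ p') = 0)
    {k : HHom (S.word p' (S.word p V₀)) V₁}
    (h₁ : m₁.comp (S.wordMap l₀ p') + m₀'.comp (S.wordMap l₁ p') = k) :
    (a.comp (S.wordMap b p')).comp (S.wordMap (S.wordMap J₀ p) p') = J₁.comp k := by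
  rw [HHom.comp_assoc, ← wordMap_comp, hb, wordMap_add, wordMap_comp, wordMap_comp, HHom.comp_add,
    ← HHom.comp_assoc a, ← HHom.comp_assoc a, ha, ha', HHom.add_comp, HHom.add_comp,
    HHom.comp_assoc, HHom.comp_assoc, HHom.comp_assoc, HHom.comp_assoc, h₀, h₂, HHom.comp_zero,
    HHom.comp_zero, zero_add, add_zero, ← HHom.comp_add, h₁]

/-- If `(I ⊗ g') g` vanishes on `D`, up to the identification in the middle, then it vanishes on all
summands of the Fock space. -/
theorem lift_comp_lift_zero (hD : D.Normal) {u₁ u₂ w w' w'' : List (Fin (m + 2))}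
    {g : HHom (S.word p D) (S.word u₁ D)} {g' : HHom (S.word p' D) (S.word u₂ D)}
    (h : (w ++ u₁).Perm w') (h' : (w' ++ u₂).Perm w'')
    (hk : ((S.wordMap g' u₁).comp ((S.move p' u₁ D).comp (S.wordMap g p'))).IsZero) :
    (S.lift w' w'' g').comp (S.wordMap (S.lift w w' g) p') = 0 := by
  rw [lift_comp_lift_eq hD h h' (C₁ := (S.move p' w (S.word p D)).comp
    (S.wordMap (S.move p w D) p'))
    (((S.isCoh_move (v := p ++ []) hD (S.word_append D [] p) p' w).comp
        ((S.isCoh_move (v := []) hD rfl p w).wordMap p'))) hk, wordMap_zero, HHom.zero_comp,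
    HHom.comp_zero]

/-- The product of two multipliers whose components of degree zero and two vanish. -/
theorem op_comp_op_comp_incl (hD : D.Normal) (a : Mult S.toPreProductSystem D p' u j)
    (b : Mult S.toPreProductSystem D p u j)
    {h₀₁ h₁₀ : HHom (S.word p' (S.word p D)) (S.word u D)}
    (h₀ : (a.g₀.comp (S.wordMap b.g₀ p')).IsZero)
    (h₂ : ((S.wordMap a.g₁ u).comp ((S.move p' u D).comp (S.wordMap b.g₁ p'))).IsZero)
    (e₀₁ : a.g₁.comp (S.wordMap b.g₀ p') = h₀₁)
    (e₁₀ : (S.wordMap a.g₀ u).comp ((S.move p' u D).comp (S.wordMap b.g₁ p')) = h₁₀)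
    {h : HHom (S.word p' (S.word p D)) (S.word u D)} (h₁ : h₀₁ + h₁₀ = h) (α : Fin (m + 1) → ℕ)
    {C₁ : HHom (S.word p' (S.word p (S.word (fockWord α) D)))
      (S.word (fockWord α) (S.word p' (S.word p D)))}
    (hC₁ : S.IsCoh D (p' ++ (p ++ (fockWord α ++ []))) (fockWord α ++ (p' ++ (p ++ []))) C₁) :
    (a.op.comp (S.wordMap b.op p')).comp (S.wordMap (S.wordMap (S.fockIncl D α) p) p')
      = (S.fockIncl D (α + Pi.single j 1)).comp
          ((S.fold (fockWord α) u (fockWord (α + Pi.single j 1)) D).comp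
            ((S.wordMap h (fockWord α)).comp C₁)) := by
  subst h₁
  have pb := mult_perm b α
  have pn : ∀ w : List (Fin (m + 2)), (w ++ []).Perm w := fun w => by rw [List.append_nil]
  have hm := S.move_nil hD p'
  have c : ∀ {v : List (Fin (m + 2))} (g : HHom (S.word p' D) (S.word v D)),
      (S.wordMap g []).comp ((S.move p' [] D).comp (S.wordMap b.g₀ p'))
        = g.comp (S.wordMap b.g₀ p') := fun g =>
    congrArg (fun f => HHom.comp g f) ((congrArg (fun f : HHom (S.word p' D) (S.word p' D) =>
      HHom.comp f (S.wordMap b.g₀ p')) hm).trans (HHom.id_comp _))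
  refine comp_map_comp_eq (op_comp_incl b hD α) (op_comp_incl a hD α)
    (op_comp_incl a hD (α + Pi.single j 1)) ?_ ?_ ?_
  · exact lift_comp_lift_zero hD (u₁ := []) (u₂ := []) (pn _) (pn _)
      ((c (v := []) a.g₀).trans h₀)
  · exact lift_comp_lift_zero hD pb (mult_perm a _) h₂
  · have e1 := lift_comp_lift_eq hD (u₁ := []) (u₂ := u) (pn (fockWord α)) pb hC₁ (k := h₀₁)
      ((c a.g₁).trans e₀₁)
    have e2 := lift_comp_lift_eq hD (u₁ := u) (u₂ := []) pb (pn _) hC₁ e₁₀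
    have n1 := S.fold_nil (S.word_normal hD u) (fockWord α)
    have n2 := S.fold_nil hD (fockWord (α + Pi.single j 1))
    rw [wordMap_add, HHom.add_comp, HHom.comp_add]
    refine congrArg₂ HAdd.hAdd (e1.trans ?_) (e2.trans ?_)
    · exact congrArg (fun f => HHom.comp f ((S.wordMap h₀₁ (fockWord α)).comp C₁))
        ((congrArg (HHom.comp (S.fold (fockWord α) u (fockWord (α + Pi.single j 1)) D)) n1).trans
          (HHom.comp_id _))
    · exact congrArg (fun f => HHom.comp f ((S.wordMap h₁₀ (fockWord α)).comp C₁))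
        ((congrArg (fun f => HHom.comp f (S.fold (fockWord α) u (fockWord (α + Pi.single j 1)) D))
          n2).trans (HHom.id_comp _))

end ProductSystem
end Relations
/-! ### Products and commutation of multipliers -/

section Commutation
variable {M : Type u} [CStarAlgebra M] [PartialOrder M] [StarOrderedRing M]
variable {X Y Z A B C : HRep M}

namespace ProductSystem
open PreProductSystem
variable {m : ℕ} {S : ProductSystem M (m + 2)} {D : HRep M}
variable {p p' u : List (Fin (m + 2))} {j : Fin (m + 1)}

/-- Operators on `E_p ⊗ ℱ(E) ⊗ D` are determined by their restrictions to the summands. -/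
theorem fock_hom_ext {f g : HHom (S.word p (S.fock D)) X}
    (h : ∀ α, f.comp (S.wordMap (S.fockIncl D α) p) = g.comp (S.wordMap (S.fockIncl D α) p)) :
    f = g :=
  (S.isDecomp_wordMap (HHom.incl_isDecomp (V := fun α => S.word (fockWord α) D)) p).hom_ext h

/-- The creation operators on the summands of the Fock space. -/
theorem create_comp_incl (hD : D.Normal) (hu : u = genWord m j) (α : Fin (m + 1) → ℕ) :
    (S.create u j D).comp (S.wordMap (S.fockIncl D α) u)
      = (S.fockIncl D (α + Pi.single j 1)).comp
          ((S.fold (fockWord α) u (fockWord (α + Pi.single j 1)) D).comp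
            (S.move u (fockWord α) D)) := by
  have h := op_comp_incl (S.createMult D u j hu) hD α
  have e0 : (S.fockIncl D α).comp (S.lift (u := []) (fockWord α) (fockWord α)
      (S.createMult D u j hu).g₀) = 0 :=
    (congrArg (HHom.comp (S.fockIncl D α)) (S.lift_zero (X := D) (Y := D) (p := u) (u := [])
      (fockWord α) (fockWord α))).trans (HHom.comp_zero _)
  rw [e0, zero_add, ← S.create_eq_op hD u j hu] at h
  refine h.trans (congrArg (HHom.comp (S.fockIncl D (α + Pi.single j 1))) ?_)
  refine congrArg (HHom.comp (S.fold (fockWord α) u (fockWord (α + Pi.single j 1)) D)) ?_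
  exact (congrArg (fun f => HHom.comp f (S.move u (fockWord α) D))
    (S.wordMap_id (fockWord α))).trans (HHom.id_comp _)

/-- Two multipliers multiply to a creation operator if, on `D`, the parts of degrees `0` and `2` of
the product vanish and the part of degree `1` is the identity. -/
theorem op_comp_op_eq_create (hD : D.Normal) {i k : Fin (m + 2)}
    (a : Mult S.toPreProductSystem D [i] [i, k] j) (b : Mult S.toPreProductSystem D [k] [i, k] j)
    {h₀₁ h₁₀ : HHom (S.word [i, k] D) (S.word [i, k] D)}
    (h₀ : (a.g₀.comp (S.wordMap b.g₀ [i])).IsZero)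
    (h₂ : ((S.wordMap a.g₁ [i, k]).comp ((S.move [i] [i, k] D).comp (S.wordMap b.g₁ [i]))).IsZero)
    (e₀₁ : a.g₁.comp (S.wordMap b.g₀ [i]) = h₀₁)
    (e₁₀ : (S.wordMap a.g₀ [i, k]).comp ((S.move [i] [i, k] D).comp (S.wordMap b.g₁ [i])) = h₁₀)
    (h₁ : h₀₁ + h₁₀ = HHom.id _) :
    a.op.comp ((S.E i).map b.op) = S.create [i, k] j D := by
  refine fock_hom_ext (p := [i, k]) fun α => ?_
  refine (op_comp_op_comp_incl hD a b h₀ h₂ e₀₁ e₁₀ h₁ α (C₁ := S.move [i, k] (fockWord α) D)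
    (S.isCoh_move (v := []) hD rfl [i, k] _)).trans ?_
  refine Eq.trans ?_ (create_comp_incl hD a.word_eq α).symm
  refine congrArg (HHom.comp (S.fockIncl D (α + Pi.single j 1))) ?_
  refine congrArg (HHom.comp (S.fold (fockWord α) [i, k] (fockWord (α + Pi.single j 1)) D)) ?_
  exact (congrArg (fun f => HHom.comp f (S.move [i, k] (fockWord α) D))
    (S.wordMap_id (fockWord α))).trans (HHom.id_comp _)

/-- Bookkeeping for an operator `f` and a composition `c C'`: both restrict on `V₁` to the same
operator once the identifications `s r₁` and `r₂ C` agree. -/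
theorem comp_eq_comp_of_swap {K K₁ K₂ V V₁ V₂ W W' : HRep M} {f : HHom K₁ K} {J₁ : HHom V₁ K₁}
    {J₂ : HHom V₂ K₂} {I : HHom V K} {g : HHom W V} {s : HHom W' W} {r₁ : HHom V₁ W'}
    {r₂ : HHom V₂ W} {C' : HHom K₁ K₂} {C : HHom V₁ V₂} {c : HHom K₂ K}
    (h₀ : f.comp J₁ = I.comp (g.comp (s.comp r₁))) (h₁ : C'.comp J₁ = J₂.comp C)
    (h₂ : c.comp J₂ = I.comp (g.comp r₂)) (h₃ : s.comp r₁ = r₂.comp C) :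
    f.comp J₁ = (c.comp C').comp J₁ := by
  rw [h₀, h₃, HHom.comp_assoc, h₁, ← HHom.comp_assoc c, h₂, HHom.comp_assoc, HHom.comp_assoc]

/-- The variant of `op_comp_op_eq_create` for the opposite order of the two factors. -/
theorem op_comp_op_eq_create_swap (hD : D.Normal) {i k : Fin (m + 2)}
    (a : Mult S.toPreProductSystem D [k] [i, k] j) (b : Mult S.toPreProductSystem D [i] [i, k] j)
    {h₀₁ h₁₀ : HHom (S.word [k, i] D) (S.word [i, k] D)}
    (h₀ : (a.g₀.comp (S.wordMap b.g₀ [k])).IsZero)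
    (h₂ : ((S.wordMap a.g₁ [i, k]).comp ((S.move [k] [i, k] D).comp (S.wordMap b.g₁ [k]))).IsZero)
    (e₀₁ : a.g₁.comp (S.wordMap b.g₀ [k]) = h₀₁)
    (e₁₀ : (S.wordMap a.g₀ [i, k]).comp ((S.move [k] [i, k] D).comp (S.wordMap b.g₁ [k])) = h₁₀)
    (h₁ : h₀₁ + h₁₀ = S.swap k i D) :
    a.op.comp ((S.E k).map b.op) = (S.create [i, k] j D).comp (S.swap k i (S.fock D)) := by
  refine fock_hom_ext (p := [k, i]) fun α => ?_
  have e0 := op_comp_op_comp_incl hD a b h₀ h₂ e₀₁ e₁₀ h₁ α (C₁ := S.move [k, i] (fockWord α) D)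
    (S.isCoh_move (v := []) hD rfl [k, i] _)
  have e2 := create_comp_incl (S := S) hD a.word_eq α
  have e3 : (S.wordMap (S.swap k i D) (fockWord α)).comp (S.move [k, i] (fockWord α) D)
      = (S.move [i, k] (fockWord α) D).comp (S.swap k i (S.word (fockWord α) D)) :=
    S.isCoh_unique hD
      (((IsCoh.swap (w := []) k i rfl).wordMap (fockWord α)).comp
        (S.isCoh_move (v := []) hD rfl [k, i] _))
      ((S.isCoh_move (v := []) hD rfl [i, k] _).comp ((IsCoh.swap (w := fockWord α) k i
        rfl).congr (by simp) (by simp))) rfl rfl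
  exact comp_eq_comp_of_swap e0 (S.swap_natural k i (S.fockIncl D α)) e2 e3

/-- The operators `I ⊗ g` commute with canonical identifications. -/
theorem lift_comp_map_coh (hD : D.Normal) {k : Fin (m + 2)} {w w' w₁ w₁' : List (Fin (m + 2))}
    (g : HHom (S.word p D) (S.word u D)) (h : (w ++ u).Perm w₁) (h' : (w' ++ u).Perm w₁')
    (hk : (w ++ [k]).Perm w') {F : HHom (S.word [k] (S.word w D)) (S.word w' D)}
    (hF : S.IsCoh D (k :: w) w' F)
    {F₁ : HHom (S.word [k] (S.word w₁ D)) (S.word w₁' D)} (hF₁ : S.IsCoh D (k :: w₁) w₁' F₁)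
    {C : HHom (S.word [k] (S.word p (S.word w D))) (S.word p (S.word [k] (S.word w D)))}
    (hC : S.IsCoh D (k :: (p ++ w)) (p ++ (k :: w)) C) :
    F₁.comp (S.wordMap (S.lift w w₁ g) [k])
      = ((S.lift w' w₁' g).comp (S.wordMap F p)).comp C := by
  have hk₁ : (w₁ ++ [k]).Perm w₁' :=
    ((h.symm.append_right [k]).trans (by
      rw [List.append_assoc]
      exact (List.Perm.append_left w List.perm_append_comm).trans
        (by rw [← List.append_assoc]; exact hk.append_right u))).trans h'
  have r1 := lift_comp_lift_eq hD (g := g) (g' := HHom.id (S.word [k] D)) h hk₁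
    (C₁ := (S.move [k] w (S.word p D)).comp (S.wordMap (S.move p w D) [k]))
    (((S.isCoh_move (v := p ++ []) hD (S.word_append D [] p) [k] w).comp
        ((S.isCoh_move (v := []) hD rfl p w).wordMap [k])))
    (k := (S.move [k] u D).comp (S.wordMap g [k])) (by rw [wordMap_id, HHom.id_comp])
  have r2 := lift_comp_lift_eq hD (g := HHom.id (S.word [k] D)) (g' := g) hk h'
    (C₁ := (S.move p w (S.word [k] D)).comp (S.wordMap (S.move [k] w D) p))
    (((S.isCoh_move (v := [k] ++ []) hD (S.word_append D [] [k]) p w).comp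
        ((S.isCoh_move (v := []) hD rfl [k] w).wordMap p)))
    (k := (S.wordMap g [k]).comp (S.move p [k] D)) (by rw [wordMap_id, HHom.comp_id])
  have hF' : F = S.lift w w' (HHom.id (S.word [k] D)) := by
    rw [S.lift_id hD hk]
    exact S.isCoh_unique hD hF (S.isCoh_fold (v := []) hD rfl
      ((List.perm_append_comm (l₁ := [k])).trans hk)) (by simp) (by simp)
  have hF₁' : F₁ = S.lift w₁ w₁' (HHom.id (S.word [k] D)) := by
    rw [S.lift_id hD hk₁]
    exact S.isCoh_unique hD hF₁ (S.isCoh_fold (v := []) hD rfl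
      ((List.perm_append_comm (l₁ := [k])).trans hk₁)) (by simp) (by simp)
  rw [hF', hF₁', r1, r2, wordMap_comp, wordMap_comp]
  have c1 : ((S.fold w₁ [k] w₁' D).comp (S.fold w u w₁ (S.word [k] D))).comp
      (S.wordMap (S.move [k] u D) w)
      = (S.fold w' u w₁' D).comp (S.fold w [k] w' (S.word u D)) := by
    refine S.isCoh_unique hD (w := w ++ ([k] ++ (u ++ []))) (w' := w₁' ++ [])
      (((S.isCoh_fold (v := []) hD rfl hk₁).comp
        ((S.isCoh_fold (v := [k] ++ []) hD (S.word_append D [] [k]) h))).comp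
        ((S.isCoh_move (v := []) hD rfl [k] u).wordMap w))
      ((S.isCoh_fold (v := []) hD rfl h').comp
        (S.isCoh_fold (v := u ++ []) hD (S.word_append D [] u) hk)) ?_ ?_ <;> simp
  have c2 : (S.move [k] w (S.word p D)).comp (S.wordMap (S.move p w D) [k])
      = (S.wordMap (S.move p [k] D) w).comp
        (((S.move p w (S.word [k] D)).comp (S.wordMap (S.move [k] w D) p)).comp C) := by
    refine S.isCoh_unique hD (w := [k] ++ (p ++ (w ++ []))) (w' := w ++ ([k] ++ (p ++ [])))
      ((S.isCoh_move (v := p ++ []) hD (S.word_append D [] p) [k] w).comp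
        ((S.isCoh_move (v := []) hD rfl p w).wordMap [k]))
      (((S.isCoh_move (v := []) hD rfl p [k]).wordMap w).comp
        (((S.isCoh_move (v := [k] ++ []) hD (S.word_append D [] [k]) p w).comp
        ((S.isCoh_move (v := []) hD rfl [k] w).wordMap p)).comp
        (hC.congr rfl (by simp)))) ?_ ?_ <;> simp
  rw [← c1, c2]
  ext x
  rfl

/-- An operator `b` with two components on each summand commutes with an operator `c` that maps
summands into summands, provided that both components commute with `c`. -/
theorem comp_comp_eq_of_two {K V₀ V₁ W₀ W₁ : HRep M} {i k : Fin (m + 2)}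
    {b : HHom (S.word [i] K) K} {c : HHom (S.word [k] K) K}
    {J₀ : HHom V₀ K} {J₁ : HHom V₁ K} {I₀ : HHom W₀ K} {I₁ : HHom W₁ K}
    {l₀ : HHom (S.word [i] V₀) V₀} {l₁ : HHom (S.word [i] V₀) V₁}
    {n₀ : HHom (S.word [i] W₀) W₀} {n₁ : HHom (S.word [i] W₀) W₁}
    {F₀ : HHom (S.word [k] V₀) W₀} {F₁ : HHom (S.word [k] V₁) W₁}
    {C : HHom (S.word [k] (S.word [i] V₀)) (S.word [i] (S.word [k] V₀))}
    {C' : HHom (S.word [k] (S.word [i] K)) (S.word [i] (S.word [k] K))}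
    (hb : b.comp (S.wordMap J₀ [i]) = J₀.comp l₀ + J₁.comp l₁)
    (hb' : b.comp (S.wordMap I₀ [i]) = I₀.comp n₀ + I₁.comp n₁)
    (hc : c.comp (S.wordMap J₀ [k]) = I₀.comp F₀)
    (hc' : c.comp (S.wordMap J₁ [k]) = I₁.comp F₁)
    (h₀ : F₀.comp (S.wordMap l₀ [k]) = (n₀.comp (S.wordMap F₀ [i])).comp C)
    (h₁ : F₁.comp (S.wordMap l₁ [k]) = (n₁.comp (S.wordMap F₀ [i])).comp C)
    (hC : C'.comp (S.wordMap (S.wordMap J₀ [i]) [k])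
      = (S.wordMap (S.wordMap J₀ [k]) [i]).comp C) :
    (c.comp (S.wordMap b [k])).comp (S.wordMap (S.wordMap J₀ [i]) [k])
      = (b.comp ((S.wordMap c [i]).comp C')).comp (S.wordMap (S.wordMap J₀ [i]) [k]) := by
  have r1 : (c.comp (S.wordMap b [k])).comp (S.wordMap (S.wordMap J₀ [i]) [k])
      = I₀.comp (F₀.comp (S.wordMap l₀ [k])) + I₁.comp (F₁.comp (S.wordMap l₁ [k])) := by
    rw [HHom.comp_assoc, ← wordMap_comp, hb, wordMap_add, wordMap_comp, wordMap_comp,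
      HHom.comp_add, ← HHom.comp_assoc c, ← HHom.comp_assoc c, hc, hc', HHom.comp_assoc,
      HHom.comp_assoc]
  have r2 : (b.comp ((S.wordMap c [i]).comp C')).comp (S.wordMap (S.wordMap J₀ [i]) [k])
      = ((I₀.comp n₀ + I₁.comp n₁).comp (S.wordMap F₀ [i])).comp C := by
    rw [HHom.comp_assoc, HHom.comp_assoc, hC, ← HHom.comp_assoc (S.wordMap c [i]),
      ← wordMap_comp, hc, wordMap_comp, ← hb']
    rfl
  rw [r1, r2, h₀, h₁, HHom.add_comp, HHom.add_comp]
  rfl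

/-- The creation operator of `E_k` commutes with every multiplier. -/
theorem create_comp_op (hD : D.Normal) {i k : Fin (m + 2)} {j' : Fin (m + 1)}
    (hk : [k] = genWord m j') (b : Mult S.toPreProductSystem D [i] u j) :
    (S.create [k] j' D).comp ((S.E k).map b.op)
      = b.op.comp (((S.E i).map (S.create [k] j' D)).comp (S.swap k i (S.fock D))) := by
  refine fock_hom_ext (p := [k, i]) fun α => ?_
  have hb := op_comp_incl b hD α
  have hb' := op_comp_incl b hD (α + Pi.single j' 1)
  have hc := create_comp_incl (S := S) hD hk α
  have hc' := create_comp_incl (S := S) hD hk (α + Pi.single j 1)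
  have pn : ∀ w : List (Fin (m + 2)), (w ++ []).Perm w := fun w => by rw [List.append_nil]
  have pc := mult_perm (S.createMult D [k] j' hk)
  have pb := mult_perm b
  have hF : ∀ α, S.IsCoh D (k :: fockWord α) (fockWord (α + Pi.single j' 1))
      ((S.fold (fockWord α) [k] (fockWord (α + Pi.single j' 1)) D).comp
        (S.move [k] (fockWord α) D)) := fun α =>
    ((S.isCoh_fold (v := []) hD rfl (pc α)).comp (S.isCoh_move (v := []) hD rfl [k] _)).congr
      (by simp) (by simp)
  have hS : S.IsCoh D (k :: ([i] ++ fockWord α)) ([i] ++ (k :: fockWord α))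
      (S.swap k i (S.word (fockWord α) D)) := .swap k i rfl
  rw [add_right_comm] at hc'
  have hF' : ∀ β, α + Pi.single j 1 + Pi.single j' 1 = β →
      S.IsCoh D (k :: fockWord (α + Pi.single j 1)) (fockWord β)
        ((S.fold (fockWord (α + Pi.single j 1)) [k] (fockWord β) D).comp
          (S.move [k] (fockWord (α + Pi.single j 1)) D)) := by
    rintro _ rfl; exact hF _
  have l0 := lift_comp_map_coh hD (u := []) b.g₀ (pn _) (pn _) (pc α) (hF α) (hF α) hS
  have l1 := lift_comp_map_coh hD b.g₁ (pb α) (pb (α + Pi.single j' 1)) (pc α) (hF α)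
    (hF' _ (add_right_comm _ _ _)) hS
  -- the operators on both sides are compared on the summand of `α`
  refine comp_comp_eq_of_two (k := k) (i := i) hb hb' hc hc' l0 l1 ?_
  exact S.swap_natural k i (S.fockIncl D α)

end ProductSystem
end Commutation
/-! ### Commuting pairs of multipliers -/

section Pairs
variable {M : Type u} [CStarAlgebra M] [PartialOrder M] [StarOrderedRing M]
variable {X Y Z W : HRep M}

namespace HHom

theorem IsZero.of_eq {f g : HHom X Y} (hg : g.IsZero) (h : f = g) : f.IsZero := h.trans hg

theorem IsZero.comp_left {f : HHom X Y} (hf : f.IsZero) (g : HHom Y Z) : (g.comp f).IsZero := by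
  rw [IsZero, show f = 0 from hf, comp_zero]

theorem IsZero.map {f : HHom X Y} (hf : f.IsZero) (E : WCorr M) : (E.map f).IsZero := by
  rw [IsZero, show f = 0 from hf, E.map_zero]

theorem IsZero.adj {f : HHom X Y} (hf : f.IsZero) : f.adj.IsZero := by
  rw [IsZero, show f = 0 from hf, adj_zero]

end HHom

namespace ProductSystem
open PreProductSystem
variable {m : ℕ} (S : ProductSystem M (m + 2)) {D : HRep M}

theorem move_fst (hX : X.Normal) :
    S.move [0] [0, Fin.last (m + 1)] X = (S.E 0).map (S.swap 0 (Fin.last (m + 1)) X) :=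
  S.isCoh_unique hX (S.isCoh_move (v := []) hX rfl [0] [0, Fin.last (m + 1)])
    ((IsCoh.swap (w := []) 0 (Fin.last (m + 1)) rfl).map 0) rfl rfl

theorem move_last (hX : X.Normal) :
    S.move [Fin.last (m + 1)] [0, Fin.last (m + 1)] X
      = S.swap (Fin.last (m + 1)) 0 ((S.E (Fin.last (m + 1))).tens X) :=
  S.isCoh_unique hX (S.isCoh_move (v := []) hX rfl [Fin.last (m + 1)] [0, Fin.last (m + 1)])
    (IsCoh.swap (w := [Fin.last (m + 1)]) (Fin.last (m + 1)) 0 rfl) rfl rfl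

/-- The relations between the operators `A : D → E₁ ⊗ D` and `B : D → Eₙ ⊗ D` that make the
operators with the columns `(A*, I₁ ⊗ B)` and `(B*, Iₙ ⊗ A)` a commuting pair of isometries. -/
structure IsPair (A : HHom D ((S.E 0).tens D)) (B : HHom D ((S.E (Fin.last (m + 1))).tens D)) :
    Prop where
  zero₁ : (((S.E 0).map B).comp A).IsZero
  zeroₙ : (((S.E (Fin.last (m + 1))).map A).comp B).IsZero
  one₁ : A.comp A.adj + (S.E 0).map (B.adj.comp B) = HHom.id _
  oneₙ : B.comp B.adj + (S.E (Fin.last (m + 1))).map (A.adj.comp A) = HHom.id _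

namespace IsPair
variable {S} {A : HHom D ((S.E 0).tens D)} {B : HHom D ((S.E (Fin.last (m + 1))).tens D)}
  (h : S.IsPair A B)

include h

theorem column₁ : A.adj.IsColumn ((S.E 0).map B) := by
  rw [HHom.IsColumn, HHom.adj_adj, ← WCorr.map_adj, ← WCorr.map_comp, h.one₁]

theorem ortho₁ : (S.mapFL A.adj).IsOrthogonal ((S.E 0).map B) := by
  rw [HHom.IsOrthogonal, ← WCorr.map_adj, ← WCorr.map_adj, HHom.adj_adj, ← WCorr.map_comp]
  exact h.zeroₙ.map _

theorem columnₙ (hD : D.Normal) : B.adj.IsColumn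
    ((S.swap (Fin.last (m + 1)) 0 D).comp ((S.E (Fin.last (m + 1))).map A)) := by
  rw [HHom.IsColumn, HHom.adj_adj, HHom.adj_comp, HHom.comp_assoc,
    (S.swap_isUnitary _ _ hD).adj_comp_assoc, ← WCorr.map_adj, ← WCorr.map_comp, h.oneₙ]

theorem orthoₙ : (S.mapFL B.adj).IsOrthogonal
    ((S.swap (Fin.last (m + 1)) 0 D).comp ((S.E (Fin.last (m + 1))).map A)) := by
  rw [HHom.IsOrthogonal, ← WCorr.map_adj, ← WCorr.map_adj, HHom.adj_adj, ← HHom.comp_assoc,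
    ← S.swap_natural, HHom.comp_assoc, ← WCorr.map_comp]
  exact (h.zero₁.map _).comp_left _

/-- The multiplier with the column `(A*, I₁ ⊗ B)`. -/
noncomputable def mult₁ : Mult S.toPreProductSystem D [0] [0, Fin.last (m + 1)] 0 :=
  S.multOf 0 A.adj ((S.E 0).map B) h.column₁ h.ortho₁

/-- The multiplier with the column `(B*, Iₙ ⊗ A)`. -/
noncomputable def multₙ (hD : D.Normal) :
    Mult S.toPreProductSystem D [Fin.last (m + 1)] [0, Fin.last (m + 1)] 0 :=
  S.multOf (Fin.last (m + 1)) B.adj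
    ((S.swap (Fin.last (m + 1)) 0 D).comp ((S.E (Fin.last (m + 1))).map A)) (h.columnₙ hD) h.orthoₙ

/-- The parts of degrees `0`, `2` and `1` of the product are computed by `zero₁`, `zero₁` and
`oneₙ`. -/
theorem op₁_comp_opₙ (hD : D.Normal) :
    h.mult₁.op.comp ((S.E 0).map (h.multₙ hD).op) = S.create [0, Fin.last (m + 1)] 0 D := by
  have hs : ∀ {Y : HRep M} (f : HHom Y _), (S.swap 0 (Fin.last (m + 1)) D).comp
      ((S.swap (Fin.last (m + 1)) 0 D).comp f) = f := fun f => by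
    rw [← HHom.comp_assoc, S.swap_swap _ _ hD, HHom.id_comp]
  have hmove : (S.move [0] [0, Fin.last (m + 1)] D).comp ((S.E 0).map
      ((S.swap (Fin.last (m + 1)) 0 D).comp ((S.E (Fin.last (m + 1))).map A)))
      = (S.E 0).map ((S.E (Fin.last (m + 1))).map A) := by
    have e : ((S.E 0).map (S.swap 0 (Fin.last (m + 1)) D)).comp ((S.E 0).map
        ((S.swap (Fin.last (m + 1)) 0 D).comp ((S.E (Fin.last (m + 1))).map A)))
        = (S.E 0).map ((S.E (Fin.last (m + 1))).map A) := by
      rw [← WCorr.map_comp, hs]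
    exact (congrArg (fun f => HHom.comp f _) (S.move_fst hD)).trans e
  have hA : (S.mapFL A.adj).comp (S.mapFL A) = S.mapFL (A.adj.comp A) := by
    rw [← WCorr.map_comp, ← WCorr.map_comp]
  refine op_comp_op_eq_create hD h.mult₁ (h.multₙ hD) (h₀₁ := (S.E 0).map (B.comp B.adj))
    (h₁₀ := (S.E 0).map ((S.E (Fin.last (m + 1))).map (A.adj.comp A))) ?_ ?_ ?_ ?_ ?_
  · refine h.zero₁.adj.of_eq ?_
    rw [HHom.adj_comp, ← WCorr.map_adj]
    rfl
  · refine ((h.zero₁.map (S.E (Fin.last (m + 1)))).map (S.E 0)).of_eq ?_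
    refine (congrArg (HHom.comp ((S.E 0).map ((S.E (Fin.last (m + 1))).map ((S.E 0).map B))))
      hmove).trans ?_
    rw [WCorr.map_comp, WCorr.map_comp]
  · exact ((S.E 0).map_comp _ _).symm
  · refine (congrArg (HHom.comp ((S.E 0).map ((S.E (Fin.last (m + 1))).map A.adj)))
      hmove).trans ?_
    exact hA
  · have := congrArg (S.E 0).map h.oneₙ
    rw [WCorr.map_add, WCorr.map_id] at this
    exact this

/-- The parts of degrees `0`, `2` and `1` of the product are computed by `zeroₙ`, `zeroₙ` and
`one₁`. -/
theorem opₙ_comp_op₁ (hD : D.Normal) :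
    (h.multₙ hD).op.comp ((S.E (Fin.last (m + 1))).map h.mult₁.op)
      = (S.create [0, Fin.last (m + 1)] 0 D).comp (S.swap (Fin.last (m + 1)) 0 (S.fock D)) := by
  have e : ∀ {Y : HRep M} (f : HHom ((S.E (Fin.last (m + 1))).tens D) Y),
      (S.mapFL f).comp ((S.swap (Fin.last (m + 1)) 0 ((S.E (Fin.last (m + 1))).tens D)).comp
        ((S.E (Fin.last (m + 1))).map ((S.E 0).map B)))
      = (S.swap (Fin.last (m + 1)) 0 Y).comp
        ((S.E (Fin.last (m + 1))).map ((S.E 0).map (f.comp B))) := fun {Y} f => by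
    rw [← HHom.comp_assoc, ← S.swap_natural, HHom.comp_assoc, ← WCorr.map_comp, ← WCorr.map_comp]
  have hmove : ∀ {Y : HRep M} (f : HHom ((S.E (Fin.last (m + 1))).tens D) Y),
      (S.mapFL f).comp ((S.move [Fin.last (m + 1)] [0, Fin.last (m + 1)] D).comp
        ((S.E (Fin.last (m + 1))).map ((S.E 0).map B)))
      = (S.swap (Fin.last (m + 1)) 0 Y).comp ((S.E (Fin.last (m + 1))).map ((S.E 0).map
          (f.comp B))) := fun {Y} f =>
    (congrArg (fun g => HHom.comp (S.mapFL f)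
      (HHom.comp g ((S.E (Fin.last (m + 1))).map ((S.E 0).map B)))) (S.move_last hD)).trans (e f)
  refine op_comp_op_eq_create_swap hD (h.multₙ hD) h.mult₁
    (h₀₁ := (S.swap (Fin.last (m + 1)) 0 D).comp
      ((S.E (Fin.last (m + 1))).map (A.comp A.adj)))
    (h₁₀ := (S.swap (Fin.last (m + 1)) 0 D).comp
      ((S.E (Fin.last (m + 1))).map ((S.E 0).map (B.adj.comp B)))) ?_ ?_ ?_ ?_ ?_
  · refine h.zeroₙ.adj.of_eq ?_
    rw [HHom.adj_comp, ← WCorr.map_adj]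
    rfl
  · refine HHom.IsZero.of_eq ?_ (hmove ((S.swap (Fin.last (m + 1)) 0 D).comp
      ((S.E (Fin.last (m + 1))).map A)))
    refine HHom.IsZero.comp_left (HHom.IsZero.map (HHom.IsZero.map ?_ _) _) _
    rw [HHom.comp_assoc]
    exact h.zeroₙ.comp_left _
  · have : ((S.swap (Fin.last (m + 1)) 0 D).comp ((S.E (Fin.last (m + 1))).map A)).comp
        ((S.E (Fin.last (m + 1))).map A.adj) = (S.swap (Fin.last (m + 1)) 0 D).comp
          ((S.E (Fin.last (m + 1))).map (A.comp A.adj)) := by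
      rw [HHom.comp_assoc, ← WCorr.map_comp]
    exact this
  · exact hmove B.adj
  · have : (S.swap (Fin.last (m + 1)) 0 D).comp
        ((S.E (Fin.last (m + 1))).map (A.comp A.adj)) + (S.swap (Fin.last (m + 1)) 0 D).comp
        ((S.E (Fin.last (m + 1))).map ((S.E 0).map (B.adj.comp B)))
        = S.swap (Fin.last (m + 1)) 0 D := by
      rw [← HHom.comp_add, ← WCorr.map_add, h.one₁, WCorr.map_id, HHom.comp_id]
    exact this

end IsPair
end ProductSystem
end Pairs
/-! ### Unitary block operators -/

section Blocks
variable {M : Type u} [CStarAlgebra M] [PartialOrder M] [StarOrderedRing M]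
variable {X Y Z W D D' V V' : HRep M}

/-- Two isometries whose ranges are orthogonal complements of each other. -/
structure HHom.IsSplit (f : HHom X Z) (g : HHom Y Z) : Prop where
  left : f.adj.comp f = HHom.id X
  right : g.adj.comp g = HHom.id Y
  ortho : f.adj.comp g = 0
  total : f.comp f.adj + g.comp g.adj = HHom.id Z

namespace HHom.IsSplit
variable {f : HHom X Z} {g : HHom Y Z}

theorem ortho' (h : f.IsSplit g) : g.adj.comp f = 0 := by
  rw [← HHom.adj_adj (g.adj.comp f), HHom.adj_comp, HHom.adj_adj, h.ortho, HHom.adj_zero]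

theorem symm (h : f.IsSplit g) : g.IsSplit f :=
  ⟨h.right, h.left, h.ortho', (add_comm _ _).trans h.total⟩

theorem comp (h : f.IsSplit g) {U : HHom Z W} (hU : U.IsUnitary) :
    (U.comp f).IsSplit (U.comp g) where
  left := by rw [HHom.adj_comp, HHom.comp_assoc, hU.adj_comp_assoc, h.left]
  right := by rw [HHom.adj_comp, HHom.comp_assoc, hU.adj_comp_assoc, h.right]
  ortho := by rw [HHom.adj_comp, HHom.comp_assoc, hU.adj_comp_assoc, h.ortho]
  total := by
    rw [HHom.adj_comp, HHom.adj_comp, HHom.comp_assoc, HHom.comp_assoc, ← HHom.comp_assoc f,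
      ← HHom.comp_assoc g, ← HHom.comp_add, ← HHom.add_comp, h.total, HHom.id_comp, hU.comp_adj]

theorem map (h : f.IsSplit g) (E : WCorr M) : (E.map f).IsSplit (E.map g) where
  left := by rw [← E.map_adj, ← E.map_comp, h.left, E.map_id]
  right := by rw [← E.map_adj, ← E.map_comp, h.right, E.map_id]
  ortho := by rw [← E.map_adj, ← E.map_comp, h.ortho, E.map_zero]
  total := by
    rw [← E.map_adj, ← E.map_adj, ← E.map_comp, ← E.map_comp, ← E.map_add, h.total, E.map_id]

end HHom.IsSplit

open PreProductSystem in
/-- The unitarity of a block operator with a zero entry. -/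
theorem block_isUnitary {A : HHom D X} {B : HHom Y X} {C : HHom D D'}
    (h₁ : A.comp A.adj + B.comp B.adj = HHom.id X) (h₂ : C.comp C.adj = HHom.id D')
    (h₃ : A.comp C.adj = 0) (h₄ : A.adj.comp A + C.adj.comp C = HHom.id D)
    (h₅ : B.adj.comp B = HHom.id Y) (h₆ : A.adj.comp B = 0) :
    (block A B C).IsUnitary := by
  have h₃' : C.comp A.adj = 0 := by
    rw [← HHom.adj_adj (C.comp A.adj), HHom.adj_comp, HHom.adj_adj, h₃, HHom.adj_zero]
  have h₆' : B.adj.comp A = 0 := by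
    rw [← HHom.adj_adj (B.adj.comp A), HHom.adj_comp, HHom.adj_adj, h₆, HHom.adj_zero]
  have e : (block A B C).adj = (HHom.inl _ _).comp (A.adj.comp (HHom.fst _ _)
      + C.adj.comp (HHom.snd _ _)) + (HHom.inr _ _).comp (B.adj.comp (HHom.fst _ _)) := by
    simp only [block, HHom.adj_add, HHom.adj_comp, HHom.inl_adj, HHom.inr_adj, HHom.fst_adj,
      HHom.snd_adj, HHom.comp_add, HHom.comp_assoc]
    ext v
    simp only [HHom.add_apply]
    abel
  rw [HHom.isUnitary_iff, e]
  constructor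
  · refine HHom.ext fun v => HHom.plus_ext ?_ ?_
    · have a1 := HHom.congr_hom h₄ (HHom.fst _ _ v)
      have a2 := HHom.congr_hom h₆ (HHom.snd _ _ v)
      simp only [HHom.add_apply, HHom.comp_apply, HHom.id_apply, HHom.zero_apply] at a1 a2
      simp only [block, HHom.add_apply, HHom.comp_apply, map_add, HHom.fst_inl, HHom.fst_inr,
        HHom.snd_inl, HHom.snd_inr, map_zero, add_zero, zero_add, HHom.id_apply]
      rw [a2, add_zero, a1]
    · have a1 := HHom.congr_hom h₅ (HHom.snd _ _ v)
      have a2 := HHom.congr_hom h₆' (HHom.fst _ _ v)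
      simp only [HHom.comp_apply, HHom.id_apply, HHom.zero_apply] at a1 a2
      simp only [block, HHom.add_apply, HHom.comp_apply, map_add, HHom.fst_inl, HHom.fst_inr,
        HHom.snd_inl, HHom.snd_inr, map_zero, add_zero, zero_add, HHom.id_apply]
      rw [a2, zero_add, a1]
  · refine HHom.ext fun v => HHom.plus_ext ?_ ?_
    · have a1 := HHom.congr_hom h₁ (HHom.fst _ _ v)
      have a2 := HHom.congr_hom h₃ (HHom.snd _ _ v)
      simp only [HHom.add_apply, HHom.comp_apply, HHom.id_apply, HHom.zero_apply] at a1 a2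
      simp only [block, HHom.add_apply, HHom.comp_apply, map_add, HHom.fst_inl, HHom.fst_inr,
        HHom.snd_inl, HHom.snd_inr, map_zero, add_zero, zero_add, HHom.id_apply]
      rw [a2, add_zero, a1]
    · have a1 := HHom.congr_hom h₂ (HHom.snd _ _ v)
      have a2 := HHom.congr_hom h₃' (HHom.fst _ _ v)
      simp only [HHom.comp_apply, HHom.id_apply, HHom.zero_apply] at a1 a2
      simp only [block, HHom.add_apply, HHom.comp_apply, map_add, HHom.fst_inl, HHom.fst_inr,
        HHom.snd_inl, HHom.snd_inr, map_zero, add_zero, zero_add, HHom.id_apply]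
      rw [a2, zero_add, a1]

section Split
variable {E F : WCorr M} {i : HHom V D} {w : HHom (F.tens V') D} {k : HHom (E.tens V) D}
  {c : HHom V' D}

/-- For the isometries of two decompositions `D = i V ⊕ w (F ⊗ V')` and `D = k (E ⊗ V) ⊕ c V'`, the
relations between the operators `A = (I ⊗ i) k*` and `B = (I ⊗ c) w*`. -/
theorem split_relations (h : i.IsSplit w) (h' : k.IsSplit c) :
    ((E.map ((F.map c).comp w.adj)).comp ((E.map i).comp k.adj)).IsZero ∧
    ((F.map ((E.map i).comp k.adj)).comp ((F.map c).comp w.adj)).IsZero ∧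
    ((E.map i).comp k.adj).comp ((E.map i).comp k.adj).adj
      + E.map (((F.map c).comp w.adj).adj.comp ((F.map c).comp w.adj)) = HHom.id _ ∧
    ((F.map c).comp w.adj).comp ((F.map c).comp w.adj).adj
      + F.map (((E.map i).comp k.adj).adj.comp ((E.map i).comp k.adj)) = HHom.id _ ∧
    ((F.map c).comp w.adj).adj.comp ((F.map c).comp w.adj) = w.comp w.adj ∧
    ((E.map i).comp k.adj).adj.comp ((E.map i).comp k.adj) = k.comp k.adj := by
  have z1 : w.adj.comp i = 0 := h.ortho'
  have z2 : k.adj.comp c = 0 := h'.ortho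
  have hB : ((F.map c).comp w.adj).adj.comp ((F.map c).comp w.adj) = w.comp w.adj := by
    rw [HHom.adj_comp, HHom.adj_adj, HHom.comp_assoc, ← HHom.comp_assoc (F.map c).adj,
      (h'.map F).right, HHom.id_comp]
  have hA : ((E.map i).comp k.adj).adj.comp ((E.map i).comp k.adj) = k.comp k.adj := by
    rw [HHom.adj_comp, HHom.adj_adj, HHom.comp_assoc, ← HHom.comp_assoc (E.map i).adj,
      (h.map E).left, HHom.id_comp]
  refine ⟨?_, ?_, ?_, ?_, hB, hA⟩
  · rw [← HHom.comp_assoc, ← WCorr.map_comp, HHom.comp_assoc, z1, HHom.comp_zero, E.map_zero,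
      HHom.zero_comp]
    rfl
  · rw [← HHom.comp_assoc, ← WCorr.map_comp, HHom.comp_assoc, z2, HHom.comp_zero, F.map_zero,
      HHom.zero_comp]
    rfl
  · rw [hB, HHom.adj_comp, HHom.adj_adj, HHom.comp_assoc, ← HHom.comp_assoc k.adj, h'.left,
      HHom.id_comp, ← WCorr.map_adj, ← WCorr.map_comp, ← WCorr.map_add, h.total, E.map_id]
  · rw [hA, HHom.adj_comp, HHom.adj_adj, HHom.comp_assoc, ← HHom.comp_assoc w.adj, h.right,
      HHom.id_comp, ← WCorr.map_adj, ← WCorr.map_comp, ← WCorr.map_add, add_comm, h'.total, F.map_id]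

end Split

/-- Two orthogonal decompositions `D = i V ⊕ w (Eₙ ⊗ V')` and `D = k (E₁ ⊗ V) ⊕ c V'` produce a
pair. -/
theorem ProductSystem.isPair_of_split {m : ℕ} {S : ProductSystem M (m + 2)} {i : HHom V D}
    {w : HHom ((S.E (Fin.last (m + 1))).tens V') D} {k : HHom ((S.E 0).tens V) D} {c : HHom V' D}
    (h : i.IsSplit w) (h' : k.IsSplit c) :
    S.IsPair (((S.E 0).map i).comp k.adj) (((S.E (Fin.last (m + 1))).map c).comp w.adj) :=
  have hr := split_relations (E := S.E 0) (F := S.E (Fin.last (m + 1))) h h'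
  ⟨hr.1, hr.2.1, hr.2.2.1, hr.2.2.2.1⟩

namespace PreProductSystem.DilationData
variable {m : ℕ} {S : ProductSystem M (m + 2)} {H : HRep M}
  {T : ∀ i, S.E i →ₗ[ℂ] (H →L[ℂ] H)} (d : S.DilationData T)

/-- The isometry `Eₙ ⊗ 𝒟' → 𝒟_{T̂₁} ⊕ (Eₙ ⊗ 𝒟_{T̂ₙ}) ⊕ ℰ₂` onto the last two summands. -/
noncomputable def tailIncl : HHom ((S.E (Fin.last (m + 1))).tens d.D')
    (d.D₁.plus (((S.E (Fin.last (m + 1))).tens d.Dₙ).plus d.ℰ₂)) :=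
  (HHom.inr _ _).comp
    ((HHom.inl _ _).comp ((S.E (Fin.last (m + 1))).map (HHom.fst _ _)) +
      (HHom.inr _ _).comp (d.u₂.adj.comp ((S.E (Fin.last (m + 1))).map (HHom.snd _ _))))

/-- The inclusion of `E₁ ⊗ 𝒟_{T̂₁}` into `𝒟`. -/
noncomputable def midIncl : HHom ((S.E 0).tens d.D₁) d.D := (HHom.inr _ _).comp (HHom.inl _ _)

theorem midIncl_adj : d.midIncl.adj = (HHom.fst _ _).comp (HHom.snd _ _) := by
  rw [midIncl, HHom.adj_comp, HHom.inl_adj, HHom.inr_adj]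

theorem C₁_adj : d.C₁.adj = (HHom.inl _ _).comp (HHom.fst _ _)
    + (HHom.inr _ _).comp ((HHom.inr _ _).comp (HHom.snd _ _)) := by
  simp [C₁, HHom.adj_add, HHom.adj_comp, HHom.comp_assoc]

/-- The first decomposition, `𝒟 = (E₁ ⊗ 𝒟₁) ⊕ 𝒟'`. -/
theorem split_mid : d.midIncl.IsSplit d.C₁.adj := by
  rw [C₁_adj]
  constructor
  · rw [midIncl_adj]; rfl
  · rw [← C₁_adj, HHom.adj_adj, C₁_adj]
    refine HHom.ext fun v => HHom.plus_ext ?_ ?_ <;> simp [C₁]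
  · rw [midIncl_adj]
    refine HHom.ext fun v => ?_
    simp
  · rw [midIncl_adj, ← C₁_adj, HHom.adj_adj, C₁_adj]
    refine HHom.ext fun v => HHom.plus_ext ?_ (HHom.plus_ext ?_ ?_) <;> simp [C₁, midIncl]

theorem tailIncl_adj : d.tailIncl.adj
    = (((S.E (Fin.last (m + 1))).map (HHom.inl _ _)).comp (HHom.fst _ _)
      + ((S.E (Fin.last (m + 1))).map (HHom.inr _ _)).comp (d.u₂.comp (HHom.snd _ _))).comp
        (HHom.snd _ _) := by
  simp only [tailIncl, HHom.adj_add, HHom.adj_comp, ← WCorr.map_adj, HHom.adj_adj, HHom.inl_adj,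
    HHom.inr_adj, HHom.fst_adj, HHom.snd_adj, HHom.comp_assoc]

theorem split_tail : (HHom.inl d.D₁ _).IsSplit d.tailIncl := by
  have hu := d.u₂_unitary
  have m0 : ∀ {A B C : HRep M} (f : HHom A B) (g : HHom B C) x,
      (S.E (Fin.last (m + 1))).map g ((S.E (Fin.last (m + 1))).map f x)
        = (S.E (Fin.last (m + 1))).map (g.comp f) x := fun f g x =>
    HHom.congr_hom ((S.E (Fin.last (m + 1))).map_comp g f).symm x
  have hu1 : ∀ x, d.u₂.adj (d.u₂ x) = x := fun x => HHom.congr_hom hu.adj_comp x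
  have hu2 : ∀ x, d.u₂ (d.u₂.adj x) = x := fun x => HHom.congr_hom hu.comp_adj x
  constructor
  · rw [HHom.inl_adj, HHom.fst_comp_inl]
  · rw [tailIncl_adj]
    have key := congrArg (S.E (Fin.last (m + 1))).map (HHom.inl_fst_add_inr_snd (X := d.Dₙ) (Y := d.ℰ₁))
    rw [WCorr.map_add, WCorr.map_comp, WCorr.map_comp, WCorr.map_id] at key
    refine Eq.trans (HHom.ext fun v => ?_) key
    simp [tailIncl, hu2]
  · rw [HHom.inl_adj]
    refine HHom.ext fun v => ?_
    simp [tailIncl]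
  · rw [tailIncl_adj, HHom.inl_adj]
    refine HHom.ext fun v => HHom.plus_ext ?_ (HHom.plus_ext ?_ ?_) <;>
      simp [tailIncl, m0, hu1]

theorem A₁_eq : d.A₁ = ((S.E 0).map (d.U.comp (HHom.inl _ _))).comp d.midIncl.adj := by
  rw [midIncl_adj, A₁, WCorr.map_comp, HHom.comp_assoc]

theorem B₁_eq : d.B₁ = (S.E 0).map (d.U.comp d.tailIncl) := rfl

theorem Aₙ_eq : d.Aₙ = ((S.E (Fin.last (m + 1))).map d.C₁.adj).comp (d.U.comp d.tailIncl).adj := by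
  have e1 : d.C₁.adj.comp (HHom.inl _ _) = HHom.inl _ _ := by
    rw [C₁_adj]; refine HHom.ext fun v => ?_; simp
  have e2 : d.C₁.adj.comp (HHom.inr _ _) = (HHom.inr _ _).comp (HHom.inr _ _) := by
    rw [C₁_adj]; refine HHom.ext fun v => ?_; simp
  have f1 : ((S.E (Fin.last (m + 1))).map d.C₁.adj).comp
      ((S.E (Fin.last (m + 1))).map (HHom.inl _ _)) = (S.E (Fin.last (m + 1))).map (HHom.inl _ _) := by
    rw [← WCorr.map_comp, e1]
  have f2 : ((S.E (Fin.last (m + 1))).map d.C₁.adj).comp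
      ((S.E (Fin.last (m + 1))).map (HHom.inr _ _))
        = (S.E (Fin.last (m + 1))).map ((HHom.inr _ _).comp (HHom.inr _ _)) := by
    rw [← WCorr.map_comp, e2]
  rw [Aₙ, HHom.adj_comp]
  refine Eq.trans (congrArg (fun f => HHom.comp f d.U.adj) ?_) (HHom.comp_assoc _ _ _)
  rw [tailIncl_adj, ← f1, ← f2]
  refine HHom.ext fun v => ?_
  simp only [HHom.comp_apply, HHom.add_apply, map_add]

theorem Bₙ_eq : d.Bₙ = ((S.E (Fin.last (m + 1))).map d.midIncl).comp
    (S.swap 0 (Fin.last (m + 1)) d.D₁) := rfl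

theorem Cₙ_eq : d.Cₙ = (d.U.comp (HHom.inl _ _)).adj := by
  rw [Cₙ, HHom.adj_comp, HHom.inl_adj]

/-- The second decomposition, `𝒟 = U 𝒟₁ ⊕ U (Eₙ ⊗ 𝒟')`. -/
theorem split_U : (d.U.comp (HHom.inl _ _)).IsSplit (d.U.comp d.tailIncl) :=
  d.split_tail.comp d.U_unitary

theorem isPair : S.IsPair d.A₁ d.Aₙ := by
  rw [A₁_eq, Aₙ_eq]
  exact ProductSystem.isPair_of_split d.split_U d.split_mid

theorem A₁_adj_comp : d.A₁.adj.comp d.A₁ = d.midIncl.comp d.midIncl.adj := by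
  rw [A₁_eq]
  exact (split_relations (F := S.E (Fin.last (m + 1))) d.split_U d.split_mid).2.2.2.2.2

theorem Aₙ_adj_comp : d.Aₙ.adj.comp d.Aₙ = (d.U.comp d.tailIncl).comp (d.U.comp d.tailIncl).adj := by
  rw [Aₙ_eq]
  exact (split_relations (E := S.E 0) d.split_U d.split_mid).2.2.2.2.1

theorem gen_normal {X : HRep M} (h : IsInfiniteGenerator X) : X.Normal := by
  obtain ⟨Y, κ, J, hY, -, -, hJ, -, hd⟩ := h
  exact HRep.normal_of_family (fun _ => hY) J hJ hd

theorem rangeClosure_normal (hH : H.Normal) (f : HHom H H) : f.rangeClosure.Normal :=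
  hH.of_isometry f.ofClosure_isIsometry

theorem D_normal (hH : H.Normal) : d.D.Normal :=
  HHom.plus_normal (rangeClosure_normal hH _)
    (HHom.plus_normal (WCorr.tens_normal _ (rangeClosure_normal hH _)) (gen_normal d.ℰ₁_gen))

theorem U₁_isUnitary : d.U₁.IsUnitary := by
  have h := d.isPair.one₁
  refine block_isUnitary ?_ ?_ ?_ ?_ ?_ ?_
  · rw [B₁_eq, ← WCorr.map_adj, ← WCorr.map_comp, ← Aₙ_adj_comp]; exact h
  · have := d.split_mid.right
    rwa [HHom.adj_adj] at this
  · rw [A₁_eq, HHom.comp_assoc, d.split_mid.ortho, HHom.comp_zero]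
  · have := d.split_mid.total
    rw [HHom.adj_adj] at this
    rw [A₁_adj_comp, this]
  · rw [B₁_eq]; exact (d.split_U.map (S.E 0)).right
  · rw [A₁_eq, B₁_eq, HHom.adj_comp, HHom.comp_assoc, (d.split_U.map (S.E 0)).ortho, HHom.comp_zero]

theorem Uₙ_isUnitary (hH : H.Normal) : d.Uₙ.IsUnitary := by
  have h := d.isPair.oneₙ
  have hs := d.split_U.symm.total
  have hm := d.split_mid.map (S.E (Fin.last (m + 1)))
  have hsw := S.swap_isUnitary 0 (Fin.last (m + 1)) (rangeClosure_normal hH (S.defFst T))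
  refine block_isUnitary ?_ ?_ ?_ ?_ ?_ ?_
  · rw [Bₙ_eq, HHom.adj_comp, HHom.comp_assoc, hsw.comp_adj_assoc, ← WCorr.map_adj,
      ← WCorr.map_comp, ← A₁_adj_comp]
    exact h
  · rw [Cₙ_eq, HHom.adj_adj]; exact d.split_U.left
  · rw [Aₙ_eq, Cₙ_eq, HHom.adj_adj, HHom.comp_assoc, d.split_U.ortho', HHom.comp_zero]
  · rw [Aₙ_adj_comp, Cₙ_eq, HHom.adj_adj]
    exact hs
  · rw [Bₙ_eq, HHom.adj_comp, HHom.comp_assoc, ← HHom.comp_assoc _ _ (S.swap _ _ _), hm.left,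
      HHom.id_comp, hsw.adj_comp]
  · rw [Aₙ_eq, Bₙ_eq, HHom.adj_comp, HHom.comp_assoc, ← HHom.comp_assoc _ _ (S.swap _ _ _),
      hm.ortho', HHom.zero_comp, HHom.comp_zero]

theorem τ₁_eq (hH : H.Normal) : d.τ₁ = d.isPair.mult₁.op := by
  refine S.transfer_eq_op (d.D_normal hH) 0 d.A₁ d.B₁ d.C₁ ?_ _ _
  rw [B₁_eq, ← WCorr.map_adj, ← WCorr.map_comp, ← Aₙ_eq]

theorem τₙ_eq (hH : H.Normal) : d.τₙ = (d.isPair.multₙ (d.D_normal hH)).op := by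
  refine S.transfer_eq_op (d.D_normal hH) (Fin.last (m + 1)) d.Aₙ d.Bₙ d.Cₙ ?_ _ _
  rw [Bₙ_eq, HHom.adj_comp, S.swap_adj, Cₙ_eq, HHom.adj_adj, ← WCorr.map_adj, ← HHom.comp_assoc,
    ← S.swap_natural, HHom.comp_assoc, ← WCorr.map_comp, ← A₁_eq]

end PreProductSystem.DilationData
end Blocks
/-! ### Gram matrices and row contractions -/

section Tilde
variable {M : Type u} [CStarAlgebra M] [PartialOrder M] [StarOrderedRing M]

/-- The form of a matrix with entries of the form `Z* Z`. -/
theorem sum_inner_star_mul {N : Type*} [CStarAlgebra N] {H : Type*} [NormedAddCommGroup H]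
    [InnerProductSpace ℂ H] [CompleteSpace H] (π : N →⋆ₐ[ℂ] (H →L[ℂ] H)) {k : ℕ}
    (Z : CStarMatrix (Fin k) (Fin k) N) (x : Fin k → H) :
    ∑ i, ∑ j, (inner ℂ (x i) (π ((star Z * Z) i j) (x j)) : ℂ)
      = ∑ l, ((‖∑ j, π (Z l j) (x j)‖ ^ 2 : ℝ) : ℂ) := by
  have h1 : ∀ l, ((‖∑ j, π (Z l j) (x j)‖ ^ 2 : ℝ) : ℂ)
      = ∑ i, ∑ j, (inner ℂ (x i) (π (star (Z l i) * Z l j) (x j)) : ℂ) := fun l => by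
    have h0 : ((‖∑ j, π (Z l j) (x j)‖ ^ 2 : ℝ) : ℂ)
        = inner ℂ (∑ j, π (Z l j) (x j)) (∑ j, π (Z l j) (x j)) := by
      rw [inner_self_eq_norm_sq_to_K]; push_cast; rfl
    rw [h0, sum_inner]
    refine Finset.sum_congr rfl fun i _ => ?_
    rw [inner_sum]
    refine Finset.sum_congr rfl fun j _ => ?_
    rw [map_mul, map_star, ContinuousLinearMap.star_eq_adjoint, mul_apply_eq_comp,
      ContinuousLinearMap.adjoint_inner_right]
  have h2 : ∀ i j, (inner ℂ (x i) (π ((star Z * Z) i j) (x j)) : ℂ)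
      = ∑ l, (inner ℂ (x i) (π (star (Z l i) * Z l j) (x j)) : ℂ) := fun i j => by
    rw [CStarMatrix.mul_apply, map_sum, sum_apply, inner_sum]
    rfl
  simp only [h1, h2]
  rw [Finset.sum_congr rfl fun i _ => Finset.sum_comm (s := Finset.univ) (t := Finset.univ)
    (f := fun j l => (inner ℂ (x i) (π (star (Z l i) * Z l j) (x j)) : ℂ)), Finset.sum_comm]

/-- A matrix of operators acts boundedly on the direct sum of copies of the space; its norm is the
norm of the `C*`-algebra of matrices. -/
theorem matrix_apply_norm_le {H : Type*} [NormedAddCommGroup H] [InnerProductSpace ℂ H]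
    [CompleteSpace H] {k : ℕ} (Z : CStarMatrix (Fin k) (Fin k) (H →L[ℂ] H)) (x : Fin k → H) :
    ∑ l, ‖∑ j, Z l j (x j)‖ ^ 2 ≤ ‖Z‖ ^ 2 * ∑ j, ‖x j‖ ^ 2 := by
  obtain ⟨Q, hQ⟩ := exists_eq_star_mul
    (sub_nonneg.mpr (CStarAlgebra.star_mul_le_algebraMap_norm_sq (a := Z)))
  have h1 := sum_inner_star_mul (StarAlgHom.id ℂ (H →L[ℂ] H)) Q x
  have h2 := sum_inner_star_mul (StarAlgHom.id ℂ (H →L[ℂ] H)) Z x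
  simp only [StarAlgHom.coe_id, id_eq] at h1 h2
  have h3 : ∑ i, ∑ j, (inner ℂ (x i) ((star Q * Q) i j (x j)) : ℂ)
      = ((‖Z‖ ^ 2 * ∑ j, ‖x j‖ ^ 2 : ℝ) : ℂ)
        - ∑ i, ∑ j, (inner ℂ (x i) ((star Z * Z) i j (x j)) : ℂ) := by
    have e : ∀ i j, (star Q * Q) i j = (if i = j then algebraMap ℝ (H →L[ℂ] H) (‖Z‖ ^ 2) else 0)
        - (star Z * Z) i j := fun i j => by
      rw [← hQ]
      change (algebraMap ℝ (CStarMatrix (Fin k) (Fin k) (H →L[ℂ] H)) (‖Z‖ ^ 2)) i j - _ = _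
      congr 1
    simp only [e, sub_apply, inner_sub_right, Finset.sum_sub_distrib]
    congr 1
    rw [Finset.mul_sum, Complex.ofReal_sum]
    refine Finset.sum_congr rfl fun i _ => ?_
    rw [Finset.sum_eq_single i]
    · rw [if_pos rfl, Algebra.algebraMap_eq_smul_one, smul_apply,
        one_apply_eq_self, ← Complex.coe_smul, inner_smul_right, inner_self_eq_norm_sq_to_K]
      push_cast; rfl
    · intro j _ hj
      rw [if_neg hj.symm]; simp
    · simp
  rw [h1, h2] at h3
  have h4 : (0 : ℝ) ≤ ∑ l, ‖∑ j, Q l j (x j)‖ ^ 2 := Finset.sum_nonneg fun _ _ => sq_nonneg _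
  have h5 : ∑ l, ‖∑ j, Q l j (x j)‖ ^ 2
      = ‖Z‖ ^ 2 * ∑ j, ‖x j‖ ^ 2 - ∑ l, ‖∑ j, Z l j (x j)‖ ^ 2 := by
    exact_mod_cast h3
  linarith

variable {E : WCorr M} {H : HRep M} {T : E →ₗ[ℂ] (H →L[ℂ] H)}

theorem WCorr.ip_ract_left (x y : E) (a : M) : E.ip (E.ract x a) y = star a * E.ip x y := by
  rw [← E.star_ip, E.ip_ract, star_mul, E.star_ip]

/-- A matrix with a single row, the first one. -/
theorem norm_row_sq_le (hT : IsCCRep E H T) {k : ℕ} (η : Fin (k + 1) → E) :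
    ‖(CStarMatrix.ofMatrix (fun i j => T (if i = 0 then η j else 0)) :
        CStarMatrix (Fin (k + 1)) (Fin (k + 1)) (H →L[ℂ] H))‖ ^ 2
      ≤ ‖(CStarMatrix.ofMatrix (fun i j => E.ip (η i) (η j)) :
          CStarMatrix (Fin (k + 1)) (Fin (k + 1)) M)‖ := by
  have h2 : (fun i j => E.ip (η i) (η j)) = fun i j => ∑ l : Fin (k + 1),
      E.ip ((fun l j => if l = 0 then η j else 0 : Fin (k + 1) → Fin (k + 1) → E) l i)
        ((fun l j => if l = 0 then η j else 0 : Fin (k + 1) → Fin (k + 1) → E) l j) := by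
    funext i j
    rw [Finset.sum_eq_single 0]
    · simp
    · intro l _ hl
      simp [hl]
    · simp
  rw [h2]
  exact hT.completely_contractive (k + 1) (fun l j => if l = 0 then η j else 0)

/-- The row of the operators `T(η_j)` is a contraction if the Gram matrix of the `η_j` is. -/
theorem IsCCRep.row_le (hT : IsCCRep E H T) {k : ℕ} (η : Fin k → E)
    (hη : ‖(CStarMatrix.ofMatrix (fun i j => E.ip (η i) (η j)) : CStarMatrix (Fin k) (Fin k) M)‖ ≤ 1)
    (x : Fin k → H) : ‖∑ j, T (η j) (x j)‖ ^ 2 ≤ ∑ j, ‖x j‖ ^ 2 := by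
  rcases k with _ | k
  · simp
  have h1 := (norm_row_sq_le hT η).trans hη
  generalize hZ : (CStarMatrix.ofMatrix (fun i j => T (if i = 0 then η j else 0)) :
        CStarMatrix (Fin (k + 1)) (Fin (k + 1)) (H →L[ℂ] H)) = Z at h1
  have h3 := matrix_apply_norm_le Z x
  have h0 : ∀ j, Z 0 j = T (η j) := fun j => by rw [← hZ]; rfl
  have h4 : ‖∑ j, Z 0 j (x j)‖ ^ 2 ≤ ∑ l, ‖∑ j, Z l j (x j)‖ ^ 2 :=
    Finset.single_le_sum (f := fun l => ‖∑ j, Z l j (x j)‖ ^ 2)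
      (fun _ _ => sq_nonneg _) (Finset.mem_univ 0)
  simp only [h0] at h4
  exact h4.trans (h3.trans (mul_le_of_le_one_left (Finset.sum_nonneg fun _ _ => sq_nonneg _) h1))

/-- A positive element is normalized by the inverse of the root of a small perturbation. -/
theorem exists_normalizer {A : Type*} [CStarAlgebra A] [PartialOrder A] [StarOrderedRing A]
    {G : A} (hG : 0 ≤ G) {ε : ℝ} (hε : 0 < ε) :
    ∃ b c : A, star c = c ∧ c * c = G + algebraMap ℝ A ε ∧ b * c = 1 ∧ ‖star b * G * b‖ ≤ 1 := by
  have hε0 : (0 : A) ≤ algebraMap ℝ _ ε := algebraMap_nonneg _ hε.le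
  have hGε : 0 ≤ G + algebraMap ℝ A ε := add_nonneg hG hε0
  have hu : IsUnit (G + algebraMap ℝ A ε) := CStarAlgebra.isUnit_of_le (algebraMap ℝ _ ε)
    (le_add_of_nonneg_left hG) ⟨hε0, (isUnit_iff_ne_zero.mpr hε.ne').map (algebraMap ℝ _)⟩
  set c := CFC.sqrt (G + algebraMap ℝ A ε)
  have hcc : c * c = G + algebraMap ℝ A ε := CFC.sqrt_mul_sqrt_self _
  have hcs : star c = c := (CFC.sqrt_nonneg (G + algebraMap ℝ A ε)).isSelfAdjoint
  obtain ⟨b, hcb, hbc⟩ : ∃ b, c * b = 1 ∧ b * c = 1 :=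
    isUnit_iff_exists.mp ((CFC.isUnit_sqrt_iff _).mpr hu)
  have hbG : star b * G * b ≤ 1 := by
    have h1 : G ≤ G + algebraMap ℝ A ε := le_add_of_nonneg_right hε0
    refine (star_left_conjugate_le_conjugate h1 b).trans (le_of_eq ?_)
    rw [← hcc, mul_assoc, mul_assoc, hcb, mul_one, ← hcs, ← star_mul, hcb, star_one]
  exact ⟨b, c, hcs, hcc, hbc, (CStarAlgebra.norm_le_one_iff_of_nonneg (star b * G * b)
    (star_left_conjugate_nonneg hG b)).mpr hbG⟩

/-- Complete contractivity implies that `T̃` is a contraction: if the `ξ j` are normalized so that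
their Gram matrix is at most `1`, then the row of the `T (ξ j)` is a contraction. -/
theorem IsCCRep.norm_sum_sq_le (hT : IsCCRep E H T) {k : ℕ} (ξ : Fin k → E) (x : Fin k → H) :
    ‖∑ j, T (ξ j) (x j)‖ ^ 2 ≤ ‖E.toPre H (∑ j, ξ j ⊗ₜ x j)‖ ^ 2 := by
  set G : CStarMatrix (Fin k) (Fin k) M := CStarMatrix.ofMatrix (fun i j => E.ip (ξ i) (ξ j))
  obtain ⟨B, hB⟩ := E.gram_nonneg ξ
  have hG : G = star B * B := by
    ext i j
    change E.ip (ξ i) (ξ j) = _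
    rw [hB, CStarMatrix.mul_apply]; rfl
  have hG0 : 0 ≤ G := hG ▸ star_mul_self_nonneg B
  have hn : ‖E.toPre H (∑ j, ξ j ⊗ₜ x j)‖ ^ 2
      = (∑ i, ∑ j, (inner ℂ (x i) (H.act (G i j) (x j)) : ℂ)).re := by
    have e1 : E.tform H (∑ i, ξ i ⊗ₜ x i) = ∑ i, E.tform H (ξ i ⊗ₜ x i) := map_sum _ _ _
    rw [WCorr.pre_norm_sq, e1, LinearMap.sum_apply]
    congr 1
    refine Finset.sum_congr rfl fun i _ => ?_
    rw [map_sum]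
    rfl
  refine le_of_forall_pos_le_add fun δ hδ => ?_
  -- the square root of `G + ε` is invertible; the inverse normalizes the `ξ j`
  set s := ∑ j, ‖x j‖ ^ 2 with hs
  have hs0 : 0 ≤ s := Finset.sum_nonneg fun _ _ => sq_nonneg _
  set ε : ℝ := δ / (s + 1)
  have hε : 0 < ε := div_pos hδ (by linarith)
  obtain ⟨b, c, hcs, hcc, hbc, hb1⟩ := exists_normalizer hG0 hε
  set η : Fin k → E := fun l => ∑ i, E.ract (ξ i) (b i l)
  set y : Fin k → H := fun l => ∑ i, H.act (c l i) (x i)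
  have hgram : (CStarMatrix.ofMatrix (fun i j => E.ip (η i) (η j)) :
      CStarMatrix (Fin k) (Fin k) M) = star b * G * b := by
    ext i j
    rw [CStarMatrix.mul_apply]
    simp only [CStarMatrix.mul_apply, Finset.sum_mul]
    change E.ip (∑ p, E.ract (ξ p) (b p i)) (∑ q, E.ract (ξ q) (b q j)) = _
    simp only [map_sum, LinearMap.sum_apply, E.ip_ract, WCorr.ip_ract_left]
    rfl
  have hrow := hT.row_le η (hgram ▸ hb1) y
  have hx : ∀ j, ∑ l, H.act (b j l) (y l) = x j := fun j => by
    have e : ∀ i, ∑ l, b j l * c l i = if j = i then 1 else 0 := fun i => by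
      have := congrFun (congrFun (congrArg CStarMatrix.ofMatrix.symm hbc) j) i
      exact this
    simp only [y, map_sum, ← mul_apply_eq_comp, ← map_mul]
    rw [Finset.sum_comm]
    simp only [← sum_apply, ← map_sum, e]
    rw [Finset.sum_eq_single j]
    · simp
    · intro i _ hi; rw [if_neg hi.symm]; simp
    · simp
  have hsum : ∑ j, T (ξ j) (x j) = ∑ l, T (η l) (y l) := by
    have e : ∀ j, T (ξ j) (x j) = ∑ l, T (E.ract (ξ j) (b j l)) (y l) := fun j => by
      conv_lhs => rw [← hx j, map_sum]
      refine Finset.sum_congr rfl fun l _ => ?_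
      rw [hT.map_ract]; rfl
    simp only [e, η, map_sum, sum_apply]
    rw [Finset.sum_comm]
  have hy : ∑ l, ‖y l‖ ^ 2 = ‖E.toPre H (∑ j, ξ j ⊗ₜ x j)‖ ^ 2 + ε * s := by
    have e1 := sum_inner_star_mul H.act c x
    have e2 : ∀ i j, (star c * c) i j = G i j + if i = j then algebraMap ℝ M ε else 0 := by
      intro i j
      rw [hcs, hcc]
      change G i j + (algebraMap ℝ (CStarMatrix (Fin k) (Fin k) M) ε) i j = _
      congr 1
    have e3 : ∑ i, ∑ j, (inner ℂ (x i) (H.act (if i = j then algebraMap ℝ M ε else 0) (x j)) : ℂ)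
        = ((ε * s : ℝ) : ℂ) := by
      rw [hs, Finset.mul_sum]
      push_cast
      refine Finset.sum_congr rfl fun i _ => ?_
      rw [Finset.sum_eq_single i]
      · have : algebraMap ℝ M ε = algebraMap ℂ M (ε : ℂ) := by
          rw [Algebra.algebraMap_eq_smul_one, Algebra.algebraMap_eq_smul_one, Complex.coe_smul]
        rw [if_pos rfl, this, AlgHomClass.commutes, Algebra.algebraMap_eq_smul_one, smul_apply,
          one_apply_eq_self, inner_smul_right, inner_self_eq_norm_sq_to_K]
        rfl
      · intro j _ hj
        rw [if_neg hj.symm]; simp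
      · simp
    simp only [e2, map_add, add_apply, inner_add_right, Finset.sum_add_distrib] at e1
    rw [e3] at e1
    have e4 := congrArg Complex.re e1
    rw [Complex.add_re, ← hn, Complex.re_sum, Complex.ofReal_re] at e4
    simp only [Complex.ofReal_re] at e4
    exact e4.symm
  rw [hsum]
  refine hrow.trans ?_
  rw [hy]
  have : ε * s ≤ δ := by
    rw [div_mul_eq_mul_div, div_le_iff₀ (by linarith)]
    nlinarith
  linarith

end Tilde
/-! ### Completely contractive representations and their operators on tensor products -/

section TildeExists
variable {M : Type u} [CStarAlgebra M] [PartialOrder M] [StarOrderedRing M]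
variable {E : WCorr M} {H : HRep M} {T : E →ₗ[ℂ] (H →L[ℂ] H)}

/-- The operator `T̃` exists, so that `tilde T` is not a junk value. -/
theorem IsCCRep.exists_tilde (hT : IsCCRep E H T) :
    ∃ S : HHom (E.tens H) H, (∀ ξ x, S (WCorr.tmul ξ x) = T ξ x) ∧ ‖S.toCLM‖ ≤ 1 := by
  let f : E ⊗[ℂ] H →ₗ[ℂ] H := TensorProduct.lift (LinearMap.mk₂ ℂ (fun ξ x => T ξ x)
    (by intro a b c; simp) (by intro a b c; simp) (by intro a b c; simp) (by intro a b c; simp))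
  have hf : ∀ u, ‖f u‖ ≤ 1 * ‖E.toPre H u‖ := fun u => by
    obtain ⟨k, ξ, x, rfl⟩ := WCorr.exists_sum u
    rw [one_mul]
    refine le_of_sq_le_sq ?_ (norm_nonneg _)
    have : f (∑ i, ξ i ⊗ₜ x i) = ∑ i, T (ξ i) (x i) := map_sum f _ _
    rw [this]
    exact hT.norm_sum_sq_le ξ x
  let g : WCorr.PreTensor E H →L[ℂ] H := LinearMap.mkContinuous (E := WCorr.PreTensor E H)
    (F := H) (σ := RingHom.id ℂ)
      { toFun := fun u => f u
        map_add' := fun u v => f.map_add u v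
        map_smul' := fun c u => f.map_smul c u } 1 hf
  let F : E.tens H →L[ℂ] H := ContinuousLinearMap.fromCompletion g
  have hF : ∀ ξ x, F (WCorr.tmul ξ x) = T ξ x := fun ξ x =>
    (ContinuousLinearMap.fromCompletion_apply_coe _ _)
  have hn : ‖F‖ ≤ 1 := by
    refine F.opNorm_le_bound zero_le_one fun v => ?_
    induction v using UniformSpace.Completion.induction_on with
    | hp => exact isClosed_le (F.continuous.norm) (continuous_const.mul continuous_norm)
    | ih a =>
      have e : F (a : WCorr.TCarrier E H) = f a := ContinuousLinearMap.fromCompletion_apply_coe _ _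
      have e' : ‖((a : WCorr.TCarrier E H) : E.tens H)‖ = ‖E.toPre H a‖ :=
        UniformSpace.Completion.norm_coe _
      refine (le_of_eq (congrArg norm e)).trans (le_of_le_of_eq ?_ (congrArg (1 * ·) e').symm)
      exact hf a
  refine ⟨⟨F, fun a v => ?_⟩, hF, hn⟩
  have : F.comp ((E.tens H).act a) = (H.act a).comp F := by
    refine WCorr.tens_ext fun ξ x => ?_
    rw [ContinuousLinearMap.comp_apply, ContinuousLinearMap.comp_apply, WCorr.act_tmul, hF, hF,
      hT.map_lact]
    rfl
  exact DFunLike.congr_fun this v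

theorem tilde_eq {S : HHom (E.tens H) H} (hS : ∀ ξ x, S (WCorr.tmul ξ x) = T ξ x) :
    tilde T = S := by
  have h : ∃ S : HHom (E.tens H) H, ∀ ξ x, S (WCorr.tmul ξ x) = T ξ x := ⟨S, hS⟩
  have e : tilde T = h.choose := dif_pos h
  refine HHom.toCLM_injective (WCorr.tens_ext fun ξ x => ?_)
  rw [e]
  exact (h.choose_spec ξ x).trans (hS ξ x).symm

theorem IsCCRep.tilde_norm_le (hT : IsCCRep E H T) : ‖(tilde T).toCLM‖ ≤ 1 := by
  obtain ⟨S, hS, h⟩ := hT.exists_tilde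
  rwa [tilde_eq hS]

/-- The linear map `E → B(H)` belonging to an operator `E ⊗ H → H`. -/
noncomputable def ofTilde (F : HHom (E.tens H) H) : E →ₗ[ℂ] (H →L[ℂ] H) where
  toFun ξ := F.toCLM.comp (WCorr.tmulCLM H ξ)
  map_add' ξ η := by
    ext x
    change F (WCorr.tmul (ξ + η) x) = F (WCorr.tmul ξ x) + F (WCorr.tmul η x)
    rw [WCorr.add_tmul]
    exact map_add F.toCLM _ _
  map_smul' c ξ := by
    ext x
    change F (WCorr.tmul (c • ξ) x) = c • F (WCorr.tmul ξ x)
    rw [WCorr.smul_tmul]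
    exact map_smul F.toCLM _ _

theorem ofTilde_apply (F : HHom (E.tens H) H) (ξ : E) (x : H) :
    ofTilde F ξ x = F (WCorr.tmul ξ x) := rfl

theorem tilde_ofTilde (F : HHom (E.tens H) H) : tilde (ofTilde F) = F :=
  tilde_eq fun _ _ => rfl

theorem isIsometric_ofTilde {F : HHom (E.tens H) H} (hF : F.IsIsometry) :
    IsIsometric E H (ofTilde F) := fun ξ η => by
  refine ContinuousLinearMap.ext fun x => ext_inner_left ℂ fun y => ?_
  rw [mul_apply_eq_comp, ContinuousLinearMap.star_eq_adjoint,
    ContinuousLinearMap.adjoint_inner_right, ofTilde_apply, ofTilde_apply,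
    hF.inner_map, WCorr.inner_tmul]

theorem norm_cstarMatrix_map_le {A B : Type*} [CStarAlgebra A] [PartialOrder A]
    [StarOrderedRing A] [CStarAlgebra B] [PartialOrder B] [StarOrderedRing B]
    (π : A →⋆ₐ[ℂ] B) {k : ℕ} (G : CStarMatrix (Fin k) (Fin k) A) :
    ‖(CStarMatrix.ofMatrix (fun i j => π (G i j)) : CStarMatrix (Fin k) (Fin k) B)‖ ≤ ‖G‖ :=
  NonUnitalStarAlgHom.norm_apply_le (CStarMatrix.mapₙₐ π.toNonUnitalStarAlgHom) G

/-- An isometry `E ⊗ H → H` comes from a completely contractive representation. -/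
theorem isCCRep_ofTilde (hH : H.Normal) {F : HHom (E.tens H) H} (hF : F.IsIsometry) :
    IsCCRep E H (ofTilde F) where
  normal := hH
  map_lact a ξ := by
    ext x
    rw [ofTilde_apply, mul_apply_eq_comp, ofTilde_apply, ← WCorr.act_tmul]
    exact F.comm a _
  map_ract ξ a := by
    ext x
    rw [ofTilde_apply, mul_apply_eq_comp, ofTilde_apply]
    congr 1
    refine WCorr.tens_vec_ext fun η y => ?_
    rw [WCorr.inner_tmul, WCorr.inner_tmul, E.ip_ract, map_mul]; rfl
  completely_contractive k x := by
    have h := isIsometric_ofTilde hF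
    generalize hZ : (CStarMatrix.ofMatrix (fun i j => ofTilde F (x i j)) :
      CStarMatrix (Fin k) (Fin k) (H →L[ℂ] H)) = Z
    have e : star Z * Z = CStarMatrix.ofMatrix (fun i j => H.act
        ((CStarMatrix.ofMatrix (fun i j => ∑ l, E.ip (x l i) (x l j)) :
          CStarMatrix (Fin k) (Fin k) M) i j)) := by
      ext1 i j
      rw [← hZ, CStarMatrix.mul_apply]
      change ∑ l, star (ofTilde F (x l i)) * ofTilde F (x l j) = H.act (∑ l, E.ip (x l i) (x l j))
      rw [map_sum]
      exact Finset.sum_congr rfl fun l _ => h _ _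
    rw [sq, ← CStarRing.norm_star_mul_self, e]
    exact norm_cstarMatrix_map_le _ _

end TildeExists
/-! ### Representations evaluated on words -/

section RepWord
variable {M : Type u} [CStarAlgebra M] [PartialOrder M] [StarOrderedRing M]

namespace PreProductSystem
variable {n : ℕ} {S : PreProductSystem M n} {H : HRep M} {T : ∀ i, S.E i →ₗ[ℂ] (H →L[ℂ] H)}

theorem repWord_append (u : List (Fin n)) :
    ∀ w, S.repWord T (w ++ u)
      = (S.repWord T w).comp ((S.wordMap (S.repWord T u) w).comp (S.wordAppend w u H))
  | [] => rfl
  | i :: w => by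
    change (tilde (T i)).comp ((S.E i).map (S.repWord T (w ++ u)))
      = ((tilde (T i)).comp ((S.E i).map (S.repWord T w))).comp
        (((S.E i).map _).comp ((S.E i).map _))
    rw [repWord_append u w, HHom.comp_assoc, WCorr.map_comp, WCorr.map_comp]

/-- The operators `T̃_w` are compatible with the identifications of words. -/
theorem IsRep.repWord_reord (hT : S.IsRep H T) {w w' : List (Fin n)}
    {f : HHom (S.word w H) (S.word w' H)} (h : S.Reord H w w' f) :
    (S.repWord T w').comp f = S.repWord T w := by
  induction h with
  | refl w => exact HHom.comp_id _
  | @cons i w w' f h ih =>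
    change ((tilde (T i)).comp ((S.E i).map (S.repWord T w'))).comp ((S.E i).map f)
      = (tilde (T i)).comp ((S.E i).map (S.repWord T w))
    rw [HHom.comp_assoc, ← WCorr.map_comp, ih]
  | swap i j w =>
    change ((tilde (T j)).comp ((S.E j).map ((tilde (T i)).comp ((S.E i).map (S.repWord T w))))).comp
      (S.swap i j (S.word w H))
      = (tilde (T i)).comp ((S.E i).map ((tilde (T j)).comp ((S.E j).map (S.repWord T w))))
    rw [WCorr.map_comp, WCorr.map_comp, HHom.comp_assoc, HHom.comp_assoc, ← HHom.comp_assoc,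
      ← HHom.comp_assoc (tilde (T i)), hT.commute i j, HHom.comp_assoc, HHom.comp_assoc,
      HHom.comp_assoc, S.swap_natural]
  | trans _ _ ih1 ih2 => rw [← HHom.comp_assoc, ih2, ih1]

end PreProductSystem

namespace ProductSystem
open PreProductSystem
variable {n : ℕ} {S : ProductSystem M n} {H : HRep M} {T : ∀ i, S.E i →ₗ[ℂ] (H →L[ℂ] H)}

theorem repWord_reorder (hT : S.IsRep H T) (hH : H.Normal) {w w' : List (Fin n)}
    (h : w.Perm w') : (S.repWord T w').comp (S.reorder w w' H) = S.repWord T w :=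
  hT.repWord_reord (S.reord_reorder hH h)

theorem repWord_fold (hT : S.IsRep H T) (hH : H.Normal) {w u w' : List (Fin n)}
    (h : (w ++ u).Perm w') : (S.repWord T w').comp (S.fold w u w' H)
      = (S.repWord T w).comp (S.wordMap (S.repWord T u) w) := by
  rw [fold, ← HHom.comp_assoc, repWord_reorder hT hH h, repWord_append, HHom.comp_assoc,
    HHom.comp_assoc, (S.wordAppend_isUnitary u w).comp_adj, HHom.comp_id]

theorem repWord_move (hT : S.IsRep H T) (hH : H.Normal) (p w : List (Fin n)) :
    (S.repWord T w).comp ((S.wordMap (S.repWord T p) w).comp (S.move p w H))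
      = (S.repWord T p).comp (S.wordMap (S.repWord T w) p) := by
  rw [← repWord_fold hT hH (w' := w ++ p) List.perm_append_comm, move, repWord_append]
  simp only [HHom.comp_assoc]

/-- Composition of `T̃` with an operator `I_w ⊗ g` factors through the value of `T̃` on `g` alone.
-/
theorem repWord_lift (hT : S.IsRep H T) (hH : H.Normal) {D : HRep M} (hD : D.Normal)
    (v : HHom D H) {p u w w' : List (Fin n)} (h : (w ++ u).Perm w')
    (g : HHom (S.word p D) (S.word u D)) :
    ((S.repWord T w').comp (S.wordMap v w')).comp (S.lift w w' g)
      = (S.repWord T w).comp ((S.wordMap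
          (((S.repWord T u).comp (S.wordMap v u)).comp g) w).comp (S.move p w D)) := by
  rw [lift, HHom.comp_assoc, ← HHom.comp_assoc (S.wordMap v w'), ← S.fold_natural hD hH h,
    HHom.comp_assoc, ← HHom.comp_assoc, repWord_fold hT hH h, wordMap_comp, wordMap_comp]
  simp only [HHom.comp_assoc]

end ProductSystem

namespace ProductSystem
open PreProductSystem
variable {m : ℕ} {S : ProductSystem M (m + 2)} {H : HRep M}
  {T : ∀ i, S.E i →ₗ[ℂ] (H →L[ℂ] H)} {D : HRep M} {p u : List (Fin (m + 2))} {j : Fin (m + 1)}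

/-- If `v*` intertwines the column of a multiplier with the representation, then so does `J*` with
the multiplier, where `J` has the components `(I ⊗ v) T_w*`. -/
theorem adj_comp_op (hT : S.IsRep H T) (hH : H.Normal) (hD : D.Normal)
    (a : Mult S.toPreProductSystem D p u j) (v : HHom D H) (J : HHom (S.fock D) H)
    (hJ : ∀ α, J.comp (S.fockIncl D α)
      = (S.repWord T (fockWord α)).comp (S.wordMap v (fockWord α)))
    (hv : (((S.repWord T []).comp (S.wordMap v [])).comp a.g₀)
      + ((S.repWord T u).comp (S.wordMap v u)).comp a.g₁ = (S.repWord T p).comp (S.wordMap v p)) :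
    J.comp a.op = (S.repWord T p).comp (S.wordMap J p) := by
  refine fock_hom_ext (p := p) fun α => ?_
  rw [HHom.comp_assoc, op_comp_incl a hD α, HHom.comp_add, ← HHom.comp_assoc, ← HHom.comp_assoc,
    hJ, hJ, HHom.comp_assoc (S.repWord T p), ← wordMap_comp, hJ]
  have h0 := repWord_lift hT hH hD v (w := fockWord α) (w' := fockWord α) (u := []) (by simp) a.g₀
  have h1 := repWord_lift hT hH hD v (mult_perm a α) a.g₁
  refine (congrArg₂ HAdd.hAdd h0 h1).trans ?_
  rw [← HHom.comp_add, ← HHom.add_comp, ← wordMap_add]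
  have e := congrArg (fun f => (S.repWord T (fockWord α)).comp
    ((S.wordMap f (fockWord α)).comp (S.move p (fockWord α) D))) hv
  refine e.trans ?_
  rw [wordMap_comp, HHom.comp_assoc, ← S.move_natural hD hH, wordMap_comp, ← HHom.comp_assoc,
    ← HHom.comp_assoc, ← HHom.comp_assoc, HHom.comp_assoc (S.repWord T (fockWord α)),
    repWord_move hT hH]

end ProductSystem
end RepWord
/-! ### Intertwining relations of the dilation map -/

section Columns
variable {M : Type u} [CStarAlgebra M] [PartialOrder M] [StarOrderedRing M]

/-- The column relation of the first operator. -/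
theorem column_fst {E F : WCorr M} {H D V V' : HRep M} {a : HHom H (E.tens H)}
    {b : HHom H (F.tens H)} {i : HHom V D} {w : HHom (F.tens V') D} {k : HHom (E.tens V) D}
    {c : HHom V' D} {v : HHom H D} {x : HHom H V} {y : HHom H V'}
    (h : i.comp i.adj + w.comp w.adj = HHom.id D)
    (hi : i.adj.comp v = x) (hw : w.adj.comp v = (F.map y).comp b)
    (hk : k.adj.comp v = (E.map x).comp a) (hc : c.adj.comp v = y) :
    (((E.map i).comp k.adj).comp v) + (E.map ((F.map c).comp w.adj).adj).comp
      ((E.map (F.map v)).comp ((E.map b).comp a)) = (E.map v).comp a := by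
  have e : (((F.map c).comp w.adj).adj.comp ((F.map v).comp b)) = w.comp (w.adj.comp v) := by
    rw [HHom.adj_comp, HHom.adj_adj, ← WCorr.map_adj, HHom.comp_assoc, ← HHom.comp_assoc (F.map _),
      ← WCorr.map_comp, hc, hw]
  have e' : (((E.map i).comp k.adj).comp v) = (E.map (i.comp (i.adj.comp v))).comp a := by
    rw [HHom.comp_assoc, hk, ← HHom.comp_assoc, ← WCorr.map_comp, hi]
  rw [e', ← HHom.comp_assoc (E.map (F.map v)), ← WCorr.map_comp, ← HHom.comp_assoc (E.map _) _ a,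
    ← WCorr.map_comp, e, ← HHom.add_comp, ← WCorr.map_add, ← HHom.comp_assoc, ← HHom.comp_assoc w,
    ← HHom.add_comp, h, HHom.id_comp]

theorem column_fst_adj {E F : WCorr M} {H D V V' : HRep M} {s : HHom (E.tens H) H}
    {t : HHom (F.tens H) H} {i : HHom V D} {w : HHom (F.tens V') D} {k : HHom (E.tens V) D}
    {c : HHom V' D} {v : HHom H D} {x : HHom H V} {y : HHom H V'}
    (h : i.comp i.adj + w.comp w.adj = HHom.id D)
    (hi : i.adj.comp v = x) (hw : w.adj.comp v = (F.map y).comp t.adj)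
    (hk : k.adj.comp v = (E.map x).comp s.adj) (hc : c.adj.comp v = y) :
    v.adj.comp ((E.map i).comp k.adj).adj + ((s.comp (E.map t)).comp (E.map (F.map v.adj))).comp
      (E.map ((F.map c).comp w.adj)) = s.comp (E.map v.adj) := by
  have e := congrArg HHom.adj (column_fst h hi hw hk hc)
  simp only [HHom.adj_add, HHom.adj_comp, ← WCorr.map_adj, HHom.adj_adj] at e ⊢
  exact e

/-- The column relation of the last operator. -/
theorem column_last {E F : WCorr M} {H D V V' : HRep M} {a : HHom H (E.tens H)}
    {b : HHom H (F.tens H)} {i : HHom V D} {w : HHom (F.tens V') D} {k : HHom (E.tens V) D}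
    {c : HHom V' D} {v : HHom H D} {x : HHom H V} {y : HHom H V'}
    (h : k.comp k.adj + c.comp c.adj = HHom.id D)
    (hi : i.adj.comp v = x) (hw : w.adj.comp v = (F.map y).comp b)
    (hk : k.adj.comp v = (E.map x).comp a) (hc : c.adj.comp v = y) :
    (((F.map c).comp w.adj).comp v) + (F.map ((E.map i).comp k.adj).adj).comp
      ((F.map (E.map v)).comp ((F.map a).comp b)) = (F.map v).comp b := by
  have e : (((E.map i).comp k.adj).adj.comp ((E.map v).comp a)) = k.comp (k.adj.comp v) := by
    rw [HHom.adj_comp, HHom.adj_adj, ← WCorr.map_adj, HHom.comp_assoc, ← HHom.comp_assoc (E.map _),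
      ← WCorr.map_comp, hi, hk]
  have e' : (((F.map c).comp w.adj).comp v) = (F.map (c.comp (c.adj.comp v))).comp b := by
    rw [HHom.comp_assoc, hw, ← HHom.comp_assoc, ← WCorr.map_comp, hc]
  rw [e', ← HHom.comp_assoc (F.map (E.map v)), ← WCorr.map_comp, ← HHom.comp_assoc (F.map _) _ b,
    ← WCorr.map_comp, e, ← HHom.add_comp, ← WCorr.map_add, ← HHom.comp_assoc, ← HHom.comp_assoc k,
    ← HHom.add_comp, add_comm, h, HHom.id_comp]

theorem column_last_adj {E F : WCorr M} {H D V V' : HRep M} {s : HHom (E.tens H) H}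
    {t : HHom (F.tens H) H} {i : HHom V D} {w : HHom (F.tens V') D} {k : HHom (E.tens V) D}
    {c : HHom V' D} {v : HHom H D} {x : HHom H V} {y : HHom H V'}
    (h : k.comp k.adj + c.comp c.adj = HHom.id D)
    (hi : i.adj.comp v = x) (hw : w.adj.comp v = (F.map y).comp t.adj)
    (hk : k.adj.comp v = (E.map x).comp s.adj) (hc : c.adj.comp v = y) :
    v.adj.comp ((F.map c).comp w.adj).adj + ((t.comp (F.map s)).comp (F.map (E.map v.adj))).comp
      (F.map ((E.map i).comp k.adj)) = t.comp (F.map v.adj) := by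
  have e := congrArg HHom.adj (column_last h hi hw hk hc)
  simp only [HHom.adj_add, HHom.adj_comp, ← WCorr.map_adj, HHom.adj_adj] at e ⊢
  exact e

theorem PreProductSystem.repWord_singleton {n : ℕ} (S : PreProductSystem M n) {H : HRep M}
    {T : ∀ i, S.E i →ₗ[ℂ] (H →L[ℂ] H)} (i : Fin n) : S.repWord T [i] = tilde (T i) := by
  change (tilde (T i)).comp ((S.E i).map (HHom.id H)) = _
  rw [WCorr.map_id, HHom.comp_id]

/-- The case of `adj_comp_op` of a multiplier of degree `(0, e₁)` on `E_i ⊗ D`. -/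
theorem ProductSystem.adj_comp_op_multOf {m : ℕ} {S : ProductSystem M (m + 2)} {H : HRep M}
    {T : ∀ i, S.E i →ₗ[ℂ] (H →L[ℂ] H)} {D : HRep M} (hT : S.IsRep H T) (hD : D.Normal)
    (i : Fin (m + 2)) (g₀ : HHom ((S.E i).tens D) D) (g₁ : HHom ((S.E i).tens D) (S.tensFL D))
    (h : g₀.IsColumn g₁) (ho : (S.mapFL g₀).IsOrthogonal g₁)
    (v : HHom D H) (J : HHom (S.fock D) H)
    (hJ : ∀ α, J.comp (S.fockIncl D α) = (S.repWord T (PreProductSystem.fockWord α)).comp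
      (S.wordMap v (PreProductSystem.fockWord α)))
    (hv : v.comp g₀ + (((tilde (T 0)).comp ((S.E 0).map (tilde (T (Fin.last (m + 1)))))).comp
      (S.mapFL v)).comp g₁ = (tilde (T i)).comp ((S.E i).map v)) :
    J.comp (S.multOf i g₀ g₁ h ho).op = (tilde (T i)).comp ((S.E i).map J) := by
  have e : S.repWord T [0, Fin.last (m + 1)]
      = (tilde (T 0)).comp ((S.E 0).map (tilde (T (Fin.last (m + 1))))) :=
    congrArg (fun f => HHom.comp (tilde (T 0)) ((S.E 0).map f)) (S.repWord_singleton _)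
  refine (ProductSystem.adj_comp_op hT (hT.ccRep 0).normal hD (S.multOf i g₀ g₁ h ho) v J hJ
    ?_).trans (congrArg (fun f => HHom.comp f ((S.E i).map J)) (S.repWord_singleton i))
  refine (congrArg₂ HAdd.hAdd ?_ ?_).trans (hv.trans
    (congrArg (fun f => HHom.comp f ((S.E i).map v)) (S.repWord_singleton i)).symm)
  · exact congrArg (fun f => HHom.comp f g₀) (HHom.id_comp v)
  · exact congrArg (fun f => HHom.comp (HHom.comp f (S.mapFL v)) g₁) e

section PairIntertwining
variable {m : ℕ} {S : ProductSystem M (m + 2)} {H : HRep M} {T : ∀ i, S.E i →ₗ[ℂ] (H →L[ℂ] H)}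
  {D V V' : HRep M} {A : HHom D ((S.E 0).tens D)} {B : HHom D ((S.E (Fin.last (m + 1))).tens D)}
  {i : HHom V D} {w : HHom ((S.E (Fin.last (m + 1))).tens V') D} {k : HHom ((S.E 0).tens V) D}
  {c : HHom V' D} {v : HHom H D} {x : HHom H V} {y : HHom H V'} {J : HHom (S.fock D) H}

/-- A map `J` with the components of the adjoint of the dilation map intertwines the first operator
of the pair with `T̃₁`: both sides are natural, which reduces this to the column relation on `D`. -/
theorem ProductSystem.IsPair.adj_comp_op₁ (hp : S.IsPair A B) (hT : S.IsRep H T) (hD : D.Normal)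
    (hA : A = ((S.E 0).map i).comp k.adj) (hB : B = ((S.E (Fin.last (m + 1))).map c).comp w.adj)
    (h : i.IsSplit w) (hi : i.adj.comp v = x)
    (hw : w.adj.comp v = ((S.E (Fin.last (m + 1))).map y).comp (tilde (T (Fin.last (m + 1)))).adj)
    (hk : k.adj.comp v = ((S.E 0).map x).comp (tilde (T 0)).adj) (hc : c.adj.comp v = y)
    (hJ : ∀ α, J.comp (S.fockIncl D α) = (S.repWord T (PreProductSystem.fockWord α)).comp
      (S.wordMap v.adj (PreProductSystem.fockWord α))) :
    J.comp hp.mult₁.op = (tilde (T 0)).comp ((S.E 0).map J) := by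
  refine ProductSystem.adj_comp_op_multOf hT hD 0 _ _ _ _ v.adj _ hJ ?_
  subst hA hB
  exact column_fst_adj h.total hi hw hk hc

theorem ProductSystem.IsPair.adj_comp_opₙ (hp : S.IsPair A B) (hT : S.IsRep H T) (hD : D.Normal)
    (hA : A = ((S.E 0).map i).comp k.adj) (hB : B = ((S.E (Fin.last (m + 1))).map c).comp w.adj)
    (h : k.IsSplit c) (hi : i.adj.comp v = x)
    (hw : w.adj.comp v = ((S.E (Fin.last (m + 1))).map y).comp (tilde (T (Fin.last (m + 1)))).adj)
    (hk : k.adj.comp v = ((S.E 0).map x).comp (tilde (T 0)).adj) (hc : c.adj.comp v = y)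
    (hJ : ∀ α, J.comp (S.fockIncl D α) = (S.repWord T (PreProductSystem.fockWord α)).comp
      (S.wordMap v.adj (PreProductSystem.fockWord α))) :
    J.comp (hp.multₙ hD).op
      = (tilde (T (Fin.last (m + 1)))).comp ((S.E (Fin.last (m + 1))).map J) := by
  refine ProductSystem.adj_comp_op_multOf hT hD (Fin.last (m + 1)) _ _ _ _ v.adj _ hJ ?_
  have e := column_last_adj h.total hi hw hk hc
  have hcomm := hT.commute (Fin.last (m + 1)) 0
  rw [← HHom.comp_assoc _ (S.swap _ _ _), HHom.comp_assoc _ _ (S.swap _ _ _), ← S.swap_natural,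
    ← HHom.comp_assoc _ (S.swap _ _ _), HHom.comp_assoc _ _ (S.swap _ _ _), ← hcomm]
  subst hA hB
  exact e

end PairIntertwining

namespace PreProductSystem.DilationData
variable {m : ℕ} {S : ProductSystem M (m + 2)} {H : HRep M}
  {T : ∀ i, S.E i →ₗ[ℂ] (H →L[ℂ] H)} (d : S.DilationData T)

/-- In the second decomposition of `𝒟`, the vector `Dₙ h ⊕ (I ⊗ D₁) T̃₁* h` has the components of
its preimage under `U`; the first of them is `D₁ h`. -/
theorem inl_adj_comp_vec : (d.U.comp (HHom.inl _ _)).adj.comp (S.vecLast T d.ℰ₁)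
    = (S.defFst T).toClosure := by
  rw [HHom.adj_comp, HHom.comp_assoc, ← d.U_comp, d.U_unitary.adj_comp_assoc, HHom.inl_adj]
  refine HHom.ext fun h => ?_
  simp [vecFst]

theorem tail_adj_comp_vec : (d.U.comp d.tailIncl).adj.comp (S.vecLast T d.ℰ₁)
    = ((S.E (Fin.last (m + 1))).map ((HHom.inl _ _).comp (S.defLast T).toClosure)).comp
      (tilde (T (Fin.last (m + 1)))).adj := by
  rw [HHom.adj_comp, HHom.comp_assoc, ← d.U_comp, d.U_unitary.adj_comp_assoc, tailIncl_adj,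
    WCorr.map_comp]
  refine HHom.ext fun h => ?_
  simp [vecFst]

theorem mid_adj_comp_vec : d.midIncl.adj.comp (S.vecLast T d.ℰ₁)
    = ((S.E 0).map (S.defFst T).toClosure).comp (tilde (T 0)).adj := by
  rw [midIncl_adj]
  refine HHom.ext fun h => ?_
  simp [vecLast]

theorem C₁_comp_vec : d.C₁.adj.adj.comp (S.vecLast T d.ℰ₁)
    = (HHom.inl _ _).comp (S.defLast T).toClosure := by
  rw [HHom.adj_adj, C₁]
  refine HHom.ext fun h => HHom.plus_ext ?_ ?_ <;> simp [vecLast]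

/-- The map `h ↦ ⨁_α (I ⊗ V D₁ₙ) T̃₁ₙ^{(α)}* h` is well-defined: it has the prescribed
components. -/
def HasComponents : Prop := ∀ α, (S.fockEval d.D α).comp d.dilationMap
  = (S.wordMap (S.vecLast T d.ℰ₁) (fockWord α)).comp (S.repWord T (fockWord α)).adj

variable {d}

theorem HasComponents.adj_comp_incl (h : d.HasComponents) (α) :
    d.dilationMap.adj.comp (S.fockIncl d.D α)
      = (S.repWord T (fockWord α)).comp (S.wordMap (S.vecLast T d.ℰ₁).adj (fockWord α)) := by
  have e := congrArg HHom.adj (h α)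
  rw [HHom.adj_comp, HHom.adj_comp, HHom.adj_adj, ← wordMap_adj] at e
  exact e

/-- The adjoint of the dilation map intertwines a multiplier with `T̃_p` if it does so on `𝒟`. -/
theorem HasComponents.adj_comp_op (h : d.HasComponents) (hT : S.IsRep H T) {p u : List (Fin (m + 2))}
    {j : Fin (m + 1)} (a : Mult S.toPreProductSystem d.D p u j)
    (hv : (((S.repWord T []).comp (S.wordMap (S.vecLast T d.ℰ₁).adj [])).comp a.g₀)
      + ((S.repWord T u).comp (S.wordMap (S.vecLast T d.ℰ₁).adj u)).comp a.g₁
      = (S.repWord T p).comp (S.wordMap (S.vecLast T d.ℰ₁).adj p)) :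
    d.dilationMap.adj.comp a.op = (S.repWord T p).comp (S.wordMap d.dilationMap.adj p) :=
  ProductSystem.adj_comp_op hT (hT.ccRep 0).normal (d.D_normal (hT.ccRep 0).normal) a _ _
    h.adj_comp_incl hv

theorem adj_intertwine {E : WCorr M} {A B : HRep M} {J : HHom A B} {t : HHom (E.tens A) A}
    {τ : HHom (E.tens B) B} (h : J.adj.comp τ = t.comp (E.map J.adj)) :
    (E.map J).comp t.adj = τ.adj.comp J := by
  have e := congrArg HHom.adj h
  rw [HHom.adj_comp, HHom.adj_comp, HHom.adj_adj, ← WCorr.map_adj, HHom.adj_adj] at e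
  exact e.symm

theorem HasComponents.τ₁ (h : d.HasComponents) (hT : S.IsRep H T) :
    ((S.E 0).map d.dilationMap).comp (tilde (T 0)).adj = d.τ₁.adj.comp d.dilationMap := by
  have hH := (hT.ccRep 0).normal
  refine adj_intertwine ?_
  rw [d.τ₁_eq hH]
  exact d.isPair.adj_comp_op₁ (D := d.D) hT (d.D_normal hH) d.A₁_eq d.Aₙ_eq d.split_U
    d.inl_adj_comp_vec d.tail_adj_comp_vec d.mid_adj_comp_vec d.C₁_comp_vec h.adj_comp_incl

theorem HasComponents.τₙ (h : d.HasComponents) (hT : S.IsRep H T) :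
    ((S.E (Fin.last (m + 1))).map d.dilationMap).comp (tilde (T (Fin.last (m + 1)))).adj
      = d.τₙ.adj.comp d.dilationMap := by
  have hH := (hT.ccRep 0).normal
  refine adj_intertwine ?_
  rw [d.τₙ_eq hH]
  exact d.isPair.adj_comp_opₙ (D := d.D) hT (d.D_normal hH) d.A₁_eq d.Aₙ_eq d.split_mid
    d.inl_adj_comp_vec d.tail_adj_comp_vec d.mid_adj_comp_vec d.C₁_comp_vec h.adj_comp_incl

theorem HasComponents.L (h : d.HasComponents) (hT : S.IsRep H T) (k : Fin m) :
    ((S.E k.succ.castSucc).map d.dilationMap).comp (tilde (T k.succ.castSucc)).adj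
      = (d.L k).adj.comp d.dilationMap := by
  have hH := (hT.ccRep 0).normal
  refine adj_intertwine ?_
  have hu : [k.succ.castSucc] = genWord m k.succ := (if_neg (Fin.succ_ne_zero k)).symm
  rw [DilationData.L, S.create_eq_op (d.D_normal hH) _ _ hu]
  refine (h.adj_comp_op hT (S.createMult d.D _ _ hu) ?_).trans ?_
  · refine (congrArg₂ HAdd.hAdd (HHom.comp_zero _) (HHom.comp_id _)).trans (zero_add _)
  · exact congrArg (fun f => HHom.comp f ((S.E k.succ.castSucc).map d.dilationMap.adj))
      (S.repWord_singleton _)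

end PreProductSystem.DilationData
end Columns
/-! ### Defect operators -/

section Defects
variable {M : Type u} [CStarAlgebra M] [PartialOrder M] [StarOrderedRing M]

theorem WCorr.map_norm_le_one (E : WCorr M) {X Y : HRep M} {f : HHom X Y} (hf : ‖f.toCLM‖ ≤ 1) :
    ‖(E.map f).toCLM‖ ≤ 1 := by
  refine ContinuousLinearMap.opNorm_le_bound _ zero_le_one fun v => ?_
  induction v using UniformSpace.Completion.induction_on with
  | hp => exact isClosed_le ((E.map f).toCLM.continuous.norm) (continuous_const.mul continuous_norm)
  | ih a =>
    have e : E.map f (E.tmulₗ X a) = E.tmulₗ Y _ :=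
      WCorr.preMap_apply _ _ (WCorr.map_bound f) a
    have e' : ‖E.tmulₗ X a‖ = ‖E.toPre X a‖ := UniformSpace.Completion.norm_coe _
    have h : ‖E.map f (E.tmulₗ X a)‖ ≤ 1 * ‖E.tmulₗ X a‖ := by
      rw [e, e']
      refine (le_of_eq (UniformSpace.Completion.norm_coe _)).trans
        ((WCorr.map_bound f a).trans ?_)
      gcongr
    exact h

theorem HHom.comp_norm_le_one {X Y Z : HRep M} {f : HHom X Y} {g : HHom Y Z} (hg : ‖g.toCLM‖ ≤ 1)
    (hf : ‖f.toCLM‖ ≤ 1) : ‖(g.comp f).toCLM‖ ≤ 1 :=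
  (ContinuousLinearMap.opNorm_comp_le _ _).trans (mul_le_one₀ hg (norm_nonneg _) hf)

theorem HHom.adj_apply_norm_le {X Y : HRep M} {f : HHom X Y} (hf : ‖f.toCLM‖ ≤ 1) (y : Y) :
    ‖f.adj y‖ ≤ ‖y‖ := by
  have h : ‖f.adj.toCLM‖ ≤ 1 := (LinearIsometryEquiv.norm_map _ f.toCLM).trans_le hf
  exact (f.adj.toCLM.le_of_opNorm_le h y).trans (one_mul _).le

namespace PreProductSystem
variable {n : ℕ} {S : PreProductSystem M n} {H : HRep M} {T : ∀ i, S.E i →ₗ[ℂ] (H →L[ℂ] H)}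

theorem wordMap_norm_le_one {X Y : HRep M} {f : HHom X Y} (hf : ‖f.toCLM‖ ≤ 1) :
    ∀ w, ‖(S.wordMap f w).toCLM‖ ≤ 1
  | [] => hf
  | i :: w => (S.E i).map_norm_le_one (wordMap_norm_le_one hf w)

theorem IsRep.repWord_norm_le_one (hT : S.IsRep H T) : ∀ w, ‖(S.repWord T w).toCLM‖ ≤ 1
  | [] => ContinuousLinearMap.norm_id_le
  | i :: w => HHom.comp_norm_le_one (hT.ccRep i).tilde_norm_le
    ((S.E i).map_norm_le_one (repWord_norm_le_one hT w))

variable (S T)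

/-- The map `f ↦ T̃_w (I ⊗ f) T̃_w*` on the commutant of `M`. -/
noncomputable def conj (w : List (Fin n)) (f : HHom H H) : HHom H H :=
  (S.repWord T w).comp ((S.wordMap f w).comp (S.repWord T w).adj)

variable {S T}

theorem conj_add (w : List (Fin n)) (f g : HHom H H) :
    S.conj T w (f + g) = S.conj T w f + S.conj T w g := by
  rw [conj, wordMap_add, HHom.add_comp, HHom.comp_add]; rfl

theorem conj_smul (w : List (Fin n)) (c : ℂ) (f : HHom H H) :
    S.conj T w (c • f) = c • S.conj T w f := by
  rw [conj, wordMap_smul, HHom.smul_comp, HHom.comp_smul]; rfl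

/-- `conj` as a linear map. -/
noncomputable def conjₗ (S : PreProductSystem M n) (T : ∀ i, S.E i →ₗ[ℂ] (H →L[ℂ] H))
    (w : List (Fin n)) : HHom H H →ₗ[ℂ] HHom H H where
  toFun := S.conj T w
  map_add' := conj_add w
  map_smul' := conj_smul w

theorem conj_sub (w : List (Fin n)) (f g : HHom H H) :
    S.conj T w (f - g) = S.conj T w f - S.conj T w g := map_sub (S.conjₗ T w) f g

theorem conj_append (w u : List (Fin n)) (f : HHom H H) :
    S.conj T (w ++ u) f = S.conj T w (S.conj T u f) := by
  rw [conj, repWord_append, HHom.adj_comp, HHom.adj_comp, conj, conj, wordMap_comp, wordMap_comp,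
    ← wordMap_adj]
  have h := S.wordAppend_natural f u w
  have h2 : (S.wordAppend w u H).comp ((S.wordMap f (w ++ u)).comp (S.wordAppend w u H).adj)
      = S.wordMap (S.wordMap f u) w := by
    rw [← HHom.comp_assoc, ← h, HHom.comp_assoc, (S.wordAppend_isUnitary u w).comp_adj,
      HHom.comp_id]
  rw [← h2]
  simp only [HHom.comp_assoc]

theorem norm_sq_wordMap_adj {D : HRep M} (v : HHom H D) (w : List (Fin n)) (h : H) :
    ‖S.wordMap v w ((S.repWord T w).adj h)‖ ^ 2
      = (inner ℂ h (S.conj T w (v.adj.comp v) h) : ℂ).re := by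
  have e := HHom.norm_sq_eq ((S.wordMap v w).comp (S.repWord T w).adj) h
  rw [HHom.comp_apply] at e
  rw [e, conj, wordMap_comp, wordMap_adj, HHom.adj_comp, HHom.adj_adj]
  simp only [HHom.comp_assoc]

theorem conj_id (w : List (Fin n)) :
    S.conj T w (HHom.id H) = (S.repWord T w).comp (S.repWord T w).adj := by
  rw [conj, wordMap_id, HHom.id_comp]

theorem inner_conj_id (w : List (Fin n)) (h : H) :
    (inner ℂ h (S.conj T w (HHom.id H) h) : ℂ).re = ‖(S.repWord T w).adj h‖ ^ 2 := by
  rw [conj_id, HHom.norm_sq_eq, HHom.adj_adj]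

theorem szego_eq (J : Finset (Fin n)) (w : Fin n → List (Fin n)) :
    S.szego T J w = ∑ G ∈ J.powerset, ((-1 : ℂ) ^ G.card) • S.conj T (G.sort.flatMap w) (HHom.id H) := by
  refine HHom.toCLM_injective ?_
  rw [HHom.toCLM_sum]
  refine Finset.sum_congr rfl fun G _ => ?_
  rw [conj_id]
  rfl

theorem szego_congr {J : Finset (Fin n)} {w w' : Fin n → List (Fin n)} (h : ∀ i ∈ J, w i = w' i) :
    S.szego T J w = S.szego T J w' := by
  rw [szego_eq, szego_eq]
  refine Finset.sum_congr rfl fun G hG => ?_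
  congr 2
  refine List.flatMap_congr fun i hi => h i ?_
  exact Finset.mem_powerset.mp hG ((Finset.mem_sort _).mp hi)

theorem conj_szego (u : List (Fin n)) (J : Finset (Fin n)) (w : Fin n → List (Fin n)) :
    S.conj T u (S.szego T J w) = ∑ G ∈ J.powerset,
      ((-1 : ℂ) ^ G.card) • S.conj T (u ++ G.sort.flatMap w) (HHom.id H) := by
  rw [szego_eq]
  refine (map_sum (S.conjₗ T u) _ _).trans (Finset.sum_congr rfl fun G _ => ?_)
  rw [map_smul, conj_append]
  rfl

end PreProductSystem

namespace ProductSystem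
open PreProductSystem
variable {n : ℕ} {S : ProductSystem M n} {H : HRep M} {T : ∀ i, S.E i →ₗ[ℂ] (H →L[ℂ] H)}

/-- Conjugation by `T̃_w` depends on the multiset of the letters only. -/
theorem conj_perm (hT : S.IsRep H T) (hH : H.Normal) {w w' : List (Fin n)} (h : w.Perm w')
    (f : HHom H H) : S.conj T w f = S.conj T w' f := by
  have hn := S.reorder_natural hH hH h f
  have e : (S.reorder w w' H).comp ((S.wordMap f w).comp (S.reorder w w' H).adj)
      = S.wordMap f w' := by
    rw [← HHom.comp_assoc, hn, HHom.comp_assoc, (S.reorder_isUnitary hH h).comp_adj, HHom.comp_id]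
  rw [conj, ← repWord_reorder hT hH h, HHom.adj_comp, conj, ← e]
  simp only [HHom.comp_assoc]

/-- The alternating sums are built up one index at a time. -/
theorem szego_insert (hT : S.IsRep H T) (hH : H.Normal) {i : Fin n} {J : Finset (Fin n)}
    (hi : i ∉ J) (w : Fin n → List (Fin n)) :
    S.szego T (insert i J) w = S.szego T J w - S.conj T (w i) (S.szego T J w) := by
  classical
  rw [conj_szego, szego_eq, szego_eq, Finset.sum_powerset_insert hi, sub_eq_add_neg,
    ← Finset.sum_neg_distrib]
  congr 1
  refine Finset.sum_congr rfl fun G hG => ?_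
  have hiG : i ∉ G := fun h => hi (Finset.mem_powerset.mp hG h)
  rw [Finset.card_insert_of_notMem hiG, pow_succ, mul_neg_one, neg_smul]
  congr 2
  refine conj_perm hT hH ?_ _
  have hp : ((insert i G).sort (· ≤ ·)).Perm (i :: G.sort (· ≤ ·)) := by
    rw [← Multiset.coe_eq_coe, ← Multiset.cons_coe, Finset.sort_eq, Finset.sort_eq,
      Finset.insert_val_of_notMem hiG]
  exact hp.flatMap_right w

end ProductSystem
end Defects
/-! ### Identities for the defect operators -/

section DefectIdentities
variable {M : Type u} [CStarAlgebra M] [PartialOrder M] [StarOrderedRing M]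

namespace ProductSystem
open PreProductSystem
variable {m : ℕ} {S : ProductSystem M (m + 2)} {H : HRep M} {T : ∀ i, S.E i →ₗ[ℂ] (H →L[ℂ] H)}

theorem fst_ne_last : (0 : Fin (m + 2)) ≠ Fin.last (m + 1) := (Fin.last_pos).ne

/-- The indices strictly between the first and the last. -/
def midSet (m : ℕ) : Finset (Fin (m + 2)) := (Finset.univ.erase 0).erase (Fin.last (m + 1))

theorem erase_last_eq : Finset.univ.erase (Fin.last (m + 1)) = insert 0 (midSet m) := by
  ext i
  simp only [midSet, Finset.mem_erase, Finset.mem_univ, and_true, Finset.mem_insert]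
  constructor
  · intro h; by_cases h0 : i = 0 <;> simp [h0, h]
  · rintro (h | h)
    · rw [h]; exact fst_ne_last
    · exact h.1

theorem erase_fst_eq : Finset.univ.erase (0 : Fin (m + 2)) = insert (Fin.last (m + 1)) (midSet m) :=
  (Finset.insert_erase (by simp [fst_ne_last.symm])).symm

theorem zero_notMem_midSet : (0 : Fin (m + 2)) ∉ midSet m := by simp [midSet]

theorem last_notMem_midSet : Fin.last (m + 1) ∉ midSet m := by simp [midSet]

theorem szegoLast_eq (hT : S.IsRep H T) : S.szegoLast T
    = S.szego T (midSet m) (fun i => [i]) - S.conj T [0] (S.szego T (midSet m) (fun i => [i])) := by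
  rw [szegoLast, erase_last_eq, szego_insert hT (hT.ccRep 0).normal zero_notMem_midSet]

theorem szegoFst_eq (hT : S.IsRep H T) : S.szegoFst T
    = S.szego T (midSet m) (fun i => [i])
      - S.conj T [Fin.last (m + 1)] (S.szego T (midSet m) (fun i => [i])) := by
  rw [szegoFst, erase_fst_eq, szego_insert hT (hT.ccRep 0).normal last_notMem_midSet]

theorem szegoFstLast_eq (hT : S.IsRep H T) : S.szegoFstLast T
    = S.szego T (midSet m) (fun i => [i])
      - S.conj T [0, Fin.last (m + 1)] (S.szego T (midSet m) (fun i => [i])) := by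
  have e : S.szego T (midSet m) (fun i => if i = 0 then [0, Fin.last (m + 1)] else [i])
      = S.szego T (midSet m) (fun i => [i]) := szego_congr fun i hi => by
    rw [if_neg]
    rintro rfl
    exact zero_notMem_midSet hi
  rw [szegoFstLast, erase_last_eq, szego_insert hT (hT.ccRep 0).normal zero_notMem_midSet, e,
    if_pos rfl]

/-- `Δ₁ₙ = Δₙ + T̃₁ (I ⊗ Δ₁) T̃₁*`. -/
theorem szegoFstLast_eq_last (hT : S.IsRep H T) :
    S.szegoFstLast T = S.szegoLast T + S.conj T [0] (S.szegoFst T) := by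
  rw [szegoFstLast_eq hT, szegoLast_eq hT, szegoFst_eq hT, conj_sub, ← conj_append,
    sub_add_sub_cancel]
  rfl

/-- `Δ₁ₙ = Δ₁ + T̃ₙ (I ⊗ Δₙ) T̃ₙ*`. -/
theorem szegoFstLast_eq_fst (hT : S.IsRep H T) :
    S.szegoFstLast T = S.szegoFst T + S.conj T [Fin.last (m + 1)] (S.szegoLast T) := by
  rw [szegoFstLast_eq hT, szegoLast_eq hT, szegoFst_eq hT, conj_sub, ← conj_append,
    sub_add_sub_cancel]
  congr 1
  exact conj_perm hT (hT.ccRep 0).normal (List.Perm.swap _ _ _) _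

theorem toClosure_adj_comp {A B : HRep M} (f : HHom A B) :
    f.toClosure.adj.comp f.toClosure = f.adj.comp f := by
  refine HHom.ext fun x => ext_inner_left ℂ fun y => ?_
  rw [HHom.comp_apply, HHom.comp_apply, HHom.adj_inner_right, HHom.adj_inner_right]
  rfl

theorem sqrt_toClosure {f : HHom H H} (hf : 0 ≤ f.toCLM) :
    f.sqrt.toClosure.adj.comp f.sqrt.toClosure = f := by
  rw [toClosure_adj_comp, HHom.sqrt_adj, HHom.sqrt_comp_sqrt f hf]

theorem plus_adj_comp {A B C : HRep M} (f : HHom A B) (g : HHom A C) :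
    ((HHom.inl B C).comp f + (HHom.inr B C).comp g).adj.comp
      ((HHom.inl B C).comp f + (HHom.inr B C).comp g) = f.adj.comp f + g.adj.comp g := by
  refine HHom.ext fun x => ext_inner_left ℂ fun y => ?_
  rw [HHom.comp_apply, HHom.adj_inner_right, HHom.plus_inner]
  simp only [HHom.add_apply, HHom.comp_apply, inner_add_right, HHom.adj_inner_right]
  simp

theorem conj_singleton (i : Fin (m + 2)) {A : HRep M} (v : HHom H A) :
    S.conj T [i] (v.adj.comp v)
      = (((S.E i).map v).comp (tilde (T i)).adj).adj.comp (((S.E i).map v).comp (tilde (T i)).adj) := by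
  have e : S.conj T [i] (v.adj.comp v)
      = (tilde (T i)).comp (((S.E i).map (v.adj.comp v)).comp (tilde (T i)).adj) :=
    congrArg (fun f => HHom.comp f (((S.E i).map (v.adj.comp v)).comp f.adj)) (S.repWord_singleton i)
  rw [e, HHom.adj_comp, HHom.adj_adj, WCorr.map_comp, WCorr.map_adj]
  simp only [HHom.comp_assoc]

/-- The squared norm of `Dₙ h ⊕ (I ⊗ D₁) T̃₁* h` is `⟨h, Δ₁ₙ h⟩`. -/
theorem vecLast_adj_comp (hT : S.IsClassT T) (ℰ : HRep M) :
    (S.vecLast T ℰ).adj.comp (S.vecLast T ℰ) = S.szegoFstLast T := by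
  have h0 := conj_singleton (S := S) (T := T) 0 (S.szegoFst T).sqrt.toClosure
  rw [sqrt_toClosure hT.szegoFst_nonneg] at h0
  have h1 := plus_adj_comp (S.defLast T).toClosure ((HHom.inl _ ℰ).comp
    (((S.E 0).map (S.defFst T).toClosure).comp (tilde (T 0)).adj))
  rw [HHom.adj_comp, HHom.comp_assoc, ← HHom.comp_assoc (HHom.inl _ ℰ).adj, HHom.inl_adj,
    HHom.fst_comp_inl, HHom.id_comp, ← h0, sqrt_toClosure hT.szegoLast_nonneg,
    ← szegoFstLast_eq_last hT.isRep] at h1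
  exact h1

/-- The squared norm of `D₁ h ⊕ (I ⊗ Dₙ) T̃ₙ* h` is `⟨h, Δ₁ₙ h⟩`. -/
theorem vecFst_adj_comp (hT : S.IsClassT T) (ℰ : HRep M) :
    (S.vecFst T ℰ).adj.comp (S.vecFst T ℰ) = S.szegoFstLast T := by
  have h0 := conj_singleton (S := S) (T := T) (Fin.last (m + 1)) (S.szegoLast T).sqrt.toClosure
  rw [sqrt_toClosure hT.szegoLast_nonneg] at h0
  have h1 := plus_adj_comp (S.defFst T).toClosure ((HHom.inl _ ℰ).comp
    (((S.E (Fin.last (m + 1))).map (S.defLast T).toClosure).comp (tilde (T (Fin.last (m + 1)))).adj))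
  rw [HHom.adj_comp, HHom.comp_assoc, ← HHom.comp_assoc (HHom.inl _ ℰ).adj, HHom.inl_adj,
    HHom.fst_comp_inl, HHom.id_comp, ← h0, sqrt_toClosure hT.szegoFst_nonneg,
    ← szegoFstLast_eq_fst hT.isRep] at h1
  exact h1

theorem szegoFstLast_nonneg (hT : S.IsClassT T) : 0 ≤ (S.szegoFstLast T).toCLM := by
  obtain ⟨Y⟩ : Nonempty (HRep M) := ⟨H⟩
  have h := vecLast_adj_comp hT Y
  rw [← h, ContinuousLinearMap.nonneg_iff_isPositive]
  exact ContinuousLinearMap.isPositive_adjoint_comp_self _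

/-- The vectors that are related by `U` have the same norm. -/
theorem norm_vec_eq (hT : S.IsClassT T) (ℰ ℰ' : HRep M) (h : H) :
    ‖S.vecFst T ℰ h‖ = ‖S.vecLast T ℰ' h‖ := by
  refine (sq_eq_sq₀ (norm_nonneg _) (norm_nonneg _)).mp ?_
  rw [HHom.norm_sq_eq, HHom.norm_sq_eq, vecFst_adj_comp hT, vecLast_adj_comp hT]

/-- The vectors that are related by `V` have the same norm. -/
theorem norm_toClosure_eq (hT : S.IsClassT T) (ℰ : HRep M) (h : H) :
    ‖S.vecLast T ℰ h‖ = ‖(S.defFstLast T).toClosure h‖ := by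
  refine (sq_eq_sq₀ (norm_nonneg _) (norm_nonneg _)).mp ?_
  rw [HHom.norm_sq_eq, HHom.norm_sq_eq, vecLast_adj_comp hT, sqrt_toClosure (szegoFstLast_nonneg hT)]

end ProductSystem
end DefectIdentities

/-! ### Alternating sums over cubes -/

section Telescoping
variable {ι : Type} [Fintype ι] [DecidableEq ι]

/-- The basis of the monoid algebra of `ℕ^ι` consists of monomials. -/
theorem single_eq_prod (α : ι → ℕ) : (AddMonoidAlgebra.single α (1 : ℝ) : AddMonoidAlgebra ℝ (ι → ℕ))
    = ∏ j, AddMonoidAlgebra.single (Pi.single j 1) 1 ^ α j := by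
  simp only [AddMonoidAlgebra.single_pow, one_pow]
  have h : ∀ s : Finset ι, ∏ j ∈ s, (AddMonoidAlgebra.single (α j • Pi.single j 1) (1 : ℝ) :
      AddMonoidAlgebra ℝ (ι → ℕ)) = AddMonoidAlgebra.single (∑ j ∈ s, α j • Pi.single j 1) 1 := by
    intro s
    induction s using Finset.induction_on with
    | empty => simp; rfl
    | insert a s ha ih => rw [Finset.prod_insert ha, ih, AddMonoidAlgebra.single_mul_single,
        Finset.sum_insert ha, one_mul]
  rw [h]
  congr 1
  ext k
  simp [Finset.sum_apply, Pi.single_apply]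

/-- The alternating differences of a function on `ℕ^ι`, summed over a cube. -/
theorem sum_alternating (c : (ι → ℕ) → ℝ) (N : ℕ) :
    ∑ α ∈ Fintype.piFinset fun _ : ι => Finset.range N, ∑ G : Finset ι,
        (-1 : ℝ) ^ G.card * c (α + fun j => if j ∈ G then 1 else 0)
      = ∑ G : Finset ι, (-1 : ℝ) ^ G.card * c (fun j => if j ∈ G then N else 0) := by
  -- the claim is the value of a linear functional at an identity in the monoid algebra,
  -- `∏ (∑ x_j^k) (1 - x_j) = ∏ (1 - x_j^N)`
  let x : ι → AddMonoidAlgebra ℝ (ι → ℕ) := fun j => AddMonoidAlgebra.single (Pi.single j 1) 1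
  let L : AddMonoidAlgebra ℝ (ι → ℕ) →ₗ[ℝ] ℝ :=
    (Finsupp.linearCombination ℝ c).comp (AddMonoidAlgebra.coeffLinearEquiv ℝ).toLinearMap
  have hL : ∀ α : ι → ℕ, L (∏ j, x j ^ α j) = c α := fun α => by
    rw [← single_eq_prod]
    exact (Finsupp.linearCombination_single ℝ 1 α).trans (one_smul _ _)
  have hone : ∀ y : ι → AddMonoidAlgebra ℝ (ι → ℕ), ∏ j, (1 - y j)
      = ∑ G : Finset ι, (-1 : ℝ) ^ G.card • ∏ j ∈ G, y j := fun y => by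
    simp only [sub_eq_add_neg]
    rw [Finset.prod_one_add, Finset.powerset_univ]
    refine Finset.sum_congr rfl fun G _ => ?_
    rw [Finset.prod_neg, Algebra.smul_def, map_pow, map_neg, map_one]
  have key : (∏ j, ∑ k ∈ Finset.range N, x j ^ k) * ∏ j, (1 - x j) = ∏ j, (1 - x j ^ N) := by
    rw [← Finset.prod_mul_distrib]
    exact Finset.prod_congr rfl fun j _ => geom_sum_mul_neg (x j) N
  rw [hone, hone, Finset.prod_univ_sum, Finset.sum_mul_sum] at key
  have h := congrArg L key
  have hx : ∀ (α : ι → ℕ) (G : Finset ι), (∏ j, x j ^ α j) * ∏ j ∈ G, x j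
      = ∏ j, x j ^ (α + fun j => if j ∈ G then 1 else 0 : ι → ℕ) j := fun α G => by
    simp only [Pi.add_apply, pow_add, Finset.prod_mul_distrib, pow_ite, pow_one, pow_zero,
      Finset.prod_ite_mem, Finset.univ_inter]
  have hx' : ∀ G : Finset ι, ∏ j ∈ G, x j ^ N = ∏ j, x j ^ (if j ∈ G then N else 0) := fun G => by
    simp only [pow_ite, pow_zero, Finset.prod_ite_mem, Finset.univ_inter]
  simp only [map_sum, map_smul, mul_smul_comm, hx, hx', hL, smul_eq_mul] at h
  exact h

end Telescoping
/-! ### The dilation map is an isometry -/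

section BoxSums
open Filter Topology
variable {ι : Type} [Fintype ι] [DecidableEq ι]

theorem tendsto_box : Tendsto (fun N => Fintype.piFinset fun _ : ι => Finset.range N)
    atTop (atTop : Filter (Finset (ι → ℕ))) := by
  refine tendsto_atTop_finset_of_monotone (fun N N' h => ?_) fun α => ?_
  · exact Fintype.piFinset_subset _ _ fun _ => Finset.range_subset_range.mpr h
  · refine ⟨∑ j, α j + 1, Fintype.mem_piFinset.mpr fun j => Finset.mem_range.mpr ?_⟩
    exact Nat.lt_succ_of_le (Finset.single_le_sum (f := α) (fun _ _ => Nat.zero_le _)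
      (Finset.mem_univ j))

theorem hasSum_of_tendsto_box {f : (ι → ℕ) → ℝ} (hf : ∀ α, 0 ≤ f α) {s : ℝ}
    (h : Tendsto (fun N => ∑ α ∈ Fintype.piFinset fun _ : ι => Finset.range N, f α) atTop (𝓝 s)) :
    HasSum f s := by
  have hm : Monotone fun N => ∑ α ∈ Fintype.piFinset fun _ : ι => Finset.range N, f α :=
    fun N N' hN => Finset.sum_le_sum_of_subset_of_nonneg
      (Fintype.piFinset_subset _ _ fun _ => Finset.range_subset_range.mpr hN) fun α _ _ => hf α
  have hs : Summable f := summable_of_sum_le hf (c := s) fun t => by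
    obtain ⟨N, hN⟩ := (tendsto_box.eventually (eventually_ge_atTop t)).exists
    exact (Finset.sum_le_sum_of_subset_of_nonneg hN fun α _ _ => hf α).trans
      (hm.ge_of_tendsto h N)
  have := tendsto_nhds_unique (hs.hasSum.comp tendsto_box) h
  exact this ▸ hs.hasSum

/-- The alternating differences of a function on `ℕ^ι` sum to its value at the origin, if its values
at the other corners of the cubes `[0, N]^ι` tend to `0`. -/
theorem hasSum_alternating {c : (ι → ℕ) → ℝ} {f : (ι → ℕ) → ℝ} (hf : ∀ α, 0 ≤ f α)
    (hfc : ∀ α, f α = ∑ G : Finset ι, (-1 : ℝ) ^ G.card * c (α + fun j => if j ∈ G then 1 else 0))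
    (hc : ∀ G : Finset ι, G.Nonempty →
      Tendsto (fun N => c (fun j => if j ∈ G then N else 0)) atTop (𝓝 0)) :
    HasSum f (c 0) := by
  refine hasSum_of_tendsto_box hf ?_
  simp only [hfc, sum_alternating]
  have h : ∀ G : Finset ι, Tendsto (fun N => (-1 : ℝ) ^ G.card * c (fun j => if j ∈ G then N else 0))
      atTop (𝓝 (if G = ∅ then c 0 else 0)) := fun G => by
    split_ifs with hG
    · subst hG
      simp only [Finset.card_empty, pow_zero, one_mul, Finset.notMem_empty, if_false]
      exact tendsto_const_nhds
    · have := (hc G (Finset.nonempty_iff_ne_empty.mpr hG)).const_mul ((-1 : ℝ) ^ G.card)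
      rwa [mul_zero] at this
  have := tendsto_finsetSum Finset.univ fun G _ => h G
  rwa [Finset.sum_ite_eq' Finset.univ ∅ (fun _ => c 0), if_pos (Finset.mem_univ _)] at this

end BoxSums

section DilationIsometry
variable {M : Type u} [CStarAlgebra M] [PartialOrder M] [StarOrderedRing M]
open Filter Topology

namespace ProductSystem
open PreProductSystem
variable {m : ℕ} {S : ProductSystem M (m + 2)} {H : HRep M} {T : ∀ i, S.E i →ₗ[ℂ] (H →L[ℂ] H)}

theorem norm_adj_append_le (hT : S.IsRep H T) (u v : List (Fin (m + 2))) (h : H) :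
    ‖(S.repWord T (u ++ v)).adj h‖ ≤ ‖(S.repWord T u).adj h‖ := by
  rw [repWord_append, HHom.adj_comp, HHom.comp_apply]
  refine HHom.adj_apply_norm_le ?_ _
  refine HHom.comp_norm_le_one (wordMap_norm_le_one (hT.repWord_norm_le_one v) u) ?_
  exact ContinuousLinearMap.opNorm_le_bound _ zero_le_one fun x => by
    rw [one_mul]
    exact (HHom.isIsometry_iff_norm.mp (S.wordAppend_isUnitary v u).isIsometry x).le

theorem norm_adj_perm (hT : S.IsRep H T) {w w' : List (Fin (m + 2))} (hw : w.Perm w') (h : H) :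
    ‖(S.repWord T w).adj h‖ = ‖(S.repWord T w').adj h‖ := by
  rw [← sq_eq_sq₀ (norm_nonneg _) (norm_nonneg _), ← inner_conj_id, ← inner_conj_id,
    conj_perm hT (hT.ccRep 0).normal hw]

/-- Since all the operators are contractions, `T̃_w* h` is bounded by the power of a single letter.
-/
theorem norm_adj_le_replicate (hT : S.IsRep H T) {w : List (Fin (m + 2))} {i : Fin (m + 2)} {N : ℕ}
    (hN : N ≤ w.count i) (h : H) :
    ‖(S.repWord T w).adj h‖ ≤ ‖(S.repWord T (List.replicate N i)).adj h‖ := by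
  obtain ⟨v, hv⟩ := (List.replicate_sublist_iff.mpr hN).exists_perm_append
  rw [norm_adj_perm hT hv]
  exact norm_adj_append_le hT _ _ _

theorem le_count_fockWord (β : Fin (m + 1) → ℕ) (j : Fin (m + 1)) :
    β j ≤ (fockWord β).count j.castSucc := by
  rw [count_fockWord]
  refine le_trans ?_ (Finset.single_le_sum (f := fun k => β k * (genWord m k).count j.castSucc)
    (fun _ _ => Nat.zero_le _) (Finset.mem_univ j))
  refine Nat.le_mul_of_pos_right _ (List.count_pos_iff.mpr ?_)
  rw [genWord]
  split_ifs with h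
  · subst h; simp
  · simp

/-- The word of a set of generators. -/
theorem fockWord_indicator_perm (α : Fin (m + 1) → ℕ) (G : Finset (Fin (m + 1)))
    (w : Fin (m + 2) → List (Fin (m + 2))) (hw : ∀ j : Fin (m + 1), w j.castSucc = genWord m j) :
    (fockWord α ++ (G.map Fin.castSuccEmb).sort.flatMap w).Perm
      (fockWord (α + fun j => if j ∈ G then 1 else 0)) := by
  rw [List.perm_iff_count]
  intro a
  have hp : ((G.map Fin.castSuccEmb).sort (· ≤ ·)).Perm (G.toList.map Fin.castSucc) := by
    rw [← Multiset.coe_eq_coe, Finset.sort_eq, Finset.map_val, ← Multiset.map_coe,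
      Finset.coe_toList]
    rfl
  rw [List.count_append, (hp.flatMap_right w).count_eq, count_fockWord, count_fockWord,
    List.flatMap_map, List.count_flatMap]
  simp only [Pi.add_apply, add_mul, Finset.sum_add_distrib, ite_mul, one_mul, zero_mul,
    Finset.sum_ite_mem, Finset.univ_inter, Function.comp_def, hw]
  congr 1
  exact Finset.sum_map_toList G _

theorem powerset_erase_last : (Finset.univ.erase (Fin.last (m + 1))).powerset
    = (Finset.univ : Finset (Finset (Fin (m + 1)))).map (Finset.mapEmbedding Fin.castSuccEmb).toEmbedding := by
  have h : Finset.univ.erase (Fin.last (m + 1)) = (Finset.univ : Finset (Fin (m + 1))).map Fin.castSuccEmb := by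
    ext i
    refine Fin.lastCases ?_ (fun j => ?_) i
    · simp
    · simp [Fin.castSucc_ne_last]
  rw [h]
  ext G
  rw [Finset.mem_powerset, Finset.subset_map_iff, Finset.mem_map]
  constructor
  · rintro ⟨u, -, rfl⟩
    exact ⟨u, Finset.mem_univ _, rfl⟩
  · rintro ⟨u, -, rfl⟩
    exact ⟨u, Finset.subset_univ _, rfl⟩

/-- The terms of the series for `‖Π h‖²` are the alternating differences of `β ↦ ‖T̃^{(β)}* h‖²`. -/
theorem conj_szegoFstLast (hT : S.IsRep H T) (α : Fin (m + 1) → ℕ) (h : H) :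
    (inner ℂ h (S.conj T (fockWord α) (S.szegoFstLast T) h) : ℂ).re
      = ∑ G : Finset (Fin (m + 1)), (-1 : ℝ) ^ G.card
        * ‖(S.repWord T (fockWord (α + fun j => if j ∈ G then 1 else 0))).adj h‖ ^ 2 := by
  rw [szegoFstLast, conj_szego, powerset_erase_last, Finset.sum_map]
  have h1 : ∀ (s : Finset (Finset (Fin (m + 1)))) (f : Finset (Fin (m + 1)) → HHom H H),
      (inner ℂ h ((∑ G ∈ s, f G) h) : ℂ).re = ∑ G ∈ s, (inner ℂ h (f G h) : ℂ).re := fun s f => by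
    rw [HHom.toCLM_sum, sum_apply, inner_sum, Complex.re_sum]
  rw [h1]
  refine Finset.sum_congr rfl fun G _ => ?_
  have h2 : ∀ (k : ℕ) (f : HHom H H), (inner ℂ h (((-1 : ℂ) ^ k • f) h) : ℂ).re
      = (-1 : ℝ) ^ k * (inner ℂ h (f h) : ℂ).re := fun k f => by
    change (inner ℂ h ((-1 : ℂ) ^ k • f h) : ℂ).re = _
    rw [inner_smul_right, show ((-1 : ℂ) ^ k) = ((((-1 : ℝ) ^ k : ℝ)) : ℂ) by push_cast; rfl,
      Complex.re_ofReal_mul]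
  rw [h2]
  congr 1
  · simp
  · rw [inner_conj_id]
    congr 1
    refine norm_adj_perm hT (fockWord_indicator_perm α G _ fun j => ?_) h
    rw [genWord]
    simp [Fin.castSucc_eq_zero_iff]

/-- `‖Π h‖² = ‖h‖²`: the alternating differences of `β ↦ ‖T̃^{(β)}* h‖²` sum to the value at the
origin, because the values at the other corners of the cubes tend to `0` by purity. -/
theorem hasSum_norm_sq (hT : S.IsClassT T) (ℰ : HRep M) (h : H) :
    HasSum (fun α : Fin (m + 1) → ℕ => ‖S.wordMap (S.vecLast T ℰ) (fockWord α)
      ((S.repWord T (fockWord α)).adj h)‖ ^ 2) (‖h‖ ^ 2) := by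
  have e0 : ‖(S.repWord T (fockWord (0 : Fin (m + 1) → ℕ))).adj h‖ ^ 2 = ‖h‖ ^ 2 := by
    have : fockWord (0 : Fin (m + 1) → ℕ) = [] := by simp [fockWord]
    rw [this]
    change ‖(HHom.id H).adj h‖ ^ 2 = _
    rw [HHom.adj_id]; rfl
  rw [← e0]
  refine hasSum_alternating (c := fun β => ‖(S.repWord T (fockWord β)).adj h‖ ^ 2)
    (fun _ => sq_nonneg _) (fun α => ?_) fun G ⟨j, hj⟩ => ?_
  · rw [norm_sq_wordMap_adj, vecLast_adj_comp hT, conj_szegoFstLast hT.isRep]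
  · have hp := hT.pure j.castSucc (Fin.castSucc_lt_last j).ne h h
    have hp' : Tendsto (fun N => ‖(S.repWord T (List.replicate N j.castSucc)).adj h‖ ^ 2)
        atTop (𝓝 0) := by
      have := (Complex.continuous_re.tendsto _).comp hp
      refine this.congr fun N => ?_
      rw [HHom.norm_sq_eq, HHom.adj_adj]; rfl
    refine squeeze_zero (fun _ => sq_nonneg _) (fun N => ?_) hp'
    refine pow_le_pow_left₀ (norm_nonneg _) (norm_adj_le_replicate hT.isRep ?_ h) 2
    refine le_trans (le_of_eq ?_) (le_count_fockWord _ j)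
    rw [if_pos hj]

end ProductSystem

namespace PreProductSystem.DilationData
variable {m : ℕ} {S : ProductSystem M (m + 2)} {H : HRep M}
  {T : ∀ i, S.E i →ₗ[ℂ] (H →L[ℂ] H)} (d : S.DilationData T)

theorem dilation_hasSum (hT : S.IsClassT T) (h : H) :
    HasSum (fun α => ‖((S.wordMap (d.V.comp (S.defFstLast T).toClosure) (fockWord α)).comp
      (S.repWord T (fockWord α)).adj) h‖ ^ 2) (‖h‖ ^ 2) := by
  rw [d.V_comp]
  exact ProductSystem.hasSum_norm_sq hT d.ℰ₁ h

theorem dilationMap_isIsometry (hT : S.IsClassT T) : d.dilationMap.IsIsometry :=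
  HHom.ofComponents_isIsometry (d.dilation_hasSum hT)

theorem hasComponents (hT : S.IsClassT T) : d.HasComponents := fun α => by
  rw [← d.V_comp]
  exact HHom.eval_ofComponents (d.dilation_hasSum hT) α

end PreProductSystem.DilationData
end DilationIsometry
/-! ### The isometric representation -/

section Representation
variable {M : Type u} [CStarAlgebra M] [PartialOrder M] [StarOrderedRing M]

/-- A commuting family of isometries `E_i ⊗ K → K` is an isometric representation. -/
theorem ProductSystem.isIsometricRep_ofTilde {n : ℕ} (S : ProductSystem M n) {K : HRep M}
    (hK : K.Normal) (f : ∀ i, HHom ((S.E i).tens K) K) (hf : ∀ i, (f i).IsIsometry)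
    (hc : ∀ i j, (f i).comp ((S.E i).map (f j))
      = (f j).comp (((S.E j).map (f i)).comp (S.swap i j K))) :
    S.IsIsometricRep K (fun i => ofTilde (f i)) where
  left :=
    { ccRep := fun i => isCCRep_ofTilde hK (hf i)
      commute := fun i j => by
        rw [tilde_ofTilde, tilde_ofTilde]
        exact hc i j }
  right i := isIsometric_ofTilde (hf i)

/-- The commutation relation of two operators is symmetric. -/
theorem ProductSystem.commute_symm {n : ℕ} (S : ProductSystem M n) {K : HRep M}
    (hK : K.Normal) {i j : Fin n} {f : HHom ((S.E i).tens K) K} {g : HHom ((S.E j).tens K) K}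
    (h : f.comp ((S.E i).map g) = g.comp (((S.E j).map f).comp (S.swap i j K))) :
    g.comp ((S.E j).map f) = f.comp (((S.E i).map g).comp (S.swap j i K)) := by
  rw [← HHom.comp_assoc, h, HHom.comp_assoc, HHom.comp_assoc, S.swap_swap _ _ hK, HHom.comp_id]

namespace PreProductSystem.DilationData
variable {m : ℕ} {S : ProductSystem M (m + 2)} {H : HRep M}
  {T : ∀ i, S.E i →ₗ[ℂ] (H →L[ℂ] H)} (d : S.DilationData T)

/-- The operators of the dilation. -/
noncomputable def dilOp (i : Fin (m + 2)) : HHom ((S.E i).tens d.K) d.K :=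
  Fin.lastCases (motive := fun i => HHom ((S.E i).tens d.K) d.K) d.τₙ
    (fun j => Fin.cases (motive := fun j => HHom ((S.E j.castSucc).tens d.K) d.K) d.τ₁ d.L j) i

theorem dilOp_last : d.dilOp (Fin.last (m + 1)) = d.τₙ := Fin.lastCases_last ..

theorem dilOp_zero : d.dilOp 0 = d.τ₁ :=
  Fin.lastCases_castSucc (motive := fun i => HHom ((S.E i).tens d.K) d.K) (last := d.τₙ) (i := 0) ..

theorem dilOp_mid (k : Fin m) : d.dilOp k.succ.castSucc = d.L k :=
  Fin.lastCases_castSucc (motive := fun i => HHom ((S.E i).tens d.K) d.K) (last := d.τₙ)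
    (i := k.succ) ..

/-- The indices are the first, the last and the middle ones. -/
@[elab_as_elim]
theorem index_cases {P : Fin (m + 2) → Prop} (h0 : P 0) (hl : P (Fin.last (m + 1)))
    (hm : ∀ k : Fin m, P k.succ.castSucc) (i : Fin (m + 2)) : P i :=
  Fin.lastCases hl (fun j => Fin.cases h0 hm j) i

theorem genWord_succ (k : Fin m) : [k.succ.castSucc] = genWord m k.succ :=
  (if_neg (Fin.succ_ne_zero k)).symm

theorem τ₁_comp_τₙ (hH : H.Normal) : d.τ₁.comp ((S.E 0).map d.τₙ) = d.L₁ := by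
  rw [d.τ₁_eq hH, d.τₙ_eq hH]
  exact d.isPair.op₁_comp_opₙ (d.D_normal hH)

theorem τₙ_comp_τ₁ (hH : H.Normal) : d.τₙ.comp ((S.E (Fin.last (m + 1))).map d.τ₁)
    = d.L₁.comp (S.swap (Fin.last (m + 1)) 0 d.K) := by
  rw [d.τ₁_eq hH, d.τₙ_eq hH]
  exact d.isPair.opₙ_comp_op₁ (d.D_normal hH)

theorem τ₁_isIsometry (hH : H.Normal) : d.τ₁.IsIsometry := by
  rw [d.τ₁_eq hH]; exact ProductSystem.op_isIsometry _ (d.D_normal hH)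

theorem τₙ_isIsometry (hH : H.Normal) : d.τₙ.IsIsometry := by
  rw [d.τₙ_eq hH]; exact ProductSystem.op_isIsometry _ (d.D_normal hH)

theorem L_eq (hH : H.Normal) (k : Fin m) :
    d.L k = (S.createMult d.D _ _ (genWord_succ k)).op :=
  S.create_eq_op (d.D_normal hH) _ _ (genWord_succ k)

theorem L_isIsometry (hH : H.Normal) (k : Fin m) : (d.L k).IsIsometry := by
  rw [d.L_eq hH]; exact ProductSystem.op_isIsometry _ (d.D_normal hH)

theorem dilOp_isIsometry (hH : H.Normal) (i : Fin (m + 2)) : (d.dilOp i).IsIsometry := by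
  refine index_cases ?_ ?_ (fun k => ?_) i
  · rw [dilOp_zero]; exact d.τ₁_isIsometry hH
  · rw [dilOp_last]; exact d.τₙ_isIsometry hH
  · rw [dilOp_mid]; exact d.L_isIsometry hH k

/-- Creation operators of the middle letters commute with all multipliers. -/
theorem L_comp_op (hH : H.Normal) (k : Fin m) {i : Fin (m + 2)} {u : List (Fin (m + 2))}
    {j : Fin (m + 1)} (b : Mult S.toPreProductSystem d.D [i] u j)
    {f : HHom ((S.E i).tens d.K) d.K} (hf : f = b.op) :
    (d.L k).comp ((S.E k.succ.castSucc).map f)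
      = f.comp (((S.E i).map (d.L k)).comp (S.swap k.succ.castSucc i d.K)) := by
  subst hf
  exact ProductSystem.create_comp_op (d.D_normal hH) (genWord_succ k) b

theorem dilOp_commute (hH : H.Normal) (i j : Fin (m + 2)) :
    (d.dilOp i).comp ((S.E i).map (d.dilOp j))
      = (d.dilOp j).comp (((S.E j).map (d.dilOp i)).comp (S.swap i j d.K)) := by
  have hK : d.K.Normal := S.fock_normal (d.D_normal hH)
  have hself : ∀ i, (d.dilOp i).comp ((S.E i).map (d.dilOp i))
      = (d.dilOp i).comp (((S.E i).map (d.dilOp i)).comp (S.swap i i d.K)) := fun i => by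
    rw [S.swap_self i hK, HHom.comp_id]
  have hmid : ∀ (k : Fin m) (j : Fin (m + 2)),
      (d.dilOp k.succ.castSucc).comp ((S.E k.succ.castSucc).map (d.dilOp j))
      = (d.dilOp j).comp (((S.E j).map (d.dilOp k.succ.castSucc)).comp
        (S.swap k.succ.castSucc j d.K)) := fun k j => by
    rw [dilOp_mid]
    refine index_cases ?_ ?_ (fun l => ?_) j
    · rw [dilOp_zero]; exact d.L_comp_op hH k d.isPair.mult₁ (d.τ₁_eq hH)
    · rw [dilOp_last]; exact d.L_comp_op hH k (d.isPair.multₙ (d.D_normal hH)) (d.τₙ_eq hH)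
    · rw [dilOp_mid]; exact d.L_comp_op hH k (S.createMult d.D _ _ (genWord_succ l)) (d.L_eq hH l)
  have hends : (d.dilOp (Fin.last (m + 1))).comp ((S.E (Fin.last (m + 1))).map (d.dilOp 0))
      = (d.dilOp 0).comp (((S.E 0).map (d.dilOp (Fin.last (m + 1)))).comp
        (S.swap (Fin.last (m + 1)) 0 d.K)) := by
    rw [dilOp_zero, dilOp_last, d.τₙ_comp_τ₁ hH, ← HHom.comp_assoc, d.τ₁_comp_τₙ hH]
  revert j
  refine index_cases ?_ ?_ (fun k => hmid k) i <;> intro j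
  · refine index_cases (hself 0) (S.commute_symm hK hends) (fun k => S.commute_symm hK (hmid k 0)) j
  · exact index_cases hends (hself _) (fun k => S.commute_symm hK (hmid k _)) j

end PreProductSystem.DilationData
end Representation
/-! ### The Cantor–Bernstein theorem for representations -/

section CantorBernstein
variable {M : Type u} [CStarAlgebra M] [PartialOrder M] [StarOrderedRing M]
variable {X Y Z W : HRep M}

theorem HRep.inner_act_left (X : HRep M) (a : M) (x y : X) :
    (inner ℂ (X.act a x) y : ℂ) = inner ℂ x (X.act (star a) y) := by
  rw [map_star, ContinuousLinearMap.star_eq_adjoint, ContinuousLinearMap.adjoint_inner_right]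

theorem HRep.act_mem_orthogonal {P : Submodule ℂ X} (hi : ∀ a, ∀ x ∈ P, X.act a x ∈ P) (a : M)
    {x : X} (hx : x ∈ Pᗮ) : X.act a x ∈ Pᗮ := by
  rw [Submodule.mem_orthogonal] at hx ⊢
  intro y hy
  rw [← star_star a, ← X.inner_act_left]
  exact hx _ (hi _ _ hy)

/-- The orthogonal projection onto a closed invariant subspace. -/
theorem HHom.exists_proj {P : Submodule ℂ X} (hc : IsClosed (P : Set X))
    (hi : ∀ a, ∀ x ∈ P, X.act a x ∈ P) :
    ∃ p : HHom X X, (∀ x, p x ∈ P) ∧ ∀ x, x - p x ∈ Pᗮ := by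
  have : CompleteSpace P := hc.completeSpace_coe
  refine ⟨⟨P.starProjection, fun a x => ?_⟩, fun x => P.starProjection_apply_mem x,
    fun x => P.sub_starProjection_mem_orthogonal x⟩
  refine Submodule.eq_starProjection_of_mem_orthogonal (hi a _ (P.starProjection_apply_mem x)) ?_
  rw [← map_sub]
  exact HRep.act_mem_orthogonal hi a (P.sub_starProjection_mem_orthogonal x)

theorem HHom.IsIsometry.isClosed_map {f : HHom X Y} (hf : f.IsIsometry) {P : Submodule ℂ X}
    (hc : IsClosed (P : Set X)) : IsClosed (P.map (f.toCLM : X →ₗ[ℂ] Y) : Set Y) := by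
  rw [Submodule.map_coe]
  exact (Isometry.isClosedEmbedding hf).isClosedMap _ hc

/-- `P ↦ (g((f P)ᗮ))ᗮ`, for intertwining operators `f : X → Y` and `g : Y → X`. -/
noncomputable def bernsteinMap (f : HHom X Y) (g : HHom Y X) : Submodule ℂ X →o Submodule ℂ X where
  toFun P := ((P.map (f.toCLM : X →ₗ[ℂ] Y))ᗮ.map (g.toCLM : Y →ₗ[ℂ] X))ᗮ
  monotone' _ _ h := Submodule.orthogonal_le (Submodule.map_mono (Submodule.orthogonal_le
    (Submodule.map_mono h)))

theorem mem_bernsteinMap {f : HHom X Y} {g : HHom Y X} {P : Submodule ℂ X} {x : X} :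
    x ∈ bernsteinMap f g P ↔ ∀ z, (∀ y ∈ P, (inner ℂ (f y) z : ℂ) = 0) → inner ℂ (g z) x = (0 : ℂ) := by
  change x ∈ ((P.map (f.toCLM : X →ₗ[ℂ] Y))ᗮ.map (g.toCLM : Y →ₗ[ℂ] X))ᗮ ↔ _
  rw [Submodule.mem_orthogonal]
  constructor
  · intro h z hz
    refine h _ ⟨z, ?_, rfl⟩
    rw [SetLike.mem_coe, Submodule.mem_orthogonal]
    rintro _ ⟨y, hy, rfl⟩
    exact hz y hy
  · rintro h _ ⟨z, hz, rfl⟩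
    rw [SetLike.mem_coe, Submodule.mem_orthogonal] at hz
    exact h z fun y hy => hz _ ⟨y, hy, rfl⟩

/-- The least fixed point of the Cantor–Bernstein map is a subrepresentation. -/
theorem lfp_bernsteinMap_invariant (f : HHom X Y) (g : HHom Y X) (a : M) {x : X}
    (hx : x ∈ (bernsteinMap f g).lfp) : X.act a x ∈ (bernsteinMap f g).lfp := by
  set P := (bernsteinMap f g).lfp with hP
  have hfix : bernsteinMap f g P = P := (bernsteinMap f g).map_lfp
  -- the largest invariant subspace of `P` is mapped into itself
  let Q : Submodule ℂ X := ⨅ a : M, P.comap (X.act a : X →ₗ[ℂ] X)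
  have hQ : ∀ y, y ∈ Q ↔ ∀ a, X.act a y ∈ P := fun y => by
    simp only [Q, Submodule.mem_iInf]; rfl
  have hle : P ≤ Q := OrderHom.lfp_le _ fun y hy => by
    rw [hQ]
    intro b
    rw [mem_bernsteinMap] at hy
    rw [← hfix, mem_bernsteinMap]
    intro z hz
    rw [← star_star b, ← X.inner_act_left, ← g.comm]
    refine hy _ fun q hq => ?_
    rw [← Y.inner_act_left, ← f.comm]
    exact hz _ ((hQ q).mp hq b)
  exact (hQ x).mp (hle hx) a

/-- Two representations that embed isometrically into each other are unitarily equivalent. -/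
theorem HHom.exists_unitary_of_isometries {f : HHom X Y} (hf : f.IsIsometry) {g : HHom Y X}
    (hg : g.IsIsometry) : ∃ U : HHom X Y, U.IsUnitary := by
  set P := (bernsteinMap f g).lfp with hP
  have hfix : ((P.map (f.toCLM : X →ₗ[ℂ] Y))ᗮ.map (g.toCLM : Y →ₗ[ℂ] X))ᗮ = P :=
    (bernsteinMap f g).map_lfp
  have hPc : IsClosed (P : Set X) := by rw [← hfix]; exact Submodule.isClosed_orthogonal _
  obtain ⟨p, hp, hp'⟩ := HHom.exists_proj hPc fun a x hx => lfp_bernsteinMap_invariant f g a hx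
  have hperp : Pᗮ = (P.map (f.toCLM : X →ₗ[ℂ] Y))ᗮ.map (g.toCLM : Y →ₗ[ℂ] X) := by
    conv_lhs => rw [← hfix]
    rw [Submodule.orthogonal_orthogonal_eq_closure]
    exact (hg.isClosed_map (Submodule.isClosed_orthogonal _)).submodule_topologicalClosure_eq
  have hgg : ∀ z, g.adj (g z) = z := fun z => HHom.congr_hom (HHom.isIsometry_iff.mp hg) z
  have hU : ∀ x z, (∀ y ∈ P, (inner ℂ (f y) z : ℂ) = 0) → x - p x = g z →
      (f.comp p + g.adj.comp (HHom.id X - p)) x = f (p x) + z := fun x z _ h => by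
    have : (HHom.id X - p) x = x - p x := HHom.sub_apply _ _ _
    rw [HHom.add_apply, HHom.comp_apply, HHom.comp_apply, this, h, hgg]
  refine ⟨f.comp p + g.adj.comp (HHom.id X - p), ?_, fun y => ?_⟩
  · refine HHom.isIsometry_iff_norm.mpr fun x => ?_
    obtain ⟨z, hz, hzx⟩ := hperp ▸ hp' x
    have hz' : ∀ y ∈ P, (inner ℂ (f y) z : ℂ) = 0 := fun y hy =>
      (Submodule.mem_orthogonal _ _).mp hz _ ⟨y, hy, rfl⟩
    rw [hU x z hz' hzx.symm]
    refine (sq_eq_sq₀ (norm_nonneg _) (norm_nonneg _)).mp ?_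
    have e1 := norm_add_sq_eq_norm_sq_add_norm_sq_of_inner_eq_zero (f (p x)) z (hz' _ (hp x))
    have e2 := norm_add_sq_eq_norm_sq_add_norm_sq_of_inner_eq_zero (𝕜 := ℂ) (p x) (x - p x)
      ((Submodule.mem_orthogonal _ _).mp (hp' x) _ (hp x))
    rw [add_sub_cancel] at e2
    have e3 : ‖x - p x‖ = ‖z‖ := by rw [← hzx]; exact HHom.isIsometry_iff_norm.mp hg z
    rw [sq, sq, e1, e2, e3, HHom.isIsometry_iff_norm.mp hf]
  · have hc := hf.isClosed_map hPc
    have : CompleteSpace (P.map (f.toCLM : X →ₗ[ℂ] Y)) := hc.completeSpace_coe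
    obtain ⟨_, ⟨q, hq, rfl⟩, z, hz, rfl⟩ :=
      (P.map (f.toCLM : X →ₗ[ℂ] Y)).exists_add_mem_mem_orthogonal y
    have hz' : ∀ y ∈ P, (inner ℂ (f y) z : ℂ) = 0 := fun y hy =>
      (Submodule.mem_orthogonal _ _).mp hz _ ⟨y, hy, rfl⟩
    have hgz : g z ∈ Pᗮ := hperp ▸ ⟨z, hz, rfl⟩
    have hpq : p (q + g z) = q := by
      have h1 : q - p (q + g z) ∈ P := P.sub_mem hq (hp _)
      have h2 : q - p (q + g z) ∈ Pᗮ := by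
        have := Pᗮ.sub_mem (hp' (q + g z)) hgz
        rwa [show q + g z - p (q + g z) - g z = q - p (q + g z) by abel] at this
      have := (Submodule.mem_orthogonal _ _).mp h2 _ h1
      exact (sub_eq_zero.mp (inner_self_eq_zero.mp this)).symm
    refine ⟨q + g z, (hU _ z hz' ?_).trans ?_⟩
    · rw [hpq]; abel
    · rw [hpq]; rfl

end CantorBernstein
/-! ### Suprema and faithful normal representations -/

section Vigier
open Filter Topology

/-- Bounded operators that converge in the sense of the weak operator topology have a limit. -/
theorem exists_weak_limit {K ι : Type*} [NormedAddCommGroup K] [InnerProductSpace ℂ K]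
    [CompleteSpace K] {l : Filter ι} [l.NeBot] {T : ι → K →L[ℂ] K} {C : ℝ} (hC : ∀ᶠ i in l, ‖T i‖ ≤ C)
    (h : ∀ x y, ∃ z : ℂ, Tendsto (fun i => inner ℂ (T i x) y) l (𝓝 z)) :
    ∃ A : K →L[ℂ] K, ∀ x y, Tendsto (fun i => inner ℂ (T i x) y) l (𝓝 (inner ℂ (A x) y)) := by
  choose z hz using h
  let B₀ : K →ₗ⋆[ℂ] K →ₗ[ℂ] ℂ := LinearMap.mk₂'ₛₗ (starRingEnd ℂ) (RingHom.id ℂ) z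
    (fun x x' y => tendsto_nhds_unique (hz (x + x') y) (by
      simpa only [map_add, inner_add_left] using (hz x y).add (hz x' y)))
    (fun c x y => tendsto_nhds_unique (hz (c • x) y) (by
      simpa only [map_smul, inner_smul_left, smul_eq_mul] using (hz x y).const_mul _))
    (fun x y y' => tendsto_nhds_unique (hz x (y + y')) (by
      simpa only [inner_add_right] using (hz x y).add (hz x y')))
    (fun c x y => tendsto_nhds_unique (hz x (c • y)) (by
      simpa only [inner_smul_right, smul_eq_mul, RingHom.id_apply] using (hz x y).const_mul c))
  have hb : ∀ x y, ‖B₀ x y‖ ≤ C * ‖x‖ * ‖y‖ := fun x y =>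
    le_of_tendsto (hz x y).norm (hC.mono fun i hi =>
      (norm_inner_le_norm _ _).trans (mul_le_mul_of_nonneg_right ((T i).le_of_opNorm_le hi x)
        (norm_nonneg _)))
  refine ⟨InnerProductSpace.continuousLinearMapOfBilin (B₀.mkContinuous₂ C hb), fun x y => ?_⟩
  rw [InnerProductSpace.continuousLinearMapOfBilin_apply]
  exact hz x y

variable {M : Type u} [CStarAlgebra M] [PartialOrder M] [StarOrderedRing M]

theorem HRep.inner_act_eq_re (Y : HRep M) {a : M} (ha : IsSelfAdjoint a) (h : Y) :
    (inner ℂ (Y.act a h) h : ℂ) = ((inner ℂ h (Y.act a h) : ℂ).re : ℂ) := by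
  have e : (inner ℂ (Y.act a h) h : ℂ) = inner ℂ h (Y.act a h) := by
    rw [Y.inner_act_left, ha.star_eq]
  rw [e]
  refine (Complex.conj_eq_iff_re.mp ?_).symm
  rw [inner_conj_symm, e]

/-- A bounded increasing net of selfadjoint elements converges weakly in every representation. -/
theorem HRep.exists_weak_sup (Y : HRep M) {S : Set M} {b : M} (hS : S.Nonempty)
    (hd : DirectedOn (· ≤ ·) S) (hsa : ∀ s ∈ S, IsSelfAdjoint s) (hb : b ∈ upperBounds S) :
    ∃ (A : Y →L[ℂ] Y) (l : Filter S), l.NeBot ∧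
      (∀ x y, Tendsto (fun s : S => inner ℂ (Y.act s x) y) l (𝓝 (inner ℂ (A x) y))) ∧
      ∀ h, IsLUB ((fun s => (inner ℂ h (Y.act s h) : ℂ).re) '' S) (inner ℂ (A h) h : ℂ).re := by
  obtain ⟨s₀, hs₀⟩ := hS
  have : Nonempty S := ⟨⟨s₀, hs₀⟩⟩
  have : IsDirectedOrder S := ⟨fun s t => by
    obtain ⟨r, hr, h1, h2⟩ := hd s s.2 t t.2
    exact ⟨⟨r, hr⟩, h1, h2⟩⟩
  have hbound : ∀ᶠ s : S in atTop, ‖Y.act s‖ ≤ ‖b - s₀‖ + ‖Y.act s₀‖ := by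
    filter_upwards [eventually_ge_atTop (⟨s₀, hs₀⟩ : S)] with s hs
    have h1 : ‖Y.act (s - s₀)‖ ≤ ‖b - s₀‖ :=
      (NonUnitalStarAlgHom.norm_apply_le Y.act (s - s₀ : M)).trans
        (CStarAlgebra.norm_le_norm_of_nonneg_of_le (sub_nonneg.mpr hs)
          (sub_le_sub_right (hb s.2) s₀))
    calc ‖Y.act s‖ = ‖Y.act (s - s₀) + Y.act s₀‖ := by rw [map_sub, sub_add_cancel]
      _ ≤ _ := (norm_add_le _ _).trans (add_le_add_left h1 _)
  have hmono : ∀ h, Monotone fun s : S => (inner ℂ h (Y.act s h) : ℂ).re :=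
    fun h s t hst => Y.act_mono_re hst h
  have hreal : ∀ h, ∃ z : ℝ, Tendsto (fun s : S => (inner ℂ h (Y.act s h) : ℂ).re) atTop (𝓝 z) :=
    fun h => ⟨_, tendsto_atTop_ciSup (hmono h)
      ⟨(inner ℂ h (Y.act b h) : ℂ).re, by rintro _ ⟨s, rfl⟩; exact Y.act_mono_re (hb s.2) h⟩⟩
  have hdiag : ∀ h, ∃ z : ℂ, Tendsto (fun s : S => (inner ℂ (Y.act s h) h : ℂ)) atTop (𝓝 z) :=
    fun h => by
      obtain ⟨z, hz⟩ := hreal h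
      refine ⟨z, ?_⟩
      simp only [fun s : S => Y.inner_act_eq_re (hsa s s.2) h]
      exact (Complex.continuous_ofReal.tendsto z).comp hz
  obtain ⟨A, hA⟩ := exists_weak_limit hbound fun x y => by
    obtain ⟨z₁, h₁⟩ := hdiag (x + y)
    obtain ⟨z₂, h₂⟩ := hdiag (x - y)
    obtain ⟨z₃, h₃⟩ := hdiag (x + Complex.I • y)
    obtain ⟨z₄, h₄⟩ := hdiag (x - Complex.I • y)
    refine ⟨_, (((((h₁.sub h₂).sub (h₃.const_mul Complex.I)).add
      (h₄.const_mul Complex.I)).div_const 4)).congr fun s => ?_⟩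
    exact (inner_map_polarization' (Y.act s : Y →ₗ[ℂ] Y) x y).symm
  refine ⟨A, atTop, inferInstance, hA, fun h => ?_⟩
  have ht : Tendsto (fun s : S => (inner ℂ h (Y.act s h) : ℂ).re) atTop (𝓝 (inner ℂ (A h) h : ℂ).re) := by
    refine ((Complex.continuous_re.tendsto _).comp (hA h h)).congr fun s => ?_
    rw [Function.comp_apply, Y.inner_act_eq_re (hsa s s.2), Complex.ofReal_re]
  have := isLUB_of_tendsto_atTop (hmono h) ht
  rwa [Set.image_eq_range]

/-- A faithful representation reflects positivity: the negative part acts by `0`. -/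
theorem HRep.nonneg_of_act (Y : HRep M) (hY : Function.Injective Y.act) {a : M}
    (ha : IsSelfAdjoint a) (h : ∀ x, 0 ≤ (inner ℂ x (Y.act a x) : ℂ).re) : 0 ≤ a := by
  obtain ⟨p, n, hp, hn, rfl, hnp⟩ := exists_pos_neg ha
  obtain ⟨c, hc⟩ := exists_eq_star_mul hn
  have hsn : star n = n := IsSelfAdjoint.of_nonneg hn
  have hcn : c * n = 0 := hY (ContinuousLinearMap.ext fun x => by
    have h1 := h (Y.act n x)
    have e1 : (inner ℂ (Y.act n x) (Y.act (p - n) (Y.act n x)) : ℂ)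
        = - inner ℂ (Y.act n x) (Y.act n (Y.act n x)) := by
      rw [map_sub, sub_apply, inner_sub_right, sub_eq_neg_self, Y.inner_act_left, hsn,
        ← mul_apply_eq_comp, ← map_mul, hnp, map_zero]
      simp
    have e2 : (inner ℂ (Y.act n x) (Y.act n (Y.act n x)) : ℂ).re = ‖Y.act (c * n) x‖ ^ 2 := by
      conv_lhs => enter [1, 3, 1]; rw [hc]
      rw [Y.inner_act_star_mul, map_mul, mul_apply_eq_comp]
      exact (norm_sq_eq_re_inner (𝕜 := ℂ) _).symm
    rw [e1, Complex.neg_re, e2] at h1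
    have h2 : ‖Y.act (c * n) x‖ = 0 := by nlinarith [norm_nonneg (Y.act (c * n) x)]
    rw [norm_eq_zero.mp h2, map_zero]; rfl)
  have hnn : star n * n = 0 := by
    rw [hsn]
    conv_lhs => enter [1]; rw [hc]
    rw [mul_assoc, hcn, mul_zero]
  rw [(CStarRing.star_mul_self_eq_zero_iff n).mp hnn, sub_zero]
  exact hp

/-- Bounded increasing nets of selfadjoint elements have a supremum. -/
def MonotoneComplete (M : Type u) [CStarAlgebra M] [PartialOrder M] : Prop :=
  ∀ S : Set M, S.Nonempty → DirectedOn (· ≤ ·) S → (∀ s ∈ S, IsSelfAdjoint s) → BddAbove S →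
    ∃ a, IsLUB S a

/-- A `W*`-algebra is monotone complete, and has a faithful normal representation: the suprema
are limits in the weak operator topology, which belong to the bicommutant. -/
theorem IsWStar.exists_normal (hM : IsWStar M) :
    MonotoneComplete M ∧ ∃ Y : HRep M, Y.Normal ∧ Function.Injective Y.act := by
  obtain ⟨K, _, _, _, V, ⟨e⟩⟩ := hM
  let Y : HRep M := ⟨K, V.toStarSubalgebra.subtype.comp (e : M →⋆ₐ[ℂ] V.toStarSubalgebra)⟩
  have hY : Function.Injective Y.act := fun a b h => e.injective (Subtype.ext h)
  have key : ∀ (S : Set M) (b : M), S.Nonempty → DirectedOn (· ≤ ·) S →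
      (∀ s ∈ S, IsSelfAdjoint s) → b ∈ upperBounds S → ∃ a, IsLUB S a ∧ ∀ h : Y,
        IsLUB ((fun s => (inner ℂ h (Y.act s h) : ℂ).re) '' S) (inner ℂ h (Y.act a h) : ℂ).re := by
    intro S b hS hd hsa hb
    obtain ⟨A, l, _, hA, hlub⟩ := Y.exists_weak_sup hS hd hsa hb
    have hAV : A ∈ V := by
      rw [← V.commutant_commutant, VonNeumannAlgebra.mem_commutant_iff]
      intro g hg
      rw [VonNeumannAlgebra.mem_commutant_iff] at hg
      refine ContinuousLinearMap.ext fun x => ext_inner_right ℂ fun y => ?_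
      refine tendsto_nhds_unique (hA (g x) y) ?_ |>.symm
      have h2 := hA x (ContinuousLinearMap.adjoint g y)
      rw [ContinuousLinearMap.adjoint_inner_right] at h2
      refine h2.congr fun s => ?_
      rw [ContinuousLinearMap.adjoint_inner_right]
      exact congrArg (fun T : K →L[ℂ] K => (inner ℂ (T x) y : ℂ)) (hg _ (e s).2).symm
    obtain ⟨a, ha⟩ : ∃ a, Y.act a = A := ⟨e.symm ⟨A, hAV⟩, by
      change ((e (e.symm ⟨A, hAV⟩) : V.toStarSubalgebra) : K →L[ℂ] K) = A
      rw [StarAlgEquiv.apply_symm_apply]⟩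
    have hsaA : ∀ x y : Y, (inner ℂ (A x) y : ℂ) = inner ℂ x (A y) := fun x y => by
      have h1 := (Complex.continuous_conj.tendsto _).comp (hA y x)
      rw [inner_conj_symm] at h1
      refine tendsto_nhds_unique (hA x y) (h1.congr fun s => ?_)
      rw [Function.comp_apply, inner_conj_symm, Y.inner_act_left, (hsa s s.2).star_eq]
    have hasa : IsSelfAdjoint a := hY (by
      refine ContinuousLinearMap.ext fun x => ext_inner_left ℂ fun y => ?_
      rw [← Y.inner_act_left, ha, hsaA])
    have hlub' : ∀ h : Y, IsLUB ((fun s => (inner ℂ h (Y.act s h) : ℂ).re) '' S)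
        (inner ℂ h (Y.act a h) : ℂ).re := fun h => by
      rw [ha, ← hsaA]
      exact hlub h
    refine ⟨a, ⟨fun s hs => ?_, fun c hc => ?_⟩, hlub'⟩
    · refine sub_nonneg.mp (Y.nonneg_of_act hY (hasa.sub (hsa s hs)) fun x => ?_)
      rw [map_sub, sub_apply, inner_sub_right, Complex.sub_re, sub_nonneg]
      exact (hlub' x).1 ⟨s, hs, rfl⟩
    · have hcsa : IsSelfAdjoint c := by
        obtain ⟨s, hs⟩ := hS
        have := (IsSelfAdjoint.of_nonneg (sub_nonneg.mpr (hc hs))).add (hsa s hs)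
        rwa [sub_add_cancel] at this
      refine sub_nonneg.mp (Y.nonneg_of_act hY (hcsa.sub hasa) fun x => ?_)
      rw [map_sub, sub_apply, inner_sub_right, Complex.sub_re, sub_nonneg]
      refine (hlub' x).2 ?_
      rintro _ ⟨s, hs, rfl⟩
      exact Y.act_mono_re (hc hs) x
  refine ⟨fun S hS hd hsa ⟨b, hb⟩ => ?_, Y, fun S a hS hd hsa ha => ?_, hY⟩
  · obtain ⟨a, ha, -⟩ := key S b hS hd hsa hb
    exact ⟨a, ha⟩
  · obtain ⟨a', ha', h⟩ := key S a hS hd hsa ha.1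
    rwa [ha'.unique ha] at h

end Vigier
/-! ### Comparison of normal representations -/

section Comparison
variable {M : Type u} [CStarAlgebra M] [PartialOrder M] [StarOrderedRing M]
variable {X Y Z W : HRep M}

/-- The positive functional `a ↦ ⟨x, a x⟩`. -/
noncomputable def HRep.vectorForm (X : HRep M) (x : X) (a : M) : ℝ :=
  (inner ℂ x (X.act a x) : ℂ).re

theorem HRep.vectorForm_add (X : HRep M) (x : X) (a b : M) :
    X.vectorForm x (a + b) = X.vectorForm x a + X.vectorForm x b := by
  rw [vectorForm, map_add, add_apply, inner_add_right, Complex.add_re]; rfl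

theorem HRep.vectorForm_zero (X : HRep M) (x : X) : X.vectorForm x 0 = 0 := by
  rw [vectorForm, map_zero]; simp

theorem HRep.vectorForm_star_mul (X : HRep M) (x : X) (a : M) :
    X.vectorForm x (star a * a) = ‖X.act a x‖ ^ 2 := by
  rw [vectorForm, X.inner_act_star_mul]
  exact (norm_sq_eq_re_inner (𝕜 := ℂ) _).symm

theorem HRep.vectorForm_real_smul (X : HRep M) (x : X) (t : ℝ) (a : M) :
    X.vectorForm x ((t : ℂ) • a) = t * X.vectorForm x a := by
  rw [vectorForm, map_smul, smul_apply, inner_smul_right, Complex.re_ofReal_mul]; rfl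

theorem HRep.vectorForm_smul_vec (X : HRep M) (x : X) (t : ℝ) (a : M) :
    X.vectorForm ((t : ℂ) • x) a = t ^ 2 * X.vectorForm x a := by
  rw [vectorForm, map_smul, inner_smul_right, inner_smul_left, Complex.conj_ofReal,
    ← mul_assoc, ← Complex.ofReal_mul, Complex.re_ofReal_mul, ← sq]; rfl

/-- A set of elements `0 ≤ a ≤ s` that is closed under suprema of chains has a maximal element. -/
theorem MonotoneComplete.exists_maximal (hM : MonotoneComplete M) {P : M → Prop} {s : M}
    (h0 : P 0) (hP : ∀ a, P a → 0 ≤ a ∧ a ≤ s)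
    (hsup : ∀ (C : Set M) (a : M), C.Nonempty → DirectedOn (· ≤ ·) C → (∀ c ∈ C, IsSelfAdjoint c) →
      (∀ c ∈ C, P c) → IsLUB C a → P a) :
    ∃ e, P e ∧ ∀ a, 0 ≤ a → P (e + a) → a = 0 := by
  obtain ⟨e, -, he⟩ := zorn_le_nonempty₀ {a | P a} (fun C hC hchain c₀ hc₀ => by
    have hsa : ∀ c ∈ C, IsSelfAdjoint c := fun c hc => IsSelfAdjoint.of_nonneg (hP c (hC hc)).1
    obtain ⟨a, ha⟩ := hM C ⟨c₀, hc₀⟩ hchain.directedOn hsa ⟨s, fun c hc => (hP c (hC hc)).2⟩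
    exact ⟨a, hsup C a ⟨c₀, hc₀⟩ hchain.directedOn hsa (fun c hc => hC hc) ha, fun c hc => ha.1 hc⟩)
    0 h0
  refine ⟨e, he.1, fun a ha hea => ?_⟩
  have := he.2 hea (le_add_of_nonneg_right ha)
  exact le_antisymm (by simpa using this) ha

theorem exists_vectorForm_pos (hY : Function.Injective Y.act) {s : M} (hs : 0 ≤ s) (h : s ≠ 0) :
    ∃ y, 0 < Y.vectorForm y s := by
  by_contra! hn
  obtain ⟨c, rfl⟩ := exists_eq_star_mul hs
  have : c = 0 := hY (ContinuousLinearMap.ext fun y => by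
    have h1 := hn y
    rw [Y.vectorForm_star_mul] at h1
    have h2 : ‖Y.act c y‖ = 0 := by nlinarith [norm_nonneg (Y.act c y)]
    rw [norm_eq_zero.mp h2, map_zero]; rfl)
  exact h (by rw [this, mul_zero])

/-- A comparison of vector functionals: a normal representation and a faithful normal one contain
nonzero vectors `x`, `y` with `⟨x, a x⟩ ≤ ⟨y, a y⟩` for all `a ≥ 0`. -/
theorem exists_vector_le (hM : MonotoneComplete M) (hX : X.Normal) {x₀ : X} (hx₀ : x₀ ≠ 0)
    (hYn : Y.Normal) (hY : Function.Injective Y.act) :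
    ∃ (x : X) (y : Y), x ≠ 0 ∧ ∀ b, ‖X.act b x‖ ≤ ‖Y.act b y‖ := by
  set φ := X.vectorForm x₀ with hφ
  have hφ0 : ∀ a, 0 ≤ a → 0 ≤ φ a := fun a ha => X.act_nonneg_re ha x₀
  -- `s` is the complement of a maximal element at which `φ` vanishes; `φ` is faithful below `s`
  obtain ⟨e₀, ⟨he₀, he₀1, hφe₀⟩, hmax₀⟩ := hM.exists_maximal (s := 1)
    (P := fun a => 0 ≤ a ∧ a ≤ 1 ∧ φ a = 0) ⟨le_rfl, zero_le_one, X.vectorForm_zero x₀⟩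
    (fun a ha => ⟨ha.1, ha.2.1⟩) (fun C a hC hd hsa hCP ha => by
      obtain ⟨c, hc⟩ := hC
      refine ⟨(hCP c hc).1.trans (ha.1 hc), ha.2 fun c hc => (hCP c hc).2.1, ?_⟩
      refine (hX C a ⟨c, hc⟩ hd hsa ha x₀).unique ?_
      refine ⟨?_, fun z hz => ?_⟩
      · rintro _ ⟨c', hc', rfl⟩
        exact (hCP c' hc').2.2.le
      · exact (hCP c hc).2.2.symm.le.trans (hz ⟨c, hc, rfl⟩))
  set s : M := 1 - e₀ with hs
  have hs0 : 0 ≤ s := sub_nonneg.mpr he₀1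
  have hφs : 0 < φ s := by
    have h1 : φ 1 = φ s + φ e₀ := by rw [hφ, ← X.vectorForm_add, hs, sub_add_cancel]
    have h2 : φ 1 = ‖x₀‖ ^ 2 := by
      have := X.vectorForm_star_mul x₀ 1
      rwa [star_one, mul_one, map_one] at this
    have h3 : 0 < ‖x₀‖ := norm_pos_iff.mpr hx₀
    rw [hφe₀, add_zero] at h1
    rw [← h1, h2]
    positivity
  have hfaith : ∀ a, 0 ≤ a → a ≤ s → a ≠ 0 → 0 < φ a := fun a ha has hne => by
    refine lt_of_le_of_ne (hφ0 a ha) fun h => hne (hmax₀ a ha ⟨add_nonneg he₀ ha, ?_, ?_⟩)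
    · rw [← sub_add_cancel (1 : M) e₀, add_comm]
      exact add_le_add_left has e₀
    · rw [hφ, X.vectorForm_add, ← hφ, hφe₀, ← h, add_zero]
  have hsne : s ≠ 0 := fun h => by rw [h, hφ, X.vectorForm_zero] at hφs; exact lt_irrefl _ hφs
  obtain ⟨y₀, hy₀⟩ : ∃ y, φ s < Y.vectorForm y s := by
    obtain ⟨y, hy⟩ := exists_vectorForm_pos hY hs0 hsne
    refine ⟨((φ s / Y.vectorForm y s + 1 : ℝ) : ℂ) • y, ?_⟩
    rw [Y.vectorForm_smul_vec]
    have h1 : 0 < φ s / Y.vectorForm y s := div_pos hφs hy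
    have h2 : φ s / Y.vectorForm y s * Y.vectorForm y s = φ s := div_mul_cancel₀ _ hy.ne'
    nlinarith [mul_pos (mul_pos h1 h1) hy]
  set ψ := Y.vectorForm y₀ with hψ
  -- `r` is the complement in `s` of a maximal element at which `ψ ≤ φ`; below `r` the functional
  -- `φ` is dominated by `ψ`
  obtain ⟨e, ⟨he, hes, hψe⟩, hmax⟩ := hM.exists_maximal (s := s)
    (P := fun a => 0 ≤ a ∧ a ≤ s ∧ ψ a ≤ φ a)
    ⟨le_rfl, hs0, by rw [hψ, hφ, X.vectorForm_zero, Y.vectorForm_zero]⟩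
    (fun a ha => ⟨ha.1, ha.2.1⟩) (fun C a hC hd hsa hCP ha => by
      obtain ⟨c, hc⟩ := hC
      refine ⟨(hCP c hc).1.trans (ha.1 hc), ha.2 fun c hc => (hCP c hc).2.1, ?_⟩
      refine (hYn C a ⟨c, hc⟩ hd hsa ha y₀).2 ?_
      rintro _ ⟨c', hc', rfl⟩
      exact (hCP c' hc').2.2.trans ((hX C a ⟨c, hc⟩ hd hsa ha x₀).1 ⟨c', hc', rfl⟩))
  set r : M := s - e with hr
  have hr0 : 0 ≤ r := sub_nonneg.mpr hes
  have hrs : r ≤ s := sub_le_self s he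
  have hrne : r ≠ 0 := fun h => by
    rw [← sub_eq_zero.mp h] at hψe
    exact hy₀.not_ge hψe
  have hdom : ∀ c, 0 ≤ c → c ≤ r → φ c ≤ ψ c := fun c hc hcr => by
    by_contra! h
    have hc0 := hmax c hc ⟨add_nonneg he hc, ?_, ?_⟩
    · rw [hc0, hφ, hψ, X.vectorForm_zero, Y.vectorForm_zero] at h
      exact lt_irrefl _ h
    · rw [← sub_add_cancel s e, add_comm]
      exact add_le_add_left hcr e
    · rw [hφ, hψ, X.vectorForm_add, Y.vectorForm_add]
      exact add_le_add hψe h.le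
  obtain ⟨q, hq⟩ := exists_eq_star_mul hr0
  -- `(b q)* (b q) ≤ ‖b‖² r` is dominated, so that `q x₀` and `q y₀` are as required
  refine ⟨X.act q x₀, Y.act q y₀, fun h => ?_, fun b => ?_⟩
  · have h1 := hfaith r hr0 hrs hrne
    rw [hq, hφ, X.vectorForm_star_mul, h, norm_zero] at h1
    norm_num at h1
  · have hle : star (b * q) * (b * q) ≤ ((‖b‖ ^ 2 : ℝ) : ℂ) • r := by
      have h1 : star b * b ≤ algebraMap ℝ M (‖b‖ ^ 2) := by
        rw [sq, ← CStarRing.norm_star_mul_self]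
        exact IsSelfAdjoint.le_algebraMap_norm_self (.star_mul_self b)
      have h2 := star_left_conjugate_le_conjugate h1 q
      rw [star_mul, hq]
      refine le_of_eq_of_le ?_ (h2.trans (le_of_eq ?_))
      · simp only [mul_assoc]
      · rw [Algebra.algebraMap_eq_smul_one, mul_smul_comm, mul_one, smul_mul_assoc]
        rw [← Complex.coe_smul]
    have key : φ (star (b * q) * (b * q)) ≤ ψ (star (b * q) * (b * q)) := by
      have hpos : (0 : ℝ) < (‖b‖ ^ 2 + 1)⁻¹ := by positivity
      have h0 := star_mul_self_nonneg (b * q)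
      set c := star (b * q) * (b * q)
      have h1 := hdom ((((‖b‖ ^ 2 + 1)⁻¹ : ℝ) : ℂ) • c) ?_ ?_
      · rw [hφ, hψ, X.vectorForm_real_smul, Y.vectorForm_real_smul] at h1
        exact le_of_mul_le_mul_left h1 hpos
      · rw [Complex.coe_smul]
        exact smul_nonneg hpos.le h0
      · rw [Complex.coe_smul] at hle ⊢
        rw [inv_smul_le_iff_of_pos (by positivity)]
        exact hle.trans (smul_le_smul_of_nonneg_right (by linarith) hr0)
    rw [hφ, hψ, X.vectorForm_star_mul, Y.vectorForm_star_mul, map_mul, map_mul,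
      mul_apply_eq_comp, mul_apply_eq_comp] at key
    exact (sq_le_sq₀ (norm_nonneg _) (norm_nonneg _)).mp key

/-- Vectors with `⟨x, a x⟩ ≤ ⟨y, a y⟩` for `a ≥ 0` give an intertwining operator: the projection
onto the closure of the graph of `a y ↦ a x`. -/
theorem exists_ne_zero_of_vector_le {x : X} {y : Y} (hx : x ≠ 0)
    (h : ∀ b, ‖X.act b x‖ ≤ ‖Y.act b y‖) : ∃ f : HHom Y X, f ≠ 0 := by
  let g : M →ₗ[ℂ] Y.plus X :=
    { toFun := fun b => HHom.inl Y X (Y.act b y) + HHom.inr Y X (X.act b x)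
      map_add' := fun b c => by simp only [map_add, add_apply]; abel
      map_smul' := fun t b => by simp only [map_smul, smul_apply, smul_add, RingHom.id_apply] }
  have hfst : ∀ b, HHom.fst Y X (g b) = Y.act b y := fun b => by simp [g]
  have hsnd : ∀ b, HHom.snd Y X (g b) = X.act b x := fun b => by simp [g]
  let G : Submodule ℂ (Y.plus X) := (LinearMap.range g).topologicalClosure
  have hGi : ∀ a, ∀ v ∈ G, (Y.plus X).act a v ∈ G := fun a v hv => by
    refine map_mem_closure ((Y.plus X).act a).continuous hv ?_
    rintro _ ⟨b, rfl⟩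
    refine ⟨a * b, ?_⟩
    simp only [g, LinearMap.coe_mk, AddHom.coe_mk, map_add, map_mul, mul_apply_eq_comp,
      HHom.comm]
  have hGle : ∀ v ∈ G, ‖HHom.snd Y X v‖ ≤ ‖HHom.fst Y X v‖ := fun v hv => by
    refine closure_minimal (s := (LinearMap.range g : Set (Y.plus X))) ?_
      (isClosed_le (f := fun v : Y.plus X => ‖HHom.snd Y X v‖)
        (g := fun v : Y.plus X => ‖HHom.fst Y X v‖) (by fun_prop) (by fun_prop)) hv
    rintro _ ⟨b, rfl⟩
    rw [Set.mem_ofPred_eq, hfst, hsnd]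
    exact h b
  obtain ⟨p, hp, hp'⟩ := HHom.exists_proj (Submodule.isClosed_topologicalClosure _) hGi
  have hpG : ∀ v ∈ G, p v = v := fun v hv => by
    have := (Submodule.mem_orthogonal _ _).mp (hp' v) _ (G.sub_mem hv (hp v))
    exact (sub_eq_zero.mp (inner_self_eq_zero.mp this)).symm
  have hpsa : p.adj = p := (HHom.eq_adj fun v w => by
    have h1 := (Submodule.mem_orthogonal _ _).mp (hp' v) _ (hp w)
    have h2 := (Submodule.mem_orthogonal' _ _).mp (hp' w) _ (hp v)
    rw [inner_sub_right, sub_eq_zero] at h1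
    rw [inner_sub_left, sub_eq_zero] at h2
    rw [h1, h2]).symm
  refine ⟨(HHom.snd Y X).comp (p.comp (HHom.inl Y X)), fun h0 => hx ?_⟩
  have h1 : (HHom.fst Y X).comp (p.comp (HHom.inr Y X)) = 0 := by
    have := congrArg HHom.adj h0
    simpa [HHom.adj_comp, HHom.comp_assoc, hpsa] using this
  have h2 : p.comp (HHom.inr Y X) = 0 := HHom.ext fun z => by
    have h3 : HHom.fst Y X (p (HHom.inr Y X z)) = 0 := HHom.congr_hom h1 z
    have h4 := hGle _ (hp (HHom.inr Y X z))
    rw [h3, norm_zero] at h4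
    exact HHom.plus_ext (h3.trans (map_zero _).symm)
      ((norm_le_zero_iff.mp h4).trans (map_zero _).symm)
  have h3 : (HHom.snd Y X).comp p = 0 := by
    have := congrArg HHom.adj h2
    simpa [HHom.adj_comp, hpsa] using this
  have h4 := HHom.congr_hom h3 (g 1)
  rw [HHom.comp_apply, hpG _ (Submodule.le_topologicalClosure _ ⟨1, rfl⟩), hsnd, map_one] at h4
  exact h4

/-- A nonzero intertwining operator has a nonzero partial isometry as its polar part. -/
theorem HHom.exists_partial_isometry {f : HHom X Y} (hf : f ≠ 0) :
    ∃ w : HHom X Y, w ≠ 0 ∧ w.comp (w.adj.comp w) = w := by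
  have hpos : 0 ≤ (f.adj.comp f).toCLM := by
    rw [ContinuousLinearMap.nonneg_iff_isPositive]
    exact ContinuousLinearMap.isPositive_adjoint_comp_self f.toCLM
  set s := (f.adj.comp f).sqrt with hs
  have hnorm : ∀ x, ‖f x‖ = ‖s.toClosure x‖ := fun x => by
    rw [toClosure_norm]
    refine (sq_eq_sq₀ (norm_nonneg _) (norm_nonneg _)).mp ?_
    rw [norm_sqrt_sq _ hpos, comp_apply, adj_inner_right]
    exact norm_sq_eq_re_inner (𝕜 := ℂ) _
  obtain ⟨k, hk, hkf⟩ := exists_extend_isometry s.toClosure s.toClosure_denseRange f hnorm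
  have hk' := isIsometry_iff.mp hk
  have hj' := isIsometry_iff.mp s.ofClosure_isIsometry
  refine ⟨k.comp s.ofClosure.adj, fun h0 => hf ?_, ?_⟩
  · have h1 : k = 0 := by
      have := congrArg (fun g => g.comp s.ofClosure) h0
      rwa [comp_assoc, hj', comp_id, zero_comp] at this
    rw [← hkf, h1, zero_comp]
  · rw [adj_comp, adj_adj]
    calc _ = k.comp ((s.ofClosure.adj.comp s.ofClosure).comp ((k.adj.comp k).comp s.ofClosure.adj)) := rfl
      _ = _ := by rw [hj', hk', id_comp, id_comp]

/-- A nonzero normal representation has a part that embeds into a given faithful normal one. -/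
theorem exists_partial_isometry (hM : MonotoneComplete M) (hX : X.Normal) {x₀ : X} (hx₀ : x₀ ≠ 0)
    (hYn : Y.Normal) (hY : Function.Injective Y.act) :
    ∃ w : HHom X Y, w ≠ 0 ∧ w.comp (w.adj.comp w) = w := by
  obtain ⟨x, y, hx, h⟩ := exists_vector_le hM hX hx₀ hYn hY
  obtain ⟨f, hf⟩ := exists_ne_zero_of_vector_le hx h
  exact HHom.exists_partial_isometry (f := f.adj) fun h0 => hf (by
    rw [← f.adj_adj, h0, HHom.adj_zero])

end Comparison
/-! ### Decomposition into parts of a faithful representation -/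

section Embedding
open Cardinal
variable {M : Type u} [CStarAlgebra M] [PartialOrder M] [StarOrderedRing M]
variable {X Y Z W : HRep M}

/-- `X` is a direct sum of at most `c` representations that embed isometrically into `Y`. -/
def HRep.IsSumOf (X Y : HRep M) (c : Cardinal.{u}) : Prop :=
  ∃ (I : Type u) (A : I → HRep M) (a : ∀ i, HHom (A i) X), #I ≤ c ∧ IsDecomp a ∧
    ∀ i, ∃ b : HHom (A i) Y, b.IsIsometry

theorem HHom.toClosure_hom_ext {f : HHom X Y} {g g' : HHom f.rangeClosure Z}
    (h : g.comp f.toClosure = g'.comp f.toClosure) : g = g' :=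
  toCLM_injective (DFunLike.coe_injective (f.toClosure_denseRange.equalizer
    (by fun_prop) (by fun_prop) (funext fun x => congr_hom h x)))

theorem HRep.IsSumOf.mono {c c' : Cardinal.{u}} (h : X.IsSumOf Y c) (hc : c ≤ c') :
    X.IsSumOf Y c' := by
  obtain ⟨I, A, a, hI, ha, hb⟩ := h
  exact ⟨I, A, a, hI.trans hc, ha, hb⟩

/-- A family of nonzero partial isometries from `X` to `Y` with pairwise orthogonal initial
spaces. -/
def IsOrthogonalSystem (s : Set (HHom X Y)) : Prop :=
  (∀ w ∈ s, w.comp (w.adj.comp w) = w) ∧ ∀ w ∈ s, ∀ w' ∈ s, w ≠ w' → w'.comp w.adj = 0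

theorem exists_maximal_orthogonalSystem (X Y : HRep M) :
    ∃ s : Set (HHom X Y), Maximal IsOrthogonalSystem s := by
  refine zorn_subset {s | IsOrthogonalSystem s} fun c hc hchain => ?_
  refine ⟨⋃₀ c, ⟨?_, ?_⟩, fun s hs => Set.subset_sUnion_of_mem hs⟩
  · rintro w ⟨s, hs, hw⟩
    exact (hc hs).1 w hw
  · rintro w ⟨s, hs, hw⟩ w' ⟨s', hs', hw'⟩ hne
    rcases hchain.total hs hs' with h | h
    · exact (hc hs').2 w (h hw) w' hw' hne
    · exact (hc hs).2 w hw w' (h hw') hne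

/-- The vectors that are annihilated by a maximal system vanish, since otherwise their space
contains the initial space of a further partial isometry. -/
theorem eq_zero_of_maximal_orthogonalSystem (hM : MonotoneComplete M) (hX : X.Normal)
    (hYn : Y.Normal) (hY : Function.Injective Y.act) {s : Set (HHom X Y)}
    (hs : Maximal IsOrthogonalSystem s) {v : X} (hv : ∀ w ∈ s, w v = 0) : v = 0 := by
  let Q : Submodule ℂ X := ⨅ w : s, LinearMap.ker (w.1.toCLM : X →ₗ[ℂ] Y)
  have hQ : ∀ x, x ∈ Q ↔ ∀ w ∈ s, w x = 0 := fun x => by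
    simp only [Q, Submodule.mem_iInf, Subtype.forall]; rfl
  have hQc : IsClosed (Q : Set X) := by
    simp only [Q, Submodule.coe_iInf]
    exact isClosed_iInter fun w => w.1.toCLM.isClosed_ker
  obtain ⟨q, hq, hq'⟩ := HHom.exists_proj hQc fun a x hx => by
    rw [hQ] at hx ⊢
    intro w hw
    rw [w.comm, hx w hw, map_zero]
  by_contra hv0
  have hqv : q v = v := by
    have := (Submodule.mem_orthogonal _ _).mp (hq' v) _ (Q.sub_mem ((hQ v).mpr hv) (hq v))
    exact (sub_eq_zero.mp (inner_self_eq_zero.mp this)).symm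
  have hv1 : q.toClosure v ≠ 0 := fun h => hv0 (by
    have := q.toClosure_norm v
    rw [h, norm_zero, hqv] at this
    exact norm_eq_zero.mp this.symm)
  obtain ⟨k, hk0, hk⟩ := exists_partial_isometry hM (hX.of_isometry q.ofClosure_isIsometry) hv1
    hYn hY
  have hj := HHom.isIsometry_iff.mp q.ofClosure_isIsometry
  have hzero : ∀ w ∈ s, w.comp q.ofClosure = 0 := fun w hw =>
    HHom.toClosure_hom_ext (HHom.ext fun x => (hQ _).mp (hq x) w hw)
  set w₀ := k.comp q.ofClosure.adj with hw₀
  have hw₀s : w₀ ∉ s := fun h => hk0 (by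
    have := hzero w₀ h
    rwa [hw₀, HHom.comp_assoc, hj, HHom.comp_id] at this)
  have h1 : ∀ w ∈ s, w.comp w₀.adj = 0 := fun w hw => by
    rw [hw₀, HHom.adj_comp, HHom.adj_adj, ← HHom.comp_assoc, hzero w hw, HHom.zero_comp]
  have h2 : ∀ w ∈ s, w₀.comp w.adj = 0 := fun w hw => by
    have := congrArg HHom.adj (h1 w hw)
    rwa [HHom.adj_comp, HHom.adj_adj, HHom.adj_zero] at this
  refine hw₀s (hs.2 (y := insert w₀ s) ⟨?_, ?_⟩ (Set.subset_insert _ _) (Set.mem_insert _ _))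
  · rintro w (rfl | hw)
    · rw [HHom.adj_comp, HHom.adj_adj]
      rw [HHom.comp_assoc q.ofClosure, HHom.comp_assoc k, ← HHom.comp_assoc q.ofClosure.adj, hj,
        HHom.id_comp, ← HHom.comp_assoc k.adj, ← HHom.comp_assoc k, hk]
    · exact hs.1.1 w hw
  · rintro w (rfl | hw) w' (rfl | hw') hne
    · exact absurd rfl hne
    · exact h1 w' hw'
    · exact h2 w hw
    · exact hs.1.2 w hw w' hw' hne

/-- Every normal representation is a direct sum of parts of a given faithful normal one. -/
theorem exists_isSumOf (hM : MonotoneComplete M) (hX : X.Normal) (hYn : Y.Normal)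
    (hY : Function.Injective Y.act) : ∃ c, X.IsSumOf Y c := by
  obtain ⟨s, hs⟩ := exists_maximal_orthogonalSystem X Y
  refine ⟨#s, s, fun w => w.1.adj.rangeClosure, fun w => w.1.adj.ofClosure, le_rfl,
    ⟨⟨fun w => HHom.isIsometry_iff.mp w.1.adj.ofClosure_isIsometry, fun w w' hne => ?_⟩, ?_⟩,
    fun w => ⟨w.1.comp w.1.adj.ofClosure, HHom.isIsometry_iff_norm.mpr fun x => ?_⟩⟩
  · have h1 := hs.1.2 w.1 w.2 w'.1 w'.2 fun h => hne (Subtype.ext h)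
    have h2 : w'.1.comp w.1.adj.ofClosure = 0 := HHom.toClosure_hom_ext h1
    refine HHom.toClosure_hom_ext ?_
    have h3 := congrArg HHom.adj h2
    rwa [HHom.adj_comp, HHom.adj_zero] at h3
  · refine dense_span_of_forall fun v hv => eq_zero_of_maximal_orthogonalSystem hM hX hYn hY hs
      fun w hw => ext_inner_left ℂ fun y => ?_
    rw [inner_zero_right, ← HHom.adj_inner_left]
    exact hv _ ⟨⟨w, hw⟩, w.adj.toClosure y, rfl⟩
  · induction x using w.1.adj.toClosure_denseRange.induction_on with
    | hp => exact isClosed_eq (by fun_prop) (by fun_prop)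
    | ih y =>
      rw [HHom.toClosure_norm]
      refine (sq_eq_sq₀ (norm_nonneg _) (norm_nonneg _)).mp ?_
      have h1 : w.1.adj.comp (w.1.comp w.1.adj) = w.1.adj := by
        conv_rhs => rw [← hs.1.1 w.1 w.2]
        rw [HHom.adj_comp, HHom.adj_comp, HHom.adj_adj, HHom.comp_assoc]
      change ‖w.1 (w.1.adj y)‖ ^ 2 = _
      rw [norm_sq_eq_re_inner (𝕜 := ℂ), ← HHom.adj_inner_right,
        show w.1.adj (w.1 (w.1.adj y)) = w.1.adj y from HHom.congr_hom h1 y]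
      exact (norm_sq_eq_re_inner (𝕜 := ℂ) _).symm

/-- A representation that is a sum of at most `κ` parts of `Y` embeds into the sum of `κ` copies
of `Y`. -/
theorem HRep.IsSumOf.exists_isometry {κ : Type u} (h : X.IsSumOf Y #κ) {J : κ → HHom Y Z}
    (hJ : IsOrtho J) : ∃ f : HHom X Z, f.IsIsometry := by
  obtain ⟨I, A, a, hI, ha, hb⟩ := h
  choose b hb using hb
  obtain ⟨e⟩ := (Cardinal.le_def _ _).mp hI
  obtain ⟨f, hf, -⟩ := ha.exists_isometry (W := Z) (f := fun i => (J (e i)).comp (b i))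
    ⟨fun i => HHom.isIsometry_iff.mp ((hJ.isIsometry _).comp (hb i)), fun i j hij => by
      rw [HHom.adj_comp]
      change (b i).adj.comp (((J (e i)).adj.comp (J (e j))).comp (b j)) = 0
      rw [hJ.ortho _ _ (e.injective.ne hij), HHom.zero_comp, HHom.comp_zero]⟩
  exact ⟨f, hf⟩

/-- A direct sum of direct sums. -/
theorem HRep.IsSumOf.of_isDecomp {κ : Type u} {c : Cardinal.{u}} (hc : ℵ₀ ≤ c) (hκ : #κ ≤ c)
    {V : κ → HRep M} (h : ∀ k, (V k).IsSumOf Y c) {J : ∀ k, HHom (V k) Z} (hJ : IsDecomp J) :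
    Z.IsSumOf Y c := by
  choose I A a hI ha hb using h
  refine ⟨Σ k, I k, fun p => A p.1 p.2, fun p => (J p.1).comp (a p.1 p.2), ?_, ⟨⟨fun p => ?_,
    fun p q hpq => ?_⟩, ?_⟩, fun p => hb p.1 p.2⟩
  · rw [Cardinal.mk_sigma]
    refine (Cardinal.sum_le_sum _ _ hI).trans ?_
    rw [Cardinal.sum_const']
    exact (mul_le_mul' hκ le_rfl).trans (Cardinal.mul_eq_self hc).le
  · exact HHom.isIsometry_iff.mp ((hJ.isIsometry _).comp ((ha _).isIsometry _))
  · obtain ⟨k, i⟩ := p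
    obtain ⟨l, j⟩ := q
    dsimp only
    rw [HHom.adj_comp]
    change (a k i).adj.comp (((J k).adj.comp (J l)).comp (a l j)) = 0
    by_cases hkl : k = l
    · subst hkl
      rw [hJ.iso, HHom.id_comp, (ha k).ortho i j fun h => hpq (by rw [h])]
    · rw [hJ.ortho k l hkl, HHom.zero_comp, HHom.comp_zero]
  · refine dense_span_of_forall fun v hv => hJ.ext fun k => (ha k).ext fun i => ?_
    rw [map_zero, map_zero]
    refine ext_inner_left ℂ fun x => ?_
    rw [inner_zero_right, HHom.adj_inner_right, HHom.adj_inner_right]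
    exact hv _ ⟨⟨k, i⟩, x, rfl⟩

theorem HRep.IsSumOf.plus {c : Cardinal.{u}} (hc : ℵ₀ ≤ c) (hX : X.IsSumOf Y c)
    (hZ : Z.IsSumOf Y c) : (X.plus Z).IsSumOf Y c := by
  refine HRep.IsSumOf.of_isDecomp hc (κ := ULift.{u} Bool) ?_
    (V := fun b => bif b.down then X else Z) (by rintro ⟨_ | _⟩ <;> assumption)
    (J := fun b => match b with
      | ⟨true⟩ => HHom.inl X Z
      | ⟨false⟩ => HHom.inr X Z) ⟨⟨?_, ?_⟩, ?_⟩
  · exact (Cardinal.lt_aleph0_of_finite _).le.trans hc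
  · rintro ⟨_ | _⟩
    exacts [HHom.isIsometry_iff.mp HHom.inr_isIsometry, HHom.isIsometry_iff.mp HHom.inl_isIsometry]
  · rintro ⟨_ | _⟩ ⟨_ | _⟩ h
    · exact absurd rfl h
    · change (HHom.inr X Z).adj.comp (HHom.inl X Z) = 0
      simp
    · change (HHom.inl X Z).adj.comp (HHom.inr X Z) = 0
      simp
    · exact absurd rfl h
  · refine dense_span_of_forall fun v hv => HHom.plus_ext ?_ ?_
    · refine ext_inner_left ℂ fun x => ?_
      have h : inner ℂ (HHom.inl X Z x) v = (0 : ℂ) := hv _ ⟨⟨true⟩, x, rfl⟩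
      rw [← HHom.adj_inner_right, HHom.inl_adj] at h
      rw [h, map_zero, inner_zero_right]
    · refine ext_inner_left ℂ fun x => ?_
      have h : inner ℂ (HHom.inr X Z x) v = (0 : ℂ) := hv _ ⟨⟨false⟩, x, rfl⟩
      rw [← HHom.adj_inner_right, HHom.inr_adj] at h
      rw [h, map_zero, inner_zero_right]

end Embedding
/-! ### Extension of partial unitaries -/

section Extension
variable {M : Type u} [CStarAlgebra M] [PartialOrder M] [StarOrderedRing M]
variable {X Y Z W : HRep M}

/-- The orthogonal complement of the range of `f`, as a representation. -/
theorem HHom.exists_compl (f : HHom X Y) : ∃ (C : HRep M) (j : HHom C Y), j.IsIsometry ∧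
    f.ofClosure.comp f.ofClosure.adj + j.comp j.adj = HHom.id Y := by
  set k := f.ofClosure with hk
  have hkk : k.adj.comp k = HHom.id _ := isIsometry_iff.mp f.ofClosure_isIsometry
  set p := HHom.id Y - k.comp k.adj with hp
  have hpk : p.comp k = 0 := by
    rw [hp]
    ext x
    change k x - k ((k.adj.comp k) x) = 0
    rw [hkk]
    exact sub_self _
  have hpsa : p.adj = p := (eq_adj fun x y => by
    rw [hp, sub_apply, sub_apply, inner_sub_left, inner_sub_right]
    change inner ℂ y x - inner ℂ (k (k.adj y)) x = inner ℂ y x - (inner ℂ y (k (k.adj x)) : ℂ)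
    rw [← adj_inner_right k (k.adj y) x, ← adj_inner_left k (k.adj x) y]).symm
  have hpp : p.comp p = p := by
    ext x
    have h1 : p (k (k.adj x)) = 0 := HHom.congr_hom hpk _
    change p (x - k (k.adj x)) = p x
    rw [map_sub, h1, sub_zero]
  set j := p.ofClosure with hj
  have hjj : j.adj.comp j = HHom.id _ := isIsometry_iff.mp p.ofClosure_isIsometry
  have hpj : p.comp j = j := toClosure_hom_ext hpp
  have hj' : j.adj.comp p = j.adj := by
    have := congrArg HHom.adj hpj
    rwa [adj_comp, hpsa] at this
  have hjp : j.comp j.adj = p := by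
    have h1 : j.adj.comp p = p.toClosure := by
      change (j.adj.comp j).comp p.toClosure = _
      rw [hjj, id_comp]
    rw [← hj', h1]; rfl
  refine ⟨p.rangeClosure, j, p.ofClosure_isIsometry, ?_⟩
  rw [hjp, hp]
  ext x
  exact add_sub_cancel _ _

/-- If `‖f h‖ = ‖g h‖`, and if `X` and `Y` embed into the orthogonal complements of the ranges of
`g` and of `f`, then `f h ↦ g h` extends to a unitary operator. -/
theorem HHom.exists_unitary_extension {f : HHom Z X} {g : HHom Z Y} (hfg : ∀ h, ‖g h‖ = ‖f h‖)
    {a : HHom X Y} (ha : a.IsIsometry) (hga : g.adj.comp a = 0)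
    {b : HHom Y X} (hb : b.IsIsometry) (hfb : f.adj.comp b = 0) :
    ∃ U : HHom X Y, U.IsUnitary ∧ U.comp f = g := by
  obtain ⟨C, j, hj, hfj⟩ := f.exists_compl
  obtain ⟨C', j', hj', hgj⟩ := g.exists_compl
  have hlift : ∀ {V V' : HRep M} {q : HHom Z V'} {C₀ : HRep M} {i : HHom C₀ V'},
      q.ofClosure.comp q.ofClosure.adj + i.comp i.adj = HHom.id V' → ∀ {e : HHom V V'},
      e.IsIsometry → q.adj.comp e = 0 → (i.adj.comp e).IsIsometry := by
    intro V V' q C₀ i hq e he hqe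
    have h1 : q.ofClosure.adj.comp e = 0 := by
      have h2 := congrArg HHom.adj hqe
      rw [adj_comp, adj_adj, adj_zero] at h2
      have h3 : e.adj.comp q.ofClosure = 0 := toClosure_hom_ext h2
      have h4 := congrArg HHom.adj h3
      rwa [adj_comp, adj_adj, adj_zero] at h4
    rw [isIsometry_iff, adj_comp, adj_adj]
    have h2 : (i.comp i.adj).comp e = e := by
      have h3 := congrArg (fun t => t.comp e) hq
      rwa [add_comp, id_comp, comp_assoc _ q.ofClosure.adj, h1, comp_zero, zero_add] at h3
    calc _ = e.adj.comp ((i.comp i.adj).comp e) := rfl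
      _ = _ := by rw [h2, isIsometry_iff.mp he]
  -- the orthogonal complements `C` and `C'` of the ranges embed into each other
  obtain ⟨v, hv⟩ := HHom.exists_unitary_of_isometries ((hlift hgj ha hga).comp hj)
    ((hlift hfj hb hfb).comp hj')
  obtain ⟨w, hw, hwf⟩ := exists_extend_isometry f.toClosure f.toClosure_denseRange g.toClosure hfg
  obtain ⟨w', hw', hwg⟩ := exists_extend_isometry g.toClosure g.toClosure_denseRange f.toClosure
    fun h => (hfg h).symm
  have hww : w.comp w' = HHom.id _ := toClosure_hom_ext (by
    rw [comp_assoc, hwg, hwf, id_comp])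
  have hwu : w.IsUnitary := ⟨hw, fun x => ⟨w' x, congr_hom hww x⟩⟩
  have hk := isIsometry_iff.mp f.ofClosure_isIsometry
  have hk' := isIsometry_iff.mp g.ofClosure_isIsometry
  have horth : ∀ {V : HRep M} {q : HHom Z V} {C₀ : HRep M} {i : HHom C₀ V}, i.IsIsometry →
      q.ofClosure.comp q.ofClosure.adj + i.comp i.adj = HHom.id V →
      q.ofClosure.adj.comp i = 0 ∧ i.adj.comp q.ofClosure = 0 := by
    intro V q C₀ i hi hq
    have h1 : i.adj.comp q.ofClosure = 0 := by
      have h2 := congrArg (fun t => i.adj.comp (t.comp q.ofClosure)) hq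
      rw [add_comp, comp_add, comp_assoc q.ofClosure, isIsometry_iff.mp q.ofClosure_isIsometry,
        comp_id, id_comp] at h2
      change _ + (i.adj.comp i).comp (i.adj.comp q.ofClosure) = _ at h2
      rw [isIsometry_iff.mp hi, id_comp] at h2
      exact add_eq_left.mp h2
    refine ⟨?_, h1⟩
    have h2 := congrArg HHom.adj h1
    rwa [adj_comp, adj_adj, adj_zero] at h2
  obtain ⟨o1, o2⟩ := horth hj hfj
  obtain ⟨o1', o2'⟩ := horth hj' hgj
  have hj1 := isIsometry_iff.mp hj
  have hj1' := isIsometry_iff.mp hj'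
  refine ⟨g.ofClosure.comp (w.comp f.ofClosure.adj) + j'.comp (v.comp j.adj),
    isUnitary_iff.mpr ⟨?_, ?_⟩, ?_⟩
  · rw [adj_add, adj_comp, adj_comp, adj_comp, adj_comp, adj_adj, adj_adj, add_comp, comp_add,
      comp_add, ← hfj]
    have e1 : ((f.ofClosure.comp w.adj).comp g.ofClosure.adj).comp
        (g.ofClosure.comp (w.comp f.ofClosure.adj)) = f.ofClosure.comp f.ofClosure.adj := by
      change (f.ofClosure.comp w.adj).comp ((g.ofClosure.adj.comp g.ofClosure).comp
        (w.comp f.ofClosure.adj)) = _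
      rw [hk', id_comp, comp_assoc, hwu.adj_comp_assoc]
    have e2 : ((f.ofClosure.comp w.adj).comp g.ofClosure.adj).comp (j'.comp (v.comp j.adj)) = 0 := by
      change (f.ofClosure.comp w.adj).comp ((g.ofClosure.adj.comp j').comp (v.comp j.adj)) = 0
      rw [o1', zero_comp, comp_zero]
    have e3 : ((j.comp v.adj).comp j'.adj).comp (g.ofClosure.comp (w.comp f.ofClosure.adj)) = 0 := by
      change (j.comp v.adj).comp ((j'.adj.comp g.ofClosure).comp (w.comp f.ofClosure.adj)) = 0
      rw [o2', zero_comp, comp_zero]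
    have e4 : ((j.comp v.adj).comp j'.adj).comp (j'.comp (v.comp j.adj)) = j.comp j.adj := by
      change (j.comp v.adj).comp ((j'.adj.comp j').comp (v.comp j.adj)) = _
      rw [hj1', id_comp, comp_assoc, hv.adj_comp_assoc]
    rw [e1, e2, e3, e4, add_zero, zero_add]
  · rw [adj_add, adj_comp, adj_comp, adj_comp, adj_comp, adj_adj, adj_adj, add_comp, comp_add,
      comp_add, ← hgj]
    have e1 : (g.ofClosure.comp (w.comp f.ofClosure.adj)).comp
        ((f.ofClosure.comp w.adj).comp g.ofClosure.adj) = g.ofClosure.comp g.ofClosure.adj := by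
      change (g.ofClosure.comp w).comp ((f.ofClosure.adj.comp f.ofClosure).comp
        (w.adj.comp g.ofClosure.adj)) = _
      rw [hk, id_comp, comp_assoc, hwu.comp_adj_assoc]
    have e2 : (g.ofClosure.comp (w.comp f.ofClosure.adj)).comp ((j.comp v.adj).comp j'.adj) = 0 := by
      change (g.ofClosure.comp w).comp ((f.ofClosure.adj.comp j).comp (v.adj.comp j'.adj)) = 0
      rw [o1, zero_comp, comp_zero]
    have e3 : (j'.comp (v.comp j.adj)).comp ((f.ofClosure.comp w.adj).comp g.ofClosure.adj) = 0 := by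
      change (j'.comp v).comp ((j.adj.comp f.ofClosure).comp (w.adj.comp g.ofClosure.adj)) = 0
      rw [o2, zero_comp, comp_zero]
    have e4 : (j'.comp (v.comp j.adj)).comp ((j.comp v.adj).comp j'.adj) = j'.comp j'.adj := by
      change (j'.comp v).comp ((j.adj.comp j).comp (v.adj.comp j'.adj)) = _
      rw [hj1, id_comp, comp_assoc, hv.comp_adj_assoc]
    rw [e1, e2, e3, e4, add_zero, zero_add]
  · have e1 : (g.ofClosure.comp (w.comp f.ofClosure.adj)).comp f = g := by
      change g.ofClosure.comp (w.comp ((f.ofClosure.adj.comp f.ofClosure).comp f.toClosure)) = g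
      rw [hk, id_comp, hwf]; rfl
    have e2 : (j'.comp (v.comp j.adj)).comp f = 0 := by
      change j'.comp (v.comp ((j.adj.comp f.ofClosure).comp f.toClosure)) = 0
      rw [o2, zero_comp, comp_zero, comp_zero]
    rw [add_comp, e1, e2, add_zero]

/-- The action of `a` on a Hilbert space direct sum of copies of `Y`. -/
noncomputable def copiesCLM (κ : Type u) (Y : HRep M) (a : M) :
    lp (fun _ : κ => Y) 2 →L[ℂ] lp (fun _ : κ => Y) 2 :=
  have key : ∀ (f : lp (fun _ : κ => Y) 2) (k : κ),
      ‖Y.act a (f k)‖ ≤ ‖(((‖a‖ : ℂ) • f : lp (fun _ : κ => Y) 2) : κ → Y) k‖ := fun f k => by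
    rw [lp.coeFn_smul, Pi.smul_apply, norm_smul, Complex.norm_real, norm_norm]
    refine (Y.act a).le_of_opNorm_le ?_ (f k)
    exact NonUnitalStarAlgHom.norm_apply_le Y.act a
  LinearMap.mkContinuous
    { toFun := fun f => ⟨fun k => Y.act a (f k),
        Memℓp.mono' (lp.memℓp ((‖a‖ : ℂ) • f : lp (fun _ : κ => Y) 2)) (key f)⟩
      map_add' := fun f g => by ext i; simp; rfl
      map_smul' := fun c f => by ext i; simp }
    ‖a‖ (fun f => by
      have h := lp.norm_mono (p := 2) two_ne_zero
        (x := (⟨fun k => Y.act a (f k), Memℓp.mono'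
          (lp.memℓp ((‖a‖ : ℂ) • f : lp (fun _ : κ => Y) 2)) (key f)⟩ : lp (fun _ : κ => Y) 2))
        (y := ((‖a‖ : ℂ) • f : lp (fun _ : κ => Y) 2)) (key f)
      rw [norm_smul, Complex.norm_real, norm_norm] at h
      exact h)

theorem copiesCLM_apply (κ : Type u) (Y : HRep M) (a : M) (f : lp (fun _ : κ => Y) 2) (k : κ) :
    (copiesCLM κ Y a f : κ → Y) k = Y.act a (f k) := rfl

/-- The Hilbert space direct sum of `κ` copies of `Y`. -/
noncomputable def copies (κ : Type u) (Y : HRep M) : HRep M where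
  carrier := lp (fun _ : κ => Y) 2
  act :=
    { toFun := copiesCLM κ Y
      map_one' := by ext f i; simp [copiesCLM_apply]
      map_mul' := fun a b => by ext f i; simp [copiesCLM_apply]
      map_zero' := by ext f i; simp [copiesCLM_apply]
      map_add' := fun a b => by ext f i; simp [copiesCLM_apply]
      commutes' := fun c => by ext f i; simp [copiesCLM_apply, Algebra.algebraMap_eq_smul_one]
      map_star' := fun a => by
        rw [ContinuousLinearMap.star_eq_adjoint, ContinuousLinearMap.eq_adjoint_iff]
        intro v w
        rw [lp.inner_eq_tsum, lp.inner_eq_tsum]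
        refine tsum_congr fun i => ?_
        rw [copiesCLM_apply, copiesCLM_apply, Y.inner_act_left, star_star] }

theorem exists_copies (κ : Type u) (Y : HRep M) :
    ∃ (Z : HRep M) (J : κ → HHom Y Z), IsDecomp J := by
  classical
  let ev : ∀ k, HHom (copies κ Y) Y := fun k => ⟨lp.evalCLM ℂ (fun _ : κ => Y) 2 k, fun _ _ => rfl⟩
  have hincl : ∀ k y, (ev k).adj y = lp.single 2 k y := fun k y => ext_inner_right ℂ fun v => by
    rw [HHom.adj_inner_left]
    exact (lp.inner_single_left (𝕜 := ℂ) k y v).symm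
  refine ⟨copies κ Y, fun k => (ev k).adj, ⟨fun k => ?_, fun k l hkl => ?_⟩, ?_⟩
  · rw [HHom.adj_adj]
    ext y
    rw [HHom.comp_apply, hincl]
    exact lp.single_apply_self (E := fun _ : κ => Y) 2 k y
  · rw [HHom.adj_adj]
    ext y
    rw [HHom.comp_apply, hincl]
    exact lp.single_apply_ne (E := fun _ : κ => Y) 2 l y hkl
  · refine dense_span_of_forall fun v hv => lp.ext (funext fun k => ext_inner_left ℂ fun y => ?_)
    have := hv _ ⟨k, y, rfl⟩
    rw [HHom.adj_inner_left] at this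
    exact this.trans (inner_zero_right _).symm

end Extension
/-! ### Existence of the data -/

section Existence
open Cardinal
variable {M : Type u} [CStarAlgebra M] [PartialOrder M] [StarOrderedRing M]
variable {X Y Z : HRep M}

/-- Injectivity of the left action is what makes `E ⊗ Y` faithful. -/
theorem WCorr.Faithful.tens_injective {E : WCorr M} (hE : E.Faithful)
    (hY : Function.Injective Y.act) : Function.Injective (E.tens Y).act := by
  refine (injective_iff_map_eq_zero (E.tens Y).act).mpr fun a ha => hE a fun ξ => ?_
  refine E.ip_definite _ (hY ?_)
  rw [_root_.map_zero]
  refine ContinuousLinearMap.ext fun y => ext_inner_left ℂ fun y' => ?_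
  have h : WCorr.tmul (E.lact a ξ) y = 0 := by
    rw [← WCorr.act_tmul, ha]; rfl
  rw [← WCorr.inner_tmul, h, inner_zero_right]
  exact (inner_zero_right _).symm

theorem IsDecomp.isInfiniteGenerator {κ : Type u} [Infinite κ] {J : κ → HHom Y X}
    (hJ : IsDecomp J) (hYn : Y.Normal) (hY : Function.Injective Y.act) : IsInfiniteGenerator X :=
  ⟨Y, κ, J, hYn, hY, inferInstance, hJ.isIsometry, fun _ _ h y y' => hJ.inner_eq_zero h y y',
    hJ.dense⟩

namespace ProductSystem
variable {m : ℕ} (S : ProductSystem M (m + 2)) {H : HRep M}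
  (T : ∀ i, S.E i →ₗ[ℂ] (H →L[ℂ] H))

/-- The summand `ℰ₁` is orthogonal to the range of the prescribed part of `U`. -/
theorem vecLast_adj_comp_inr (ℰ : HRep M) :
    (S.vecLast T ℰ).adj.comp ((HHom.inr _ _).comp (HHom.inr _ _)) = 0 := by
  have h : ((HHom.snd _ _).comp (HHom.snd _ _)).comp (S.vecLast T ℰ) = 0 := by
    ext x
    simp [PreProductSystem.vecLast]
  have := congrArg HHom.adj h
  rwa [HHom.adj_comp, HHom.adj_comp, HHom.snd_adj, HHom.snd_adj, HHom.adj_zero] at this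

/-- The summand `ℰ₂` is orthogonal to the domain of the prescribed part of `U`. -/
theorem vecFst_adj_comp_inr (ℰ : HRep M) :
    (S.vecFst T ℰ).adj.comp ((HHom.inr _ _).comp (HHom.inr _ _)) = 0 := by
  have h : ((HHom.snd _ _).comp (HHom.snd _ _)).comp (S.vecFst T ℰ) = 0 := by
    ext x
    simp [PreProductSystem.vecFst]
  have := congrArg HHom.adj h
  rwa [HHom.adj_comp, HHom.adj_comp, HHom.snd_adj, HHom.snd_adj, HHom.adj_zero] at this

variable {T}

/-- The data of the dilation exist: a multiple `ℰ₁` of a faithful normal representation and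
`ℰ₂ = Eₙ ⊗ ℰ₁` absorb all the representations that are involved, if the multiplicity is large. -/
theorem exists_dilationData (hM : IsWStar M) (hS : ∀ i, (S.E i).Faithful) (hT : S.IsClassT T) :
    Nonempty (S.DilationData T) := by
  obtain ⟨hMc, Y, hYn, hY⟩ := hM.exists_normal
  have hH : H.Normal := (hT.isRep.ccRep 0).normal
  set E₀ := S.E 0
  set Eₙ := S.E (Fin.last (m + 1))
  set D₁ := (S.defFst T).rangeClosure
  set Dₙ := (S.defLast T).rangeClosure
  have hD₁ : D₁.Normal := PreProductSystem.DilationData.rangeClosure_normal hH _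
  have hDₙ : Dₙ.Normal := PreProductSystem.DilationData.rangeClosure_normal hH _
  have hYn' : (Eₙ.tens Y).Normal := Eₙ.tens_normal hYn
  have hY' : Function.Injective (Eₙ.tens Y).act := (hS _).tens_injective hY
  have hYn'' : (E₀.tens (Eₙ.tens Y)).Normal := E₀.tens_normal hYn'
  have hY'' : Function.Injective (E₀.tens (Eₙ.tens Y)).act := (hS _).tens_injective hY'
  obtain ⟨c₁, h₁⟩ := exists_isSumOf hMc hD₁ hYn hY
  obtain ⟨c₂, h₂⟩ := exists_isSumOf hMc (Eₙ.tens_normal hDₙ) hYn hY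
  obtain ⟨c₃, h₃⟩ := exists_isSumOf hMc hYn' hYn hY
  obtain ⟨c₄, h₄⟩ := exists_isSumOf hMc hDₙ hYn' hY'
  obtain ⟨c₅, h₅⟩ := exists_isSumOf hMc (E₀.tens_normal hD₁) hYn' hY'
  obtain ⟨c₆, h₆⟩ := exists_isSumOf hMc hYn hYn' hY'
  obtain ⟨c₇, h₇⟩ := exists_isSumOf hMc hYn'' hYn hY
  obtain ⟨c₈, h₈⟩ := exists_isSumOf hMc hYn hYn'' hY''
  obtain ⟨κ, hκ, hle⟩ : ∃ κ : Type u, ℵ₀ ≤ #κ ∧ ∀ c ∈ [c₁, c₂, c₃, c₄, c₅, c₆, c₇, c₈], c ≤ #κ := by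
    refine ⟨(ℵ₀ + [c₁, c₂, c₃, c₄, c₅, c₆, c₇, c₈].sum).out, ?_, fun c hc => ?_⟩
    · rw [Cardinal.mk_out]
      exact self_le_add_right _ _
    · rw [Cardinal.mk_out]
      exact (List.single_le_sum (fun _ _ => zero_le) c hc).trans (self_le_add_left _ _)
  have : Infinite κ := Cardinal.infinite_iff.mpr hκ
  obtain ⟨ℰ₁, J, hJ⟩ := exists_copies κ Y
  have hJ' := hJ.map Eₙ
  have hJ'' := hJ'.map E₀
  -- `E₁ ⊗ ℰ₂` and `ℰ₁` embed into each other
  obtain ⟨p, hp⟩ := (HRep.IsSumOf.of_isDecomp hκ le_rfl (fun _ => h₇.mono (hle _ (by simp)))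
    hJ'').exists_isometry hJ.toIsOrtho
  obtain ⟨q, hq⟩ := (HRep.IsSumOf.of_isDecomp hκ le_rfl (fun _ => h₈.mono (hle _ (by simp)))
    hJ).exists_isometry hJ''.toIsOrtho
  obtain ⟨u₁, hu₁⟩ := HHom.exists_unitary_of_isometries hp hq
  -- the domain of `U` embeds into `ℰ₁`, and its range into `ℰ₂`
  obtain ⟨a, ha⟩ := ((h₁.mono (hle _ (by simp))).plus hκ ((h₂.mono (hle _ (by simp))).plus hκ
    (HRep.IsSumOf.of_isDecomp hκ le_rfl (fun _ => h₃.mono (hle _ (by simp)))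
    hJ'))).exists_isometry hJ.toIsOrtho
  obtain ⟨b, hb⟩ := ((h₄.mono (hle _ (by simp))).plus hκ ((h₅.mono (hle _ (by simp))).plus hκ
    (HRep.IsSumOf.of_isDecomp hκ le_rfl (fun _ => h₆.mono (hle _ (by simp)))
    hJ))).exists_isometry hJ'.toIsOrtho
  obtain ⟨U, hU, hUv⟩ := HHom.exists_unitary_extension (f := S.vecFst T (Eₙ.tens ℰ₁))
    (g := S.vecLast T ℰ₁) (fun h => (norm_vec_eq hT _ _ h).symm)
    (a := ((HHom.inr _ _).comp (HHom.inr _ _)).comp a)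
    ((HHom.inr_isIsometry.comp HHom.inr_isIsometry).comp ha)
    (by rw [← HHom.comp_assoc, S.vecLast_adj_comp_inr, HHom.zero_comp])
    (b := ((HHom.inr _ _).comp (HHom.inr _ _)).comp b)
    ((HHom.inr_isIsometry.comp HHom.inr_isIsometry).comp hb)
    (by rw [← HHom.comp_assoc, S.vecFst_adj_comp_inr, HHom.zero_comp])
  obtain ⟨V, hV, hVv⟩ := HHom.exists_extend_isometry (S.defFstLast T).toClosure
    (S.defFstLast T).toClosure_denseRange (S.vecLast T ℰ₁) fun h => norm_toClosure_eq hT _ h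
  exact ⟨{
    ℰ₁ := ℰ₁
    ℰ₂ := Eₙ.tens ℰ₁
    ℰ₁_gen := hJ.isInfiniteGenerator hYn hY
    ℰ₂_gen := hJ'.isInfiniteGenerator hYn' hY'
    u₁ := u₁
    u₁_unitary := hu₁
    u₂ := HHom.id _
    u₂_unitary := HHom.isUnitary_id
    U := U
    U_unitary := hU
    U_comp := hUv
    V := V
    V_isometry := hV
    V_comp := hVv }⟩

end ProductSystem
end Existence
end ProdSys

/-! ### Existence of the data and the dilation they define -/

theorem mainTheorem1 {M : Type u} [CStarAlgebra M] [PartialOrder M] [StarOrderedRing M]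
    (hM : IsWStar M) (m : ℕ) (S : ProductSystem M (m + 2)) (hS : ∀ i, (S.E i).Faithful)
    (H : HRep M) (T : ∀ i, S.E i →ₗ[ℂ] (H →L[ℂ] H)) (hT : S.IsClassT T) :
    Nonempty (S.DilationData T) ∧
    ∀ d : S.DilationData T,
      d.U₁.IsUnitary ∧ d.Uₙ.IsUnitary ∧ d.τ₁.IsIsometry ∧ d.τₙ.IsIsometry ∧
      d.dilationMap.IsIsometry ∧
      ((S.E 0).map d.dilationMap).comp (tilde (T 0)).adj = d.τ₁.adj.comp d.dilationMap ∧
      (∀ k : Fin m, ((S.E k.succ.castSucc).map d.dilationMap).comp (tilde (T k.succ.castSucc)).adj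
        = (d.L k).adj.comp d.dilationMap) ∧
      ((S.E (Fin.last (m + 1))).map d.dilationMap).comp (tilde (T (Fin.last (m + 1)))).adj
        = d.τₙ.adj.comp d.dilationMap ∧
      d.τ₁.comp ((S.E 0).map d.τₙ) = d.L₁ ∧
      d.τₙ.comp ((S.E (Fin.last (m + 1))).map d.τ₁)
        = d.L₁.comp (S.swap (Fin.last (m + 1)) 0 d.K) ∧
      ∃ R : ∀ i, S.E i →ₗ[ℂ] (d.K →L[ℂ] d.K),
        S.IsIsometricRep d.K R ∧
        tilde (R 0) = d.τ₁ ∧ tilde (R (Fin.last (m + 1))) = d.τₙ ∧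
        (∀ k : Fin m, tilde (R k.succ.castSucc) = d.L k) ∧
        S.IsDilation d.dilationMap T R := by
  have hH : H.Normal := (hT.isRep.ccRep 0).normal
  refine ⟨S.exists_dilationData hM hS hT, fun d => ?_⟩
  have h0 := (d.hasComponents hT).τ₁ hT.isRep
  have hk := fun k => (d.hasComponents hT).L hT.isRep k
  have hn := (d.hasComponents hT).τₙ hT.isRep
  refine ⟨d.U₁_isUnitary, d.Uₙ_isUnitary hH, d.τ₁_isIsometry hH, d.τₙ_isIsometry hH,
    d.dilationMap_isIsometry hT, h0, hk, hn, d.τ₁_comp_τₙ hH, d.τₙ_comp_τ₁ hH,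
    fun i => ofTilde (d.dilOp i),
    S.isIsometricRep_ofTilde (S.fock_normal (d.D_normal hH)) d.dilOp (d.dilOp_isIsometry hH) (d.dilOp_commute hH),
    ?_, ?_, fun k => ?_, d.dilationMap_isIsometry hT, fun i => ?_⟩
  · rw [tilde_ofTilde, d.dilOp_zero]
  · rw [tilde_ofTilde, d.dilOp_last]
  · rw [tilde_ofTilde, d.dilOp_mid]
  · rw [tilde_ofTilde]
    refine PreProductSystem.DilationData.index_cases ?_ ?_ (fun k => ?_) i
    · rw [d.dilOp_zero]; exact h0
    · rw [d.dilOp_last]; exact hn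
    · rw [d.dilOp_mid]; exact hk k
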